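/- Let $\Omega\subset\mathbb R^2$ be a domain (open, connected, non-empty) with a finite conforming triangulation $\mathcal T$: every simplex is a face of a triangle of $\mathcal T$, $\Omega$ is the interior of the union of the closed triangles, and for every vertex $x$ the union of the closed triangles containing $x$ has connected interior. Orient every edge $e$ and let $\bm t$ be its unit tangent vector and $\bm n$ its unit normal vector, obtained from $\bm t$ by a counterclockwise quarter turn. Orient all triangles clockwise. Let $k\ge 4$. Write $\operatorname{curl}v=(-\partial_y v,\partial_x v)$; $\operatorname{curl}$ and $\operatorname{div}$ act row-wise on vector and matrix fields, and $\mathbb S^2$ is the space of symmetric $2\times2$ matrices. Let $\mathcal{RT}^2=\{\bm a+b\bm x:\bm a\in\mathbb R^2,\ b\in\mathbb R\}$, let $\psi_1,\psi_2,\psi_3$ be a basis of $P_1$ and $z_1,z_2,z_3$ a basis of $\mathcal{RT}^2$. *Sequence.* On triangles $f$, edges $e$ and vertices $x$ put $$A^0(f)=P_k(f)\otimes\mathbb R^2,\quad A^1(f)=P_{k-1}(f)\otimes\mathbb S^2,\quad A^2(f)=P_{k-3}(f),$$ $$A^0(e)=P_k(e)\times P_k(e)\times P_{k-1}(e),\quad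 A^1(e)=P_{k-1}(e)\times P_{k-1}(e)\times P_{k-2}(e),\quad A^2(e)=0,$$ $$A^0(x)=\mathbb R^2\oplus\mathbb R^{2\times 2},\quad A^1(x)=\mathbb R^{2\times2},\quad A^2(x)=0,$$ with the traces - $\operatorname{tr}_{f\to e}\bm u=(\bm u\cdot\bm n,\ \bm u\cdot\bm t,\ \operatorname{div}\bm u)|_e$, $\operatorname{tr}_{f\to x}\bm u=(\bm u(x),\nabla\bm u(x))$, and $\operatorname{tr}_{e\to x}(a_0,a_1,a_2)=\big(a_0\bm n+a_1\bm t,\ (\partial_{\bm t}a_0)\bm n\bm n^T+(\partial_{\bm t}a_1)\bm t\bm t^T+a_2\bm n\bm t^T\big)(x)$ in degree $0$; - $\operatorname{tr}_{f\to e}\bm\sigma=(\bm n^T\bm\sigma\bm n,\ \bm t^T\bm\sigma\bm n,\ \operatorname{div}\bm\sigma\cdot\bm n)|_e$, $\operatorname{tr}_{f\to x}\bm\sigma=\bm\sigma(x)$, and $\operatorname{tr}_{e\to x}(a_0,a_1,a_2)=a_0(x)\bm n\bm n^T+a_1(x)\bm n\bm t^T$ in degree $1$; - zero in degree $2$, and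 the operators $d$: $\operatorname{sym}\operatorname{curl}$ and $\operatorname{div}\operatorname{div}$ on triangles; $(a_0,a_1,a_2)\mapsto(\partial_{\bm t}a_0,\ \partial_{\bm t}a_1-\tfrac12a_2,\ \tfrac12\partial_{\bm t}a_2)$ and $0$ on edges; $\operatorname{sym}\operatorname{curl}$ of first order jets and $0$ at vertices. The global space $\bm A^i$ consists of the functions on $\Omega$ whose restriction to each triangle $f$ lies in $A^i(f)$ and whose traces $\operatorname{tr}_{f\to\tau}$ on every edge and vertex $\tau$ do not depend on the triangle $f$ containing $\tau$. For a triangle $f$ and a face $\tau$ of $f$ (possibly $\tau=f$, with $\operatorname{tr}_{f\to f}=\mathrm{id}$), the bubble space is $B^i(\tau)=\{a\in\operatorname{tr}_{f\to\tau}A^i(f):\operatorname{tr}_{\tau\to\eta}a=0\text{ for all proper faces }\eta\text{ of }\tau\}$. *Currents.* $$\Upsilon_x(\bm u)=\sum_i\big(\tfrac12(\operatorname{div}\bm u)\psi_i-\bm u\cdot\nabla\psi_i\big)(x)\,z_i,\qquad \Upsilon_e(\bm\sigma)=\sum_i\Big(\int_e(\operatorname{div}\bm\sigma\cdot\bm n)\psi_i-\bm\sigma\bm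 n\cdot\nabla\psi_i\Big)z_i,\qquad \Upsilon_f(q)=\sum_i\Big(\int_f q\,\psi_i\Big)z_i .$$ Then the following hold. 1. $\Upsilon$ is a family of generalized currents for the divdiv complex: on fields that are smooth up to the boundary (with values in $\mathbb R^2$, $\mathbb S^2$ and $\mathbb R$, respectively), the maps $\Upsilon_x,\Upsilon_e,\Upsilon_f$ are linear and surjective onto $\mathcal{RT}^2$, and the Stokes formula $\Upsilon_\sigma(dw)=\sum_{\tau}\mathcal O(\tau,\sigma)\Upsilon_\tau(w)$ holds, the sum being over the faces $\tau$ of $\sigma$ of codimension one, with incidence numbers $\mathcal O(\tau,\sigma)=\pm1$. 2. The sequence is a finite element complex with trace structure (FECTS): the traces map the shape function spaces into each other; $\operatorname{tr}_{f\to x}u=0$ implies $\operatorname{tr}_{e\to x}\operatorname{tr}_{f\to e}u=0$; on every simplex $d$ maps $A^i(\tau)$ into $A^{i+1}(\tau)$ with $d\circ d=0$, and $d\operatorname{tr}_{f\to\tau}=\operatorname{tr}_{f\to\tau}d$; and the piecewise operators map $\bm A^i$ into $\bm A^{i+1}$ and coincide on $\bm A^0$ and $\bm A^1$ with the distributional operators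 $\operatorname{sym}\operatorname{curl}$ and $\operatorname{div}\operatorname{div}$ on $\Omega$. In each degree it has the geometric decomposition property $\sum_{\tau\subseteq f}\dim B^i(\tau)=\dim A^i(f)$ for every triangle $f$. 3. The sequence is compatible with $\Upsilon$: $\mathcal{RT}^2\subset\bm A^0$; for every simplex $\tau$ there is a linear map $\widetilde\Upsilon_\tau:A^{\dim\tau}(\tau)\to\mathcal{RT}^2$ with $\widetilde\Upsilon_\tau(\operatorname{tr}_{f\to\tau}w)=\Upsilon_\tau(w)$ for every triangle $f\supseteq\tau$ and $w\in A^{\dim\tau}(f)$; and the bubble complexes $$0\to B^0(f)\to B^1(f)\to B^2(f)\cap\ker\widetilde\Upsilon_f\to0,$$ $$0\to B^0(e)\to B^1(e)\cap\ker\widetilde\Upsilon_e\to B^2(e)\to0,$$ $$0\to B^0(x)\cap\ker\widetilde\Upsilon_x\to B^1(x)\to B^2(x)\to0$$ are exact complexes for all triangles $f$, edges $e$ and vertices $x$. 4. In each degree $i=0,1,2$, the cohomology of $0\to\bm A^0\xrightarrow{\operatorname{sym}\operatorname{curl}}\bm A^1\xrightarrow{\operatorname{div}\operatorname{div}}\bm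 A^2\to0$ is isomorphic to $\mathcal{RT}^2\otimes\mathcal H^i_{dR}(\Omega)$, where $\mathcal H^\bullet_{dR}(\Omega)$ is the cohomology of $0\to C^\infty(\Omega)\xrightarrow{\operatorname{grad}}C^\infty(\Omega)\otimes\mathbb R^2\xrightarrow{\operatorname{rot}}C^\infty(\Omega)\to0$, $\operatorname{rot}\bm q=\partial_xq_2-\partial_yq_1$. -/

import Mathlib

open scoped ContDiff TensorProduct

noncomputable section

namespace DivDiv

/-! ## Fields, polynomials and differential operators in the plane -/

/-- The Euclidean plane. -/
abbrev Plane := EuclideanSpace ℝ (Fin 2)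

/-- Real polynomials in two variables. -/
abbrev Poly := MvPolynomial (Fin 2) ℝ

/-- Vector valued polynomials. -/
abbrev VecPoly := Fin 2 → Poly

/-- Matrix valued polynomials. -/
abbrev MatPoly := Matrix (Fin 2) (Fin 2) Poly

/-- Polynomials of total degree at most `m`. -/
abbrev polyLE (m : ℕ) : Submodule ℝ Poly := MvPolynomial.restrictTotalDegree (Fin 2) ℝ m

/-- Value of a polynomial at a point of the plane. -/
def evalAt (x : Plane) : Poly →ₗ[ℝ] ℝ := (MvPolynomial.aeval (fun i => x i)).toLinearMap

section Operators

/-! The operators are written once, for scalars in `R` with partial derivatives `D 0`, `D 1`; they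
are used for functions on the plane and for polynomials. They act row-wise. -/

variable {R : Type} [AddCommGroup R] [Module ℝ R] (D : Fin 2 → R → R)

/-- `div q = ∂₀ q₀ + ∂₁ q₁`. -/
def divV (q : Fin 2 → R) : R := D 0 (q 0) + D 1 (q 1)

/-- `rot q = ∂₀ q₁ - ∂₁ q₀`. -/
def rotV (q : Fin 2 → R) : R := D 0 (q 1) - D 1 (q 0)

/-- Row-wise `curl`, where `curl v = (-∂₁ v, ∂₀ v)`. -/
def curlV (u : Fin 2 → R) : Matrix (Fin 2) (Fin 2) R :=
  Matrix.of fun i => ![- D 1 (u i), D 0 (u i)]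

/-- The symmetric part of the row-wise `curl`. -/
def symCurl (u : Fin 2 → R) : Matrix (Fin 2) (Fin 2) R :=
  (1 / 2 : ℝ) • (curlV D u + (curlV D u).transpose)

/-- Row-wise divergence. -/
def divM (σ : Matrix (Fin 2) (Fin 2) R) : Fin 2 → R := fun i => divV D (σ i)

/-- The operator `div div`. -/
def divDiv (σ : Matrix (Fin 2) (Fin 2) R) : R := divV D (divM D σ)

end Operators

/-- Partial derivatives of functions on the plane. -/
def pd (i : Fin 2) (g : Plane → ℝ) : Plane → ℝ :=
  fun x => fderiv ℝ g x (EuclideanSpace.single i 1)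

/-- Partial derivatives of polynomials. -/
def pdP (i : Fin 2) (p : Poly) : Poly := MvPolynomial.pderiv i p

/-- The functions on the plane given by polynomials. -/
def polyFun (p : Poly) : Plane → ℝ := fun x => evalAt x p

def vecFun (u : VecPoly) : Fin 2 → Plane → ℝ := fun i => polyFun (u i)

def matFun (σ : MatPoly) : Matrix (Fin 2) (Fin 2) (Plane → ℝ) :=
  Matrix.of fun i j => polyFun (σ i j)

/-- Smooth scalar, vector and symmetric matrix fields on the plane. Their restrictions to the
closure of a domain are the fields that are smooth up to the boundary. -/
def SmoothScalar : Submodule ℝ (Plane → ℝ) where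
  carrier := {q | ContDiff ℝ ∞ q}
  zero_mem' := (contDiff_const : ContDiff ℝ ∞ fun _ : Plane => (0 : ℝ))
  add_mem' := fun {a b} (ha : ContDiff ℝ ∞ a) (hb : ContDiff ℝ ∞ b) => ha.add hb
  smul_mem' := fun c a (ha : ContDiff ℝ ∞ a) => ha.const_smul c

def SmoothVec : Submodule ℝ (Fin 2 → Plane → ℝ) where
  carrier := {u | ∀ i, u i ∈ SmoothScalar}
  zero_mem' _ := Submodule.zero_mem _
  add_mem' ha hb i := Submodule.add_mem _ (ha i) (hb i)
  smul_mem' c _ ha i := Submodule.smul_mem _ c (ha i)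

def SmoothSym : Submodule ℝ (Matrix (Fin 2) (Fin 2) (Plane → ℝ)) where
  carrier := {σ | σ.IsSymm ∧ ∀ i j, σ i j ∈ SmoothScalar}
  zero_mem' := ⟨Matrix.isSymm_zero, fun _ _ => Submodule.zero_mem _⟩
  add_mem' ha hb := ⟨ha.1.add hb.1, fun i j => Submodule.add_mem _ (ha.2 i j) (hb.2 i j)⟩
  smul_mem' c _ ha := ⟨ha.1.smul c, fun i j => Submodule.smul_mem _ c (ha.2 i j)⟩

/-- The lowest order Raviart-Thomas space `{a + b x : a ∈ ℝ², b ∈ ℝ}`. -/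
def RT2 : Submodule ℝ VecPoly where
  carrier := {u | ∃ (a : Fin 2 → ℝ) (b : ℝ),
    u = fun i => MvPolynomial.C (a i) + MvPolynomial.C b * MvPolynomial.X i}
  zero_mem' := ⟨0, 0, by funext i; simp⟩
  add_mem' := by
    rintro _ _ ⟨a, b, rfl⟩ ⟨a', b', rfl⟩
    refine ⟨a + a', b + b', ?_⟩
    funext i
    simp only [Pi.add_apply, map_add]
    ring
  smul_mem' := by
    rintro c _ ⟨a, b, rfl⟩
    refine ⟨c • a, c * b, ?_⟩
    funext i
    simp only [Pi.smul_apply, MvPolynomial.smul_eq_C_mul, smul_eq_mul, map_mul]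
    ring

/-! ## Cohomology of short sequences -/

section Cohomology

variable {V₀ V₁ V₂ : Type} [AddCommGroup V₀] [Module ℝ V₀] [AddCommGroup V₁] [Module ℝ V₁]
  [AddCommGroup V₂] [Module ℝ V₂]

/-! The cohomology of `0 → A₀ → A₁ → A₂ → 0`, for subspaces `A₀`, `A₁`, `A₂` that are preserved by
the maps `d₀ : V₀ → V₁` and `d₁ : V₁ → V₂`. -/

abbrev Coh0 (A₀ : Submodule ℝ V₀) (d₀ : V₀ →ₗ[ℝ] V₁) : Type :=
  ↥(A₀ ⊓ LinearMap.ker d₀)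

abbrev Coh1 (A₀ : Submodule ℝ V₀) (A₁ : Submodule ℝ V₁) (d₀ : V₀ →ₗ[ℝ] V₁) (d₁ : V₁ →ₗ[ℝ] V₂) :
    Type :=
  ↥(A₁ ⊓ LinearMap.ker d₁) ⧸ (A₀.map d₀).submoduleOf (A₁ ⊓ LinearMap.ker d₁)

abbrev Coh2 (A₁ : Submodule ℝ V₁) (A₂ : Submodule ℝ V₂) (d₁ : V₁ →ₗ[ℝ] V₂) : Type :=
  ↥A₂ ⧸ (A₁.map d₁).submoduleOf A₂

/-- `0 → B₀ → B₁ → B₂ → 0` is an exact complex. (The second equality contains that `d₀` maps `B₀`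
into `B₁` and that `d₁ ∘ d₀` vanishes on `B₀`.) -/
def IsExactSeq (B₀ : Submodule ℝ V₀) (B₁ : Submodule ℝ V₁) (B₂ : Submodule ℝ V₂)
    (d₀ : V₀ →ₗ[ℝ] V₁) (d₁ : V₁ →ₗ[ℝ] V₂) : Prop :=
  B₀ ⊓ LinearMap.ker d₀ = ⊥ ∧ B₁ ⊓ LinearMap.ker d₁ = B₀.map d₀ ∧ B₁.map d₁ = B₂

end Cohomology

/-! ## De Rham cohomology of a plane domain -/

section DeRham

variable (Ω : TopologicalSpace.Opens Plane)

/-- Extension by zero of a function on `Ω`. -/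
def extZero : (Ω → ℝ) →ₗ[ℝ] (Plane → ℝ) := Function.ExtendByZero.linearMap ℝ Subtype.val

lemma extZero_apply (g : Ω → ℝ) (x : Ω) : extZero Ω g x = g x :=
  Subtype.val_injective.extend_apply g 0 x

/-- The space `C^∞(Ω)`. -/
def Cinf : Submodule ℝ (Ω → ℝ) where
  carrier := {g | ContDiffOn ℝ ∞ (extZero Ω g) Ω}
  zero_mem' := by
    show ContDiffOn ℝ ∞ (extZero Ω 0) Ω
    rw [map_zero]
    exact contDiffOn_const
  add_mem' := by
    intro a b ha hb
    show ContDiffOn ℝ ∞ (extZero Ω (a + b)) Ω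
    rw [map_add]
    exact ContDiffOn.add ha hb
  smul_mem' := by
    intro c a ha
    show ContDiffOn ℝ ∞ (extZero Ω (c • a)) Ω
    rw [map_smul]
    exact ContDiffOn.const_smul c ha

variable {Ω} in
lemma Cinf_differentiableAt (g : Cinf Ω) (x : Ω) :
    DifferentiableAt ℝ (extZero Ω g.1) x :=
  (g.2.differentiableOn (by simp)).differentiableAt (Ω.isOpen.mem_nhds x.2)

/-- Partial derivatives on `C^∞(Ω)`. -/
def pdΩ (i : Fin 2) : Cinf Ω →ₗ[ℝ] Cinf Ω where
  toFun g := ⟨fun x => pd i (extZero Ω g.1) x, by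
    have h1 : ContDiffOn ℝ ∞ (fun x => fderiv ℝ (extZero Ω g.1) x) Ω :=
      g.2.fderiv_of_isOpen Ω.isOpen (by simp)
    have h2 : ContDiffOn ℝ ∞ (pd i (extZero Ω g.1)) Ω := h1.clm_apply contDiffOn_const
    exact h2.congr fun x hx => extZero_apply Ω _ ⟨x, hx⟩⟩
  map_add' a b := by
    ext x
    simp only [pd, Submodule.coe_add, map_add, Pi.add_apply]
    rw [fderiv_add (Cinf_differentiableAt a x) (Cinf_differentiableAt b x)]
    rfl
  map_smul' c a := by
    ext x
    simp only [pd, Submodule.coe_smul, map_smul, Pi.smul_apply, RingHom.id_apply]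
    rw [fderiv_const_smul (Cinf_differentiableAt a x)]
    rfl

/-- `grad : C^∞(Ω) → C^∞(Ω) ⊗ ℝ²`. -/
def gradΩ : Cinf Ω →ₗ[ℝ] (Fin 2 → Cinf Ω) := LinearMap.pi fun i => pdΩ Ω i

/-- `rot : C^∞(Ω) ⊗ ℝ² → C^∞(Ω)`, `rot q = ∂₀ q₁ - ∂₁ q₀`. -/
def rotΩ : (Fin 2 → Cinf Ω) →ₗ[ℝ] Cinf Ω :=
  (pdΩ Ω 0) ∘ₗ LinearMap.proj 1 - (pdΩ Ω 1) ∘ₗ LinearMap.proj 0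

/-- De Rham cohomology of `Ω`: the cohomology of
`0 → C^∞(Ω) → C^∞(Ω) ⊗ ℝ² → C^∞(Ω) → 0` with the maps `grad` and `rot`. -/
abbrev HdR0 : Type := Coh0 (⊤ : Submodule ℝ (Cinf Ω)) (gradΩ Ω)

abbrev HdR1 : Type :=
  Coh1 (⊤ : Submodule ℝ (Cinf Ω)) (⊤ : Submodule ℝ (Fin 2 → Cinf Ω)) (gradΩ Ω) (rotΩ Ω)

abbrev HdR2 : Type :=
  Coh2 (⊤ : Submodule ℝ (Fin 2 → Cinf Ω)) (⊤ : Submodule ℝ (Cinf Ω)) (rotΩ Ω)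

end DeRham

/-! ## Triangulations -/

/-- The triangles of a simplicial complex in the plane, as sets of three vertices. -/
def triangles (K : Geometry.SimplicialComplex ℝ Plane) : Set (Finset Plane) :=
  {f | f ∈ K.faces ∧ f.card = 3}

/-- The star of a vertex: the union of the closed triangles that contain it. -/
def vertexStar (K : Geometry.SimplicialComplex ℝ Plane) (x : Plane) : Set Plane :=
  ⋃ f ∈ {f | f ∈ triangles K ∧ x ∈ f}, convexHull ℝ (f : Set Plane)

/-- `K` is a (finite, conforming) triangulation of `Ω`: all simplices of `K` are faces of triangles
of `K`, and `Ω` is the interior of the union of the closed triangles. The triangles at a vertex form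
a patch with connected interior, which excludes domains that touch themselves at a vertex. -/
structure IsTriangulation (K : Geometry.SimplicialComplex ℝ Plane)
    (Ω : TopologicalSpace.Opens Plane) : Prop where
  finite : K.faces.Finite
  pure : ∀ s ∈ K.faces, ∃ f ∈ triangles K, s ⊆ f
  eq_interior : (Ω : Set Plane) = interior K.space
  star_connected : ∀ x ∈ K.vertices, IsConnected (interior (vertexStar K x))

/-- An orientation of every edge of `K`. -/
structure EdgeOrientation (K : Geometry.SimplicialComplex ℝ Plane) where
  start : Finset Plane → Plane
  finish : Finset Plane → Plane
  spec : ∀ e ∈ K.faces, e.card = 2 → (e : Set Plane) = {start e, finish e}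

section Edge

variable {K : Geometry.SimplicialComplex ℝ Plane} (o : EdgeOrientation K) (e : Finset Plane)

/-- Length of an edge. -/
def EdgeOrientation.len : ℝ := dist (o.start e) (o.finish e)

/-- Unit tangential vector `t` of an edge. -/
def EdgeOrientation.tang : Plane := (o.len e)⁻¹ • (o.finish e - o.start e)

/-- Unit normal vector `n` of an edge: `t` rotated by a quarter turn counterclockwise. -/
def EdgeOrientation.nrm : Plane := !₂[- (o.tang e) 1, (o.tang e) 0]

/-- Arclength parametrization of an edge, by `[0, len e]`. -/
def EdgeOrientation.param (s : ℝ) : Plane := o.start e + s • o.tang e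

/-- Arclength coordinate of a point of an edge. -/
def EdgeOrientation.coord (x : Plane) : ℝ := inner ℝ (x - o.start e) (o.tang e)

/-- Restriction to an edge of a polynomial, as a polynomial in the arclength coordinate. In this
coordinate, the tangential derivative is the ordinary derivative of univariate polynomials. -/
def EdgeOrientation.restr : Poly →ₗ[ℝ] Polynomial ℝ :=
  (MvPolynomial.aeval fun i =>
    Polynomial.C (o.start e i) + Polynomial.C (o.tang e i) * Polynomial.X).toLinearMap

/-- Incidence number of a vertex of an edge and the edge. -/
def EdgeOrientation.incV (x : Plane) : ℝ :=
  open Classical in if x = o.finish e then 1 else -1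

/-- Incidence number of an edge of a triangle and the triangle, all triangles being oriented
clockwise (so that the normal vector of the oriented boundary points outwards): it is `-1` if the
triangle lies to the left of the oriented edge. -/
def EdgeOrientation.incF (f : Finset Plane) : ℝ :=
  open Classical in if ∃ c ∈ f, 0 < inner ℝ (c - o.start e) (o.nrm e) then -1 else 1

end Edge

/-! ## Trace structures -/

section TraceStructure

/-- Shape function spaces on triangles, edges and vertices, and trace operators between them. The
shape function spaces are subspaces of fixed spaces `MF`, `ME`, `MV`. The traces `σ → σ` are the
identity and are left out. -/
structure TraceData (MF ME MV : Type) [AddCommGroup MF] [Module ℝ MF] [AddCommGroup ME]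
    [Module ℝ ME] [AddCommGroup MV] [Module ℝ MV] where
  AF : Finset Plane → Submodule ℝ MF
  AE : Finset Plane → Submodule ℝ ME
  AV : Plane → Submodule ℝ MV
  trFE : Finset Plane → Finset Plane → MF →ₗ[ℝ] ME
  trFV : Finset Plane → Plane → MF →ₗ[ℝ] MV
  trEV : Finset Plane → Plane → ME →ₗ[ℝ] MV

variable {MF ME MV : Type} [AddCommGroup MF] [Module ℝ MF] [AddCommGroup ME]
    [Module ℝ ME] [AddCommGroup MV] [Module ℝ MV]
variable (K : Geometry.SimplicialComplex ℝ Plane) (S : TraceData MF ME MV)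

/-- The traces map the shape function spaces into each other, and a vanishing trace at a vertex
implies that the composed trace through an edge vanishes. -/
def IsTraceStructure : Prop :=
  (∀ f ∈ triangles K, ∀ e ∈ f.powersetCard 2, ∀ u ∈ S.AF f, S.trFE f e u ∈ S.AE e) ∧
  (∀ f ∈ triangles K, ∀ x ∈ f, ∀ u ∈ S.AF f, S.trFV f x u ∈ S.AV x) ∧
  (∀ f ∈ triangles K, ∀ e ∈ f.powersetCard 2, ∀ x ∈ e, ∀ a ∈ S.AE e, S.trEV e x a ∈ S.AV x) ∧
  (∀ f ∈ triangles K, ∀ e ∈ f.powersetCard 2, ∀ x ∈ e, ∀ u ∈ S.AF f,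
    S.trFV f x u = 0 → S.trEV e x (S.trFE f e u) = 0)

/-- Bubble space of a triangle. -/
def bubbleF (f : Finset Plane) : Submodule ℝ MF :=
  S.AF f ⊓ (⨅ e ∈ f.powersetCard 2, LinearMap.ker (S.trFE f e)) ⊓
    (⨅ x ∈ f, LinearMap.ker (S.trFV f x))

/-- Bubble space of an edge `e`, seen from a triangle `f` that contains it. -/
def bubbleE (f e : Finset Plane) : Submodule ℝ ME :=
  (S.AF f).map (S.trFE f e) ⊓ (⨅ x ∈ e, LinearMap.ker (S.trEV e x))

/-- Bubble space of a vertex `x`, seen from a triangle `f` that contains it. -/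
def bubbleV (f : Finset Plane) (x : Plane) : Submodule ℝ MV := (S.AF f).map (S.trFV f x)

/-- Geometric decomposition: the dimensions of the bubble spaces of all faces of a triangle add up
to the dimension of its shape function space. -/
def HasGeometricDecomposition : Prop :=
  ∀ f ∈ triangles K,
    Module.finrank ℝ (bubbleF S f) + ∑ e ∈ f.powersetCard 2, Module.finrank ℝ (bubbleE S f e) +
      ∑ x ∈ f, Module.finrank ℝ (bubbleV S f x) = Module.finrank ℝ (S.AF f)

/-- The global space. A function in `L²(Ω)` whose restriction to each triangle is a shape function
is given by the family of its restrictions; all traces have to be single-valued. -/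
def globalSpace : Submodule ℝ (triangles K → MF) where
  carrier := {u | (∀ f : triangles K, u f ∈ S.AF f) ∧
    (∀ f g : triangles K, ∀ e ∈ f.1.powersetCard 2, e ⊆ g.1 →
      S.trFE f e (u f) = S.trFE g e (u g)) ∧
    (∀ f g : triangles K, ∀ x ∈ f.1, x ∈ g.1 → S.trFV f x (u f) = S.trFV g x (u g))}
  zero_mem' := ⟨fun _ => Submodule.zero_mem _, fun f g e _ _ => by simp, fun f g x _ _ => by simp⟩
  add_mem' := by
    rintro u v ⟨hu1, hu2, hu3⟩ ⟨hv1, hv2, hv3⟩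
    refine ⟨fun f => Submodule.add_mem _ (hu1 f) (hv1 f), fun f g e he hg => ?_,
      fun f g x hf hg => ?_⟩
    · simp only [Pi.add_apply, map_add, hu2 f g e he hg, hv2 f g e he hg]
    · simp only [Pi.add_apply, map_add, hu3 f g x hf hg, hv3 f g x hf hg]
  smul_mem' := by
    rintro c u ⟨hu1, hu2, hu3⟩
    refine ⟨fun f => Submodule.smul_mem _ c (hu1 f), fun f g e he hg => ?_, fun f g x hf hg => ?_⟩
    · simp only [Pi.smul_apply, map_smul, hu2 f g e he hg]
    · simp only [Pi.smul_apply, map_smul, hu3 f g x hf hg]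

end TraceStructure

/-! ## Finite element complexes with trace structure, for the divdiv complex -/

/-- Triples of polynomials on an edge, in the arclength coordinate. -/
abbrev Edge3 := Polynomial ℝ × Polynomial ℝ × Polynomial ℝ

abbrev Mat2 := Matrix (Fin 2) (Fin 2) ℝ

/-- First order jets of vector fields at a point: the value `v` and the matrix with the entry
`∂ⱼ vᵢ` in row `i` and column `j`. -/
abbrev Jet1 := (Fin 2 → ℝ) × Mat2

/-- Three columns of shape function spaces and traces, with row operators on each simplex. -/
structure Sequence where
  S0 : TraceData VecPoly Edge3 Jet1
  S1 : TraceData MatPoly Edge3 Mat2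
  S2 : TraceData Poly PUnit PUnit
  dF0 : Finset Plane → VecPoly →ₗ[ℝ] MatPoly
  dF1 : Finset Plane → MatPoly →ₗ[ℝ] Poly
  dE0 : Finset Plane → Edge3 →ₗ[ℝ] Edge3
  dE1 : Finset Plane → Edge3 →ₗ[ℝ] PUnit
  dV0 : Plane → Jet1 →ₗ[ℝ] Mat2
  dV1 : Plane → Mat2 →ₗ[ℝ] PUnit

section FECTS

variable (K : Geometry.SimplicialComplex ℝ Plane) (Ω : TopologicalSpace.Opens Plane) (Q : Sequence)

/-- The operators on piecewise polynomial functions, triangle by triangle. -/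
def globalD0 : (triangles K → VecPoly) →ₗ[ℝ] (triangles K → MatPoly) :=
  LinearMap.pi fun f => (Q.dF0 f.1) ∘ₗ LinearMap.proj f

def globalD1 : (triangles K → MatPoly) →ₗ[ℝ] (triangles K → Poly) :=
  LinearMap.pi fun f => (Q.dF1 f.1) ∘ₗ LinearMap.proj f

/-- Compactly supported smooth scalar functions in `Ω`. -/
def IsTest (φ : Plane → ℝ) : Prop :=
  ContDiff ℝ ∞ φ ∧ HasCompactSupport φ ∧ tsupport φ ⊆ Ω

/-- The piecewise polynomial `τ` is `sym curl u` in the sense of distributions on `Ω`. (The formal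
adjoint of `sym curl` on symmetric matrix fields is `-rot`, row-wise.) -/
def IsWeakSymCurl (u : triangles K → VecPoly) (τ : triangles K → MatPoly) : Prop :=
  ∀ φ : Matrix (Fin 2) (Fin 2) (Plane → ℝ), φ.IsSymm → (∀ i j, IsTest Ω (φ i j)) →
    ∑ᶠ f : triangles K, ∫ x in convexHull ℝ (f.1 : Set Plane),
        ∑ i, polyFun (u f i) x * (- rotV pd (φ i) x) =
      ∑ᶠ f : triangles K, ∫ x in convexHull ℝ (f.1 : Set Plane),
        ∑ i, ∑ j, polyFun (τ f i j) x * φ i j x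

/-- The piecewise polynomial `q` is `div div σ` in the sense of distributions on `Ω`. -/
def IsWeakDivDiv (σ : triangles K → MatPoly) (q : triangles K → Poly) : Prop :=
  ∀ φ : Plane → ℝ, IsTest Ω φ →
    ∑ᶠ f : triangles K, ∫ x in convexHull ℝ (f.1 : Set Plane),
        ∑ i, ∑ j, polyFun (σ f i j) x * pd i (pd j φ) x =
      ∑ᶠ f : triangles K, ∫ x in convexHull ℝ (f.1 : Set Plane), polyFun (q f) x * φ x

/-- Conforming finite element subcomplex with trace structure of the divdiv complex on `Ω`. -/
structure IsFECTS : Prop where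
  trace0 : IsTraceStructure K Q.S0
  trace1 : IsTraceStructure K Q.S1
  trace2 : IsTraceStructure K Q.S2
  /-- The global spaces are mapped into each other, by the distributional operators on `Ω`. -/
  conf0 : ∀ u ∈ globalSpace K Q.S0,
    globalD0 K Q u ∈ globalSpace K Q.S1 ∧ IsWeakSymCurl K Ω u (globalD0 K Q u)
  conf1 : ∀ σ ∈ globalSpace K Q.S1,
    globalD1 K Q σ ∈ globalSpace K Q.S2 ∧ IsWeakDivDiv K Ω σ (globalD1 K Q σ)
  /-- On triangles, the row operators are the operators of the divdiv complex. -/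
  dF0_eq : ∀ f ∈ triangles K, ∀ u ∈ Q.S0.AF f, matFun (Q.dF0 f u) = symCurl pd (vecFun u)
  dF1_eq : ∀ f ∈ triangles K, ∀ σ ∈ Q.S1.AF f, polyFun (Q.dF1 f σ) = divDiv pd (matFun σ)
  /-- On every simplex, the row operators map the shape function spaces into each other and compose
  to zero. -/
  mapsF : ∀ f ∈ triangles K, (∀ u ∈ Q.S0.AF f, Q.dF0 f u ∈ Q.S1.AF f ∧ Q.dF1 f (Q.dF0 f u) = 0) ∧
    ∀ σ ∈ Q.S1.AF f, Q.dF1 f σ ∈ Q.S2.AF f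
  mapsE : ∀ e ∈ K.faces, e.card = 2 →
    (∀ a ∈ Q.S0.AE e, Q.dE0 e a ∈ Q.S1.AE e ∧ Q.dE1 e (Q.dE0 e a) = 0) ∧
    ∀ a ∈ Q.S1.AE e, Q.dE1 e a ∈ Q.S2.AE e
  mapsV : ∀ x ∈ K.vertices, (∀ a ∈ Q.S0.AV x, Q.dV0 x a ∈ Q.S1.AV x ∧ Q.dV1 x (Q.dV0 x a) = 0) ∧
    ∀ a ∈ Q.S1.AV x, Q.dV1 x a ∈ Q.S2.AV x
  /-- The row operators commute with the traces from triangles. -/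
  commE0 : ∀ f ∈ triangles K, ∀ e ∈ f.powersetCard 2, ∀ u ∈ Q.S0.AF f,
    Q.dE0 e (Q.S0.trFE f e u) = Q.S1.trFE f e (Q.dF0 f u)
  commE1 : ∀ f ∈ triangles K, ∀ e ∈ f.powersetCard 2, ∀ σ ∈ Q.S1.AF f,
    Q.dE1 e (Q.S1.trFE f e σ) = Q.S2.trFE f e (Q.dF1 f σ)
  commV0 : ∀ f ∈ triangles K, ∀ x ∈ f, ∀ u ∈ Q.S0.AF f,
    Q.dV0 x (Q.S0.trFV f x u) = Q.S1.trFV f x (Q.dF0 f u)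
  commV1 : ∀ f ∈ triangles K, ∀ x ∈ f, ∀ σ ∈ Q.S1.AF f,
    Q.dV1 x (Q.S1.trFV f x σ) = Q.S2.trFV f x (Q.dF1 f σ)

end FECTS

/-! ## Generalized currents and compatibility -/

/-- Maps from vector fields, matrix fields and scalar fields on the plane to `Z`, for each vertex,
each edge and each triangle. -/
structure Currents (Z : Submodule ℝ VecPoly) where
  V : Plane → (Fin 2 → Plane → ℝ) → Z
  E : Finset Plane → Matrix (Fin 2) (Fin 2) (Plane → ℝ) → Z
  F : Finset Plane → (Plane → ℝ) → Z

section Compatibility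

variable {Z : Submodule ℝ VecPoly} (K : Geometry.SimplicialComplex ℝ Plane)

/-- Generalized currents for the divdiv complex: on smooth fields, the maps are linear and
surjective and satisfy the Stokes formula. -/
structure IsGeneralizedCurrents (o : EdgeOrientation K) (Υ : Currents Z) : Prop where
  linV : ∀ x ∈ K.vertices, ∃ L : SmoothVec →ₗ[ℝ] Z, (∀ u, L u = Υ.V x u) ∧ Function.Surjective L
  linE : ∀ e ∈ K.faces, e.card = 2 →
    ∃ L : SmoothSym →ₗ[ℝ] Z, (∀ σ, L σ = Υ.E e σ) ∧ Function.Surjective L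
  linF : ∀ f ∈ triangles K,
    ∃ L : SmoothScalar →ₗ[ℝ] Z, (∀ q, L q = Υ.F f q) ∧ Function.Surjective L
  stokesE : ∀ e ∈ K.faces, e.card = 2 → ∀ u ∈ SmoothVec,
    Υ.E e (symCurl pd u) = ∑ x ∈ e, o.incV e x • Υ.V x u
  stokesF : ∀ f ∈ triangles K, ∀ σ ∈ SmoothSym,
    Υ.F f (divDiv pd σ) = ∑ e ∈ f.powersetCard 2, o.incF e f • Υ.E e σ

/-- Compatibility with currents `Υ`: the currents factor through the traces, `Z` is contained in the
first global space, and the bubble complexes of all triangles, edges and vertices, restricted by the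
kernel of the localized current in the degree given by the dimension, are exact. -/
def IsCompatible (Q : Sequence) (Υ : Currents Z) : Prop :=
  (∀ z ∈ Z, (fun _ => z) ∈ globalSpace K Q.S0) ∧
  ∃ (LV : Plane → Jet1 →ₗ[ℝ] Z) (LE : Finset Plane → Edge3 →ₗ[ℝ] Z)
    (LF : Finset Plane → Poly →ₗ[ℝ] Z),
    (∀ f ∈ triangles K, ∀ x ∈ f, ∀ u ∈ Q.S0.AF f, LV x (Q.S0.trFV f x u) = Υ.V x (vecFun u)) ∧
    (∀ f ∈ triangles K, ∀ e ∈ f.powersetCard 2, ∀ σ ∈ Q.S1.AF f,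
      LE e (Q.S1.trFE f e σ) = Υ.E e (matFun σ)) ∧
    (∀ f ∈ triangles K, ∀ q ∈ Q.S2.AF f, LF f q = Υ.F f (polyFun q)) ∧
    (∀ f ∈ triangles K,
      IsExactSeq (bubbleF Q.S0 f) (bubbleF Q.S1 f) (bubbleF Q.S2 f ⊓ LinearMap.ker (LF f))
        (Q.dF0 f) (Q.dF1 f)) ∧
    (∀ f ∈ triangles K, ∀ e ∈ f.powersetCard 2,
      IsExactSeq (bubbleE Q.S0 f e) (bubbleE Q.S1 f e ⊓ LinearMap.ker (LE e)) (bubbleE Q.S2 f e)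
        (Q.dE0 e) (Q.dE1 e)) ∧
    (∀ f ∈ triangles K, ∀ x ∈ f,
      IsExactSeq (bubbleV Q.S0 f x ⊓ LinearMap.ker (LV x)) (bubbleV Q.S1 f x) (bubbleV Q.S2 f x)
        (Q.dV0 x) (Q.dV1 x))

end Compatibility

/-! ## The currents of the divdiv complex and the Hu-Ma-Zhang sequence -/

section HuMaZhang

variable {K : Geometry.SimplicialComplex ℝ Plane} (o : EdgeOrientation K)

/-- The currents of the divdiv complex, for a basis `ψ` of `P₁` and a basis `z` of `RT2`. -/
def divdivCurrents (ψ : Module.Basis (Fin 3) ℝ (polyLE 1)) (z : Module.Basis (Fin 3) ℝ RT2) :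
    Currents RT2 where
  V x u := ∑ i, ((1 / 2) * divV pd u x * polyFun (ψ i) x -
    ∑ j, u j x * polyFun (pdP j (ψ i)) x) • z i
  E e σ := ∑ i, (∫ s in (0 : ℝ)..(o.len e),
    ((∑ j, divM pd σ j (o.param e s) * o.nrm e j) * polyFun (ψ i) (o.param e s) -
      ∑ j, (∑ l, σ j l (o.param e s) * o.nrm e l) * polyFun (pdP j (ψ i)) (o.param e s))) • z i
  F f q := ∑ i, (∫ x in convexHull ℝ (f : Set Plane), q x * polyFun (ψ i) x) • z i

/-- Shape functions `P_m ⊗ ℝ²`. -/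
def vecPolyLE (m : ℕ) : Submodule ℝ VecPoly := Submodule.pi Set.univ fun _ => polyLE m

/-- Shape functions `P_m ⊗ 𝕊²`. -/
def symPolyLE (m : ℕ) : Submodule ℝ MatPoly where
  carrier := {σ | σ.IsSymm ∧ ∀ i j, σ i j ∈ polyLE m}
  zero_mem' := ⟨Matrix.isSymm_zero, fun _ _ => Submodule.zero_mem _⟩
  add_mem' ha hb := ⟨ha.1.add hb.1, fun i j => Submodule.add_mem _ (ha.2 i j) (hb.2 i j)⟩
  smul_mem' c _ ha := ⟨ha.1.smul c, fun i j => Submodule.smul_mem _ c (ha.2 i j)⟩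

/-- `u ↦ (u · n, u · t, div u)` on an edge. -/
def trFE0 (e : Finset Plane) : VecPoly →ₗ[ℝ] Edge3 where
  toFun u := (∑ i, o.nrm e i • o.restr e (u i), ∑ i, o.tang e i • o.restr e (u i),
    o.restr e (divV pdP u))
  map_add' u v := by
    ext1
    · simp [Finset.sum_add_distrib, smul_add]
    · ext1
      · simp [Finset.sum_add_distrib, smul_add]
      · simp only [divV, pdP, Pi.add_apply, map_add, Prod.snd_add]
        abel
  map_smul' c u := by
    ext1
    · simp [smul_comm c]
    · ext1
      · simp [smul_comm c]
      · simp [divV, pdP]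

/-- `σ ↦ (nᵀ σ n, tᵀ σ n, div σ · n)` on an edge. -/
def trFE1 (e : Finset Plane) : MatPoly →ₗ[ℝ] Edge3 where
  toFun σ := (∑ i, ∑ j, (o.nrm e i * o.nrm e j) • o.restr e (σ i j),
    ∑ i, ∑ j, (o.tang e i * o.nrm e j) • o.restr e (σ i j),
    ∑ i, o.nrm e i • o.restr e (divM pdP σ i))
  map_add' u v := by
    ext1
    · simp only [Matrix.add_apply, map_add, smul_add, Finset.sum_add_distrib, Prod.fst_add]
    · ext1
      · simp only [Matrix.add_apply, map_add, smul_add, Finset.sum_add_distrib, Prod.fst_add,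
          Prod.snd_add]
      · simp only [divM, divV, pdP, Matrix.add_apply, map_add, smul_add, Finset.sum_add_distrib,
          Prod.snd_add]
        abel
  map_smul' c u := by
    ext1
    · simp only [Matrix.smul_apply, map_smul, smul_comm _ c, Finset.smul_sum, Prod.smul_fst,
        RingHom.id_apply]
    · ext1
      · simp only [Matrix.smul_apply, map_smul, smul_comm _ c, Finset.smul_sum, Prod.smul_fst,
          Prod.smul_snd, RingHom.id_apply]
      · simp only [divM, divV, pdP, Matrix.smul_apply, Derivation.map_smul, map_add, map_smul,
          smul_add, smul_comm _ c, Finset.smul_sum, Prod.smul_snd, RingHom.id_apply]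

/-- `u ↦ (u(x), ∇u(x))`. -/
def trFV0 (x : Plane) : VecPoly →ₗ[ℝ] Jet1 where
  toFun u := (fun i => evalAt x (u i), Matrix.of fun i j => evalAt x (pdP j (u i)))
  map_add' u v := by
    ext <;> simp [pdP]
  map_smul' c u := by
    ext <;> simp [pdP]

/-- `σ ↦ σ(x)`. -/
def trFV1 (x : Plane) : MatPoly →ₗ[ℝ] Mat2 where
  toFun σ := Matrix.of fun i j => evalAt x (σ i j)
  map_add' u v := by
    ext
    simp
  map_smul' c u := by
    ext
    simp

/-- `(a₀, a₁, a₂) ↦ (a₀ n + a₁ t, a₀' n nᵀ + a₁' t tᵀ + a₂ n tᵀ)` at a vertex of an edge. -/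
def trEV0 (e : Finset Plane) (x : Plane) : Edge3 →ₗ[ℝ] Jet1 where
  toFun a :=
    (fun i => a.1.eval (o.coord e x) * o.nrm e i + a.2.1.eval (o.coord e x) * o.tang e i,
     Matrix.of fun i j =>
      a.1.derivative.eval (o.coord e x) * (o.nrm e i * o.nrm e j) +
      a.2.1.derivative.eval (o.coord e x) * (o.tang e i * o.tang e j) +
      a.2.2.eval (o.coord e x) * (o.nrm e i * o.tang e j))
  map_add' a b := by
    ext <;> simp <;> ring
  map_smul' c a := by
    ext <;> simp <;> ring

/-- `(a₀, a₁, a₂) ↦ a₀ n nᵀ + a₁ n tᵀ` at a vertex of an edge. -/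
def trEV1 (e : Finset Plane) (x : Plane) : Edge3 →ₗ[ℝ] Mat2 where
  toFun a := Matrix.of fun i j =>
    a.1.eval (o.coord e x) * (o.nrm e i * o.nrm e j) +
    a.2.1.eval (o.coord e x) * (o.nrm e i * o.tang e j)
  map_add' a b := by
    ext
    simp
    ring
  map_smul' c a := by
    ext
    simp
    ring

/-- `sym curl` on polynomials. -/
def symCurlP : VecPoly →ₗ[ℝ] MatPoly where
  toFun u := symCurl pdP u
  map_add' u v := by
    ext1 i j
    fin_cases i <;> fin_cases j <;> simp [symCurl, curlV, pdP] <;> module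
  map_smul' c u := by
    ext1 i j
    fin_cases i <;> fin_cases j <;> simp [symCurl, curlV, pdP] <;> module

/-- `div div` on polynomials. -/
def divDivP : MatPoly →ₗ[ℝ] Poly where
  toFun σ := divDiv pdP σ
  map_add' u v := by
    simp [divDiv, divM, divV, pdP]
    abel
  map_smul' c u := by
    simp [divDiv, divM, divV, pdP]

/-- The operator `(a₀, a₁, a₂) ↦ (a₀', a₁' - a₂ / 2, a₂' / 2)` on an edge. -/
def edgeOp : Edge3 →ₗ[ℝ] Edge3 where
  toFun a := (a.1.derivative, a.2.1.derivative - (1 / 2 : ℝ) • a.2.2,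
    (1 / 2 : ℝ) • a.2.2.derivative)
  map_add' a b := by
    ext1
    · simp
    · ext1
      · simp only [Prod.snd_add, Prod.fst_add, map_add]
        module
      · simp only [Prod.snd_add, map_add]
        module
  map_smul' c a := by
    ext1
    · simp
    · ext1
      · simp only [Prod.smul_snd, Prod.smul_fst, Polynomial.derivative_smul, RingHom.id_apply]
        module
      · simp only [Prod.smul_snd, Polynomial.derivative_smul, RingHom.id_apply]
        module

/-- `sym curl` on first order jets. -/
def jetOp : Jet1 →ₗ[ℝ] Mat2 where
  toFun a := (1 / 2 : ℝ) • ((Matrix.of fun i => ![- a.2 i 1, a.2 i 0]) +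
    (Matrix.of fun i => ![- a.2 i 1, a.2 i 0]).transpose)
  map_add' a b := by
    ext1 i j
    fin_cases i <;> fin_cases j <;> simp <;> ring
  map_smul' c a := by
    ext1 i j
    fin_cases i <;> fin_cases j <;> simp <;> ring

/-- The sequence of degree `k`: `P_k ⊗ ℝ² → P_{k-1} ⊗ 𝕊² → P_{k-3}` on triangles, with the operators
`sym curl` and `div div`. -/
def huMaZhang (k : ℕ) : Sequence where
  S0 :=
    { AF := fun _ => vecPolyLE k
      AE := fun _ => (Polynomial.degreeLE ℝ k).prod
        ((Polynomial.degreeLE ℝ k).prod (Polynomial.degreeLE ℝ (k - 1 : ℕ)))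
      AV := fun _ => ⊤
      trFE := fun _ e => trFE0 o e
      trFV := fun _ x => trFV0 x
      trEV := fun e x => trEV0 o e x }
  S1 :=
    { AF := fun _ => symPolyLE (k - 1)
      AE := fun _ => (Polynomial.degreeLE ℝ (k - 1 : ℕ)).prod
        ((Polynomial.degreeLE ℝ (k - 1 : ℕ)).prod (Polynomial.degreeLE ℝ (k - 2 : ℕ)))
      AV := fun _ => ⊤
      trFE := fun _ e => trFE1 o e
      trFV := fun _ x => trFV1 x
      trEV := fun e x => trEV1 o e x }
  S2 :=
    { AF := fun _ => polyLE (k - 3)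
      AE := fun _ => ⊤
      AV := fun _ => ⊤
      trFE := fun _ _ => 0
      trFV := fun _ _ => 0
      trEV := fun _ _ => 0 }
  dF0 := fun _ => symCurlP
  dF1 := fun _ => divDivP
  dE0 := fun _ => edgeOp
  dE1 := fun _ => 0
  dV0 := fun _ => jetOp
  dV1 := fun _ => 0

end HuMaZhang

end DivDiv

end

open scoped ContDiff TensorProduct

noncomputable section

namespace DivDiv

/-! ## Polynomials in the plane -/

section Polynomials

open MvPolynomial

/-! Locally, everything rests on three facts. On polynomials the sequence is exact in the middle
(`exists_symCurl_of_divDiv_eq_zero`), the kernel of `sym curl` is `RT2` (`symCurlP_eq_zero_iff`),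
and Green's formulas on one triangle have boundary integrands that depend only on the edge traces.
With an affine test function, whose Hessian vanishes, Green's formula for `div div` is the Stokes
formula for the currents; summed over all triangles, where inner edges cancel and boundary edges
carry no test function, Green's formulas give conformity.

Unisolvence and exactness of the triangle bubbles come out of one dimension count. The bubble spaces
are only bounded from above: bubbles in degree 0 are written explicitly with barycentric coordinates
(`bubbleF0_le`), those in degree 1 are bounded by rank-nullity for `div div`. The bounds add up
exactly to the dimension of the shape function space, so `trace_squeeze` turns all of them into
equalities. As a consequence traces at vertices and on edges can be prescribed, and `div div` maps
the bubbles onto all polynomials orthogonal to `P₁`. The edge and vertex bubble complexes are exact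
by integration along the edge and by linear algebra.

Globally, an element of `RT2` is determined by its first order jet at any point, so `RT2` plays the
role of the constants. Hence the cohomology in degree 0 is `RT2`, as `Ω` is connected. In degree 2
it vanishes: the edge currents reduce the question to surjectivity of the boundary map from edges to
triangles, which holds because the triangles are connected through edges and one of them has a
boundary edge. De Rham cohomology in degree 2 vanishes too, because near a boundary point the domain
is a cone: with a partition of unity, a function is written as a `rot` by integrating along rays
away from a point outside the domain.

In degree 1 both sides are compared with the combinatorial space `DiffCoh`: functions of two
triangles that are differences `κ f - κ g` around every vertex, modulo those that are differences
everywhere. This is a Čech type description for the covering by vertex stars. A closed finite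
element field has a potential on each triangle, with jumps in `RT2`; a closed one-form has a
primitive on each triangle, with jumps in `ℝ`. Conversely all local differences occur as jumps. In a
basis of `RT2` the two coefficient spaces differ by a tensor factor (`diffCoh_tensor`).
Connectedness of the vertex stars is needed at boundary vertices, where nearby points of `Ω` do not
link all the triangles at once. -/

lemma pdP_add (i : Fin 2) (p q : Poly) : pdP i (p + q) = pdP i p + pdP i q := map_add _ _ _
lemma pdP_sub (i : Fin 2) (p q : Poly) : pdP i (p - q) = pdP i p - pdP i q := map_sub _ _ _
lemma pdP_neg (i : Fin 2) (p : Poly) : pdP i (-p) = -pdP i p := map_neg _ _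
lemma pdP_zero (i : Fin 2) : pdP i 0 = 0 := map_zero _
lemma pdP_smul (i : Fin 2) (c : ℝ) (p : Poly) : pdP i (c • p) = c • pdP i p :=
  Derivation.map_smul _ _ _
lemma pdP_mul (i : Fin 2) (p q : Poly) : pdP i (p * q) = pdP i p * q + p * pdP i q :=
  MvPolynomial.pderiv_mul
lemma pdP_C (i : Fin 2) (a : ℝ) : pdP i (C a) = 0 := MvPolynomial.pderiv_C
lemma pdP_X (i j : Fin 2) : pdP i (X j : Poly) = if i = j then 1 else 0 := by
  unfold pdP
  rw [MvPolynomial.pderiv_X]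
  simp [Pi.single_apply, eq_comm]

/-- Partial derivatives of polynomials, as linear maps. -/
def pdL (i : Fin 2) : Poly →ₗ[ℝ] Poly := (pderiv i).toLinearMap

lemma pdL_apply (i : Fin 2) (p : Poly) : pdL i p = pdP i p := rfl

lemma pdP_comm (i j : Fin 2) (p : Poly) : pdP i (pdP j p) = pdP j (pdP i p) := by
  ext m
  simp only [pdP, coeff_pderiv, add_right_comm m (Finsupp.single i 1)]
  by_cases h : i = j
  · subst h; rfl
  · simp [h, Ne.symm h]
    ring

lemma degree_fin_two (d : Fin 2 →₀ ℕ) : (d.sum fun _ e => e) = d 0 + d 1 := by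
  rw [Finsupp.sum_fintype _ _ (fun _ => rfl), Fin.sum_univ_two]

lemma monomial_mem_polyLE {m : ℕ} {d : Fin 2 →₀ ℕ} (h : d 0 + d 1 ≤ m) (c : ℝ) :
    monomial d c ∈ polyLE m :=
  (monomial_mem_restrictSupport ℝ).2 (Or.inl (by
    rw [Set.mem_ofPred_eq, degree_fin_two]; exact h))

lemma polyLE_le_of_monomial {m : ℕ} {N : Submodule ℝ Poly}
    (h : ∀ d : Fin 2 →₀ ℕ, d 0 + d 1 ≤ m → monomial d (1 : ℝ) ∈ N) : polyLE m ≤ N := by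
  unfold polyLE restrictTotalDegree
  rw [restrictSupport_eq_span, Submodule.span_le]
  rintro _ ⟨d, hd, rfl⟩
  exact h d (by simpa [degree_fin_two] using hd)

lemma polyLE_mono {m n : ℕ} (h : m ≤ n) : polyLE m ≤ polyLE n := fun p hp => by
  rw [mem_restrictTotalDegree] at hp ⊢
  exact hp.trans h

lemma mul_mem_polyLE {m n l : ℕ} {p q : Poly} (hp : p ∈ polyLE m) (hq : q ∈ polyLE n)
    (h : m + n ≤ l) : p * q ∈ polyLE l := by
  rw [mem_restrictTotalDegree] at hp hq ⊢
  exact (totalDegree_mul _ _).trans (by lia)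

lemma C_mem_polyLE (a : ℝ) (m : ℕ) : (C a : Poly) ∈ polyLE m := by
  rw [mem_restrictTotalDegree, totalDegree_C]; exact Nat.zero_le _

lemma X_mem_polyLE (i : Fin 2) {m : ℕ} (hm : 1 ≤ m) : (X i : Poly) ∈ polyLE m := by
  rw [mem_restrictTotalDegree, totalDegree_X]; exact hm

lemma mem_polyLE_of_mul {m n : ℕ} {l q : Poly} (hl : l.totalDegree = n) (hl0 : l ≠ 0)
    (h : l * q ∈ polyLE m) : q ∈ polyLE (m - n) := by
  rw [mem_restrictTotalDegree] at h ⊢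
  by_cases hq : q = 0
  · simp [hq]
  · rw [totalDegree_mul_of_isDomain hl0 hq] at h
    lia

lemma pdP_mem_polyLE (i : Fin 2) {m : ℕ} {p : Poly} (hp : p ∈ polyLE m) :
    pdP i p ∈ polyLE (m - 1) := by
  have : polyLE m ≤ (polyLE (m - 1)).comap (pdL i) := by
    refine polyLE_le_of_monomial fun d hd => ?_
    change pderiv i (monomial d (1 : ℝ)) ∈ polyLE (m - 1)
    rw [pderiv_monomial]
    by_cases h : d i = 0
    · simp [h]
    · refine monomial_mem_polyLE ?_ _
      fin_cases i <;> simp at h ⊢ <;> omega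
  exact this hp

/-- Antiderivative of a polynomial in the variable `i`. -/
def integP (i : Fin 2) : Poly →ₗ[ℝ] Poly :=
  (basisMonomials (Fin 2) ℝ).constr ℝ fun d =>
    monomial (d + Finsupp.single i 1) ((d i + 1 : ℝ)⁻¹)

lemma integP_monomial (i : Fin 2) (d : Fin 2 →₀ ℕ) :
    integP i (monomial d (1 : ℝ)) = monomial (d + Finsupp.single i 1) ((d i + 1 : ℝ)⁻¹) := by
  have := (basisMonomials (Fin 2) ℝ).constr_basis ℝ
    (fun d => (monomial (d + Finsupp.single i 1) ((d i + 1 : ℝ)⁻¹) : Poly)) d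
  simpa [integP] using this

lemma poly_linearMap_ext {M : Type} [AddCommGroup M] [Module ℝ M] {A B : Poly →ₗ[ℝ] M}
    (h : ∀ d, A (monomial d 1) = B (monomial d 1)) : A = B :=
  (basisMonomials (Fin 2) ℝ).ext fun d => by simpa using h d

lemma pdP_integP (i : Fin 2) (p : Poly) : pdP i (integP i p) = p := by
  have : (pdL i) ∘ₗ integP i = LinearMap.id := by
    refine poly_linearMap_ext fun d => ?_
    have h : ((d i : ℝ) + 1) ≠ 0 := by positivity
    simp [integP_monomial, pdL_apply, pdP, pderiv_monomial, inv_mul_cancel₀ h]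
  exact LinearMap.congr_fun this p

lemma pdP_integP_of_ne {i j : Fin 2} (hij : i ≠ j) (p : Poly) :
    pdP j (integP i p) = integP i (pdP j p) := by
  have : (pdL j) ∘ₗ integP i = integP i ∘ₗ (pdL j) := by
    refine poly_linearMap_ext fun d => ?_
    change pderiv j (integP i (monomial d 1)) = integP i (pderiv j (monomial d 1))
    have e1 : (monomial (d - Finsupp.single j 1) ((1 : ℝ) * d j) : Poly) =
        (d j : ℝ) • monomial (d - Finsupp.single j 1) (1 : ℝ) := by
      rw [smul_monomial]; simp
    rw [integP_monomial, pderiv_monomial, pderiv_monomial, e1, map_smul, integP_monomial,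
      smul_monomial]
    by_cases h : d j = 0
    · simp [h, hij.symm]
    · have e2 : d + Finsupp.single i 1 - Finsupp.single j 1 =
          d - Finsupp.single j 1 + Finsupp.single i 1 := by
        refine tsub_add_eq_add_tsub ?_ |>.symm
        rw [Finsupp.single_le_iff]; omega
      rw [e2]
      simp [hij, mul_comm]
  exact LinearMap.congr_fun this p

lemma integP_mem_polyLE (i : Fin 2) {m : ℕ} {p : Poly} (hp : p ∈ polyLE m) :
    integP i p ∈ polyLE (m + 1) := by
  have : polyLE m ≤ (polyLE (m + 1)).comap (integP i) := by
    refine polyLE_le_of_monomial fun d hd => ?_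
    rw [Submodule.mem_comap, integP_monomial]
    refine monomial_mem_polyLE ?_ _
    fin_cases i <;> simp <;> omega
  exact this hp

/-- A divergence free polynomial field is a `curl`. -/
lemma exists_curl_of_divV_eq_zero {m : ℕ} {v : VecPoly} (hv : ∀ i, v i ∈ polyLE m)
    (h : divV pdP v = 0) : ∃ w ∈ polyLE (m + 1), v 0 = -pdP 1 w ∧ v 1 = pdP 0 w := by
  -- The antiderivative of `v 1` in the first variable already solves the second equation. The
  -- defect `r` in the first one does not depend on the first variable because the divergence
  -- vanishes, so integrating it in the second variable repairs the first equation and leaves the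
  -- second intact.
  set r := v 0 + pdP 1 (integP 0 (v 1)) with hr
  have hr0 : pdP 0 r = 0 := by
    rw [hr, pdP_add, pdP_comm, pdP_integP]; exact h
  have hrm : r ∈ polyLE m :=
    Submodule.add_mem _ (hv 0) (by simpa using pdP_mem_polyLE 1 (integP_mem_polyLE 0 (hv 1)))
  refine ⟨integP 0 (v 1) - integP 1 r, Submodule.sub_mem _ (integP_mem_polyLE 0 (hv 1))
    (integP_mem_polyLE 1 hrm), ?_, ?_⟩
  · rw [pdP_sub, pdP_integP, hr]; ring
  · rw [pdP_sub, pdP_integP, pdP_integP_of_ne (by decide), hr0, map_zero, sub_zero]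

/-- A symmetric polynomial matrix field `σ` with `div div σ = 0` is a `sym curl`; more precisely,
`div σ = curl w` and `σ - w J = curl u`. -/
lemma exists_symCurl_of_divDiv_eq_zero {m : ℕ} {σ : MatPoly} (hσ : ∀ i j, σ i j ∈ polyLE m)
    (hs : σ.IsSymm) (h : divDiv pdP σ = 0) :
    ∃ u : VecPoly, ∃ w : Poly, (∀ i, u i ∈ polyLE (m + 1)) ∧ symCurl pdP u = σ ∧
      divM pdP σ 0 = -pdP 1 w ∧ divM pdP σ 1 = pdP 0 w ∧
      σ 0 0 = -pdP 1 (u 0) ∧ σ 0 1 + w = pdP 0 (u 0) ∧ σ 1 0 - w = -pdP 1 (u 1) ∧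
      σ 1 1 = pdP 0 (u 1) ∧ divV pdP u = (2 : ℝ) • w := by
  have hd : ∀ i, divM pdP σ i ∈ polyLE (m - 1) := fun i =>
    Submodule.add_mem _ (pdP_mem_polyLE 0 (hσ i 0)) (pdP_mem_polyLE 1 (hσ i 1))
  obtain ⟨w, hw, hw0, hw1⟩ : ∃ w ∈ polyLE m, divM pdP σ 0 = -pdP 1 w ∧ divM pdP σ 1 = pdP 0 w := by
    -- For `m = 0` the truncated `m - 1` is again `0` and the general bound on the degree of `w`
    -- would be one too large; there `div σ = 0` and `w = 0` serves.
    by_cases hm : m = 0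
    · subst hm
      refine ⟨0, Submodule.zero_mem _, ?_⟩
      have hz : ∀ i j l, pdP l (σ i j) = 0 := by
        intro i j l
        have := (mem_restrictTotalDegree _ _ _).1 (hσ i j)
        rw [totalDegree_eq_zero_iff_eq_C.1 (Nat.le_zero.1 this), pdP_C]
      simp [divM, divV, hz, pdP_zero]
    · have := exists_curl_of_divV_eq_zero hd h
      rwa [Nat.sub_add_cancel (by omega)] at this
  have hs10 : σ 1 0 = σ 0 1 := hs.apply 0 1
  -- Since `div σ = curl w`, the rows of `σ` become divergence free after adding `w` at the upper
  -- right and subtracting it at the lower left. This correction is skew, so it disappears in the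
  -- symmetric part.
  obtain ⟨u0, hu0, h00, h01⟩ := exists_curl_of_divV_eq_zero (v := ![σ 0 0, σ 0 1 + w]) (m := m)
    (by intro i; fin_cases i
        · exact hσ 0 0
        · exact Submodule.add_mem _ (hσ 0 1) hw)
    (by have := hw0; simp [divM, divV, pdP_add] at this ⊢; linear_combination this)
  obtain ⟨u1, hu1, h10, h11⟩ := exists_curl_of_divV_eq_zero (v := ![σ 1 0 - w, σ 1 1]) (m := m)
    (by intro i; fin_cases i
        · exact Submodule.sub_mem _ (hσ 1 0) hw
        · exact hσ 1 1)
    (by have := hw1; simp [divM, divV, pdP_sub] at this ⊢; linear_combination this)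
  simp at h00 h01 h10 h11
  refine ⟨![u0, u1], w, ?_, ?_, hw0, hw1, h00, h01, h10, h11, ?_⟩
  · intro i; fin_cases i <;> assumption
  · ext1 i j
    fin_cases i <;> fin_cases j
    · simp [symCurl, curlV, ← h00]; module
    · simp [symCurl, curlV, ← h01, ← h10, hs10]; module
    · simp [symCurl, curlV, ← h01, ← h10, hs10]; module
    · simp [symCurl, curlV, ← h11]; module
  · have : pdP 1 u1 = -(σ 1 0 - w) := by rw [h10]; ring
    simp [divV, ← h01, this, hs10]; module

/-- The dimension of the space of polynomials of degree at most `m`. -/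
lemma finrank_polyLE (m : ℕ) : Module.finrank ℝ (polyLE m) = (m + 1) * (m + 2) / 2 := by
  unfold polyLE restrictTotalDegree
  rw [Module.finrank_eq_nat_card_basis (basisRestrictSupport ℝ _)]
  let S : Finset (Σ _ : ℕ, ℕ) := (Finset.range (m + 1)).sigma fun a => Finset.range (m + 1 - a)
  have e : {n : Fin 2 →₀ ℕ | (n.sum fun _ e => e) ≤ m} ≃ S :=
    { toFun := fun d => ⟨⟨d.1 0, d.1 1⟩, by
        have := d.2; simp only [Set.mem_ofPred_eq, degree_fin_two] at this
        simp [S]; omega⟩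
      invFun := fun s => ⟨Finsupp.equivFunOnFinite.symm ![s.1.1, s.1.2], by
        have := s.2; simp only [S, Finset.mem_sigma, Finset.mem_range] at this
        simp only [Set.mem_ofPred_eq, degree_fin_two]; simp; omega⟩
      left_inv := fun d => by
        ext i; fin_cases i <;> simp
      right_inv := fun s => by
        ext <;> simp }
  rw [Nat.card_congr e, Nat.card_eq_fintype_card, Fintype.card_coe, Finset.card_sigma]
  have h2 : ∀ m : ℕ, (∑ a ∈ Finset.range (m + 1), (Finset.range (m + 1 - a)).card) * 2 =
      (m + 1) * (m + 2) := by
    intro m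
    induction m with
    | zero => simp
    | succ n ih =>
      rw [Finset.sum_range_succ', add_mul]
      simp only [Finset.card_range, Nat.add_sub_add_right] at ih ⊢
      rw [ih]; simp; ring
  have := h2 m
  omega

/-! ### Polynomial functions -/

lemma evalAt_mul (x : Plane) (p q : Poly) : evalAt x (p * q) = evalAt x p * evalAt x q := by
  simp [evalAt]
lemma evalAt_C (x : Plane) (a : ℝ) : evalAt x (C a) = a := by simp [evalAt]
lemma evalAt_X (x : Plane) (i : Fin 2) : evalAt x (X i) = x i := by simp [evalAt]
lemma evalAt_one (x : Plane) : evalAt x 1 = 1 := by simp [evalAt]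

lemma hasFDerivAt_polyFun (p : Poly) (x : Plane) :
    HasFDerivAt (polyFun p) (∑ i, evalAt x (pdP i p) •
      (EuclideanSpace.proj i : Plane →L[ℝ] ℝ)) x := by
  induction p using MvPolynomial.induction_on with
  | C a =>
    simp only [pdP_C, map_zero, zero_smul, Finset.sum_const_zero]
    have : polyFun (C a) = fun _ => a := funext fun y => evalAt_C y a
    rw [this]; exact hasFDerivAt_const _ _
  | add p q hp hq =>
    have : polyFun (p + q) = polyFun p + polyFun q := funext fun y => map_add _ _ _
    rw [this]
    convert! hp.add hq using 1
    simp only [pdP_add, map_add, add_smul, Finset.sum_add_distrib]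
  | mul_X p i hp =>
    have : polyFun (p * X i) = fun y => polyFun p y * (EuclideanSpace.proj i : Plane →L[ℝ] ℝ) y :=
      funext fun y => by simp [polyFun, evalAt_mul, evalAt_X]
    rw [this]
    convert! hp.mul (EuclideanSpace.proj i : Plane →L[ℝ] ℝ).hasFDerivAt using 1
    ext v
    simp only [pdP_mul, pdP_X, map_add, evalAt_mul, evalAt_X, polyFun, Fin.sum_univ_two]
    fin_cases i <;> simp [evalAt_one] <;> ring

lemma fderiv_polyFun (p : Poly) (x v : Plane) :
    fderiv ℝ (polyFun p) x v = ∑ i, evalAt x (pdP i p) * v i := by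
  rw [(hasFDerivAt_polyFun p x).fderiv]
  simp [Fin.sum_univ_two]

lemma pd_polyFun (i : Fin 2) (p : Poly) : pd i (polyFun p) = polyFun (pdP i p) := by
  funext x
  unfold pd
  rw [fderiv_polyFun]
  fin_cases i <;> simp [polyFun]

lemma contDiff_polyFun (p : Poly) : ContDiff ℝ ∞ (polyFun p) := by
  induction p using MvPolynomial.induction_on with
  | C a =>
    have : polyFun (C a) = fun _ => a := funext fun y => evalAt_C y a
    rw [this]; exact contDiff_const
  | add p q hp hq =>
    have : polyFun (p + q) = polyFun p + polyFun q := funext fun y => map_add _ _ _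
    rw [this]; exact hp.add hq
  | mul_X p i hp =>
    have : polyFun (p * X i) = fun y => polyFun p y * (EuclideanSpace.proj i : Plane →L[ℝ] ℝ) y :=
      funext fun y => by simp [polyFun, evalAt_mul, evalAt_X]
    rw [this]; exact hp.mul (ContinuousLinearMap.contDiff _)

/-- A ball contains a box, which is a product of infinite sets, and a polynomial that vanishes on
such a product is zero. -/
lemma poly_eq_zero_of_eventually {p : Poly} {x : Plane} (h : ∀ᶠ y in nhds x, polyFun p y = 0) :
    p = 0 := by
  obtain ⟨ε, hε, hb⟩ := Metric.eventually_nhds_iff.1 h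
  refine MvPolynomial.funext_set (fun i => Set.Ioo (x i) (x i + ε / 2))
    (fun i => Set.Ioo_infinite (by linarith)) fun y hy => ?_
  have hd : dist (!₂[y 0, y 1] : Plane) x < ε := by
    have h0 := hy 0 trivial
    have h1 := hy 1 trivial
    simp only [Set.mem_Ioo] at h0 h1
    rw [EuclideanSpace.dist_eq, Fin.sum_univ_two, Real.sqrt_lt' hε]
    simp only [Real.dist_eq, sq_abs]
    simp
    nlinarith
  have := hb hd
  simp only [polyFun, evalAt] at this
  rw [map_zero, ← this]
  change _ = aeval _ p
  rw [aeval_eq_eval]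
  congr 1
  congr 1
  funext i; fin_cases i <;> simp

end Polynomials

/-! ## Edges -/

section Edges

open MvPolynomial

lemma inner_plane (x y : Plane) : inner ℝ x y = x 0 * y 0 + x 1 * y 1 := by
  simp [PiLp.inner_apply, Fin.sum_univ_two, mul_comm]

lemma plane_ext {x y : Plane} (h0 : x 0 = y 0) (h1 : x 1 = y 1) : x = y := by
  ext i; fin_cases i <;> assumption

lemma poly_ext {p q : Poly} (h : ∀ x, evalAt x p = evalAt x q) : p = q := by
  rw [← sub_eq_zero]
  refine poly_eq_zero_of_eventually (x := 0) (Filter.Eventually.of_forall fun x => ?_)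
  simp [polyFun, h x]

variable {K : Geometry.SimplicialComplex ℝ Plane} (o : EdgeOrientation K) {e : Finset Plane}

/-- `e` has two distinct vertices, which are its end points in the orientation `o`. -/
def EdgeOrientation.IsEdge (e : Finset Plane) : Prop :=
  (e : Set Plane) = {o.start e, o.finish e} ∧ o.start e ≠ o.finish e

variable {o}

lemma isEdge_of_mem_faces (he : e ∈ K.faces) (hc : e.card = 2) : o.IsEdge e := by
  have h := o.spec e he hc
  refine ⟨h, fun h' => ?_⟩
  rw [h', Set.pair_eq_singleton] at h
  have h2 : e = {o.finish e} := by exact_mod_cast h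
  rw [h2] at hc
  simp at hc

namespace EdgeOrientation.IsEdge

variable (he : o.IsEdge e)
include he

lemma mem_iff {x : Plane} : x ∈ e ↔ x = o.start e ∨ x = o.finish e := by
  rw [← Finset.mem_coe, he.1]; simp

lemma eq_pair [DecidableEq Plane] : e = {o.start e, o.finish e} := by
  ext x; rw [he.mem_iff]; simp

lemma start_mem : o.start e ∈ e := he.mem_iff.2 (Or.inl rfl)
lemma finish_mem : o.finish e ∈ e := he.mem_iff.2 (Or.inr rfl)

lemma len_pos : 0 < o.len e := dist_pos.2 he.2

lemma len_smul_tang : o.len e • o.tang e = o.finish e - o.start e := by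
  rw [EdgeOrientation.tang, smul_inv_smul₀ he.len_pos.ne']

lemma tang_sq : o.tang e 0 ^ 2 + o.tang e 1 ^ 2 = 1 := by
  have h : ‖o.tang e‖ = 1 := by
    rw [EdgeOrientation.tang, norm_smul, norm_inv, Real.norm_of_nonneg he.len_pos.le,
      EdgeOrientation.len, dist_comm, dist_eq_norm]
    refine inv_mul_cancel₀ ?_
    rw [norm_ne_zero_iff, sub_ne_zero]
    exact he.2.symm
  have := real_inner_self_eq_norm_sq (o.tang e)
  rw [h, inner_plane] at this
  nlinarith

end EdgeOrientation.IsEdge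

lemma nrm_zero : o.nrm e 0 = -o.tang e 1 := rfl
lemma nrm_one : o.nrm e 1 = o.tang e 0 := rfl

variable (o) in
/-- Signed distance to the line of an edge. -/
def EdgeOrientation.hgt (e : Finset Plane) (x : Plane) : ℝ := inner ℝ (x - o.start e) (o.nrm e)

lemma hgt_apply (x : Plane) : o.hgt e x =
    (x 0 - o.start e 0) * o.nrm e 0 + (x 1 - o.start e 1) * o.nrm e 1 := by
  rw [EdgeOrientation.hgt, inner_plane]; rfl

lemma coord_apply (x : Plane) : o.coord e x =
    (x 0 - o.start e 0) * o.tang e 0 + (x 1 - o.start e 1) * o.tang e 1 := by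
  rw [EdgeOrientation.coord, inner_plane]; rfl

lemma param_apply (s : ℝ) (i : Fin 2) : o.param e s i = o.start e i + s * o.tang e i := rfl

lemma coord_start : o.coord e (o.start e) = 0 := by simp [coord_apply]
lemma hgt_start : o.hgt e (o.start e) = 0 := by simp [hgt_apply]
lemma hgt_param (s : ℝ) : o.hgt e (o.param e s) = 0 := by
  rw [hgt_apply, param_apply, param_apply, nrm_zero, nrm_one]; ring

lemma param_zero : o.param e 0 = o.start e := by simp [EdgeOrientation.param]

namespace EdgeOrientation.IsEdge

variable (he : o.IsEdge e)
include he

lemma param_len : o.param e (o.len e) = o.finish e := by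
  simp [EdgeOrientation.param, he.len_smul_tang]

lemma coord_param (s : ℝ) : o.coord e (o.param e s) = s := by
  rw [coord_apply, param_apply, param_apply]
  linear_combination s * he.tang_sq

lemma coord_finish : o.coord e (o.finish e) = o.len e := by
  rw [← he.param_len, he.coord_param]

lemma hgt_finish : o.hgt e (o.finish e) = 0 := by
  rw [← he.param_len, hgt_param]

lemma hgt_eq_zero {x : Plane} (hx : x ∈ e) : o.hgt e x = 0 := by
  rcases he.mem_iff.1 hx with rfl | rfl
  exacts [hgt_start, he.hgt_finish]

lemma decomp (x : Plane) (i : Fin 2) :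
    x i = o.start e i + o.coord e x * o.tang e i + o.hgt e x * o.nrm e i := by
  have := he.tang_sq
  fin_cases i <;> simp only [hgt_apply, coord_apply, nrm_zero, nrm_one, Fin.zero_eta, Fin.mk_one]
  · linear_combination -(x 0 - o.start e 0) * this
  · linear_combination -(x 1 - o.start e 1) * this

lemma param_coord {x : Plane} (hx : o.hgt e x = 0) : o.param e (o.coord e x) = x := by
  refine plane_ext ?_ ?_ <;> rw [he.decomp x, hx, param_apply] <;> ring

lemma param_coord_of_mem {x : Plane} (hx : x ∈ e) : o.param e (o.coord e x) = x :=
  he.param_coord (he.hgt_eq_zero hx)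

end EdgeOrientation.IsEdge

/-! ### Restriction of polynomials to edges -/

lemma restr_mul (p q : Poly) : o.restr e (p * q) = o.restr e p * o.restr e q := by
  simp [EdgeOrientation.restr]

lemma restr_one : o.restr e 1 = 1 := by simp [EdgeOrientation.restr]

lemma restr_C (a : ℝ) : o.restr e (C a) = Polynomial.C a := by
  simp [EdgeOrientation.restr]

lemma restr_X (i : Fin 2) : o.restr e (X i) =
    Polynomial.C (o.start e i) + Polynomial.C (o.tang e i) * Polynomial.X := by
  simp [EdgeOrientation.restr]

lemma eval_restr (s : ℝ) (p : Poly) : (o.restr e p).eval s = evalAt (o.param e s) p := by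
  induction p using MvPolynomial.induction_on with
  | C a => simp [restr_C, evalAt_C]
  | add p q hp hq => simp [hp, hq]
  | mul_X p i hp =>
    rw [restr_mul, Polynomial.eval_mul, hp, evalAt_mul, restr_X, evalAt_X, param_apply]
    simp
    left; ring

lemma eval_coord_restr (he : o.IsEdge e) {x : Plane} (hx : x ∈ e) (p : Poly) :
    (o.restr e p).eval (o.coord e x) = evalAt x p := by
  rw [eval_restr, he.param_coord_of_mem hx]

/-- The chain rule along the arclength parametrization. It makes tangential derivatives of traces
computable from partial derivatives on the triangle. -/
lemma derivative_restr (p : Poly) : (o.restr e p).derivative =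
    o.tang e 0 • o.restr e (pdP 0 p) + o.tang e 1 • o.restr e (pdP 1 p) := by
  induction p using MvPolynomial.induction_on with
  | C a => simp [restr_C, pdP_C]
  | add p q hp hq => simp only [map_add, hp, hq, pdP_add]; module
  | mul_X p i hp =>
    simp only [restr_mul, Polynomial.derivative_mul, hp, pdP_mul, pdP_X, map_add, restr_X]
    fin_cases i <;> simp [Polynomial.smul_eq_C_mul, restr_one] <;> ring

lemma restr_mem_degreeLE {m : ℕ} {p : Poly} (hp : p ∈ polyLE m) :
    o.restr e p ∈ Polynomial.degreeLE ℝ (m : ℕ) := by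
  rw [Polynomial.mem_degreeLE]
  refine Polynomial.degree_le_of_natDegree_le ?_
  have := MvPolynomial.aeval_natDegree_le (n := 1) p ((mem_restrictTotalDegree _ _ _).1 hp)
    (fun i => Polynomial.C (o.start e i) + Polynomial.C (o.tang e i) * Polynomial.X)
    (fun i => by
      rw [add_comm]
      exact Polynomial.natDegree_linear_le)
  rw [mul_one] at this
  exact this

/-- The polynomial of an affine function. -/
def affP (a : Plane →ᵃ[ℝ] ℝ) : Poly :=
  C (a 0) + ∑ i, C (a.linear (EuclideanSpace.single i 1)) * X i

lemma evalAt_affP (a : Plane →ᵃ[ℝ] ℝ) (x : Plane) : evalAt x (affP a) = a x := by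
  have h1 : a x = a.linear x + a 0 := by
    conv_lhs => rw [AffineMap.decomp a]
    rfl
  have h2 : x = x 0 • EuclideanSpace.single 0 1 + x 1 • EuclideanSpace.single 1 1 :=
    plane_ext (by simp) (by simp)
  simp only [affP, Fin.sum_univ_two, map_add, evalAt_mul, evalAt_C, evalAt_X]
  rw [h1]
  conv_rhs => rw [h2]
  simp only [map_add, map_smul, smul_eq_mul]
  ring

lemma affP_mem_polyLE (a : Plane →ᵃ[ℝ] ℝ) : affP a ∈ polyLE 1 :=
  Submodule.add_mem _ (C_mem_polyLE _ _) (Submodule.sum_mem _ fun i _ =>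
    mul_mem_polyLE (C_mem_polyLE _ 0) (X_mem_polyLE i le_rfl) le_rfl)

lemma pdP_affP (a : Plane →ᵃ[ℝ] ℝ) (i : Fin 2) :
    pdP i (affP a) = C (a.linear (EuclideanSpace.single i 1)) := by
  fin_cases i <;> simp [affP, pdP_add, pdP_C, pdP_mul, pdP_X, Fin.sum_univ_two]

variable (o) in
/-- The polynomial of the signed distance to the line of an edge. -/
def EdgeOrientation.hgtP (e : Finset Plane) : Poly :=
  C (o.nrm e 0) * (X 0 - C (o.start e 0)) + C (o.nrm e 1) * (X 1 - C (o.start e 1))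

lemma evalAt_hgtP (x : Plane) : evalAt x (o.hgtP e) = o.hgt e x := by
  simp [EdgeOrientation.hgtP, evalAt_mul, evalAt_C, evalAt_X, hgt_apply]; ring

/-- Modulo the distance polynomial each coordinate equals its value along the edge at the arclength
polynomial `S`. Hence `p` is congruent to its restriction with `S` substituted, which is zero. -/
lemma hgtP_dvd (he : o.IsEdge e) {p : Poly} (h : o.restr e p = 0) : o.hgtP e ∣ p := by
  let S : Poly := C (o.tang e 0) * (X 0 - C (o.start e 0)) + C (o.tang e 1) * (X 1 - C (o.start e 1))
  let mk := Ideal.Quotient.mkₐ ℝ (Ideal.span {o.hgtP e})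
  let ρ : Poly →ₐ[ℝ] Poly := (Polynomial.aeval S).comp (MvPolynomial.aeval fun i =>
    Polynomial.C (o.start e i) + Polynomial.C (o.tang e i) * Polynomial.X)
  have hρ : mk.comp ρ = mk := by
    refine MvPolynomial.algHom_ext fun i => ?_
    change mk (ρ (X i)) = mk (X i)
    rw [← sub_eq_zero, ← map_sub]
    refine Ideal.Quotient.eq_zero_iff_mem.2 (Ideal.mem_span_singleton.2 ⟨-C (o.nrm e i), ?_⟩)
    refine poly_ext fun x => ?_
    have h2 := he.decomp x i
    have hS : evalAt x S = o.coord e x := by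
      simp [S, evalAt_mul, evalAt_C, evalAt_X, coord_apply]; ring
    rw [evalAt_mul, evalAt_hgtP, map_neg, evalAt_C, map_sub, evalAt_X]
    have : ρ (X i) = C (o.start e i) + C (o.tang e i) * S := by simp [ρ, S]
    rw [this, map_add, evalAt_mul, evalAt_C, evalAt_C, hS]
    linear_combination -h2
  have h1 : mk p = 0 := by
    rw [← hρ]
    change mk ((Polynomial.aeval S) (o.restr e p)) = 0
    rw [h]; simp
  exact Ideal.mem_span_singleton.1 (Ideal.Quotient.eq_zero_iff_mem.1 h1)

end Edges

/-! ## Triangles -/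

section Triangles

/-- A nondegenerate triangle, given by its vertices. -/
def IsTri (f : Finset Plane) : Prop := AffineIndependent ℝ ((↑) : f → Plane) ∧ f.card = 3

/-- The affine basis of the plane given by the vertices of a triangle. -/
def IsTri.basis {f : Finset Plane} (hf : IsTri f) : AffineBasis f ℝ Plane where
  toFun := (↑)
  ind' := hf.1
  tot' := by
    rw [hf.1.affineSpan_eq_top_iff_card_eq_finrank_add_one]
    simp [hf.2]

open Classical in
/-- The barycentric coordinate of the vertex `x` of the triangle `f`. -/
def bary (f : Finset Plane) (x : Plane) : Plane →ᵃ[ℝ] ℝ :=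
  if h : IsTri f ∧ x ∈ f then h.1.basis.coord ⟨x, h.2⟩ else 0

variable {f : Finset Plane} (hf : IsTri f)
include hf

lemma bary_eq {x : Plane} (hx : x ∈ f) : bary f x = hf.basis.coord ⟨x, hx⟩ :=
  dif_pos ⟨hf, hx⟩

lemma bary_self {x : Plane} (hx : x ∈ f) : bary f x x = 1 := by
  rw [bary_eq hf hx]; exact hf.basis.coord_apply_eq ⟨x, hx⟩

lemma bary_of_ne {x y : Plane} (hx : x ∈ f) (hy : y ∈ f) (h : x ≠ y) : bary f x y = 0 := by
  rw [bary_eq hf hx]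
  exact hf.basis.coord_apply_ne (i := ⟨x, hx⟩) (j := ⟨y, hy⟩) (by simpa using h)

lemma sum_bary (p : Plane) : ∑ x ∈ f, bary f x p = 1 := by
  rw [← hf.basis.sum_coord_apply_eq_one p, ← Finset.sum_coe_sort]
  exact Finset.sum_congr rfl fun x _ => by rw [bary_eq hf x.2]

lemma sum_bary_smul (p : Plane) : ∑ x ∈ f, bary f x p • x = p := by
  conv_rhs => rw [← hf.basis.linear_combination_coord_eq_self p]
  rw [← Finset.sum_coe_sort]
  exact Finset.sum_congr rfl fun x _ => by rw [bary_eq hf x.2]; rfl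

lemma aff_eq_sum_bary (a : Plane →ᵃ[ℝ] ℝ) (p : Plane) :
    a p = ∑ x ∈ f, bary f x p * a x := by
  have h1 : ∀ y, a y = a.linear y + a 0 := fun y => by
    conv_lhs => rw [AffineMap.decomp a]
    rfl
  rw [h1 p, Finset.sum_congr rfl fun x _ => by rw [h1 x, mul_add], Finset.sum_add_distrib,
    ← Finset.sum_mul, sum_bary hf, one_mul]
  conv_lhs => rw [← sum_bary_smul hf p]
  simp only [map_sum, map_smul, smul_eq_mul]

lemma mem_hull_iff {p : Plane} :
    p ∈ convexHull ℝ (f : Set Plane) ↔ ∀ x ∈ f, 0 ≤ bary f x p := by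
  have h1 : (f : Set Plane) = Set.range hf.basis := by
    change _ = Set.range ((↑) : f → Plane); simp
  rw [h1, hf.basis.convexHull_eq_nonneg_coord]
  constructor
  · intro h x hx; rw [bary_eq hf hx]; exact h ⟨x, hx⟩
  · intro h x; rw [← bary_eq hf x.2]; exact h x x.2

lemma mem_interior_hull_iff {p : Plane} :
    p ∈ interior (convexHull ℝ (f : Set Plane)) ↔ ∀ x ∈ f, 0 < bary f x p := by
  have h1 : (f : Set Plane) = Set.range hf.basis := by
    change _ = Set.range ((↑) : f → Plane); simp
  rw [h1, hf.basis.interior_convexHull]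
  constructor
  · intro h x hx; rw [bary_eq hf hx]; exact h ⟨x, hx⟩
  · intro h x; rw [← bary_eq hf x.2]; exact h x x.2

lemma mem_face_hull_iff {s : Finset Plane} (hs : s ⊆ f) {p : Plane} :
    p ∈ convexHull ℝ (s : Set Plane) ↔
      p ∈ convexHull ℝ (f : Set Plane) ∧ ∀ x ∈ f, x ∉ s → bary f x p = 0 := by
  constructor
  · refine fun h => ⟨convexHull_mono (by exact_mod_cast hs) h, fun x hx hxs => ?_⟩
    have hc : Convex ℝ ((bary f x) ⁻¹' {0}) := (convex_singleton 0).affine_preimage _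
    refine convexHull_min ?_ hc h
    intro y hy
    exact bary_of_ne hf hx (hs hy) fun h => hxs (h ▸ hy)
  · rintro ⟨h, h0⟩
    have h1 : ∑ x ∈ s, bary f x p • x = p := by
      rw [Finset.sum_subset hs, sum_bary_smul hf p]
      intro x hx hxs; rw [h0 x hx hxs, zero_smul]
    have h2 : ∑ x ∈ s, bary f x p = 1 := by
      rw [← sum_bary hf p, Finset.sum_subset hs]
      intro x hx hxs; exact h0 x hx hxs
    rw [← h1]
    exact (convex_convexHull ℝ _).sum_mem (fun x hx => (mem_hull_iff hf).1 h x (hs hx)) h2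
      fun x hx => subset_convexHull ℝ _ hx

omit hf in
lemma continuous_bary (x : Plane) : Continuous (bary f x) :=
  AffineMap.continuous_of_finiteDimensional _

/-- Near a point of a triangle, the triangle is described by the coordinates that vanish there. -/
lemma eventually_mem_hull_iff {p : Plane} (hp : p ∈ convexHull ℝ (f : Set Plane)) :
    ∀ᶠ q in nhds p, (q ∈ convexHull ℝ (f : Set Plane) ↔
      ∀ x ∈ f, bary f x p = 0 → 0 ≤ bary f x q) := by
  have h : ∀ᶠ q in nhds p, ∀ x ∈ f, bary f x p ≠ 0 → 0 < bary f x q := by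
    rw [Filter.eventually_all_finset]
    intro x hx
    by_cases h0 : bary f x p = 0
    · exact Filter.Eventually.of_forall fun q hq => absurd h0 hq
    · have hpos : 0 < bary f x p := lt_of_le_of_ne ((mem_hull_iff hf).1 hp x hx) (Ne.symm h0)
      filter_upwards [(continuous_bary x).continuousAt.eventually (lt_mem_nhds hpos)] with q hq _
      exact hq
  filter_upwards [h] with q hq
  rw [mem_hull_iff hf]
  exact ⟨fun H x hx _ => H x hx, fun H x hx => by
    by_cases h0 : bary f x p = 0
    exacts [H x hx h0, (hq x hx h0).le]⟩

/-- The barycenter has all coordinates `1 / 3`. -/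
lemma interior_hull_nonempty : (interior (convexHull ℝ (f : Set Plane))).Nonempty := by
  have hne : f.Nonempty := Finset.card_pos.1 (by rw [hf.2]; norm_num)
  refine ⟨∑ x ∈ f, (1 / 3 : ℝ) • x, (mem_interior_hull_iff hf).2 fun y hy => ?_⟩
  have h := aff_eq_sum_bary hf (bary f y)
  have hl : bary f y (∑ x ∈ f, (1 / 3 : ℝ) • x) = ∑ x ∈ f, (1 / 3 : ℝ) * bary f y x := by
    have h3 : ∑ x ∈ f, (1 / 3 : ℝ) = 1 := by simp [hf.2]
    have h1 : ∀ z, bary f y z = (bary f y).linear z + bary f y 0 := fun z => by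
      conv_lhs => rw [AffineMap.decomp (bary f y)]
      rfl
    have h4 : bary f y 0 = (∑ x ∈ f, (1 / 3 : ℝ)) * bary f y 0 := by rw [h3, one_mul]
    rw [h1]
    conv_lhs => rw [h4]
    rw [Finset.sum_mul, map_sum, ← Finset.sum_add_distrib]
    refine Finset.sum_congr rfl fun x _ => ?_
    rw [h1 x, map_smul, smul_eq_mul]; ring
  rw [hl, ← Finset.mul_sum, Finset.sum_eq_single y]
  · rw [bary_self hf hy]; norm_num
  · intro x hx hxy; exact bary_of_ne hf hy hx hxy.symm
  · intro h; exact absurd hy h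

end Triangles

/-! ## Integration over triangles -/

section Integration

open MeasureTheory

/-- The determinant of two vectors in the plane. -/
def cross (v w : Plane) : ℝ := v 0 * w 1 - v 1 * w 0

/-- Coordinates of the plane, as a measurable equivalence. -/
def planeEquiv : (ℝ × ℝ) ≃ᵐ Plane :=
  (MeasurableEquiv.finTwoArrow (α := ℝ)).symm.trans (MeasurableEquiv.toLp 2 (Fin 2 → ℝ))

lemma planeEquiv_apply (q : ℝ × ℝ) : planeEquiv q = !₂[q.1, q.2] := by
  refine plane_ext ?_ ?_ <;> rfl

lemma measurePreserving_planeEquiv : MeasurePreserving planeEquiv volume volume :=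
  ((volume_preserving_finTwoArrow ℝ).symm).trans
    (PiLp.volume_preserving_toLp (Fin 2))

/-- The reference triangle. -/
def refTri : Set (ℝ × ℝ) := {q | 0 ≤ q.1 ∧ 0 ≤ q.2 ∧ q.1 + q.2 ≤ 1}

lemma isClosed_refTri : IsClosed refTri :=
  (isClosed_le continuous_const continuous_fst).inter
    ((isClosed_le continuous_const continuous_snd).inter
      (isClosed_le (continuous_fst.add continuous_snd) continuous_const))

lemma isCompact_refTri : IsCompact refTri := by
  refine (isCompact_Icc (a := (0 : ℝ)) (b := 1) |>.prod
    (isCompact_Icc (a := (0 : ℝ)) (b := 1))).of_isClosed_subset isClosed_refTri ?_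
  rintro ⟨x, y⟩ ⟨h1, h2, h3⟩
  dsimp only at h1 h2 h3
  exact ⟨⟨h1, by linarith⟩, h2, by linarith⟩

lemma integral_refTri {g : ℝ × ℝ → ℝ} (hg : Continuous g) :
    ∫ q in refTri, g q = ∫ s in (0 : ℝ)..1, ∫ t in (0 : ℝ)..(1 - s), g (s, t) := by
  have hm : MeasurableSet refTri := isClosed_refTri.measurableSet
  have hi : IntegrableOn g refTri := hg.continuousOn.integrableOn_compact isCompact_refTri
  rw [← integral_indicator hm]
  have hi' : Integrable (refTri.indicator g) (volume.prod volume) :=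
    (integrable_indicator_iff hm).2 hi
  rw [show (volume : Measure (ℝ × ℝ)) = volume.prod volume from rfl, integral_prod _ hi']
  rw [intervalIntegral.integral_of_le zero_le_one, ← integral_Icc_eq_integral_Ioc,
    ← integral_indicator measurableSet_Icc]
  congr 1
  funext s
  by_cases hs : s ∈ Set.Icc (0 : ℝ) 1
  · rw [Set.indicator_of_mem hs, intervalIntegral.integral_of_le (by linarith [hs.2]),
      ← integral_Icc_eq_integral_Ioc, ← integral_indicator measurableSet_Icc]
    congr 1
    funext t
    by_cases ht : t ∈ Set.Icc (0 : ℝ) (1 - s)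
    · rw [Set.indicator_of_mem ht, Set.indicator_of_mem]
      exact ⟨hs.1, ht.1, by have := ht.2; dsimp; linarith⟩
    · rw [Set.indicator_of_notMem ht, Set.indicator_of_notMem]
      rintro ⟨_, h2, h3⟩
      exact ht ⟨h2, by dsimp at h3; linarith⟩
  · rw [Set.indicator_of_notMem hs]
    have : (fun t => refTri.indicator g (s, t)) = 0 := by
      funext t
      rw [Set.indicator_of_notMem]
      · rfl
      rintro ⟨h1, h2, h3⟩
      exact hs ⟨h1, by dsimp at h2 h3; linarith⟩
    rw [this]; simp

variable {a b c : Plane}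

/-- The affine parametrization of a triangle by the reference triangle. -/
def triParam (a b c : Plane) (q : ℝ × ℝ) : Plane := a + q.1 • (b - a) + q.2 • (c - a)

lemma convexHull_triple :
    convexHull ℝ ({a, b, c} : Set Plane) = triParam a b c '' refTri := by
  have h : convexHull ℝ ({a, b, c} : Set Plane) = convexHull ℝ (Set.range ![a, b, c]) := by
    congr 1
    simp [Matrix.range_cons, Matrix.range_empty, Set.union_singleton]
    ext x; simp; tauto
  ext p
  constructor
  · intro hp
    rw [h, convexHull_range_eq_exists_affineCombination] at hp
    obtain ⟨s, w, hw0, hw1, hp⟩ := hp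
    classical
    have hw : ∃ w' : Fin 3 → ℝ, (∀ i, 0 ≤ w' i) ∧ ∑ i, w' i = 1 ∧ ∑ i, w' i • ![a, b, c] i = p := by
      refine ⟨fun i => if i ∈ s then w i else 0, fun i => ?_, ?_, ?_⟩
      · dsimp only
        split_ifs with hi
        exacts [hw0 i hi, le_rfl]
      · rw [← hw1]; simp
      · rw [← hp, s.affineCombination_eq_linear_combination _ _ hw1]
        simp [Finset.sum_ite_mem]
    obtain ⟨w', h0, h1, h2⟩ := hw
    simp [Fin.sum_univ_three] at h1 h2
    refine ⟨(w' 1, w' 2), ⟨h0 1, h0 2, by have := h0 0; dsimp; linarith⟩, ?_⟩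
    rw [← h2, triParam]
    have : w' 0 = 1 - w' 1 - w' 2 := by linarith
    rw [this]; module
  · rintro ⟨q, ⟨h1, h2, h3⟩, rfl⟩
    have hm := (convex_convexHull ℝ ({a, b, c} : Set Plane))
    have : triParam a b c q = ∑ i, ![1 - q.1 - q.2, q.1, q.2] i • ![a, b, c] i := by
      simp [Fin.sum_univ_three, triParam]; module
    rw [this]
    refine hm.sum_mem (fun i _ => ?_) ?_ (fun i _ => subset_convexHull ℝ _ ?_)
    · fin_cases i <;> simp [h1, h2]; linarith
    · simp [Fin.sum_univ_three]; ring
    · fin_cases i <;> simp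

/-- Change of variables: the affine parametrization by the reference triangle has constant Jacobian
`cross (b - a) (c - a)`. -/
lemma integral_triple (hD : cross (b - a) (c - a) ≠ 0) {g : Plane → ℝ} :
    ∫ x in convexHull ℝ ({a, b, c} : Set Plane), g x =
      |cross (b - a) (c - a)| * ∫ q in refTri, g (triParam a b c q) := by
  let M : Matrix (Fin 2) (Fin 2) ℝ := !![(b - a) 0, (c - a) 0; (b - a) 1, (c - a) 1]
  let A : ℝ × ℝ →L[ℝ] ℝ × ℝ :=
    (Matrix.toLin (Module.Basis.finTwoProd ℝ) (Module.Basis.finTwoProd ℝ) M).toContinuousLinearMap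
  have hA : ∀ q : ℝ × ℝ, A q = (q.1 * (b - a) 0 + q.2 * (c - a) 0,
      q.1 * (b - a) 1 + q.2 * (c - a) 1) := by
    intro q
    simp only [A, M, LinearMap.coe_toContinuousLinearMap', Matrix.toLin_finTwoProd_apply]
    ext <;> simp <;> ring
  let Ψ : ℝ × ℝ → ℝ × ℝ := fun q => (a 0, a 1) + A q
  have hΨ : ∀ q, planeEquiv (Ψ q) = triParam a b c q := by
    intro q
    rw [planeEquiv_apply]
    refine plane_ext ?_ ?_ <;> simp [Ψ, hA, triParam, add_assoc]
  have hdet : A.det = cross (b - a) (c - a) := by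
    simp only [A, M, ContinuousLinearMap.det, LinearMap.coe_toContinuousLinearMap, LinearMap.det_toLin,
      Matrix.det_fin_two_of, cross]
    ring
  have hinj : Set.InjOn Ψ refTri := by
    intro q _ q' _ h
    have h' : A q = A q' := add_left_cancel h
    rw [hA, hA] at h'
    have e1 := congrArg Prod.fst h'
    have e2 := congrArg Prod.snd h'
    dsimp only at e1 e2
    have hD' := hD
    unfold cross at hD'
    ext
    · apply mul_right_cancel₀ hD'
      linear_combination (c - a) 1 * e1 - (c - a) 0 * e2
    · apply mul_right_cancel₀ hD'
      linear_combination (b - a) 0 * e2 - (b - a) 1 * e1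
  have hd : ∀ q ∈ refTri, HasFDerivWithinAt Ψ A refTri q := fun q _ =>
    (A.hasFDerivAt.const_add _).hasFDerivWithinAt
  have h1 := integral_image_eq_integral_abs_det_fderiv_smul volume
    isClosed_refTri.measurableSet hd hinj (fun q => g (planeEquiv q))
  have h2 : planeEquiv ⁻¹' (convexHull ℝ ({a, b, c} : Set Plane)) = Ψ '' refTri := by
    rw [convexHull_triple]
    ext q
    constructor
    · rintro ⟨q', hq', h⟩
      exact ⟨q', hq', planeEquiv.injective (by rw [hΨ, h])⟩
    · rintro ⟨q', hq', rfl⟩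
      exact ⟨q', hq', (hΨ q').symm⟩
  rw [← measurePreserving_planeEquiv.setIntegral_preimage_emb planeEquiv.measurableEmbedding, h2, h1]
  simp only [hΨ, hdet, smul_eq_mul]
  rw [integral_const_mul]

/-- Mean value over a segment. -/
def segAvg (φ : Plane → ℝ) (p q : Plane) : ℝ := ∫ r in (0 : ℝ)..1, φ (p + r • (q - p))

lemma segAvg_comm (φ : Plane → ℝ) (p q : Plane) : segAvg φ p q = segAvg φ q p := by
  unfold segAvg
  have := intervalIntegral.integral_comp_sub_left (a := 0) (b := 1)
    (fun r => φ (p + r • (q - p))) 1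
  simp only [sub_zero, sub_self] at this
  rw [← this]
  congr 1
  funext r
  congr 1
  module

/-- In the reference coordinates the direction `c - a` is the second axis. The inner integral is a
difference of values on the edges `bc` and `ab`, and the outer one turns these into means. -/
lemma integral_fderiv_triple (hD : cross (b - a) (c - a) ≠ 0) {φ : Plane → ℝ}
    (hφ : ContDiff ℝ 1 φ) :
    ∫ x in convexHull ℝ ({a, b, c} : Set Plane), fderiv ℝ φ x (c - a) =
      |cross (b - a) (c - a)| * (segAvg φ b c - segAvg φ a b) := by
  have hcd : Continuous fun x => fderiv ℝ φ x (c - a) :=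
    (hφ.continuous_fderiv (by norm_num)).clm_apply continuous_const
  have hcp : Continuous (triParam a b c) := by unfold triParam; fun_prop
  rw [integral_triple hD,
    integral_refTri (g := fun q => fderiv ℝ φ (triParam a b c q) (c - a)) (hcd.comp hcp)]
  congr 1
  have hin : ∀ s : ℝ, ∫ t in (0 : ℝ)..(1 - s), fderiv ℝ φ (triParam a b c (s, t)) (c - a) =
      φ (c + s • (b - c)) - φ (a + s • (b - a)) := by
    intro s
    have hder : ∀ t ∈ Set.uIcc (0 : ℝ) (1 - s), HasDerivAt (fun t => φ (triParam a b c (s, t)))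
        (fderiv ℝ φ (triParam a b c (s, t)) (c - a)) t := by
      intro t _
      have h1 : HasDerivAt (fun t => triParam a b c (s, t)) (c - a) t := by
        unfold triParam
        simpa using ((hasDerivAt_id t).smul_const (c - a)).const_add (a + s • (b - a))
      exact ((hφ.differentiable (by norm_num)) _).hasFDerivAt.comp_hasDerivAt t h1
    rw [intervalIntegral.integral_eq_sub_of_hasDerivAt hder]
    · congr 2 <;> (unfold triParam; module)
    · refine Continuous.intervalIntegrable ?_ _ _
      exact hcd.comp (hcp.comp (by fun_prop))
  rw [intervalIntegral.integral_congr (fun s _ => hin s), intervalIntegral.integral_sub,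
    segAvg_comm φ b c]
  · rfl
  · exact Continuous.intervalIntegrable (hφ.continuous.comp (by fun_prop)) _ _
  · exact Continuous.intervalIntegrable (hφ.continuous.comp (by fun_prop)) _ _

end Integration

/-! ### The divergence theorem on a triangle -/

section Divergence

open MeasureTheory

variable {K : Geometry.SimplicialComplex ℝ Plane} {o : EdgeOrientation K} {e f : Finset Plane}

lemma IsTri.exists_triple [DecidableEq Plane] (hf : IsTri f) :
    ∃ a b c, a ≠ b ∧ a ≠ c ∧ b ≠ c ∧ f = {a, b, c} := Finset.card_eq_three.1 hf.2

lemma IsTri.cross_ne_zero [DecidableEq Plane] (hf : IsTri f) {a b c : Plane} (hab : a ≠ b)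
    (hac : a ≠ c) (hbc : b ≠ c) (h : f = {a, b, c}) : cross (b - a) (c - a) ≠ 0 := by
  intro hD
  have hs : ∀ p, bary f a p • a + (bary f b p • b + bary f c p • c) = p := by
    intro p
    have := sum_bary_smul hf p
    rw [h, Finset.sum_insert (by simp [hab, hac]), Finset.sum_pair hbc] at this
    rw [h]; exact this
  have h1 : ∀ p, bary f a p + (bary f b p + bary f c p) = 1 := by
    intro p
    have := sum_bary hf p
    rw [h, Finset.sum_insert (by simp [hab, hac]), Finset.sum_pair hbc] at this
    rw [h]; exact this
  -- If the determinant vanished, all affine combinations of the vertices would lie on one line. The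
  -- test point is `a` plus a quarter turn of `b - a`, which would force `|b - a|² = 0`.
  set p : Plane := !₂[a 0 - (b 1 - a 1), a 1 + (b 0 - a 0)] with hp
  have e0 := congrArg (fun v : Plane => v 0) (hs p)
  have e1 := congrArg (fun v : Plane => v 1) (hs p)
  have e2 := h1 p
  have p0 : p 0 = a 0 - (b 1 - a 1) := rfl
  have p1 : p 1 = a 1 + (b 0 - a 0) := rfl
  simp only [PiLp.add_apply, PiLp.smul_apply, smul_eq_mul, p0, p1, cross, PiLp.sub_apply]
    at e0 e1 hD
  have h3 : (b 0 - a 0) ^ 2 + (b 1 - a 1) ^ 2 = 0 := by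
    linear_combination (-(b 0 - a 0)) * e1 + (b 1 - a 1) * e0 +
      bary f c p * hD + ((b 0 - a 0) * a 1 - (b 1 - a 1) * a 0) * e2
  have h4 : b 0 - a 0 = 0 := by nlinarith [sq_nonneg (b 0 - a 0), sq_nonneg (b 1 - a 1)]
  have h5 : b 1 - a 1 = 0 := by nlinarith [sq_nonneg (b 0 - a 0), sq_nonneg (b 1 - a 1)]
  exact hab (plane_ext (by linarith) (by linarith))

lemma integral_edge (he : o.IsEdge e) (φ : Plane → ℝ) :
    ∫ s in (0 : ℝ)..(o.len e), φ (o.param e s) = o.len e * segAvg φ (o.start e) (o.finish e) := by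
  unfold segAvg
  have := intervalIntegral.integral_comp_mul_left (a := 0) (b := 1)
    (fun s => φ (o.param e s)) he.len_pos.ne'
  simp only [mul_zero, mul_one, smul_eq_mul] at this
  rw [← he.len_smul_tang, eq_comm]
  rw [inv_mul_eq_div, eq_div_iff he.len_pos.ne'] at this
  rw [← this, mul_comm]
  congr 2
  funext r
  rw [EdgeOrientation.param, smul_smul, mul_comm]

lemma len_mul_nrm (he : o.IsEdge e) (v : Plane) :
    o.len e * inner ℝ v (o.nrm e) = cross (o.finish e - o.start e) v := by
  rw [← he.len_smul_tang, inner_plane, nrm_zero, nrm_one, cross]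
  simp; ring

/-- The contribution of an edge to the divergence theorem. -/
lemma edge_term [DecidableEq Plane] (he : o.IsEdge e) {x y z : Plane} (hxyz : cross (y - x) (z - x) ≠ 0)
    (hxy : x ≠ y) (hexy : e = {x, y}) (hf : f = {x, y, z}) (v : Plane) (φ : Plane → ℝ) :
    o.incF e f * inner ℝ v (o.nrm e) * ∫ s in (0 : ℝ)..(o.len e), φ (o.param e s) =
      -(|cross (y - x) (z - x)| / cross (y - x) (z - x) * cross (y - x) v) * segAvg φ x y := by
  have hcase : (o.start e = x ∧ o.finish e = y) ∨ (o.start e = y ∧ o.finish e = x) := by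
    have h1 := hexy.subset he.start_mem
    have h2 := hexy.subset he.finish_mem
    have h3 := he.2
    simp only [Finset.mem_insert, Finset.mem_singleton] at h1 h2
    rcases h1 with h1 | h1 <;> rcases h2 with h2 | h2
    · exact absurd (h1.trans h2.symm) h3
    · exact Or.inl ⟨h1, h2⟩
    · exact Or.inr ⟨h1, h2⟩
    · exact absurd (h1.trans h2.symm) h3
  -- The incidence number is minus the sign of the area of the triangle seen along the oriented
  -- edge. Reversing the edge changes both sides alike.
  have hinc : o.incF e f * |cross (y - x) (z - x)| =
      -cross (o.finish e - o.start e) (z - o.start e) := by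
    have hz := len_mul_nrm he (z - o.start e)
    have hc : cross (o.finish e - o.start e) (z - o.start e) = cross (y - x) (z - x) ∨
        cross (o.finish e - o.start e) (z - o.start e) = -cross (y - x) (z - x) := by
      rcases hcase with ⟨h1, h2⟩ | ⟨h1, h2⟩
      · left; rw [h1, h2]
      · right; rw [h1, h2]; simp [cross]; ring
    have hiff : (∃ c ∈ f, 0 < inner ℝ (c - o.start e) (o.nrm e)) ↔
        0 < cross (o.finish e - o.start e) (z - o.start e) := by
      rw [← hz, mul_pos_iff_of_pos_left he.len_pos]
      constructor
      · rintro ⟨w, hw, hpos⟩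
        rw [hf] at hw
        simp only [Finset.mem_insert, Finset.mem_singleton] at hw
        have h0 : ∀ w ∈ e, inner ℝ (w - o.start e) (o.nrm e) = 0 := fun w hw =>
          he.hgt_eq_zero hw
        rcases hw with rfl | rfl | rfl
        · rw [h0 w (by rw [hexy]; simp)] at hpos; exact absurd hpos (lt_irrefl _)
        · rw [h0 w (by rw [hexy]; simp)] at hpos; exact absurd hpos (lt_irrefl _)
        · exact hpos
      · intro h; exact ⟨z, by rw [hf]; simp, h⟩
    unfold EdgeOrientation.incF
    simp only [hiff]
    split_ifs with hpos
    · rcases hc with hc | hc <;> rw [hc] at hpos ⊢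
      · rw [abs_of_pos hpos]; ring
      · rw [abs_of_neg (by linarith)]; ring
    · rcases hc with hc | hc <;> rw [hc] at hpos ⊢
      · rw [abs_of_nonpos (by linarith)]; ring
      · rw [abs_of_nonneg (by linarith)]; ring
  rw [integral_edge he]
  have hv := len_mul_nrm he v
  have hseg : segAvg φ (o.start e) (o.finish e) = segAvg φ x y := by
    rcases hcase with ⟨h1, h2⟩ | ⟨h1, h2⟩
    · rw [h1, h2]
    · rw [h1, h2, segAvg_comm]
  rw [hseg]
  have habs : |cross (y - x) (z - x)| ≠ 0 := abs_ne_zero.2 hxyz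
  -- Each factor changes sign with the orientation of the edge, so the product does not depend on
  -- it.
  have hprod : cross (o.finish e - o.start e) (z - o.start e) *
      cross (o.finish e - o.start e) v = cross (y - x) (z - x) * cross (y - x) v := by
    rcases hcase with ⟨h1, h2⟩ | ⟨h1, h2⟩ <;> rw [h1, h2] <;> simp [cross]; ring
  have key : o.incF e f * cross (o.finish e - o.start e) v =
      -(|cross (y - x) (z - x)| / cross (y - x) (z - x) * cross (y - x) v) := by
    apply mul_right_cancel₀ habs
    have h5 : o.incF e f * cross (o.finish e - o.start e) v * |cross (y - x) (z - x)| =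
        -(cross (y - x) (z - x) * cross (y - x) v) := by
      rw [← hprod]; linear_combination cross (o.finish e - o.start e) v * hinc
    rw [h5]
    have h6 : |cross (y - x) (z - x)| * |cross (y - x) (z - x)| =
      cross (y - x) (z - x) * cross (y - x) (z - x) := abs_mul_abs_self _
    field_simp
    linear_combination cross (y - x) v * h6
  rw [← key, ← hv]; ring

lemma powersetCard_two_triple [DecidableEq Plane] {a b c : Plane} (hab : a ≠ b) (hac : a ≠ c)
    (hbc : b ≠ c) :
    ({a, b, c} : Finset Plane).powersetCard 2 = {{a, b}, {c, a}, {b, c}} := by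
  ext s
  simp only [Finset.mem_powersetCard, Finset.mem_insert, Finset.mem_singleton]
  constructor
  · rintro ⟨hs, hc⟩
    obtain ⟨x, y, hxy, rfl⟩ := Finset.card_eq_two.1 hc
    have hx := hs (Finset.mem_insert_self x {y})
    have hy := hs (Finset.mem_insert_of_mem (Finset.mem_singleton_self y) : y ∈ ({x, y} : Finset Plane))
    simp only [Finset.mem_insert, Finset.mem_singleton] at hx hy
    grind [Finset.pair_comm]
  · rintro (rfl | rfl | rfl)
    · exact ⟨by grind, Finset.card_pair hab⟩
    · exact ⟨by grind, Finset.card_pair hac.symm⟩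
    · exact ⟨by grind, Finset.card_pair hbc⟩

lemma sum_powersetCard_two_triple [DecidableEq Plane] {a b c : Plane} (hab : a ≠ b) (hac : a ≠ c)
    (hbc : b ≠ c) {M : Type*} [AddCommMonoid M] (F : Finset Plane → M) :
    ∑ e ∈ ({a, b, c} : Finset Plane).powersetCard 2, F e = F {a, b} + (F {c, a} + F {b, c}) := by
  rw [powersetCard_two_triple hab hac hbc, Finset.sum_insert, Finset.sum_pair]
  · intro h
    have : b ∈ ({c, a} : Finset Plane) := by rw [h]; simp
    simp only [Finset.mem_insert, Finset.mem_singleton] at this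
    grind
  · simp only [Finset.mem_insert, Finset.mem_singleton, not_or]
    constructor <;> intro h
    · have : b ∈ ({c, a} : Finset Plane) := by rw [← h]; simp
      simp only [Finset.mem_insert, Finset.mem_singleton] at this
      grind
    · have : a ∈ ({b, c} : Finset Plane) := by rw [← h]; simp
      simp only [Finset.mem_insert, Finset.mem_singleton] at this
      grind

/-- The divergence theorem on a triangle. -/
theorem integral_fderiv_triangle (hf : IsTri f) (he : ∀ e ∈ f.powersetCard 2, o.IsEdge e)
    {φ : Plane → ℝ} (hφ : ContDiff ℝ 1 φ) (v : Plane) :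
    ∫ x in convexHull ℝ (f : Set Plane), fderiv ℝ φ x v = ∑ e ∈ f.powersetCard 2,
      o.incF e f * inner ℝ v (o.nrm e) * ∫ s in (0 : ℝ)..(o.len e), φ (o.param e s) := by
  classical
  obtain ⟨a, b, c, hab, hac, hbc, hfabc⟩ := hf.exists_triple
  have hD := hf.cross_ne_zero hab hac hbc hfabc
  rw [hfabc, powersetCard_two_triple hab hac hbc] at he
  have e1 : cross (a - c) (b - c) = cross (b - a) (c - a) := by simp [cross]; ring
  have e2 : cross (c - b) (a - b) = cross (b - a) (c - a) := by simp [cross]; ring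
  conv_rhs => rw [hfabc]
  rw [sum_powersetCard_two_triple hab hac hbc,
    edge_term (he {a, b} (by simp)) hD hab rfl rfl,
    edge_term (z := b) (he {c, a} (by simp)) (by rw [e1]; exact hD) hac.symm rfl
      (by ext; simp; tauto),
    edge_term (z := a) (he {b, c} (by simp)) (by rw [e2]; exact hD) hbc rfl
      (by ext; simp; tauto), e1, e2]
  have hcoe : (f : Set Plane) = {a, b, c} := by rw [hfabc]; simp
  have hD' : cross (c - a) (b - a) ≠ 0 := by
    intro h; apply hD; simp only [cross] at h ⊢; linarith
  have i1 := integral_fderiv_triple hD hφ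
  have i2 := integral_fderiv_triple hD' hφ
  rw [show ({a, c, b} : Set Plane) = {a, b, c} by ext; simp; tauto] at i2
  have habs : |cross (c - a) (b - a)| = |cross (b - a) (c - a)| := by
    rw [← abs_neg]; congr 1; simp only [cross]; ring
  rw [habs, segAvg_comm φ c b, segAvg_comm φ a c] at i2
  set D := cross (b - a) (c - a) with hDdef
  -- Cramer's rule for `v` in the basis `b - a`, `c - a`. The integrals in these two directions are
  -- `i2` and `i1`.
  set α := cross v (c - a) / D
  set β := cross (b - a) v / D
  have hv : v = α • (b - a) + β • (c - a) := by
    refine plane_ext ?_ ?_ <;> simp [α, β] <;> field_simp <;> simp [hDdef, cross] <;> ring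
  have hint : ∀ w : Plane, IntegrableOn (fun x => fderiv ℝ φ x w)
      (convexHull ℝ ({a, b, c} : Set Plane)) := fun w =>
    (((hφ.continuous_fderiv (by norm_num)).clm_apply continuous_const).continuousOn).integrableOn_compact
      (Set.Finite.isCompact_convexHull ℝ (Set.toFinite _))
  have hl : ∫ x in convexHull ℝ ({a, b, c} : Set Plane), fderiv ℝ φ x v =
      α * (|D| * (segAvg φ b c - segAvg φ c a)) + β * (|D| * (segAvg φ b c - segAvg φ a b)) := by
    rw [← i1, ← i2, ← integral_const_mul, ← integral_const_mul, ← integral_add]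
    · congr 1; funext x
      conv_lhs => rw [hv]
      simp
    · exact (hint _).const_mul _
    · exact (hint _).const_mul _
  rw [hcoe, hl]
  have h3 : cross (a - c) v = D * α := by
    simp only [α]; field_simp; simp [cross]; ring
  have h4 : cross (b - a) v = D * β := by
    simp only [β]; field_simp
  have h5 : cross (c - b) v = -(D * α) - D * β := by
    rw [← h3, ← h4]; simp [cross]; ring
  rw [h3, h4, h5]
  field_simp
  ring

lemma integral_pd_triangle (hf : IsTri f) (he : ∀ e ∈ f.powersetCard 2, o.IsEdge e)
    {φ : Plane → ℝ} (hφ : ContDiff ℝ 1 φ) (i : Fin 2) :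
    ∫ x in convexHull ℝ (f : Set Plane), pd i φ x = ∑ e ∈ f.powersetCard 2,
      o.incF e f * (o.nrm e i * ∫ s in (0 : ℝ)..(o.len e), φ (o.param e s)) := by
  unfold pd
  rw [integral_fderiv_triangle hf he hφ]
  refine Finset.sum_congr rfl fun e _ => ?_
  rw [mul_assoc]
  congr 2
  fin_cases i <;> simp [inner_plane]

end Divergence

/-! ## Calculus of partial derivatives -/

section Calculus

lemma differentiable_of_smooth {g : Plane → ℝ} (hg : ContDiff ℝ ∞ g) : Differentiable ℝ g :=
  hg.differentiable (by simp)

lemma contDiff_pd {g : Plane → ℝ} (hg : ContDiff ℝ ∞ g) (i : Fin 2) : ContDiff ℝ ∞ (pd i g) :=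
  (hg.fderiv_right (m := ∞) (by simp)).clm_apply contDiff_const

lemma continuous_pd {g : Plane → ℝ} (hg : ContDiff ℝ ∞ g) (i : Fin 2) : Continuous (pd i g) :=
  (contDiff_pd hg i).continuous

lemma pd_add {g h : Plane → ℝ} (hg : ContDiff ℝ ∞ g) (hh : ContDiff ℝ ∞ h) (i : Fin 2) :
    pd i (g + h) = pd i g + pd i h := by
  funext x
  simp only [pd, Pi.add_apply]
  rw [fderiv_add (differentiable_of_smooth hg x) (differentiable_of_smooth hh x)]; rfl

lemma pd_sub {g h : Plane → ℝ} (hg : ContDiff ℝ ∞ g) (hh : ContDiff ℝ ∞ h) (i : Fin 2) :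
    pd i (g - h) = pd i g - pd i h := by
  funext x
  simp only [pd, Pi.sub_apply]
  rw [fderiv_sub (differentiable_of_smooth hg x) (differentiable_of_smooth hh x)]; rfl

lemma pd_smul {g : Plane → ℝ} (hg : ContDiff ℝ ∞ g) (c : ℝ) (i : Fin 2) :
    pd i (c • g) = c • pd i g := by
  funext x
  simp only [pd, Pi.smul_apply]
  rw [fderiv_const_smul (differentiable_of_smooth hg x)]; rfl

lemma pd_neg (g : Plane → ℝ) (i : Fin 2) : pd i (-g) = -pd i g := by
  funext x
  simp only [pd, Pi.neg_apply]
  rw [fderiv_neg]; rfl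

lemma pd_mul {g h : Plane → ℝ} (hg : ContDiff ℝ ∞ g) (hh : ContDiff ℝ ∞ h) (i : Fin 2) :
    pd i (g * h) = pd i g * h + g * pd i h := by
  funext x
  simp only [pd, Pi.add_apply, Pi.mul_apply]
  rw [fderiv_mul (differentiable_of_smooth hg x) (differentiable_of_smooth hh x)]
  simp; ring

lemma pd_comm {g : Plane → ℝ} (hg : ContDiff ℝ ∞ g) (i j : Fin 2) :
    pd i (pd j g) = pd j (pd i g) := by
  funext x
  have hd : DifferentiableAt ℝ (fderiv ℝ g) x :=
    (hg.fderiv_right (m := ∞) (by simp)).differentiable (by simp) x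
  have h : ∀ v w : Plane, fderiv ℝ (fun y => fderiv ℝ g y v) x w = fderiv ℝ (fderiv ℝ g) x w v := by
    intro v w
    rw [fderiv_clm_apply hd (differentiableAt_const v)]
    simp
  unfold pd
  rw [h, h]
  have hs : IsSymmSndFDerivAt ℝ g x :=
    (hg.contDiffAt).isSymmSndFDerivAt (by
      rw [minSmoothness_of_isRCLikeNormedField]; exact WithTop.coe_le_coe.2 le_top)
  exact hs _ _

lemma fderiv_apply_eq (g : Plane → ℝ) (x v : Plane) :
    fderiv ℝ g x v = v 0 * pd 0 g x + v 1 * pd 1 g x := by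
  have h2 : v = v 0 • EuclideanSpace.single 0 1 + v 1 • EuclideanSpace.single 1 1 :=
    plane_ext (by simp) (by simp)
  conv_lhs => rw [h2]
  simp only [map_add, map_smul, smul_eq_mul, pd]

variable {K : Geometry.SimplicialComplex ℝ Plane} {o : EdgeOrientation K} {e f : Finset Plane}

lemma continuous_param : Continuous (o.param e) := by
  unfold EdgeOrientation.param; fun_prop

lemma hasDerivAt_comp_param {g : Plane → ℝ} (hg : ContDiff ℝ ∞ g) (s : ℝ) :
    HasDerivAt (fun s => g (o.param e s))
      (o.tang e 0 * pd 0 g (o.param e s) + o.tang e 1 * pd 1 g (o.param e s)) s := by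
  have h1 : HasDerivAt (o.param e) (o.tang e) s := by
    unfold EdgeOrientation.param
    simpa using ((hasDerivAt_id s).smul_const (o.tang e)).const_add (o.start e)
  have := (differentiable_of_smooth hg (o.param e s)).hasFDerivAt.comp_hasDerivAt s h1
  rw [fderiv_apply_eq] at this
  exact this

lemma isCompact_hull (f : Finset Plane) : IsCompact (convexHull ℝ (f : Set Plane)) :=
  Set.Finite.isCompact_convexHull ℝ f.finite_toSet

lemma integrableOn_hull {g : Plane → ℝ} (hg : Continuous g) (f : Finset Plane) :
    MeasureTheory.IntegrableOn g (convexHull ℝ (f : Set Plane)) :=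
  hg.continuousOn.integrableOn_compact (isCompact_hull f)

/-- The divergence theorem for vector fields on a triangle. -/
lemma integral_divV (hf : IsTri f) (he : ∀ e ∈ f.powersetCard 2, o.IsEdge e)
    {X : Fin 2 → Plane → ℝ} (hX : ∀ i, ContDiff ℝ ∞ (X i)) :
    ∫ x in convexHull ℝ (f : Set Plane), divV pd X x = ∑ e ∈ f.powersetCard 2,
      o.incF e f * ∫ s in (0 : ℝ)..(o.len e), (∑ i, o.nrm e i * X i (o.param e s)) := by
  have h1 : ∀ i, ContDiff ℝ 1 (X i) := fun i => (hX i).of_le (by simp)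
  simp only [divV, Pi.add_apply]
  rw [MeasureTheory.integral_add (integrableOn_hull (continuous_pd (hX 0) 0) f)
    (integrableOn_hull (continuous_pd (hX 1) 1) f),
    integral_pd_triangle hf he (h1 0), integral_pd_triangle hf he (h1 1), ← Finset.sum_add_distrib]
  refine Finset.sum_congr rfl fun e _ => ?_
  have hc : ∀ i, Continuous fun s => o.nrm e i * X i (o.param e s) := fun i =>
    continuous_const.mul ((hX i).continuous.comp continuous_param)
  simp only [Fin.sum_univ_two]
  rw [intervalIntegral.integral_add
    ((hc 0).intervalIntegrable _ _) ((hc 1).intervalIntegrable _ _),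
    intervalIntegral.integral_const_mul, intervalIntegral.integral_const_mul]
  ring

lemma contDiff_divM {σ : Matrix (Fin 2) (Fin 2) (Plane → ℝ)} (hσ : ∀ i j, ContDiff ℝ ∞ (σ i j))
    (i : Fin 2) : ContDiff ℝ ∞ (divM pd σ i) :=
  (contDiff_pd (hσ i 0) 0).add (contDiff_pd (hσ i 1) 1)

/-- Green's formula for `div div` on a triangle. -/
lemma integral_divDiv_mul (hf : IsTri f) (he : ∀ e ∈ f.powersetCard 2, o.IsEdge e)
    {σ : Matrix (Fin 2) (Fin 2) (Plane → ℝ)} (hσ : ∀ i j, ContDiff ℝ ∞ (σ i j))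
    {φ : Plane → ℝ} (hφ : ContDiff ℝ ∞ φ) :
    ∫ x in convexHull ℝ (f : Set Plane),
        (divDiv pd σ x * φ x - ∑ i, ∑ j, σ i j x * pd i (pd j φ) x) =
      ∑ e ∈ f.powersetCard 2, o.incF e f * ∫ s in (0 : ℝ)..(o.len e),
        ((∑ j, divM pd σ j (o.param e s) * o.nrm e j) * φ (o.param e s) -
          ∑ j, (∑ l, σ j l (o.param e s) * o.nrm e l) * pd j φ (o.param e s)) := by
  -- This field is `φ div σ - σᵀ ∇φ`. In its divergence the terms with `div σ · ∇φ` cancel, and its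
  -- normal component is the boundary integrand.
  let X : Fin 2 → Plane → ℝ := fun j =>
    divM pd σ j * φ - (σ 0 j * pd 0 φ + σ 1 j * pd 1 φ)
  have c1 : ∀ j, ContDiff ℝ ∞ (divM pd σ j * φ) := fun j => (contDiff_divM hσ j).mul hφ
  have c2 : ∀ i j, ContDiff ℝ ∞ (σ i j * pd i φ) := fun i j => (hσ i j).mul (contDiff_pd hφ i)
  have c3 : ∀ j, ContDiff ℝ ∞ (σ 0 j * pd 0 φ + σ 1 j * pd 1 φ) := fun j => (c2 0 j).add (c2 1 j)
  have hX : ∀ i, ContDiff ℝ ∞ (X i) := fun j => (c1 j).sub (c3 j)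
  have hdiv : divV pd X = fun x =>
      divDiv pd σ x * φ x - ∑ i, ∑ j, σ i j x * pd i (pd j φ) x := by
    funext x
    simp only [divV, X]
    rw [pd_sub (c1 0) (c3 0), pd_sub (c1 1) (c3 1),
      pd_add (c2 0 0) (c2 1 0), pd_add (c2 0 1) (c2 1 1),
      pd_mul (contDiff_divM hσ 0) hφ, pd_mul (contDiff_divM hσ 1) hφ,
      pd_mul (hσ 0 0) (contDiff_pd hφ 0), pd_mul (hσ 1 0) (contDiff_pd hφ 1),
      pd_mul (hσ 0 1) (contDiff_pd hφ 0), pd_mul (hσ 1 1) (contDiff_pd hφ 1), pd_comm hφ 1 0]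
    simp only [Fin.sum_univ_two, divDiv, divV, divM, Pi.add_apply, Pi.sub_apply, Pi.mul_apply,
      pd_comm hφ 1 0]
    ring
  have := integral_divV hf he hX
  rw [hdiv] at this
  rw [this]
  refine Finset.sum_congr rfl fun e _ => ?_
  congr 2
  funext s
  simp only [X, Fin.sum_univ_two, Pi.sub_apply, Pi.mul_apply, Pi.add_apply]
  ring

/-- Green's formula for `curl` on a triangle. -/
lemma integral_curl_mul (hf : IsTri f) (he : ∀ e ∈ f.powersetCard 2, o.IsEdge e)
    {u : Fin 2 → Plane → ℝ} (hu : ∀ i, ContDiff ℝ ∞ (u i))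
    {φ : Matrix (Fin 2) (Fin 2) (Plane → ℝ)} (hφ : ∀ i j, ContDiff ℝ ∞ (φ i j)) :
    ∫ x in convexHull ℝ (f : Set Plane),
        (∑ i, ∑ j, curlV pd u i j x * φ i j x - ∑ i, u i x * (-rotV pd (φ i) x)) =
      ∑ e ∈ f.powersetCard 2, o.incF e f * ∫ s in (0 : ℝ)..(o.len e),
        (∑ i, u i (o.param e s) *
          (o.nrm e 0 * φ i 1 (o.param e s) - o.nrm e 1 * φ i 0 (o.param e s))) := by
  -- The quarter turn of `φᵀ u`: its divergence is `curl u : φ + u · rot φ`.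
  let X : Fin 2 → Plane → ℝ := ![u 0 * φ 0 1 + u 1 * φ 1 1, -(u 0 * φ 0 0 + u 1 * φ 1 0)]
  have c : ∀ i j, ContDiff ℝ ∞ (u i * φ i j) := fun i j => (hu i).mul (hφ i j)
  have hX : ∀ i, ContDiff ℝ ∞ (X i) := by
    intro i; fin_cases i
    · exact (c 0 1).add (c 1 1)
    · exact ((c 0 0).add (c 1 0)).neg
  have hdiv : divV pd X = fun x =>
      ∑ i, ∑ j, curlV pd u i j x * φ i j x - ∑ i, u i x * (-rotV pd (φ i) x) := by
    funext x
    simp only [divV, X, Matrix.cons_val_zero, Matrix.cons_val_one]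
    rw [pd_neg, pd_add (c 0 1) (c 1 1), pd_add (c 0 0) (c 1 0), pd_mul (hu 0) (hφ 0 1),
      pd_mul (hu 1) (hφ 1 1), pd_mul (hu 0) (hφ 0 0), pd_mul (hu 1) (hφ 1 0)]
    simp [Fin.sum_univ_two, curlV, rotV]
    ring
  have := integral_divV hf he hX
  rw [hdiv] at this
  rw [this]
  refine Finset.sum_congr rfl fun e _ => ?_
  congr 2
  funext s
  simp [X, Fin.sum_univ_two]
  ring

end Calculus

/-! ## The currents -/

section Currents

open MeasureTheory

variable {K : Geometry.SimplicialComplex ℝ Plane} {o : EdgeOrientation K} {e f : Finset Plane}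

lemma pdP_of_mem_polyLE_one {p : Poly} (hp : p ∈ polyLE 1) (i : Fin 2) :
    ∃ c : ℝ, pdP i p = MvPolynomial.C c := by
  have := pdP_mem_polyLE i hp
  rw [MvPolynomial.mem_restrictTotalDegree] at this
  exact ⟨_, MvPolynomial.totalDegree_eq_zero_iff_eq_C.1 (Nat.le_zero.1 this)⟩

lemma pdP_pdP_of_mem_polyLE_one {p : Poly} (hp : p ∈ polyLE 1) (i j : Fin 2) :
    pdP i (pdP j p) = 0 := by
  obtain ⟨c, hc⟩ := pdP_of_mem_polyLE_one hp j
  rw [hc, pdP_C]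

variable (ψ : Module.Basis (Fin 3) ℝ (polyLE 1)) (z : Module.Basis (Fin 3) ℝ RT2)

/-- Functionals on `P₁` correspond to elements of `RT2`, by the choice of bases. -/
def curEquiv : Module.Dual ℝ (polyLE 1) ≃ₗ[ℝ] RT2 :=
  (ψ.constr ℝ).symm ≪≫ₗ z.equivFun.symm

lemma curEquiv_apply (Φ : Module.Dual ℝ (polyLE 1)) : curEquiv ψ z Φ = ∑ i, Φ (ψ i) • z i := by
  rw [curEquiv, LinearEquiv.trans_apply, Module.Basis.equivFun_symm_apply]
  rfl

/-- The pairing of first order jets at `x` with `P₁`. -/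
def jetPair (x : Plane) : Jet1 →ₗ[ℝ] Module.Dual ℝ (polyLE 1) :=
  LinearMap.mk₂ ℝ (fun j p => 1 / 2 * (j.2 0 0 + j.2 1 1) * evalAt x p.1 -
      (j.1 0 * evalAt x (pdP 0 p.1) + j.1 1 * evalAt x (pdP 1 p.1)))
    (fun j j' p => by simp; ring) (fun c j p => by simp; ring)
    (fun j p q => by simp [pdP_add]; ring) (fun c j p => by simp [pdP_smul]; ring)

lemma jetPair_apply (x : Plane) (j : Jet1) (p : polyLE 1) :
    jetPair x j p = 1 / 2 * (j.2 0 0 + j.2 1 1) * evalAt x p.1 -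
      (j.1 0 * evalAt x (pdP 0 p.1) + j.1 1 * evalAt x (pdP 1 p.1)) := rfl

/-- The integral of a univariate polynomial. -/
def polyInt (l : ℝ) : Polynomial ℝ →ₗ[ℝ] ℝ where
  toFun p := ∫ s in (0 : ℝ)..l, p.eval s
  map_add' p q := by
    simp only [Polynomial.eval_add]
    exact intervalIntegral.integral_add (p.continuous.intervalIntegrable _ _)
      (q.continuous.intervalIntegrable _ _)
  map_smul' c p := by simp

lemma polyInt_apply (l : ℝ) (p : Polynomial ℝ) : polyInt l p = ∫ s in (0 : ℝ)..l, p.eval s := rfl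

variable (o e) in
/-- The pairing of traces on the edge `e` with `P₁`. -/
def edgePair : Edge3 →ₗ[ℝ] Module.Dual ℝ (polyLE 1) :=
  LinearMap.mk₂ ℝ (fun a p => polyInt (o.len e) (a.2.2 * o.restr e p.1 -
      (a.1 * o.restr e (o.nrm e 0 • pdP 0 p.1 + o.nrm e 1 • pdP 1 p.1) +
        a.2.1 * o.restr e (o.tang e 0 • pdP 0 p.1 + o.tang e 1 • pdP 1 p.1))))
    (fun a b p => by rw [← map_add]; congr 1; simp; ring)
    (fun c a p => by
      rw [← map_smul]; congr 1; simp only [Prod.smul_fst, Prod.smul_snd, smul_mul_assoc]; module)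
    (fun a p q => by rw [← map_add]; congr 1; simp [pdP_add]; ring)
    (fun c a p => by
      rw [← map_smul]; congr 1
      simp only [SetLike.val_smul, pdP_smul, map_add, map_smul, Algebra.mul_smul_comm,
        mul_add, smul_comm _ c]
      module)

lemma edgePair_apply (a : Edge3) (p : polyLE 1) :
    edgePair o e a p = polyInt (o.len e) (a.2.2 * o.restr e p.1 -
      (a.1 * o.restr e (o.nrm e 0 • pdP 0 p.1 + o.nrm e 1 • pdP 1 p.1) +
        a.2.1 * o.restr e (o.tang e 0 • pdP 0 p.1 + o.tang e 1 • pdP 1 p.1))) := rfl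

/-- The integral of a polynomial over a triangle. -/
def triInt (f : Finset Plane) : Poly →ₗ[ℝ] ℝ where
  toFun p := ∫ x in convexHull ℝ (f : Set Plane), polyFun p x
  map_add' p q := by
    simp only [polyFun, map_add]
    exact integral_add (integrableOn_hull (contDiff_polyFun p).continuous f)
      (integrableOn_hull (contDiff_polyFun q).continuous f)
  map_smul' c p := by simp [polyFun, integral_const_mul]

lemma triInt_apply (f : Finset Plane) (p : Poly) :
    triInt f p = ∫ x in convexHull ℝ (f : Set Plane), polyFun p x := rfl

/-- The `L²` pairing of polynomials with `P₁` on a triangle. -/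
def triPair (f : Finset Plane) : Poly →ₗ[ℝ] Module.Dual ℝ (polyLE 1) :=
  LinearMap.mk₂ ℝ (fun q p => triInt f (q * p.1))
    (fun a b p => by rw [add_mul, map_add]) (fun c a p => by rw [smul_mul_assoc, map_smul])
    (fun a p q => by rw [Submodule.coe_add, mul_add, map_add])
    (fun c a p => by rw [Submodule.coe_smul, mul_smul_comm, map_smul])

lemma triPair_apply (q : Poly) (p : polyLE 1) : triPair f q p = triInt f (q * p.1) := rfl

/-- A linear map to the dual of a finite dimensional space is onto if it separates points. -/
lemma surjective_dual_of_separating {U : Type*} [AddCommGroup U] [Module ℝ U]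
    {A : U →ₗ[ℝ] Module.Dual ℝ (polyLE 1)} (h : ∀ p, (∀ u, A u p = 0) → p = 0) :
    Function.Surjective A := by
  rw [← LinearMap.range_eq_top]
  by_contra hne
  -- A nonzero functional that kills the range is, by reflexivity of the finite dimensional `P₁`,
  -- the evaluation at some `p`; that `p` is not separated from zero.
  obtain ⟨Φ, hΦ, hle⟩ := Submodule.exists_le_ker_of_lt_top _ (lt_top_iff_ne_top.2 hne)
  obtain ⟨p, rfl⟩ := (Module.evalEquiv ℝ (polyLE 1)).surjective Φ
  apply hΦ
  rw [h p fun u => ?_, map_zero]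
  exact hle (LinearMap.mem_range_self A u)

end Currents

/-! ### The currents as pairings with `P₁`, their surjectivity and the Stokes formulas -/

section CurrentFormulas

open MeasureTheory

variable {K : Geometry.SimplicialComplex ℝ Plane} {o : EdgeOrientation K} {e f : Finset Plane}
variable (ψ : Module.Basis (Fin 3) ℝ (polyLE 1)) (z : Module.Basis (Fin 3) ℝ RT2)

lemma current_V (x : Plane) (u : Fin 2 → Plane → ℝ) :
    (divdivCurrents o ψ z).V x u =
      curEquiv ψ z (jetPair x (fun i => u i x, Matrix.of fun i j => pd j (u i) x)) := by
  rw [curEquiv_apply]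
  simp only [divdivCurrents]
  refine Finset.sum_congr rfl fun i _ => ?_
  rw [jetPair_apply]
  congr 1
  simp [divV, Fin.sum_univ_two, polyFun]

lemma current_V_vecFun (x : Plane) (u : VecPoly) :
    (divdivCurrents o ψ z).V x (vecFun u) = curEquiv ψ z (jetPair x (trFV0 x u)) := by
  rw [current_V]
  congr 2
  simp only [vecFun, pd_polyFun]
  rfl

lemma current_E_matFun (he : o.IsEdge e) (σ : MatPoly) :
    (divdivCurrents o ψ z).E e (matFun σ) = curEquiv ψ z (edgePair o e (trFE1 o e σ)) := by
  rw [curEquiv_apply]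
  simp only [divdivCurrents]
  refine Finset.sum_congr rfl fun i _ => ?_
  rw [edgePair_apply, polyInt_apply]
  congr 2
  funext s
  have hd : ∀ j, divM pd (matFun σ) j = polyFun (divM pdP σ j) := by
    intro j
    funext y
    simp [divM, divV, matFun, pd_polyFun, polyFun]
  simp only [hd]
  simp only [trFE1, LinearMap.coe_mk, AddHom.coe_mk, Fin.sum_univ_two, Polynomial.eval_sub,
    Polynomial.eval_add, Polynomial.eval_mul, Polynomial.eval_smul, smul_eq_mul, eval_restr,
    map_add, map_smul, matFun, Matrix.of_apply, polyFun, nrm_zero, nrm_one]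
  set t0 := o.tang e 0
  set t1 := o.tang e 1
  have ht : t0 ^ 2 + t1 ^ 2 = 1 := he.tang_sq
  set p := o.param e s
  linear_combination ((evalAt p (σ 0 0) * -t1 + evalAt p (σ 0 1) * t0) * evalAt p (pdP 0 (ψ i).1) +
      (evalAt p (σ 1 0) * -t1 + evalAt p (σ 1 1) * t0) * evalAt p (pdP 1 (ψ i).1)) * ht

lemma current_F_polyFun (f : Finset Plane) (q : Poly) :
    (divdivCurrents o ψ z).F f (polyFun q) = curEquiv ψ z (triPair f q) := by
  rw [curEquiv_apply]
  simp only [divdivCurrents]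
  refine Finset.sum_congr rfl fun i _ => ?_
  rw [triPair_apply, triInt_apply]
  simp [polyFun, evalAt_mul]

lemma eq_zero_of_jet_eq_zero {p : Poly} (hp : p ∈ polyLE 1) {x : Plane}
    (h0 : evalAt x (pdP 0 p) = 0) (h1 : evalAt x (pdP 1 p) = 0) (h : evalAt x p = 0) : p = 0 := by
  have hz : ∀ i, pdP i p = 0 := by
    intro i
    obtain ⟨c, hc⟩ := pdP_of_mem_polyLE_one hp i
    have : evalAt x (pdP i p) = 0 := by fin_cases i <;> assumption
    rw [hc, evalAt_C] at this
    rw [hc, this, map_zero]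
  refine poly_ext fun y => ?_
  have := is_const_of_fderiv_eq_zero (𝕜 := ℝ) (f := polyFun p)
    (differentiable_of_smooth (contDiff_polyFun p)) (fun y => by
      rw [(hasFDerivAt_polyFun p y).fderiv]; simp [hz]) y x
  rw [map_zero, ← h]
  exact this

lemma trFV0_surjective (x : Plane) (j : Jet1) :
    ∃ u : VecPoly, (∀ i, u i ∈ polyLE 1) ∧ trFV0 x u = j := by
  refine ⟨fun i => MvPolynomial.C (j.1 i) +
    (MvPolynomial.C (j.2 i 0) * (MvPolynomial.X 0 - MvPolynomial.C (x 0)) +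
      MvPolynomial.C (j.2 i 1) * (MvPolynomial.X 1 - MvPolynomial.C (x 1))), fun i => ?_, ?_⟩
  · refine Submodule.add_mem _ (C_mem_polyLE _ _) (Submodule.add_mem _ ?_ ?_) <;>
      exact mul_mem_polyLE (C_mem_polyLE _ 0)
        (Submodule.sub_mem _ (X_mem_polyLE _ le_rfl) (C_mem_polyLE _ _)) le_rfl
  · ext i
    · simp [trFV0, evalAt_mul, evalAt_C, evalAt_X]
    · rename_i l
      fin_cases l <;>
      simp [trFV0, evalAt_mul, evalAt_C, evalAt_X, pdP_add, pdP_mul, pdP_sub, pdP_C, pdP_X]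

/-- The unit values with zero gradient detect the partial derivatives of `p`, and the identity
gradient with zero value detects `p(x)`. -/
lemma jetPair_surjective (x : Plane) : Function.Surjective (jetPair x) := by
  refine surjective_dual_of_separating fun p h => ?_
  have h0 := h (![1, 0], 0)
  have h1 := h (![0, 1], 0)
  have h2 := h (0, 1)
  simp [jetPair_apply] at h0 h1 h2
  exact Subtype.ext (eq_zero_of_jet_eq_zero p.2 h0 h1 h2)

/-- A nonzero polynomial is nonzero somewhere in the nonempty interior of the triangle, hence on an
open set of positive measure. -/
lemma triInt_mul_self_pos (hf : IsTri f) {p : Poly} (hp : p ≠ 0) : 0 < triInt f (p * p) := by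
  have hc := (contDiff_polyFun (p * p)).continuous
  have heq : ∀ x, polyFun (p * p) x = polyFun p x * polyFun p x := fun x => evalAt_mul x p p
  rw [triInt_apply, setIntegral_pos_iff_support_of_nonneg_ae
    (Filter.Eventually.of_forall fun x => by rw [heq]; exact mul_self_nonneg _)
    (integrableOn_hull hc f)]
  have hne : ((Function.support (polyFun (p * p))) ∩
      interior (convexHull ℝ (f : Set Plane))).Nonempty := by
    by_contra hemp
    obtain ⟨y, hy⟩ := interior_hull_nonempty hf
    apply hp
    refine poly_eq_zero_of_eventually (x := y) ?_
    filter_upwards [isOpen_interior.mem_nhds hy] with w hw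
    by_contra hw0
    exact hemp ⟨w, by rw [Function.mem_support, heq]; exact mul_self_ne_zero.2 hw0, hw⟩
  have hopen : IsOpen ((Function.support (polyFun (p * p))) ∩
      interior (convexHull ℝ (f : Set Plane))) :=
    (hc.isOpen_support).inter isOpen_interior
  exact lt_of_lt_of_le (hopen.measure_pos volume hne)
    (measure_mono (Set.inter_subset_inter_right _ interior_subset))

/-- An affine `p` is tested with itself, which is allowed as soon as `m ≥ 1`. -/
lemma triPair_surjective (hf : IsTri f) {m : ℕ} (hm : 1 ≤ m) :
    Function.Surjective ((triPair f).domRestrict (polyLE m)) := by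
  refine surjective_dual_of_separating fun p h => ?_
  by_contra hp
  have := triInt_mul_self_pos hf (p := p.1) fun h0 => hp (Subtype.ext h0)
  exact this.ne' (h ⟨p.1, polyLE_mono hm p.2⟩)

lemma polyInt_mul_self_pos {l : ℝ} (hl : 0 < l) {p : Polynomial ℝ} (hp : p ≠ 0) :
    0 < polyInt l (p * p) := by
  rw [polyInt_apply, intervalIntegral.integral_pos_iff_support_of_nonneg_ae
    (Filter.Eventually.of_forall fun x => by
      simp only [Polynomial.eval_mul]; exact mul_self_nonneg _)
    ((p * p).continuous.intervalIntegrable _ _)]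
  refine ⟨hl, ?_⟩
  have hsub : Set.Ioc 0 l \ (p.roots.toFinset : Set ℝ) ⊆
      Function.support (fun s => Polynomial.eval s (p * p)) ∩ Set.Ioc 0 l := by
    rintro s ⟨hs, hr⟩
    refine ⟨?_, hs⟩
    rw [Function.mem_support, Polynomial.eval_mul]
    refine mul_self_ne_zero.2 fun h0 => hr ?_
    simp [hp, h0]
  refine lt_of_lt_of_le ?_ (measure_mono hsub)
  rw [measure_sdiff_null ((p.roots.toFinset.finite_toSet).measure_zero volume)]
  simp [hl]

/-- Edge bubbles realize all functionals on `P₁`. -/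
lemma edgePair_bubble_surjective (he : o.IsEdge e) (Φ : Module.Dual ℝ (polyLE 1)) :
    ∃ (c : ℝ) (q : Polynomial ℝ), q ∈ Polynomial.degreeLE ℝ (1 : ℕ) ∧
      edgePair o e (c • (Polynomial.X * (Polynomial.C (o.len e) - Polynomial.X)), 0, q) = Φ := by
  let A : (ℝ × Polynomial.degreeLE ℝ (1 : ℕ)) →ₗ[ℝ] Edge3 :=
    { toFun := fun a =>
        (a.1 • (Polynomial.X * (Polynomial.C (o.len e) - Polynomial.X)), 0, a.2.1)
      map_add' := fun a b => by ext1 <;> simp [add_smul]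
      map_smul' := fun c a => by ext1 <;> simp [mul_smul] }
  have hs : Function.Surjective (edgePair o e ∘ₗ A) := by
    refine surjective_dual_of_separating fun p h => ?_
    -- Testing with the third component equal to the restriction of `p` shows that `p` vanishes on
    -- the edge, and so does its tangential derivative.
    have hr : o.restr e p.1 = 0 := by
      by_contra hne
      have h1 := h (0, ⟨o.restr e p.1, restr_mem_degreeLE p.2⟩)
      have h2 := polyInt_mul_self_pos he.len_pos hne
      simp [A, edgePair_apply] at h1
      exact h2.ne' h1
    obtain ⟨c0, h0⟩ := pdP_of_mem_polyLE_one p.2 0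
    obtain ⟨c1, h1⟩ := pdP_of_mem_polyLE_one p.2 1
    have hn := h (1, 0)
    have ht := derivative_restr (o := o) (e := e) p.1
    rw [hr] at ht
    simp only [map_zero, h0, h1, restr_C] at ht
    have ht' := congrArg (Polynomial.eval 0) ht
    simp at ht'
    -- The remaining normal derivative is constant and is detected by the quadratic bubble, whose
    -- integral over the edge is `len³ / 6`.
    have hn' : o.nrm e 0 * c0 + o.nrm e 1 * c1 = 0 := by
      have h3 : edgePair o e (A (1, 0)) p =
          -((o.nrm e 0 * c0 + o.nrm e 1 * c1) * (o.len e ^ 3 / 6)) := by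
        rw [edgePair_apply, polyInt_apply]
        simp only [A, LinearMap.coe_mk, AddHom.coe_mk, h0, h1, map_add, map_smul, restr_C]
        have : (fun s => Polynomial.eval s ((0 : Polynomial.degreeLE ℝ (1 : ℕ)).1 * o.restr e p.1 -
            ((1 : ℝ) • (Polynomial.X * (Polynomial.C (o.len e) - Polynomial.X)) *
              (o.nrm e 0 • Polynomial.C c0 + o.nrm e 1 • Polynomial.C c1) +
              0 * (o.tang e 0 • Polynomial.C c0 + o.tang e 1 • Polynomial.C c1)))) =
            fun s => (-(o.nrm e 0 * c0 + o.nrm e 1 * c1)) * (o.len e * s - s ^ 2) := by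
          funext s; simp; ring
        rw [this, intervalIntegral.integral_const_mul, intervalIntegral.integral_sub
          (Continuous.intervalIntegrable (by fun_prop) _ _)
          (Continuous.intervalIntegrable (by fun_prop) _ _),
          intervalIntegral.integral_const_mul, integral_id, integral_pow]
        norm_num
        ring
      have h4 : edgePair o e (A (1, 0)) p = 0 := hn
      rw [h3] at h4
      have hl : o.len e ^ 3 / 6 ≠ 0 := by have := he.len_pos; positivity
      rcases mul_eq_zero.1 (neg_eq_zero.1 h4) with h5 | h5
      exacts [h5, absurd h5 hl]
    rw [nrm_zero, nrm_one] at hn'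
    have hc0 : c0 = 0 := by
      linear_combination -c0 * he.tang_sq - o.tang e 0 * ht' - o.tang e 1 * hn'
    have hc1 : c1 = 0 := by
      linear_combination -c1 * he.tang_sq - o.tang e 1 * ht' + o.tang e 0 * hn'
    refine Subtype.ext (eq_zero_of_jet_eq_zero p.2 (x := o.param e 0) ?_ ?_ ?_)
    · rw [h0, evalAt_C, hc0]
    · rw [h1, evalAt_C, hc1]
    · rw [← eval_restr, hr]; simp
  obtain ⟨a, ha⟩ := hs Φ
  exact ⟨a.1, a.2.1, a.2.2, ha⟩

/-! ### Stokes formulas -/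

lemma sum_edge (he : o.IsEdge e) {M : Type*} [AddCommMonoid M] (F : Plane → M) :
    ∑ x ∈ e, F x = F (o.start e) + F (o.finish e) := by
  classical
  calc ∑ x ∈ e, F x = ∑ x ∈ ({o.start e, o.finish e} : Finset Plane), F x :=
        Finset.sum_congr he.eq_pair fun _ _ => rfl
    _ = _ := Finset.sum_pair he.2

lemma symCurl_entries (u : Fin 2 → Plane → ℝ) :
    symCurl pd u 0 0 = -pd 1 (u 0) ∧ symCurl pd u 1 1 = pd 0 (u 1) ∧
    symCurl pd u 0 1 = (1 / 2 : ℝ) • (pd 0 (u 0) - pd 1 (u 1)) ∧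
    symCurl pd u 1 0 = (1 / 2 : ℝ) • (pd 0 (u 0) - pd 1 (u 1)) := by
  refine ⟨?_, ?_, ?_, ?_⟩ <;> funext x <;> simp [symCurl, curlV] <;> ring

lemma contDiff_symCurl {u : Fin 2 → Plane → ℝ} (hu : ∀ i, ContDiff ℝ ∞ (u i)) (i j : Fin 2) :
    ContDiff ℝ ∞ (symCurl pd u i j) := by
  obtain ⟨h00, h11, h01, h10⟩ := symCurl_entries u
  have hd : ContDiff ℝ ∞ (pd 0 (u 0) - pd 1 (u 1)) :=
    (contDiff_pd (hu 0) 0).sub (contDiff_pd (hu 1) 1)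
  have hc : ContDiff ℝ ∞ ((1 / 2 : ℝ) • (pd 0 (u 0) - pd 1 (u 1))) := hd.const_smul (1 / 2 : ℝ)
  fin_cases i <;> fin_cases j
  · exact h00 ▸ (contDiff_pd (hu 0) 1).neg
  · exact h01 ▸ hc
  · exact h10 ▸ hc
  · exact h11 ▸ contDiff_pd (hu 1) 0

/-- Row-wise `div curl` vanishes, and the divergence of the transposed `curl` leaves `½ curl div u`.
This is why `div u` has to appear in the edge trace in degree 0. -/
lemma divM_symCurl {u : Fin 2 → Plane → ℝ} (hu : ∀ i, ContDiff ℝ ∞ (u i)) :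
    divM pd (symCurl pd u) 0 = -((1 / 2 : ℝ) • pd 1 (divV pd u)) ∧
      divM pd (symCurl pd u) 1 = (1 / 2 : ℝ) • pd 0 (divV pd u) := by
  obtain ⟨h00, h11, h01, h10⟩ := symCurl_entries u
  have a0 := contDiff_pd (hu 0) 0
  have a1 := contDiff_pd (hu 1) 1
  have hs : ContDiff ℝ ∞ (pd 0 (u 0) - pd 1 (u 1)) := a0.sub a1
  have hd : ∀ i, pd i (divV pd u) = pd i (pd 0 (u 0)) + pd i (pd 1 (u 1)) := fun i =>
    pd_add a0 a1 i
  constructor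
  · simp only [divM, divV, h00, h01] at hd ⊢
    rw [hd, pd_neg, pd_smul hs, pd_sub a0 a1, pd_comm (hu 0) 0 1]
    module
  · simp only [divM, divV, h10, h11] at hd ⊢
    rw [hd, pd_smul hs, pd_sub a0 a1, pd_comm (hu 1) 1 0]
    module

/-- Along the edge the integrand is the derivative of `½ (div u) φ - u · ∇φ`, because `∇φ` is
constant for affine `φ`. -/
lemma stokes_edge (he : o.IsEdge e) {u : Fin 2 → Plane → ℝ} (hu : ∀ i, ContDiff ℝ ∞ (u i)) :
    (divdivCurrents o ψ z).E e (symCurl pd u) =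
      ∑ x ∈ e, o.incV e x • (divdivCurrents o ψ z).V x u := by
  rw [sum_edge he]
  have i1 : o.incV e (o.start e) = -1 := by simp [EdgeOrientation.incV, he.2]
  have i2 : o.incV e (o.finish e) = 1 := by simp [EdgeOrientation.incV]
  rw [i1, i2]
  simp only [divdivCurrents]
  rw [Finset.smul_sum, Finset.smul_sum, ← Finset.sum_add_distrib]
  refine Finset.sum_congr rfl fun i _ => ?_
  rw [smul_smul, smul_smul, ← add_smul]
  congr 1
  obtain ⟨c0, h0⟩ := pdP_of_mem_polyLE_one (ψ i).2 0
  obtain ⟨c1, h1⟩ := pdP_of_mem_polyLE_one (ψ i).2 1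
  have hdiv : ContDiff ℝ ∞ (divV pd u) := (contDiff_pd (hu 0) 0).add (contDiff_pd (hu 1) 1)
  obtain ⟨d0, d1⟩ := divM_symCurl hu
  obtain ⟨s00, s11, s01, s10⟩ := symCurl_entries u
  set φ := polyFun (ψ i).1 with hφ
  have hφs : ContDiff ℝ ∞ φ := contDiff_polyFun _
  have p0 : pd 0 φ = fun _ => c0 := by
    rw [hφ, pd_polyFun, h0]; funext x; exact evalAt_C x c0
  have p1 : pd 1 φ = fun _ => c1 := by
    rw [hφ, pd_polyFun, h1]; funext x; exact evalAt_C x c1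
  have q0 : polyFun (pdP 0 (ψ i).1) = fun _ => c0 := by rw [h0]; funext x; exact evalAt_C x c0
  have q1 : polyFun (pdP 1 (ψ i).1) = fun _ => c1 := by rw [h1]; funext x; exact evalAt_C x c1
  have hder : ∀ s ∈ Set.uIcc (0 : ℝ) (o.len e), HasDerivAt (fun s =>
      1 / 2 * (divV pd u (o.param e s) * φ (o.param e s)) -
        (u 0 (o.param e s) * c0 + u 1 (o.param e s) * c1))
      ((∑ j, divM pd (symCurl pd u) j (o.param e s) * o.nrm e j) * φ (o.param e s) -
        ∑ j, (∑ l, symCurl pd u j l (o.param e s) * o.nrm e l) *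
          polyFun (pdP j (ψ i).1) (o.param e s)) s := by
    intro s _
    have := (((hasDerivAt_comp_param (o := o) (e := e) hdiv s).mul
      (hasDerivAt_comp_param (o := o) (e := e) hφs s)).const_mul (1 / 2)).sub
      (((hasDerivAt_comp_param (o := o) (e := e) (hu 0) s).mul_const c0).add
        ((hasDerivAt_comp_param (o := o) (e := e) (hu 1) s).mul_const c1))
    refine this.congr_deriv ?_
    simp only [Fin.sum_univ_two, d0, d1, s00, s11, s01, s10, p0, p1, q0, q1, nrm_zero, nrm_one,
      Pi.neg_apply, Pi.smul_apply, Pi.sub_apply, smul_eq_mul, divV, Pi.add_apply]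
    set t0 := o.tang e 0
    set t1 := o.tang e 1
    ring
  rw [intervalIntegral.integral_eq_sub_of_hasDerivAt hder]
  · rw [he.param_len, param_zero]
    simp only [Fin.sum_univ_two, q0, q1]
    ring
  · refine Continuous.intervalIntegrable ?_ _ _
    have hc : ∀ g : Plane → ℝ, ContDiff ℝ ∞ g → Continuous fun s => g (o.param e s) :=
      fun g hg => hg.continuous.comp continuous_param
    refine Continuous.sub (Continuous.mul (continuous_finsetSum _ fun j _ =>
      (hc _ (contDiff_divM (contDiff_symCurl hu) j)).mul continuous_const) (hc _ hφs))
      (continuous_finsetSum _ fun j _ => Continuous.mul (continuous_finsetSum _ fun l _ =>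
        (hc _ (contDiff_symCurl hu j l)).mul continuous_const) (hc _ (contDiff_polyFun _)))

/-- Green's formula for `div div` with an affine test function, whose second derivatives vanish. -/
lemma stokes_triangle (hf : IsTri f) (he : ∀ e ∈ f.powersetCard 2, o.IsEdge e)
    {σ : Matrix (Fin 2) (Fin 2) (Plane → ℝ)} (hσ : ∀ i j, ContDiff ℝ ∞ (σ i j)) :
    (divdivCurrents o ψ z).F f (divDiv pd σ) =
      ∑ e ∈ f.powersetCard 2, o.incF e f • (divdivCurrents o ψ z).E e σ := by
  simp only [divdivCurrents, Finset.smul_sum]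
  rw [Finset.sum_comm]
  refine Finset.sum_congr rfl fun i _ => ?_
  simp only [smul_smul]
  rw [← Finset.sum_smul]
  congr 1
  have h2 : ∀ j l x, polyFun (pdP j (pdP l (ψ i).1)) x = 0 := by
    intro j l x
    rw [pdP_pdP_of_mem_polyLE_one (ψ i).2]
    simp [polyFun]
  have := integral_divDiv_mul hf he hσ (contDiff_polyFun (ψ i).1)
  simp only [pd_polyFun, h2, mul_zero, Finset.sum_const_zero, sub_zero] at this
  exact this

end CurrentFormulas

/-! ## Dimension count for trace structures -/

section Squeeze

open Module

variable {MF ME MV : Type} [AddCommGroup MF] [Module ℝ MF] [AddCommGroup ME]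
    [Module ℝ ME] [AddCommGroup MV] [Module ℝ MV]

/-- A linear map into a product of subspaces given by a family of linear maps. -/
lemma finrank_le_of_family {V W : Type} [AddCommGroup V] [Module ℝ V] [AddCommGroup W] [Module ℝ W]
    {ι : Type} (s : Finset ι) (A : Submodule ℝ V) [FiniteDimensional ℝ A] (T : ι → V →ₗ[ℝ] W)
    (B : ι → Submodule ℝ W) [∀ i, FiniteDimensional ℝ (B i)]
    (hT : ∀ i ∈ s, ∀ u ∈ A, T i u ∈ B i) :
    finrank ℝ A ≤ finrank ℝ ↥(A ⊓ ⨅ i ∈ s, LinearMap.ker (T i)) + ∑ i ∈ s, finrank ℝ (B i) ∧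
    (finrank ℝ ↥(A ⊓ ⨅ i ∈ s, LinearMap.ker (T i)) + ∑ i ∈ s, finrank ℝ (B i) ≤ finrank ℝ A →
      ∀ b : ι → W, (∀ i ∈ s, b i ∈ B i) → ∃ u ∈ A, ∀ i ∈ s, T i u = b i) := by
  let Φ : A →ₗ[ℝ] (∀ i : s, B i) := LinearMap.pi fun i =>
    ((T i).domRestrict A).codRestrict (B i) fun u => hT i i.2 u u.2
  have hker : finrank ℝ (LinearMap.ker Φ) = finrank ℝ ↥(A ⊓ ⨅ i ∈ s, LinearMap.ker (T i)) := by
    have h1 : (LinearMap.ker Φ).map A.subtype = A ⊓ ⨅ i ∈ s, LinearMap.ker (T i) := by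
      ext u
      simp only [Submodule.mem_map, LinearMap.mem_ker, Submodule.mem_inf, Submodule.mem_iInf]
      constructor
      · rintro ⟨w, hw, rfl⟩
        refine ⟨w.2, fun i hi => ?_⟩
        have := congrArg Subtype.val (congrFun hw ⟨i, hi⟩)
        exact this
      · rintro ⟨hA, h⟩
        refine ⟨⟨u, hA⟩, ?_, rfl⟩
        funext i
        exact Subtype.ext (h i i.2)
    rw [← h1]
    exact (LinearEquiv.finrank_eq
      (Submodule.equivMapOfInjective _ A.injective_subtype (LinearMap.ker Φ)))
  have hcod : finrank ℝ (∀ i : s, B i) = ∑ i ∈ s, finrank ℝ (B i) := by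
    rw [finrank_pi_fintype, Finset.sum_coe_sort s (fun i => finrank ℝ (B i))]
  have hrn := LinearMap.finrank_range_add_finrank_ker Φ
  have hle := Submodule.finrank_le (LinearMap.range Φ)
  rw [hcod] at hle
  rw [hker] at hrn
  refine ⟨by omega, fun h b hb => ?_⟩
  have htop : LinearMap.range Φ = ⊤ := by
    apply Submodule.eq_top_of_finrank_eq
    rw [hcod]; omega
  obtain ⟨u, hu⟩ := LinearMap.range_eq_top.1 htop fun i => ⟨b i, hb i i.2⟩
  refine ⟨u, u.2, fun i hi => ?_⟩
  exact congrArg Subtype.val (congrFun hu ⟨i, hi⟩)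

variable {S : TraceData MF ME MV} {f : Finset Plane}

/-- If the bubble spaces are not larger than the shape function space, then there is a geometric
decomposition and traces can be prescribed. -/
theorem trace_squeeze [FiniteDimensional ℝ (S.AF f)]
    (htr : ∀ e ∈ f.powersetCard 2, ∀ x ∈ e, ∀ u ∈ S.AF f, S.trFV f x u = 0 →
      S.trEV e x (S.trFE f e u) = 0) {nF : ℕ} {nE nV : ℕ} (hc : f.card = 3)
    (hF : finrank ℝ (bubbleF S f) ≤ nF)
    (hE : ∀ e ∈ f.powersetCard 2, finrank ℝ (bubbleE S f e) ≤ nE)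
    (hV : ∀ x ∈ f, finrank ℝ (bubbleV S f x) ≤ nV)
    (hsum : nF + 3 * nE + 3 * nV ≤ finrank ℝ (S.AF f)) :
    finrank ℝ (bubbleF S f) = nF ∧ (∀ e ∈ f.powersetCard 2, finrank ℝ (bubbleE S f e) = nE) ∧
    (∀ x ∈ f, finrank ℝ (bubbleV S f x) = nV) ∧ finrank ℝ (S.AF f) = nF + 3 * nE + 3 * nV ∧
    (∀ j : Plane → MV, (∀ x ∈ f, j x ∈ bubbleV S f x) →
      ∃ u ∈ S.AF f, ∀ x ∈ f, S.trFV f x u = j x) ∧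
    (∀ a : Finset Plane → ME, (∀ e ∈ f.powersetCard 2, a e ∈ bubbleE S f e) →
      ∃ u ∈ S.AF f, (∀ x ∈ f, S.trFV f x u = 0) ∧ ∀ e ∈ f.powersetCard 2, S.trFE f e u = a e) := by
  have hce : (f.powersetCard 2).card = 3 := by rw [Finset.card_powersetCard, hc]; rfl
  have fV : ∀ x, FiniteDimensional ℝ (bubbleV S f x) := fun x => by
    unfold bubbleV; infer_instance
  have fE : ∀ e, FiniteDimensional ℝ (bubbleE S f e) := fun e => by
    unfold bubbleE; infer_instance
  -- The traces are taken in two stages: first the vertex traces on the whole space, then the edge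
  -- traces on the fields that vanish at the vertices. By `htr` the latter are edge bubbles, so
  -- rank-nullity applies at both stages.
  let A0 : Submodule ℝ MF := S.AF f ⊓ ⨅ x ∈ f, LinearMap.ker (S.trFV f x)
  have hA0 : ∀ u, u ∈ A0 ↔ u ∈ S.AF f ∧ ∀ x ∈ f, S.trFV f x u = 0 := by
    intro u
    simp [A0, Submodule.mem_iInf]
  have fA0 : FiniteDimensional ℝ A0 := by unfold A0; infer_instance
  obtain ⟨h1, h2⟩ := finrank_le_of_family f (S.AF f) (fun x => S.trFV f x)
    (fun x => bubbleV S f x) (fun x _ u hu => Submodule.mem_map_of_mem hu)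
  obtain ⟨h3, h4⟩ := finrank_le_of_family (f.powersetCard 2) A0 (fun e => S.trFE f e)
    (fun e => bubbleE S f e) (fun e he u hu => by
      obtain ⟨hu1, hu2⟩ := (hA0 u).1 hu
      refine ⟨Submodule.mem_map_of_mem hu1, ?_⟩
      simp only [SetLike.mem_coe, Submodule.mem_iInf, LinearMap.mem_ker]
      exact fun x hx => htr e he x hx u hu1 (hu2 x ((Finset.mem_powersetCard.1 he).1 hx)))
  have hB : A0 ⊓ ⨅ e ∈ f.powersetCard 2, LinearMap.ker (S.trFE f e) = bubbleF S f := by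
    unfold A0 bubbleF
    rw [inf_assoc, inf_assoc, inf_comm (⨅ x ∈ f, _)]
  rw [hB] at h3 h4
  change finrank ℝ (S.AF f) ≤ finrank ℝ A0 + _ at h1
  change finrank ℝ A0 + _ ≤ _ → _ at h2
  have sE : ∑ e ∈ f.powersetCard 2, finrank ℝ (bubbleE S f e) ≤ 3 * nE := by
    have := Finset.sum_le_card_nsmul _ _ _ hE
    rwa [hce, smul_eq_mul] at this
  have sV : ∑ x ∈ f, finrank ℝ (bubbleV S f x) ≤ 3 * nV := by
    have := Finset.sum_le_card_nsmul _ _ _ hV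
    rwa [hc, smul_eq_mul] at this
  -- The rank-nullity inequalities and the bounds on the bubbles sandwich the dimension between
  -- equal numbers. Every inequality is therefore an equality, which makes both trace maps onto.
  refine ⟨by omega, ?_, ?_, by omega, h2 (by omega), fun a ha => ?_⟩
  · have : ∑ e ∈ f.powersetCard 2, finrank ℝ (bubbleE S f e) = ∑ e ∈ f.powersetCard 2, nE := by
      rw [Finset.sum_const, hce, smul_eq_mul]; omega
    exact (Finset.sum_eq_sum_iff_of_le hE).1 this
  · have : ∑ x ∈ f, finrank ℝ (bubbleV S f x) = ∑ x ∈ f, nV := by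
      rw [Finset.sum_const, hc, smul_eq_mul]; omega
    exact (Finset.sum_eq_sum_iff_of_le hV).1 this
  · obtain ⟨u, hu, hu2⟩ := h4 (by omega) a ha
    exact ⟨u, ((hA0 u).1 hu).1, ((hA0 u).1 hu).2, hu2⟩

end Squeeze

/-! ## Bubble functions on edges -/

section EdgeBubbles

open Module Polynomial

instance finiteDimensional_degreeLE (m : ℕ) : FiniteDimensional ℝ (degreeLE ℝ (m : ℕ)) := by
  rw [← degreeLT_succ_eq_degreeLE]
  exact Module.Finite.equiv (degreeLTEquiv ℝ (m + 1)).symm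

lemma finrank_degreeLE (m : ℕ) : finrank ℝ (degreeLE ℝ (m : ℕ)) = m + 1 := by
  rw [← degreeLT_succ_eq_degreeLE, (degreeLTEquiv ℝ (m + 1)).finrank_eq]
  simp

lemma mem_degreeLE_of_mul {m n : ℕ} {l q : ℝ[X]} (hl : l.Monic) (hn : l.natDegree = n)
    (h : l * q ∈ degreeLE ℝ (m : ℕ)) : q ∈ degreeLE ℝ ((m - n : ℕ) : ℕ) := by
  by_cases hq : q = 0
  · rw [hq]; exact Submodule.zero_mem _
  rw [mem_degreeLE] at h ⊢
  rw [← natDegree_le_iff_degree_le] at h ⊢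
  rw [hl.natDegree_mul' hq] at h
  omega

lemma X_sub_C_sq_dvd {p : ℝ[X]} {a : ℝ} (h0 : p.eval a = 0) (h1 : p.derivative.eval a = 0) :
    (X - C a) ^ 2 ∣ p := by
  obtain ⟨q, rfl⟩ := dvd_iff_isRoot.2 h0
  have hq : q.eval a = 0 := by simpa using h1
  obtain ⟨r, rfl⟩ := dvd_iff_isRoot.2 hq
  exact ⟨r, by ring⟩

lemma isCoprime_X_sub_C {l : ℝ} (hl : l ≠ 0) : IsCoprime (X - C (0 : ℝ)) (X - C l) :=
  isCoprime_X_sub_C_of_isUnit_sub (by simpa using hl)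

lemma exists_of_double_roots {l : ℝ} (hl : l ≠ 0) {m : ℕ} {p : ℝ[X]} (hp : p ∈ degreeLE ℝ (m : ℕ))
    (h0 : p.eval 0 = 0) (h0' : p.derivative.eval 0 = 0) (h1 : p.eval l = 0)
    (h1' : p.derivative.eval l = 0) :
    ∃ q ∈ degreeLE ℝ ((m - 4 : ℕ) : ℕ), (X - C (0 : ℝ)) ^ 2 * (X - C l) ^ 2 * q = p := by
  obtain ⟨q, rfl⟩ := ((isCoprime_X_sub_C hl).pow (m := 2) (n := 2)).mul_dvd
    (X_sub_C_sq_dvd h0 h0') (X_sub_C_sq_dvd h1 h1')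
  refine ⟨q, mem_degreeLE_of_mul (((monic_X_sub_C _).pow 2).mul ((monic_X_sub_C _).pow 2)) ?_ hp, rfl⟩
  rw [((monic_X_sub_C (0 : ℝ)).pow 2).natDegree_mul ((monic_X_sub_C l).pow 2),
    (monic_X_sub_C (0 : ℝ)).natDegree_pow, (monic_X_sub_C l).natDegree_pow, natDegree_X_sub_C,
    natDegree_X_sub_C]

lemma exists_of_roots {l : ℝ} (hl : l ≠ 0) {m : ℕ} {p : ℝ[X]} (hp : p ∈ degreeLE ℝ (m : ℕ))
    (h0 : p.eval 0 = 0) (h1 : p.eval l = 0) :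
    ∃ q ∈ degreeLE ℝ ((m - 2 : ℕ) : ℕ), (X - C (0 : ℝ)) * (X - C l) * q = p := by
  obtain ⟨q, rfl⟩ := (isCoprime_X_sub_C hl).mul_dvd (dvd_iff_isRoot.2 h0) (dvd_iff_isRoot.2 h1)
  refine ⟨q, mem_degreeLE_of_mul ((monic_X_sub_C _).mul (monic_X_sub_C _)) ?_ hp, rfl⟩
  rw [(monic_X_sub_C (0 : ℝ)).natDegree_mul (monic_X_sub_C l), natDegree_X_sub_C,
    natDegree_X_sub_C]

/-- Multiplication of triples of polynomials by fixed polynomials. -/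
def mulTriple (a b c : ℝ[X]) (l m n : ℕ) :
    (degreeLE ℝ (l : ℕ) × degreeLE ℝ (m : ℕ) × degreeLE ℝ (n : ℕ)) →ₗ[ℝ] Edge3 where
  toFun p := (a * p.1.1, b * p.2.1.1, c * p.2.2.1)
  map_add' p q := by ext1 <;> simp [mul_add]
  map_smul' r p := by ext1 <;> simp

/-- Upper bounds for the edge bubbles suffice, since `trace_squeeze` later turns them into
equalities; only a parametrization that reaches all of `B` is needed. -/
lemma finrank_le_of_mulTriple {B : Submodule ℝ Edge3} {a b c : ℝ[X]} {l m n : ℕ}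
    (h : ∀ p ∈ B, ∃ q ∈ degreeLE ℝ (l : ℕ), ∃ r ∈ degreeLE ℝ (m : ℕ), ∃ s ∈ degreeLE ℝ (n : ℕ),
      a * q = p.1 ∧ b * r = p.2.1 ∧ c * s = p.2.2) :
    finrank ℝ B ≤ (l + 1) + ((m + 1) + (n + 1)) := by
  have hle : B ≤ LinearMap.range (mulTriple a b c l m n) := by
    intro p hp
    obtain ⟨q, hq, r, hr, s, hs, h1, h2, h3⟩ := h p hp
    exact ⟨(⟨q, hq⟩, ⟨r, hr⟩, ⟨s, hs⟩), Prod.ext h1 (Prod.ext h2 h3)⟩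
  refine (Submodule.finrank_mono hle).trans ((LinearMap.finrank_range_le _).trans ?_)
  rw [finrank_prod, finrank_prod, finrank_degreeLE, finrank_degreeLE, finrank_degreeLE]

variable {K : Geometry.SimplicialComplex ℝ Plane} {o : EdgeOrientation K} {e f : Finset Plane}

/-- The matrices `n nᵀ`, `t tᵀ`, `n tᵀ` are independent: contracting with `n` and `t` on either side
isolates each coefficient. The factor `t0² + t1² + 1` comes from `|t|⁴ - 1 = (|t|² + 1)(|t|² - 1)`.
-/
lemma trEV0_eq_zero_iff (he : o.IsEdge e) {x : Plane} {a : Edge3} :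
    trEV0 o e x a = 0 ↔ a.1.eval (o.coord e x) = 0 ∧ a.2.1.eval (o.coord e x) = 0 ∧
      a.1.derivative.eval (o.coord e x) = 0 ∧ a.2.1.derivative.eval (o.coord e x) = 0 ∧
      a.2.2.eval (o.coord e x) = 0 := by
  have ht := he.tang_sq
  constructor
  · intro h
    have hv := congrArg Prod.fst h
    have hm := congrArg Prod.snd h
    have v0 := congrFun hv 0
    have v1 := congrFun hv 1
    have m00 := congrFun (congrFun hm 0) 0
    have m01 := congrFun (congrFun hm 0) 1
    have m10 := congrFun (congrFun hm 1) 0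
    have m11 := congrFun (congrFun hm 1) 1
    simp only [trEV0, LinearMap.coe_mk, AddHom.coe_mk, Matrix.of_apply, nrm_zero, nrm_one,
      Prod.fst_zero, Prod.snd_zero, Pi.zero_apply, Matrix.zero_apply] at v0 v1 m00 m01 m10 m11
    set t0 := o.tang e 0
    set t1 := o.tang e 1
    refine ⟨?_, ?_, ?_, ?_, ?_⟩
    · linear_combination -t1 * v0 + t0 * v1 - a.1.eval (o.coord e x) * ht
    · linear_combination t0 * v0 + t1 * v1 - a.2.1.eval (o.coord e x) * ht
    · linear_combination t1 * t1 * m00 - t0 * t1 * m01 - t0 * t1 * m10 + t0 * t0 * m11 -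
        a.1.derivative.eval (o.coord e x) * (t0 ^ 2 + t1 ^ 2 + 1) * ht
    · linear_combination t0 * t0 * m00 + t0 * t1 * m01 + t0 * t1 * m10 + t1 * t1 * m11 -
        a.2.1.derivative.eval (o.coord e x) * (t0 ^ 2 + t1 ^ 2 + 1) * ht
    · linear_combination -t1 * t0 * m00 - t1 * t1 * m01 + t0 * t0 * m10 + t0 * t1 * m11 -
        a.2.2.eval (o.coord e x) * (t0 ^ 2 + t1 ^ 2 + 1) * ht
  · rintro ⟨h1, h2, h3, h4, h5⟩
    ext <;> simp [trEV0, h1, h2, h3, h4, h5]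

lemma trEV1_eq_zero_iff (he : o.IsEdge e) {x : Plane} {a : Edge3} :
    trEV1 o e x a = 0 ↔ a.1.eval (o.coord e x) = 0 ∧ a.2.1.eval (o.coord e x) = 0 := by
  have ht := he.tang_sq
  constructor
  · intro h
    have m00 := congrFun (congrFun h 0) 0
    have m01 := congrFun (congrFun h 0) 1
    have m10 := congrFun (congrFun h 1) 0
    have m11 := congrFun (congrFun h 1) 1
    simp only [trEV1, LinearMap.coe_mk, AddHom.coe_mk, Matrix.of_apply, nrm_zero, nrm_one,
      Matrix.zero_apply] at m00 m01 m10 m11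
    set t0 := o.tang e 0
    set t1 := o.tang e 1
    constructor
    · linear_combination t1 * t1 * m00 - t0 * t1 * m01 - t0 * t1 * m10 + t0 * t0 * m11 -
        a.1.eval (o.coord e x) * (t0 ^ 2 + t1 ^ 2 + 1) * ht
    · linear_combination -t1 * t0 * m00 - t1 * t1 * m01 + t0 * t0 * m10 + t0 * t1 * m11 -
        a.2.1.eval (o.coord e x) * (t0 ^ 2 + t1 ^ 2 + 1) * ht
  · rintro ⟨h1, h2⟩
    ext; simp [trEV1, h1, h2]

variable (o) in
/-- Triples on an edge that vanish at the end points, in degree `0`. -/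
def edgeBubble0 (k : ℕ) (e : Finset Plane) : Submodule ℝ Edge3 :=
  (huMaZhang o k).S0.AE e ⊓ ⨅ x ∈ e, LinearMap.ker (trEV0 o e x)

variable (o) in
/-- Triples on an edge that vanish at the end points, in degree `1`. -/
def edgeBubble1 (k : ℕ) (e : Finset Plane) : Submodule ℝ Edge3 :=
  (huMaZhang o k).S1.AE e ⊓ ⨅ x ∈ e, LinearMap.ker (trEV1 o e x)

lemma mem_edgeBubble0 (he : o.IsEdge e) {k : ℕ} {a : Edge3} : a ∈ edgeBubble0 o k e ↔
    (a.1 ∈ degreeLE ℝ (k : ℕ) ∧ a.2.1 ∈ degreeLE ℝ (k : ℕ) ∧ a.2.2 ∈ degreeLE ℝ ((k - 1 : ℕ) : ℕ)) ∧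
    (a.1.eval 0 = 0 ∧ a.2.1.eval 0 = 0 ∧ a.1.derivative.eval 0 = 0 ∧ a.2.1.derivative.eval 0 = 0 ∧
      a.2.2.eval 0 = 0) ∧
    (a.1.eval (o.len e) = 0 ∧ a.2.1.eval (o.len e) = 0 ∧ a.1.derivative.eval (o.len e) = 0 ∧
      a.2.1.derivative.eval (o.len e) = 0 ∧ a.2.2.eval (o.len e) = 0) := by
  unfold edgeBubble0
  simp only [Submodule.mem_inf, Submodule.mem_iInf, LinearMap.mem_ker, he.mem_iff, forall_eq_or_imp,
    forall_eq, trEV0_eq_zero_iff he, coord_start, he.coord_finish]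
  simp only [huMaZhang, Submodule.mem_prod]

lemma mem_edgeBubble1 (he : o.IsEdge e) {k : ℕ} {a : Edge3} : a ∈ edgeBubble1 o k e ↔
    (a.1 ∈ degreeLE ℝ ((k - 1 : ℕ) : ℕ) ∧ a.2.1 ∈ degreeLE ℝ ((k - 1 : ℕ) : ℕ) ∧
      a.2.2 ∈ degreeLE ℝ ((k - 2 : ℕ) : ℕ)) ∧
    (a.1.eval 0 = 0 ∧ a.2.1.eval 0 = 0) ∧ (a.1.eval (o.len e) = 0 ∧ a.2.1.eval (o.len e) = 0) := by
  unfold edgeBubble1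
  simp only [Submodule.mem_inf, Submodule.mem_iInf, LinearMap.mem_ker, he.mem_iff, forall_eq_or_imp,
    forall_eq, trEV1_eq_zero_iff he, coord_start, he.coord_finish]
  simp only [huMaZhang, Submodule.mem_prod]

/-- The first two components have double zeros at both end points and leave `k - 3` parameters each;
the third has degree `k - 1` and simple zeros, leaving `k - 2`. -/
lemma finrank_edgeBubble0_le (he : o.IsEdge e) {k : ℕ} (hk : 4 ≤ k) :
    finrank ℝ (edgeBubble0 o k e) ≤ 3 * k - 8 := by
  have hl := he.len_pos.ne'
  refine (finrank_le_of_mulTriple (a := (X - C (0 : ℝ)) ^ 2 * (X - C (o.len e)) ^ 2)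
    (b := (X - C (0 : ℝ)) ^ 2 * (X - C (o.len e)) ^ 2) (c := (X - C (0 : ℝ)) * (X - C (o.len e)))
    (l := k - 4) (m := k - 4) (n := k - 1 - 2) ?_).trans (by omega)
  intro p hp
  obtain ⟨⟨d0, d1, d2⟩, ⟨a0, a1, a2, a3, a4⟩, ⟨b0, b1, b2, b3, b4⟩⟩ := (mem_edgeBubble0 he).1 hp
  obtain ⟨q, hq, hq'⟩ := exists_of_double_roots hl d0 a0 a2 b0 b2
  obtain ⟨r, hr, hr'⟩ := exists_of_double_roots hl d1 a1 a3 b1 b3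
  obtain ⟨s, hs, hs'⟩ := exists_of_roots hl d2 a4 b4
  exact ⟨q, hq, r, hr, s, hs, hq', hr', hs'⟩

/-- The first two components, of degree `k - 1` with simple zeros, leave `k - 2` parameters each.
The third is not constrained at the end points and has `k - 1`. -/
lemma finrank_edgeBubble1_le (he : o.IsEdge e) {k : ℕ} (hk : 4 ≤ k) :
    finrank ℝ (edgeBubble1 o k e) ≤ 3 * k - 5 := by
  have hl := he.len_pos.ne'
  refine (finrank_le_of_mulTriple (a := (X - C (0 : ℝ)) * (X - C (o.len e)))
    (b := (X - C (0 : ℝ)) * (X - C (o.len e))) (l := k - 1 - 2) (m := k - 1 - 2) (n := k - 2)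
    (c := 1) ?_).trans
    (by omega)
  intro p hp
  obtain ⟨⟨d0, d1, d2⟩, ⟨a0, a1⟩, ⟨b0, b1⟩⟩ := (mem_edgeBubble1 he).1 hp
  obtain ⟨q, hq, hq'⟩ := exists_of_roots hl d0 a0 b0
  obtain ⟨r, hr, hr'⟩ := exists_of_roots hl d1 a1 b1
  exact ⟨q, hq, r, hr, p.2.2, d2, hq', hr', one_mul _⟩

end EdgeBubbles

/-! ## Barycentric coordinates as polynomials -/

section BaryP

open MvPolynomial

variable {K : Geometry.SimplicialComplex ℝ Plane} {o : EdgeOrientation K} {e f : Finset Plane}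

/-- The barycentric coordinate of a vertex of a triangle, as a polynomial. -/
def baryP (f : Finset Plane) (x : Plane) : Poly := affP (bary f x)

lemma evalAt_baryP (x p : Plane) : evalAt p (baryP f x) = bary f x p := evalAt_affP _ _

lemma baryP_mem_polyLE (x : Plane) : baryP f x ∈ polyLE 1 := affP_mem_polyLE _

lemma erase_mem_powersetCard [DecidableEq Plane] (hf : IsTri f) {y : Plane} (hy : y ∈ f) :
    f.erase y ∈ f.powersetCard 2 := by
  rw [Finset.mem_powersetCard, Finset.card_erase_of_mem hy, hf.2]
  exact ⟨Finset.erase_subset _ _, rfl⟩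

lemma exists_eq_erase [DecidableEq Plane] (hf : IsTri f) (h : e ∈ f.powersetCard 2) :
    ∃ y ∈ f, e = f.erase y := by
  obtain ⟨hs, hc⟩ := Finset.mem_powersetCard.1 h
  have : (f \ e).card = 1 := by rw [Finset.card_sdiff_of_subset hs, hf.2, hc]
  obtain ⟨y, hy⟩ := Finset.card_eq_one.1 this
  have hy' : y ∈ f \ e := by rw [hy]; simp
  refine ⟨y, (Finset.mem_sdiff.1 hy').1, ?_⟩
  rw [← Finset.sdiff_singleton_eq_erase, ← hy, Finset.sdiff_sdiff_eq_self hs]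

lemma exists_mem_erase_ne [DecidableEq Plane] (hf : IsTri f) (y : Plane) : ∃ x ∈ f, x ≠ y := by
  have : 1 < f.card := by rw [hf.2]; norm_num
  exact Finset.exists_mem_ne this y

/-- Both sides are affine and vanish at the two vertices of the edge. The lemma translates between
signed distances, used for incidence numbers, and barycentric coordinates. -/
lemma hgt_eq_bary [DecidableEq Plane] (hf : IsTri f) {y : Plane} (hy : y ∈ f)
    (he : o.IsEdge (f.erase y)) (p : Plane) :
    o.hgt (f.erase y) p = o.hgt (f.erase y) y * bary f y p := by
  have h1 := sum_bary hf p
  have h2 := sum_bary_smul hf p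
  have h3 : ∀ i : Fin 2, p i = ∑ x ∈ f, bary f x p * x i := fun i => by
    conv_lhs => rw [← h2]
    simp
  have h4 : o.hgt (f.erase y) p = ∑ x ∈ f, bary f x p * o.hgt (f.erase y) x := by
    simp only [hgt_apply]
    rw [h3 0, h3 1]
    have e1 : ∀ (i : Fin 2) (c : ℝ), ∑ x ∈ f, bary f x p * x i - c =
        ∑ x ∈ f, bary f x p * (x i - c) := by
      intro i c
      simp only [mul_sub, Finset.sum_sub_distrib, ← Finset.sum_mul, h1, one_mul]
    rw [e1, e1, Finset.sum_mul, Finset.sum_mul, ← Finset.sum_add_distrib]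
    refine Finset.sum_congr rfl fun x _ => by ring
  rw [h4, Finset.sum_eq_single_of_mem y hy, mul_comm]
  intro x hx hxy
  rw [he.hgt_eq_zero (Finset.mem_erase.2 ⟨hxy, hx⟩), mul_zero]

lemma baryP_dvd [DecidableEq Plane] (hf : IsTri f) {y : Plane} (hy : y ∈ f)
    (he : o.IsEdge (f.erase y)) {p : Poly} (h : o.restr (f.erase y) p = 0) : baryP f y ∣ p := by
  have : o.hgtP (f.erase y) = C (o.hgt (f.erase y) y) * baryP f y := by
    refine poly_ext fun x => ?_
    rw [evalAt_hgtP, evalAt_mul, evalAt_C, evalAt_baryP, hgt_eq_bary hf hy he]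
  exact (Dvd.intro_left _ this.symm).trans (hgtP_dvd he h)

/-- A univariate polynomial of degree at most one with zeros at both end points. -/
lemma restr_baryP [DecidableEq Plane] (hf : IsTri f) {y : Plane} (hy : y ∈ f)
    (he : o.IsEdge (f.erase y)) : o.restr (f.erase y) (baryP f y) = 0 := by
  have h1 : ∀ q : Polynomial ℝ, q ∈ Polynomial.degreeLE ℝ (1 : ℕ) → q.eval 0 = 0 →
      q.eval (o.len (f.erase y)) = 0 → q = 0 := by
    intro q hq h0 h1
    rw [Polynomial.mem_degreeLE, ← Polynomial.natDegree_le_iff_degree_le] at hq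
    rw [Polynomial.eq_X_add_C_of_natDegree_le_one hq] at h0 h1 ⊢
    simp only [Polynomial.eval_add, Polynomial.eval_mul, Polynomial.eval_C, Polynomial.eval_X,
      mul_zero, zero_add] at h0 h1
    have : q.coeff 1 = 0 := by
      rw [h0, add_zero] at h1
      exact (mul_eq_zero.1 h1).resolve_right he.len_pos.ne'
    rw [this, h0]; simp
  have hb : ∀ x ∈ f.erase y, bary f y x = 0 := fun x hx =>
    bary_of_ne hf hy (Finset.mem_of_mem_erase hx) (Finset.ne_of_mem_erase hx).symm
  refine h1 _ (restr_mem_degreeLE (baryP_mem_polyLE y)) ?_ ?_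
  · rw [eval_restr, param_zero, evalAt_baryP, hb _ he.start_mem]
  · rw [eval_restr, he.param_len, evalAt_baryP, hb _ he.finish_mem]

lemma restr_baryP_ne_zero [DecidableEq Plane] (hf : IsTri f) {x y : Plane} (hx : x ∈ f)
    (hxy : x ≠ y) (he : o.IsEdge (f.erase y)) : o.restr (f.erase y) (baryP f x) ≠ 0 := by
  intro h
  have := eval_coord_restr he (Finset.mem_erase.2 ⟨hxy, hx⟩) (baryP f x)
  rw [h, evalAt_baryP, bary_self hf hx] at this
  simp at this

lemma baryP_ne_zero (hf : IsTri f) {y : Plane} (hy : y ∈ f) : baryP f y ≠ 0 := by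
  intro h
  have := evalAt_baryP (f := f) y y
  rw [h, bary_self hf hy] at this
  simp at this

lemma totalDegree_baryP (hf : IsTri f) {y : Plane} (hy : y ∈ f) : (baryP f y).totalDegree = 1 := by
  classical
  apply le_antisymm
  · exact (mem_restrictTotalDegree _ _ _).1 (baryP_mem_polyLE y)
  · by_contra h
    have h0 : (baryP f y).totalDegree = 0 := by omega
    rw [totalDegree_eq_zero_iff_eq_C] at h0
    obtain ⟨x, hx, hxy⟩ := exists_mem_erase_ne hf y
    have h1 := evalAt_baryP (f := f) y y
    have h2 := evalAt_baryP (f := f) y x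
    rw [h0, evalAt_C, bary_self hf hy] at h1
    rw [h0, evalAt_C, bary_of_ne hf hy hx hxy.symm] at h2
    rw [h1] at h2
    exact one_ne_zero h2

/-- The factors are split off one at a time. On the edge opposite `y` the other barycentric
coordinates have nonzero restrictions, and univariate polynomials form a domain, so the cofactor
vanishes there as well. -/
lemma exists_prod_baryP [DecidableEq Plane] (hf : IsTri f) (he : ∀ e ∈ f.powersetCard 2, o.IsEdge e)
    {s : Finset Plane} (hs : s ⊆ f) {m : ℕ} {p : Poly} (hp : p ∈ polyLE m)
    (h : ∀ y ∈ s, o.restr (f.erase y) p = 0) :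
    ∃ q ∈ polyLE (m - s.card), p = (∏ y ∈ s, baryP f y) * q := by
  induction s using Finset.induction_on with
  | empty => exact ⟨p, by simpa using hp, by simp⟩
  | insert y s hy ih =>
    obtain ⟨q, hq, hpq⟩ := ih (fun x hx => hs (Finset.mem_insert_of_mem hx))
      fun x hx => h x (Finset.mem_insert_of_mem hx)
    have hyf : y ∈ f := hs (Finset.mem_insert_self _ _)
    have hey := he _ (erase_mem_powersetCard hf hyf)
    have h1 := h y (Finset.mem_insert_self _ _)
    have h2 : o.restr (f.erase y) q = 0 := by
      rw [hpq, restr_mul] at h1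
      refine (mul_eq_zero.1 h1).resolve_left ?_
      have : ∀ t : Finset Plane, t ⊆ s → o.restr (f.erase y) (∏ x ∈ t, baryP f x) ≠ 0 := by
        intro t
        induction t using Finset.induction_on with
        | empty => intro _; simp [restr_one]
        | insert x t hx iht =>
          intro hxt
          rw [Finset.prod_insert hx, restr_mul]
          refine mul_ne_zero (restr_baryP_ne_zero hf ?_ ?_ hey)
            (iht fun z hz => hxt (Finset.mem_insert_of_mem hz))
          · exact hs (Finset.mem_insert_of_mem (hxt (Finset.mem_insert_self _ _)))
          · rintro rfl
            exact hy (hxt (Finset.mem_insert_self _ _))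
      exact this s subset_rfl
    obtain ⟨r, rfl⟩ := baryP_dvd hf hyf hey h2
    refine ⟨r, ?_, ?_⟩
    · rw [Finset.card_insert_of_notMem hy, ← Nat.sub_sub]
      exact mem_polyLE_of_mul (totalDegree_baryP hf hyf) (baryP_ne_zero hf hyf) hq
    · rw [hpq, Finset.prod_insert hy]; ring

lemma exists_bubble_factor [DecidableEq Plane] (hf : IsTri f) (he : ∀ e ∈ f.powersetCard 2, o.IsEdge e)
    {m : ℕ} {p : Poly} (hp : p ∈ polyLE m)
    (h : ∀ e ∈ f.powersetCard 2, o.restr e p = 0) :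
    ∃ q ∈ polyLE (m - 3), p = (∏ y ∈ f, baryP f y) * q := by
  have := exists_prod_baryP hf he subset_rfl hp fun y hy => h _ (erase_mem_powersetCard hf hy)
  rwa [hf.2] at this

lemma sum_baryP (hf : IsTri f) : ∑ x ∈ f, baryP f x = 1 := by
  refine poly_ext fun p => ?_
  rw [map_sum, evalAt_one, ← sum_bary hf p]
  exact Finset.sum_congr rfl fun x _ => evalAt_baryP x p

lemma sum_baryP_mul (hf : IsTri f) (i : Fin 2) : ∑ x ∈ f, C (x i) * baryP f x = X i := by
  refine poly_ext fun p => ?_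
  rw [map_sum, evalAt_X]
  conv_rhs => rw [← sum_bary_smul hf p]
  simp [evalAt_mul, evalAt_C, evalAt_baryP, mul_comm]

/-- Monomials of degree at most `j` are multiplied by `∑ λₓ = 1`. From a monomial of degree `j + 1`
one variable is split off and written as `∑ xᵢ λₓ`. -/
lemma range_sum_baryP (hf : IsTri f) {j : ℕ} {p : Poly} (hp : p ∈ polyLE (j + 1)) :
    ∃ w : Plane → Poly, (∀ x, w x ∈ polyLE j) ∧ ∑ x ∈ f, baryP f x * w x = p := by
  let N : Submodule ℝ Poly :=
    { carrier := {p | ∃ w : Plane → Poly, (∀ x, w x ∈ polyLE j) ∧ ∑ x ∈ f, baryP f x * w x = p}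
      zero_mem' := ⟨0, fun _ => Submodule.zero_mem _, by simp⟩
      add_mem' := by
        rintro _ _ ⟨w, hw, rfl⟩ ⟨w', hw', rfl⟩
        exact ⟨w + w', fun x => Submodule.add_mem _ (hw x) (hw' x), by
          simp [mul_add, Finset.sum_add_distrib]⟩
      smul_mem' := by
        rintro c _ ⟨w, hw, rfl⟩
        exact ⟨c • w, fun x => Submodule.smul_mem _ _ (hw x), by simp [Finset.smul_sum]⟩ }
  refine (polyLE_le_of_monomial (N := N) fun d hd => ?_) hp
  by_cases hd' : d 0 + d 1 ≤ j
  · refine ⟨fun _ => monomial d 1, fun _ => monomial_mem_polyLE hd' 1, ?_⟩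
    rw [← Finset.sum_mul, sum_baryP hf, one_mul]
  · have : ∃ i, 1 ≤ d i := by
      by_contra h
      push Not at h
      have h0 := h 0
      have h1 := h 1
      omega
    obtain ⟨i, hi⟩ := this
    refine ⟨fun x => C (x i) * monomial (d - Finsupp.single i 1) 1, fun x => ?_, ?_⟩
    · refine mul_mem_polyLE (m := 0) (C_mem_polyLE _ _) (monomial_mem_polyLE (m := j) ?_ 1) (by omega)
      fin_cases i <;> simp at hi ⊢ <;> omega
    · have : ∑ x ∈ f, baryP f x * (C (x i) * monomial (d - Finsupp.single i 1) (1 : ℝ)) =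
          X i * monomial (d - Finsupp.single i 1) 1 := by
        rw [← sum_baryP_mul hf i, Finset.sum_mul]
        exact Finset.sum_congr rfl fun x _ => by ring
      rw [this, X, monomial_mul, one_mul]
      have hd2 : Finsupp.single i 1 + (d - Finsupp.single i 1) = d :=
        add_tsub_cancel_of_le (Finsupp.single_le_iff.2 hi)
      rw [hd2]

end BaryP

/-! ## The bubble space of a triangle in degree `0` -/

section BubbleF

open Module MvPolynomial

variable {K : Geometry.SimplicialComplex ℝ Plane} {o : EdgeOrientation K} {e f : Finset Plane}

lemma mem_vecPolyLE {m : ℕ} {u : VecPoly} : u ∈ vecPolyLE m ↔ ∀ i, u i ∈ polyLE m := by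
  simp [vecPolyLE, Submodule.mem_pi]

lemma mem_bubbleF0 {k : ℕ} {u : VecPoly} : u ∈ bubbleF (huMaZhang o k).S0 f ↔
    (∀ i, u i ∈ polyLE k) ∧ (∀ e ∈ f.powersetCard 2, trFE0 o e u = 0) ∧
      ∀ x ∈ f, trFV0 x u = 0 := by
  simp only [bubbleF, Submodule.mem_inf, Submodule.mem_iInf, LinearMap.mem_ker, and_assoc]
  simp only [huMaZhang, mem_vecPolyLE]

lemma mem_bubbleF1 {k : ℕ} {σ : MatPoly} : σ ∈ bubbleF (huMaZhang o k).S1 f ↔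
    (σ.IsSymm ∧ ∀ i j, σ i j ∈ polyLE (k - 1)) ∧ (∀ e ∈ f.powersetCard 2, trFE1 o e σ = 0) ∧
      ∀ x ∈ f, trFV1 x σ = 0 := by
  simp only [bubbleF, Submodule.mem_inf, Submodule.mem_iInf, LinearMap.mem_ker]
  rw [and_assoc]
  rfl

lemma trFE0_eq_zero_iff (he : o.IsEdge e) {u : VecPoly} : trFE0 o e u = 0 ↔
    (∀ i, o.restr e (u i) = 0) ∧ o.restr e (divV pdP u) = 0 := by
  have ht := he.tang_sq
  simp only [trFE0, LinearMap.coe_mk, AddHom.coe_mk, Prod.mk_eq_zero, Fin.sum_univ_two, nrm_zero,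
    nrm_one, Fin.forall_fin_two]
  generalize o.tang e 0 = a at ht ⊢
  generalize o.tang e 1 = b at ht ⊢
  constructor
  · rintro ⟨h1, h2, h3⟩
    refine ⟨⟨?_, ?_⟩, h3⟩
    · have : (a ^ 2 + b ^ 2) • o.restr e (u 0) = a • (a • o.restr e (u 0) + b • o.restr e (u 1)) -
        b • (-b • o.restr e (u 0) + a • o.restr e (u 1)) := by module
      rwa [ht, h1, h2, one_smul, smul_zero, smul_zero, sub_zero] at this
    · have : (a ^ 2 + b ^ 2) • o.restr e (u 1) = b • (a • o.restr e (u 0) + b • o.restr e (u 1)) +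
        a • (-b • o.restr e (u 0) + a • o.restr e (u 1)) := by module
      rwa [ht, h1, h2, one_smul, smul_zero, smul_zero, add_zero] at this
  · rintro ⟨⟨h1, h2⟩, h3⟩
    simp [h1, h2, h3]

/-- The partial derivatives of a barycentric coordinate. -/
def baryGrad (f : Finset Plane) (x : Plane) (i : Fin 2) : ℝ :=
  (bary f x).linear (EuclideanSpace.single i 1)

lemma pdP_baryP (x : Plane) (i : Fin 2) : pdP i (baryP f x) = C (baryGrad f x i) := pdP_affP _ _

lemma sum_baryGrad (hf : IsTri f) (i : Fin 2) : ∑ x ∈ f, baryGrad f x i = 0 := by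
  have h := congrArg (pdL i) (sum_baryP hf)
  rw [map_sum] at h
  simp only [pdL_apply, pdP_baryP] at h
  rw [← map_sum, show (1 : Poly) = C 1 from (map_one C).symm, pdP_C, map_eq_zero_iff _ (C_injective _ _)] at h
  exact h

lemma sum_baryGrad_mul (hf : IsTri f) (i j : Fin 2) :
    ∑ x ∈ f, x i * baryGrad f x j = if j = i then 1 else 0 := by
  have h := congrArg (pdL j) (sum_baryP_mul hf i)
  rw [map_sum] at h
  simp only [pdL_apply, pdP_mul, pdP_C, pdP_baryP, zero_mul, zero_add, pdP_X, ← C_mul] at h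
  rw [← map_sum] at h
  apply C_injective (Fin 2) ℝ
  rw [h]
  split_ifs <;> simp

/-- The sum `∑ λₓ wₓ` over the vertices of a triangle. -/
def barySum (f : Finset Plane) (j : ℕ) : (f → polyLE j) →ₗ[ℝ] polyLE (j + 1) :=
  (∑ x : f, LinearMap.mulLeft ℝ (baryP f x) ∘ₗ (polyLE j).subtype ∘ₗ LinearMap.proj x).codRestrict _
    fun w => by
      simp only [LinearMap.sum_apply, LinearMap.comp_apply, LinearMap.proj_apply,
        Submodule.subtype_apply, LinearMap.mulLeft_apply]
      exact Submodule.sum_mem _ fun x _ => mul_mem_polyLE (baryP_mem_polyLE _) (w x).2 (by omega)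

lemma barySum_apply (j : ℕ) (w : f → polyLE j) :
    (barySum f j w : Poly) = ∑ x : f, baryP f x * (w x : Poly) := by
  simp [barySum]

/-- The map is onto by `range_sum_baryP`, and `3 (j + 1)(j + 2) / 2 - (j + 2)(j + 3) / 2 = (j + 2)
j`. -/
lemma finrank_ker_barySum (hf : IsTri f) (j : ℕ) :
    finrank ℝ (LinearMap.ker (barySum f j)) = (j + 2) * j := by
  have hs : LinearMap.range (barySum f j) = ⊤ := by
    rw [LinearMap.range_eq_top]
    rintro ⟨p, hp⟩
    obtain ⟨w, hw, h⟩ := range_sum_baryP hf hp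
    refine ⟨fun x => ⟨w x, hw x⟩, Subtype.ext ?_⟩
    rw [barySum_apply]
    exact (Finset.sum_coe_sort f (fun x => baryP f x * w x)).trans h
  have h := LinearMap.finrank_range_add_finrank_ker (barySum f j)
  rw [hs, finrank_top, finrank_polyLE, finrank_pi_fintype, Finset.sum_const, finrank_polyLE,
    Finset.card_univ, Fintype.card_coe, hf.2, smul_eq_mul] at h
  have h1 := Nat.div_mul_cancel (Nat.even_mul_succ_self (j + 1)).two_dvd
  have h2 := Nat.div_mul_cancel (Nat.even_mul_succ_self (j + 1 + 1)).two_dvd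

  have e1 : j + 1 + 1 = j + 2 := rfl
  have e2 : j + 1 + 1 + 1 = j + 1 + 2 := rfl
  rw [e1] at h1
  rw [e2] at h2
  set A := (j + 1) * (j + 2) / 2
  set B := (j + 1 + 1) * (j + 1 + 2) / 2
  nlinarith

/-- The vector fields `λ₁ λ₂ λ₃ ∑ λₓ wₓ x`. -/
def bubbleParam (f : Finset Plane) (j : ℕ) : (f → polyLE j) →ₗ[ℝ] VecPoly :=
  LinearMap.pi fun i => LinearMap.mulLeft ℝ (∏ x ∈ f, baryP f x) ∘ₗ
    ∑ x : f, LinearMap.mulLeft ℝ (C ((x : Plane) i) * baryP f x) ∘ₗ (polyLE j).subtype ∘ₗ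
      LinearMap.proj x

lemma bubbleParam_apply (j : ℕ) (w : f → polyLE j) (i : Fin 2) : bubbleParam f j w i =
    (∏ x ∈ f, baryP f x) * ∑ x : f, C ((x : Plane) i) * baryP f x * (w x : Poly) := by
  simp [bubbleParam, Finset.mul_sum, mul_assoc]

/-- Vanishing on all edges gives `u = λ₁λ₂λ₃ v`. On the edge `λ_y = 0` the divergence reduces to the
product of the other two coordinates times `∇λ_y · v`, so `∇λ_y · v = λ_y w_y`. Then `v = ∑ (∇λₓ ·
v) x = ∑ λₓ wₓ x`, while `∑ ∇λₓ = 0` becomes `∑ λₓ wₓ = 0`. The vertex conditions are not used. -/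
lemma bubbleF0_le (hf : IsTri f) (he : ∀ e ∈ f.powersetCard 2, o.IsEdge e) (j : ℕ) :
    bubbleF (huMaZhang o (j + 4)).S0 f ≤
      (LinearMap.ker (barySum f j)).map (bubbleParam f j) := by
  classical
  intro u hu
  obtain ⟨h1, h2, -⟩ := mem_bubbleF0.1 hu
  have h2' := fun e h => (trFE0_eq_zero_iff (he e h)).1 (h2 e h)
  choose v hv huv using fun i => exists_bubble_factor hf he (h1 i) fun e h => (h2' e h).1 i
  have h3 : ∀ y : f, ∃ w ∈ polyLE j,
      C (baryGrad f y 0) * v 0 + C (baryGrad f y 1) * v 1 = baryP f y * w := by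
    rintro ⟨y, hy⟩
    have hmem := erase_mem_powersetCard hf hy
    have hey := he _ hmem
    have h4 := (h2' _ hmem).2
    have h5 : o.restr (f.erase y) (C (baryGrad f y 0) * v 0 + C (baryGrad f y 1) * v 1) = 0 := by
      have hd : divV pdP u = (∏ x ∈ f.erase y, baryP f x) *
          (C (baryGrad f y 0) * v 0 + C (baryGrad f y 1) * v 1) + baryP f y *
          (pdP 0 ((∏ x ∈ f.erase y, baryP f x) * v 0) +
            pdP 1 ((∏ x ∈ f.erase y, baryP f x) * v 1)) := by
        unfold divV
        rw [huv 0, huv 1, ← Finset.mul_prod_erase f _ hy, mul_assoc, mul_assoc,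
          pdP_mul 0 (baryP f y), pdP_mul 1 (baryP f y), pdP_baryP, pdP_baryP]
        ring
      rw [hd, map_add, restr_mul, restr_mul, restr_baryP hf hy hey, zero_mul, add_zero] at h4
      refine (mul_eq_zero.1 h4).resolve_left ?_
      have : ∀ t : Finset Plane, t ⊆ f.erase y →
          o.restr (f.erase y) (∏ x ∈ t, baryP f x) ≠ 0 := by
        intro t
        induction t using Finset.induction_on with
        | empty => intro _; simp [restr_one]
        | insert x t hx iht =>
          intro hxt
          obtain ⟨a, b⟩ := Finset.mem_erase.1 (hxt (Finset.mem_insert_self _ _))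
          rw [Finset.prod_insert hx, restr_mul]
          exact mul_ne_zero (restr_baryP_ne_zero hf b a hey)
            (iht fun z hz => hxt (Finset.mem_insert_of_mem hz))
      exact this _ subset_rfl
    obtain ⟨w, hw⟩ := baryP_dvd hf hy hey h5
    refine ⟨w, ?_, hw⟩
    have hm : baryP f y * w ∈ polyLE (j + 1) := by
      rw [← hw]
      exact Submodule.add_mem _ (mul_mem_polyLE (C_mem_polyLE _ 0) (hv 0) (by omega))
        (mul_mem_polyLE (C_mem_polyLE _ 0) (hv 1) (by omega))
    exact mem_polyLE_of_mul (totalDegree_baryP hf hy) (baryP_ne_zero hf hy) hm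
  choose w hw hvw using h3
  refine ⟨fun y => ⟨w y, hw y⟩, ?_, ?_⟩
  · rw [SetLike.mem_coe, LinearMap.mem_ker]
    apply Subtype.ext
    rw [barySum_apply]
    simp only [← hvw, Submodule.coe_zero]
    rw [Finset.sum_add_distrib, ← Finset.sum_mul, ← Finset.sum_mul, ← map_sum, ← map_sum]
    have := fun i => (Finset.sum_coe_sort f (fun x => baryGrad f x i)).trans (sum_baryGrad hf i)
    rw [this, this]
    simp
  · funext i
    rw [bubbleParam_apply, huv i]
    congr 1
    simp only [mul_assoc, ← hvw]
    simp only [mul_add, ← mul_assoc, ← C_mul]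
    rw [Finset.sum_add_distrib, ← Finset.sum_mul, ← Finset.sum_mul, ← map_sum, ← map_sum]
    have := fun l => (Finset.sum_coe_sort f (fun x => x i * baryGrad f x l)).trans
      (sum_baryGrad_mul hf i l)
    rw [this, this]
    fin_cases i <;> simp

lemma finrank_bubbleF0_le (hf : IsTri f) (he : ∀ e ∈ f.powersetCard 2, o.IsEdge e) (j : ℕ) :
    finrank ℝ (bubbleF (huMaZhang o (j + 4)).S0 f) ≤ (j + 2) * j := by
  rw [← finrank_ker_barySum hf j]
  exact (Submodule.finrank_mono (bubbleF0_le hf he j)).trans (Submodule.finrank_map_le _ _)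

end BubbleF

/-! ## Commutation of traces and operators -/

section Commutation

open Module MvPolynomial

variable {K : Geometry.SimplicialComplex ℝ Plane} {o : EdgeOrientation K} {e f : Finset Plane}

lemma symCurlP_entries (u : VecPoly) : symCurlP u 0 0 = -pdP 1 (u 0) ∧ symCurlP u 1 1 = pdP 0 (u 1) ∧
    symCurlP u 0 1 = (1 / 2 : ℝ) • (pdP 0 (u 0) - pdP 1 (u 1)) ∧
    symCurlP u 1 0 = (1 / 2 : ℝ) • (pdP 0 (u 0) - pdP 1 (u 1)) := by
  refine ⟨?_, ?_, ?_, ?_⟩ <;> simp [symCurlP, symCurl, curlV] <;> module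

lemma isSymm_symCurlP (u : VecPoly) : (symCurlP u).IsSymm := by
  obtain ⟨-, -, h1, h2⟩ := symCurlP_entries u
  ext i j
  fin_cases i <;> fin_cases j <;> simp [Matrix.transpose_apply, h1, h2]

lemma symCurlP_mem {k : ℕ} {u : VecPoly} (hu : ∀ i, u i ∈ polyLE k) (i j : Fin 2) :
    symCurlP u i j ∈ polyLE (k - 1) := by
  obtain ⟨h1, h2, h3, h4⟩ := symCurlP_entries u
  have h := fun i j => pdP_mem_polyLE i (hu j)
  fin_cases i <;> fin_cases j
  · simpa [h1] using h 1 0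
  · simpa only [Fin.zero_eta, Fin.mk_one, h3] using Submodule.smul_mem _ _ (Submodule.sub_mem _ (h 0 0) (h 1 1))
  · simpa only [Fin.zero_eta, Fin.mk_one, h4] using Submodule.smul_mem _ _ (Submodule.sub_mem _ (h 0 0) (h 1 1))
  · simpa [h2] using h 0 1

lemma divM_symCurlP (u : VecPoly) :
    divM pdP (symCurlP u) 0 = -((1 / 2 : ℝ) • pdP 1 (divV pdP u)) ∧
    divM pdP (symCurlP u) 1 = (1 / 2 : ℝ) • pdP 0 (divV pdP u) := by
  obtain ⟨h1, h2, h3, h4⟩ := symCurlP_entries u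
  constructor
  · simp only [divM, divV, h1, h3, pdP_neg, pdP_smul, pdP_sub, pdP_add, pdP_comm 0 1 (u 0)]
    module
  · simp only [divM, divV, h2, h4, pdP_smul, pdP_sub, pdP_add, pdP_comm 0 1 (u 1)]
    module

lemma divDivP_symCurlP (u : VecPoly) : divDivP (symCurlP u) = 0 := by
  obtain ⟨h1, h2⟩ := divM_symCurlP u
  show divV pdP (divM pdP (symCurlP u)) = 0
  rw [divV, h1, h2, pdP_neg, pdP_smul, pdP_smul, pdP_comm 0 1]
  simp

lemma divDivP_mem {m : ℕ} {σ : MatPoly} (hσ : ∀ i j, σ i j ∈ polyLE m) :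
    divDivP σ ∈ polyLE (m - 2) := by
  have h1 : ∀ i, divM pdP σ i ∈ polyLE (m - 1) := fun i =>
    Submodule.add_mem _ (pdP_mem_polyLE 0 (hσ i 0)) (pdP_mem_polyLE 1 (hσ i 1))
  have h2 : m - 2 = m - 1 - 1 := by omega
  rw [h2]
  exact Submodule.add_mem _ (pdP_mem_polyLE 0 (h1 0)) (pdP_mem_polyLE 1 (h1 1))

/-- Here `(curl u) n = ∂ₜ u` and `(curl u) t = -∂ₙ u`. The tangential component of the symmetric
part is thus `½ (∂ₜ uₜ - ∂ₙ uₙ) = ∂ₜ uₜ - ½ div u`, and `n · ½ curl div u = ½ ∂ₜ div u`. -/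
lemma trFE1_symCurlP (he : o.IsEdge e) (u : VecPoly) :
    trFE1 o e (symCurlP u) = edgeOp (trFE0 o e u) := by
  obtain ⟨h1, h2, h3, h4⟩ := symCurlP_entries u
  obtain ⟨d1, d2⟩ := divM_symCurlP u
  have ht : Polynomial.C (o.tang e 0) ^ 2 + Polynomial.C (o.tang e 1) ^ 2 = 1 := by
    rw [← map_pow, ← map_pow, ← map_add, he.tang_sq, map_one]
  simp only [trFE1, trFE0, edgeOp, LinearMap.coe_mk, AddHom.coe_mk, Fin.sum_univ_two, h1, h2, h3, h4,
    d1, d2, nrm_zero, nrm_one, map_add, map_sub, map_neg, map_smul, derivative_restr]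
  simp only [divV, map_add, Polynomial.smul_eq_C_mul, map_neg, map_mul]
  generalize Polynomial.C (o.tang e 0) = a at ht ⊢
  generalize Polynomial.C (o.tang e 1) = b at ht ⊢
  have hh : Polynomial.C (1 / 2 : ℝ) * 2 = 1 := by
    rw [show (2 : Polynomial ℝ) = Polynomial.C 2 from rfl, ← map_mul]; norm_num
  generalize Polynomial.C (1 / 2 : ℝ) = c at hh ⊢
  ext1
  · linear_combination (-a * b * (o.restr e (pdP 0 (u 0)) - o.restr e (pdP 1 (u 1)))) * hh
  · ext1
    · linear_combination (a * a * o.restr e (pdP 0 (u 0)) + b * b * o.restr e (pdP 1 (u 1))) * hh -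
        (c * (o.restr e (pdP 0 (u 0)) + o.restr e (pdP 1 (u 1)))) * ht
    · ring

lemma trFV1_symCurlP (x : Plane) (u : VecPoly) : trFV1 x (symCurlP u) = jetOp (trFV0 x u) := by
  obtain ⟨h1, h2, h3, h4⟩ := symCurlP_entries u
  ext i j
  fin_cases i <;> fin_cases j
  · simp only [trFV1, trFV0, jetOp, LinearMap.coe_mk, AddHom.coe_mk, Matrix.of_apply, Fin.zero_eta,
      h1]
    simp
    ring
  · simp only [trFV1, trFV0, jetOp, LinearMap.coe_mk, AddHom.coe_mk, Matrix.of_apply, Fin.zero_eta,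
      Fin.mk_one, h3]
    simp
    ring
  · simp only [trFV1, trFV0, jetOp, LinearMap.coe_mk, AddHom.coe_mk, Matrix.of_apply, Fin.zero_eta,
      Fin.mk_one, h4]
    simp
    ring
  · simp only [trFV1, trFV0, jetOp, LinearMap.coe_mk, AddHom.coe_mk, Matrix.of_apply, Fin.mk_one,
      h2]
    simp
    ring

lemma trEV0_trFE0 (he : o.IsEdge e) {x : Plane} (hx : x ∈ e) {u : VecPoly} (h : trFV0 x u = 0) :
    trEV0 o e x (trFE0 o e u) = 0 := by
  have hv : ∀ i, evalAt x (u i) = 0 := fun i => congrFun (congrArg Prod.fst h) i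
  have hm : ∀ i j, evalAt x (pdP j (u i)) = 0 := fun i j =>
    congrFun (congrFun (congrArg Prod.snd h) i) j
  rw [trEV0_eq_zero_iff he]
  simp only [trFE0, LinearMap.coe_mk, AddHom.coe_mk, Fin.sum_univ_two, map_add,
    Polynomial.derivative_smul, derivative_restr, Polynomial.eval_add, Polynomial.eval_smul,
    eval_coord_restr he hx, hv, hm, divV]
  simp

lemma trEV1_trFE1 (he : o.IsEdge e) {x : Plane} (hx : x ∈ e) {σ : MatPoly} (h : trFV1 x σ = 0) :
    trEV1 o e x (trFE1 o e σ) = 0 := by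
  have hm : ∀ i j, evalAt x (σ i j) = 0 := fun i j => congrFun (congrFun h i) j
  rw [trEV1_eq_zero_iff he]
  simp only [trFE1, LinearMap.coe_mk, AddHom.coe_mk, Fin.sum_univ_two, Polynomial.eval_add,
    Polynomial.eval_smul, eval_coord_restr he hx, hm]
  simp

lemma trFE0_mem {k : ℕ} {u : VecPoly} (hu : ∀ i, u i ∈ polyLE k) :
    trFE0 o e u ∈ (huMaZhang o k).S0.AE e := by
  refine ⟨?_, ?_, ?_⟩
  · show ∑ i, o.nrm e i • o.restr e (u i) ∈ Polynomial.degreeLE ℝ (k : ℕ)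
    exact Submodule.sum_mem _ fun i _ => Submodule.smul_mem _ _ (restr_mem_degreeLE (hu i))
  · show ∑ i, o.tang e i • o.restr e (u i) ∈ Polynomial.degreeLE ℝ (k : ℕ)
    exact Submodule.sum_mem _ fun i _ => Submodule.smul_mem _ _ (restr_mem_degreeLE (hu i))
  · exact restr_mem_degreeLE (Submodule.add_mem _ (pdP_mem_polyLE 0 (hu 0)) (pdP_mem_polyLE 1 (hu 1)))

lemma trFE1_mem {k : ℕ} {σ : MatPoly} (hσ : ∀ i j, σ i j ∈ polyLE (k - 1)) :
    trFE1 o e σ ∈ (huMaZhang o k).S1.AE e := by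
  refine ⟨?_, ?_, ?_⟩
  · show ∑ i, ∑ j, (o.nrm e i * o.nrm e j) • o.restr e (σ i j) ∈
      Polynomial.degreeLE ℝ ((k - 1 : ℕ) : ℕ)
    exact Submodule.sum_mem _ fun i _ => Submodule.sum_mem _ fun j _ =>
      Submodule.smul_mem _ _ (restr_mem_degreeLE (hσ i j))
  · show ∑ i, ∑ j, (o.tang e i * o.nrm e j) • o.restr e (σ i j) ∈
      Polynomial.degreeLE ℝ ((k - 1 : ℕ) : ℕ)
    exact Submodule.sum_mem _ fun i _ => Submodule.sum_mem _ fun j _ =>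
      Submodule.smul_mem _ _ (restr_mem_degreeLE (hσ i j))
  · show ∑ i, o.nrm e i • o.restr e (divM pdP σ i) ∈ Polynomial.degreeLE ℝ ((k - 1 - 1 : ℕ) : ℕ)
    exact Submodule.sum_mem _ fun i _ => Submodule.smul_mem _ _ (restr_mem_degreeLE
      (Submodule.add_mem _ (pdP_mem_polyLE 0 (hσ i 0)) (pdP_mem_polyLE 1 (hσ i 1))))

lemma eq_C_of_pdP_eq_zero {p : Poly} (h : ∀ i, pdP i p = 0) : p = C (evalAt 0 p) := by
  refine poly_ext fun x => ?_
  rw [evalAt_C]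
  have hd : Differentiable ℝ (polyFun p) := differentiable_of_smooth (contDiff_polyFun p)
  refine is_const_of_fderiv_eq_zero (𝕜 := ℝ) hd (fun y => ?_) x 0
  ext v
  rw [fderiv_polyFun]
  simp [h]

/-- The kernel of `sym curl` is the space `RT2`. -/
lemma symCurlP_eq_zero_iff {u : VecPoly} : symCurlP u = 0 ↔ u ∈ RT2 := by
  obtain ⟨h1, h2, h3, h4⟩ := symCurlP_entries u
  constructor
  · intro h
    rw [h] at h1 h2 h3
    simp only [Matrix.zero_apply] at h1 h2 h3
    have h01 : pdP 1 (u 0) = 0 := neg_eq_zero.1 h1.symm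
    have h10 : pdP 0 (u 1) = 0 := h2.symm
    have hg : pdP 0 (u 0) = pdP 1 (u 1) := by
      have := (smul_eq_zero.1 h3.symm).resolve_left (by norm_num)
      exact sub_eq_zero.1 this
    -- The gradient of `u` is a multiple of the identity; commuting mixed derivatives shows that
    -- this multiple is constant.
    have hb : pdP 0 (u 0) = C (evalAt 0 (pdP 0 (u 0))) := by
      apply eq_C_of_pdP_eq_zero
      rw [Fin.forall_fin_two]
      constructor
      · rw [hg, pdP_comm, h10, pdP_zero]
      · rw [pdP_comm, h01, pdP_zero]
    set b := evalAt 0 (pdP 0 (u 0))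
    have hc : ∀ i, u i - C b * X i = C (evalAt 0 (u i - C b * X i)) := by
      intro i
      apply eq_C_of_pdP_eq_zero
      intro j
      rw [pdP_sub, pdP_mul, pdP_C, pdP_X]
      fin_cases i <;> fin_cases j <;> simp [hb, h01, h10, ← hg]
    refine ⟨fun i => evalAt 0 (u i - C b * X i), b, ?_⟩
    funext i
    rw [← hc]
    ring
  · rintro ⟨a, b, rfl⟩
    simp only [pdP_add, pdP_mul, pdP_C, pdP_X] at h1 h2 h3 h4
    ext1 i j
    fin_cases i <;> fin_cases j
    · simpa using h1
    · simpa using h3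
    · simpa using h4
    · simpa using h2

/-- The gradient of `a + b x` gives `b`, and then the value gives `a`. Owing to this rigidity,
elements of `RT2` with the same jet at one point agree, as constants do. -/
lemma RT2_eq_zero_of_jet {u : VecPoly} (hu : u ∈ RT2) {x : Plane} (h : trFV0 x u = 0) : u = 0 := by
  obtain ⟨a, b, rfl⟩ := hu
  have hv := fun i => congrFun (congrArg Prod.fst h) i
  have hm := congrFun (congrFun (congrArg Prod.snd h) 0) 0
  simp only [trFV0, LinearMap.coe_mk, AddHom.coe_mk, map_add, evalAt_C, evalAt_mul, evalAt_X,
    Matrix.of_apply, pdP_add, pdP_mul, pdP_C, pdP_X, Prod.fst_zero, Prod.snd_zero, Pi.zero_apply,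
    Matrix.zero_apply] at hv hm
  have hb : b = 0 := by simpa [evalAt_one] using hm
  funext i
  have := hv i
  rw [hb] at this
  simp only [zero_mul, add_zero] at this
  simp [hb, this]

end Commutation

/-! ## Unisolvence and exactness on triangles -/

section LocalExactness

open Module MvPolynomial

variable {K : Geometry.SimplicialComplex ℝ Plane} {o : EdgeOrientation K} {e f : Finset Plane}

/-- A polynomial that is constant along each edge is constant on the boundary. -/
lemma restr_sub_C_eq_zero (he : ∀ e ∈ f.powersetCard 2, o.IsEdge e) {p : Poly}
    (h : ∀ e ∈ f.powersetCard 2, (o.restr e p).derivative = 0) {a : Plane} (ha : a ∈ f) :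
    ∀ e ∈ f.powersetCard 2, o.restr e (p - C (evalAt a p)) = 0 := by
  classical
  -- On each edge the restriction is the constant given by the value at any of its vertices. Two
  -- vertices of a triangle always span an edge, so the constants agree.
  have hc : ∀ e ∈ f.powersetCard 2, ∀ x ∈ e, o.restr e p = Polynomial.C (evalAt x p) := by
    intro e hE x hx
    have h1 := Polynomial.eq_C_of_derivative_eq_zero (h e hE)
    have h2 := eval_coord_restr (he e hE) hx p
    rw [h1, Polynomial.eval_C] at h2
    rw [← h2]
    exact h1
  have hconst : ∀ x ∈ f, evalAt x p = evalAt a p := by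
    intro x hx
    by_cases hxa : x = a
    · rw [hxa]
    have hE : ({x, a} : Finset Plane) ∈ f.powersetCard 2 := by
      rw [Finset.mem_powersetCard]
      refine ⟨?_, Finset.card_pair hxa⟩
      intro y hy
      rcases Finset.mem_insert.1 hy with rfl | hy
      · exact hx
      · rwa [Finset.mem_singleton.1 hy]
    have h1 := hc _ hE x (by simp)
    have h2 := hc _ hE a (by simp)
    exact Polynomial.C_injective (h1.symm.trans h2)
  intro e hE
  have hx := (he e hE).start_mem
  rw [map_sub, restr_C, hc e hE _ hx, hconst _ ((Finset.mem_powersetCard.1 hE).1 hx), sub_self]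

lemma trFE1_eq_zero_iff (he : o.IsEdge e) {σ : MatPoly} : trFE1 o e σ = 0 ↔
    (∀ i, o.nrm e 0 • o.restr e (σ i 0) + o.nrm e 1 • o.restr e (σ i 1) = 0) ∧
      o.nrm e 0 • o.restr e (divM pdP σ 0) + o.nrm e 1 • o.restr e (divM pdP σ 1) = 0 := by
  have ht : Polynomial.C (o.tang e 0) ^ 2 + Polynomial.C (o.tang e 1) ^ 2 = 1 := by
    rw [← map_pow, ← map_pow, ← map_add, he.tang_sq, map_one]
  simp only [trFE1, LinearMap.coe_mk, AddHom.coe_mk, Prod.mk_eq_zero, Fin.sum_univ_two,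
    Fin.forall_fin_two, nrm_zero, nrm_one]
  simp only [Polynomial.smul_eq_C_mul, map_neg, map_mul]
  generalize Polynomial.C (o.tang e 0) = a at ht ⊢
  generalize Polynomial.C (o.tang e 1) = b at ht ⊢
  constructor
  · rintro ⟨h1, h2, h3⟩
    refine ⟨⟨?_, ?_⟩, h3⟩
    · linear_combination a * h2 - b * h1 -
        (-b * o.restr e (σ 0 0) + a * o.restr e (σ 0 1)) * ht
    · linear_combination b * h2 + a * h1 -
        (-b * o.restr e (σ 1 0) + a * o.restr e (σ 1 1)) * ht
  · rintro ⟨⟨h1, h2⟩, h3⟩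
    refine ⟨?_, ?_, h3⟩
    · linear_combination -b * h1 + a * h2
    · linear_combination a * h1 + b * h2

/-- With the potentials `u` and `w` from the polynomial sequence, `div σ · n` is the tangential
derivative of `w`, so `w` is a constant `c` on the boundary. Replacing `u` by `v = u - c x` shifts
`w` by `c`. Now `σ n = 0` says that the tangential derivatives of `v` vanish on the edges, so `v` is
constant on the boundary and the constant can be subtracted. All corrections lie in `RT2`, the
kernel of `sym curl`. -/
lemma exists_bubble_of_divDiv_eq_zero (hf : IsTri f) (he : ∀ e ∈ f.powersetCard 2, o.IsEdge e)
    {k : ℕ} (hk : 1 ≤ k) {σ : MatPoly} (hσ : σ ∈ bubbleF (huMaZhang o k).S1 f)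
    (h : divDivP σ = 0) : ∃ u ∈ bubbleF (huMaZhang o k).S0 f, symCurlP u = σ := by
  obtain ⟨⟨hs, hm⟩, hE, hV⟩ := mem_bubbleF1.1 hσ
  obtain ⟨u, w, hu, hsc, d0, d1, e00, e01, e10, e11, hdiv⟩ :=
    exists_symCurl_of_divDiv_eq_zero hm hs h
  rw [Nat.sub_add_cancel hk] at hu
  obtain ⟨a, ha⟩ : f.Nonempty := Finset.card_pos.1 (by rw [hf.2]; norm_num)
  have hE' := fun e hE' => (trFE1_eq_zero_iff (he e hE')).1 (hE e hE')
  have hw := restr_sub_C_eq_zero he (p := w) (fun e h' => by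
    have := (hE' e h').2
    rw [d0, d1, map_neg, nrm_zero, nrm_one] at this
    rw [derivative_restr, ← this]
    module) ha
  set c := evalAt a w
  let v : VecPoly := fun i => u i - C c * X i
  have hv : ∀ i j, pdP j (v i) = pdP j (u i) - if j = i then C c else 0 := by
    intro i j
    simp only [v, pdP_sub, pdP_mul, pdP_C, pdP_X, zero_mul, zero_add]
    split_ifs <;> simp
  have hv00 : pdP 0 (v 0) = σ 0 1 + (w - C c) := by rw [hv, ← e01]; simp; ring
  have hv01 : pdP 1 (v 0) = -σ 0 0 := by rw [hv, e00]; simp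
  have hv10 : pdP 0 (v 1) = σ 1 1 := by rw [hv, e11]; simp
  have hv11 : pdP 1 (v 1) = -σ 1 0 + (w - C c) := by
    rw [hv]
    have : pdP 1 (u 1) = -σ 1 0 + w := by linear_combination e10
    rw [this]; simp; ring
  have hvr := fun i => restr_sub_C_eq_zero he (p := v i) (fun e h' => by
    have h1 := (hE' e h').1 i
    have h2 := hw e h'
    rw [nrm_zero, nrm_one] at h1
    rw [derivative_restr, ← h1]
    fin_cases i
    · simp only [Fin.zero_eta, hv00, hv01, map_add, h2, map_neg]; module
    · simp only [Fin.mk_one, hv10, hv11, map_add, h2, map_neg]; module) ha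
  let y : VecPoly := fun i => v i - C (evalAt a (v i))
  have hy : ∀ i j, pdP j (y i) = pdP j (v i) := fun i j => by simp [y, pdP_sub, pdP_C]
  have hydiv : divV pdP y = (2 : ℝ) • (w - C c) := by
    rw [divV, hy, hy, hv00, hv11, two_smul, hs.apply 0 1]
    ring
  have hres : ∀ e ∈ f.powersetCard 2, ∀ i, o.restr e (y i) = 0 := fun e h' i => hvr i e h'
  have hval : ∀ (p : Poly), (∀ e ∈ f.powersetCard 2, o.restr e p = 0) → ∀ x ∈ f, evalAt x p = 0 := by
    classical
    intro p hp x hx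
    obtain ⟨z, hz, hzx⟩ := exists_mem_erase_ne hf x
    have hmem := erase_mem_powersetCard hf hz
    have := eval_coord_restr (he _ hmem) (Finset.mem_erase.2 ⟨hzx.symm, hx⟩) p
    rw [hp _ hmem] at this
    simpa using this.symm
  refine ⟨y, mem_bubbleF0.2 ⟨fun i => ?_, fun e h' => ?_, fun x hx => ?_⟩, ?_⟩
  · refine Submodule.sub_mem _ (Submodule.sub_mem _ (hu i) ?_) (C_mem_polyLE _ _)
    exact mul_mem_polyLE (C_mem_polyLE _ 0) (X_mem_polyLE i le_rfl) (by omega)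
  · rw [trFE0_eq_zero_iff (he e h')]
    refine ⟨hres e h', ?_⟩
    rw [hydiv, map_smul, hw e h', smul_zero]
  · have hσx : ∀ i j, evalAt x (σ i j) = 0 := fun i j => congrFun (congrFun (hV x hx) i) j
    have hwx := hval _ hw x hx
    ext i j
    · exact hval (y i) (fun e h' => hres e h' i) x hx
    · show evalAt x (pdP j (y i)) = 0
      rw [hy]
      fin_cases i <;> fin_cases j <;>
        simp only [Fin.zero_eta, Fin.mk_one, hv00, hv01, hv10, hv11, map_add, map_neg, hσx, hwx] <;>
        simp
  · have h1 : symCurlP u = σ := hsc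
    rw [← h1, ← sub_eq_zero, ← map_sub, symCurlP_eq_zero_iff]
    refine ⟨fun i => -evalAt a (v i), -c, ?_⟩
    funext i
    simp only [y, v, Pi.sub_apply, map_neg]
    ring

lemma symCurlP_mem_bubbleF1 (he : ∀ e ∈ f.powersetCard 2, o.IsEdge e) {k : ℕ} {u : VecPoly}
    (hu : u ∈ bubbleF (huMaZhang o k).S0 f) : symCurlP u ∈ bubbleF (huMaZhang o k).S1 f := by
  obtain ⟨h1, h2, h3⟩ := mem_bubbleF0.1 hu
  refine mem_bubbleF1.2 ⟨⟨isSymm_symCurlP u, symCurlP_mem h1⟩, fun e h => ?_, fun x hx => ?_⟩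
  · rw [trFE1_symCurlP (he e h), h2 e h, map_zero]
  · rw [trFV1_symCurlP, h3 x hx, map_zero]

instance finiteDimensional_vecPolyLE (m : ℕ) : FiniteDimensional ℝ (vecPolyLE m) := by
  let Φ : vecPolyLE m →ₗ[ℝ] (Fin 2 → polyLE m) :=
    LinearMap.pi fun i => ((LinearMap.proj i).domRestrict (vecPolyLE m)).codRestrict _
      fun u => mem_vecPolyLE.1 u.2 i
  refine FiniteDimensional.of_injective Φ fun u v h => ?_
  ext1
  funext i
  exact congrArg Subtype.val (congrFun h i)

lemma finrank_vecPolyLE (m : ℕ) : finrank ℝ (vecPolyLE m) = (m + 1) * (m + 2) := by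
  let Φ : vecPolyLE m ≃ₗ[ℝ] (Fin 2 → polyLE m) :=
    { toFun := fun u i => ⟨u.1 i, mem_vecPolyLE.1 u.2 i⟩
      map_add' := fun _ _ => rfl
      map_smul' := fun _ _ => rfl
      invFun := fun u => ⟨fun i => u i, mem_vecPolyLE.2 fun i => (u i).2⟩
      left_inv := fun _ => rfl
      right_inv := fun _ => rfl }
  rw [Φ.finrank_eq, finrank_pi_fintype]
  simp only [finrank_polyLE, Finset.sum_const, Finset.card_univ, Fintype.card_fin, smul_eq_mul]
  exact Nat.mul_div_cancel' (Nat.even_mul_succ_self (m + 1)).two_dvd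

/-- Symmetric matrices are triples. -/
def symPolyEquiv (m : ℕ) : symPolyLE m ≃ₗ[ℝ] polyLE m × polyLE m × polyLE m where
  toFun σ := (⟨σ.1 0 0, σ.2.2 0 0⟩, ⟨σ.1 0 1, σ.2.2 0 1⟩, ⟨σ.1 1 1, σ.2.2 1 1⟩)
  map_add' _ _ := rfl
  map_smul' _ _ := rfl
  invFun p := ⟨!![p.1.1, p.2.1.1; p.2.1.1, p.2.2.1], by
    constructor
    · ext i j
      fin_cases i <;> fin_cases j <;> rfl
    · intro i j
      fin_cases i <;> fin_cases j
      exacts [p.1.2, p.2.1.2, p.2.1.2, p.2.2.2]⟩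
  left_inv σ := by
    ext1
    ext1 i j
    fin_cases i <;> fin_cases j <;> try rfl
    exact (σ.2.1.apply 1 0)
  right_inv _ := rfl

instance finiteDimensional_symPolyLE (m : ℕ) : FiniteDimensional ℝ (symPolyLE m) :=
  Module.Finite.equiv (symPolyEquiv m).symm

lemma finrank_symPolyLE (m : ℕ) : 2 * finrank ℝ (symPolyLE m) = 3 * ((m + 1) * (m + 2)) := by
  rw [(symPolyEquiv m).finrank_eq, finrank_prod, finrank_prod, finrank_polyLE]
  have := Nat.div_mul_cancel (Nat.even_mul_succ_self (m + 1)).two_dvd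
  rw [show m + 1 + 1 = m + 2 from rfl] at this
  omega

instance finiteDimensional_S0 (k : ℕ) : FiniteDimensional ℝ ((huMaZhang o k).S0.AF f) :=
  inferInstanceAs (FiniteDimensional ℝ (vecPolyLE k))

instance finiteDimensional_S1 (k : ℕ) : FiniteDimensional ℝ ((huMaZhang o k).S1.AF f) :=
  inferInstanceAs (FiniteDimensional ℝ (symPolyLE (k - 1)))

lemma bubbleE0_le {k : ℕ} : bubbleE (huMaZhang o k).S0 f e ≤ edgeBubble0 o k e := by
  rintro _ ⟨⟨u, hu, rfl⟩, h⟩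
  exact ⟨trFE0_mem (mem_vecPolyLE.1 hu), h⟩

lemma bubbleE1_le {k : ℕ} : bubbleE (huMaZhang o k).S1 f e ≤ edgeBubble1 o k e := by
  rintro _ ⟨⟨u, hu, rfl⟩, h⟩
  exact ⟨trFE1_mem hu.2, h⟩

instance finiteDimensional_prod {V W : Type} [AddCommGroup V] [Module ℝ V] [AddCommGroup W]
    [Module ℝ W] (A : Submodule ℝ V) (B : Submodule ℝ W) [hA : FiniteDimensional ℝ A]
    [hB : FiniteDimensional ℝ B] : FiniteDimensional ℝ (A.prod B) :=
  Module.Finite.iff_fg.2 ((Module.Finite.iff_fg.1 hA).prod (Module.Finite.iff_fg.1 hB))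

instance finiteDimensional_edgeBubble0 (k : ℕ) : FiniteDimensional ℝ (edgeBubble0 o k e) := by
  have : FiniteDimensional ℝ ((huMaZhang o k).S0.AE e) :=
    inferInstanceAs (FiniteDimensional ℝ ↥((Polynomial.degreeLE ℝ k).prod
        ((Polynomial.degreeLE ℝ k).prod (Polynomial.degreeLE ℝ (k - 1 : ℕ)))))
  unfold edgeBubble0
  infer_instance

instance finiteDimensional_edgeBubble1 (k : ℕ) : FiniteDimensional ℝ (edgeBubble1 o k e) := by
  have : FiniteDimensional ℝ ((huMaZhang o k).S1.AE e) :=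
    inferInstanceAs (FiniteDimensional ℝ ↥((Polynomial.degreeLE ℝ (k - 1 : ℕ)).prod
        ((Polynomial.degreeLE ℝ (k - 1 : ℕ)).prod (Polynomial.degreeLE ℝ (k - 2 : ℕ)))))
  unfold edgeBubble1
  infer_instance

end LocalExactness

/-! ### Unisolvence in both degrees and the bubble complex of a triangle -/

section LocalDimensions

open Module MvPolynomial

variable {K : Geometry.SimplicialComplex ℝ Plane} {o : EdgeOrientation K} {e f : Finset Plane}

lemma finrank_sum_eq {MF ME MV : Type} [AddCommGroup MF] [Module ℝ MF] [AddCommGroup ME]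
    [Module ℝ ME] [AddCommGroup MV] [Module ℝ MV] {S : TraceData MF ME MV} {nF nE nV : ℕ}
    (hc : f.card = 3) (hF : finrank ℝ (bubbleF S f) = nF)
    (hE : ∀ e ∈ f.powersetCard 2, finrank ℝ (bubbleE S f e) = nE)
    (hV : ∀ x ∈ f, finrank ℝ (bubbleV S f x) = nV) :
    finrank ℝ (bubbleF S f) + ∑ e ∈ f.powersetCard 2, finrank ℝ (bubbleE S f e) +
      ∑ x ∈ f, finrank ℝ (bubbleV S f x) = nF + 3 * nE + 3 * nV := by
  have hce : (f.powersetCard 2).card = 3 := by rw [Finset.card_powersetCard, hc]; rfl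
  rw [Finset.sum_congr rfl hE, Finset.sum_congr rfl hV, hF]
  simp [hce, hc]

/-- Unisolvence in degree `0`. -/
theorem unisolvence0 (hf : IsTri f) (he : ∀ e ∈ f.powersetCard 2, o.IsEdge e) {k : ℕ} (hk : 4 ≤ k) :
    (finrank ℝ (bubbleF (huMaZhang o k).S0 f) +
      ∑ e ∈ f.powersetCard 2, finrank ℝ (bubbleE (huMaZhang o k).S0 f e) +
      ∑ x ∈ f, finrank ℝ (bubbleV (huMaZhang o k).S0 f x) =
        finrank ℝ ((huMaZhang o k).S0.AF f)) ∧
    (∀ e ∈ f.powersetCard 2, bubbleE (huMaZhang o k).S0 f e = edgeBubble0 o k e) ∧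
    (∀ x ∈ f, bubbleV (huMaZhang o k).S0 f x = ⊤) ∧
    (∀ j : Plane → Jet1, ∃ u : VecPoly, (∀ i, u i ∈ polyLE k) ∧ ∀ x ∈ f, trFV0 x u = j x) ∧
    (∀ a : Finset Plane → Edge3, (∀ e ∈ f.powersetCard 2, a e ∈ edgeBubble0 o k e) →
      ∃ u : VecPoly, (∀ i, u i ∈ polyLE k) ∧ (∀ x ∈ f, trFV0 x u = 0) ∧
        ∀ e ∈ f.powersetCard 2, trFE0 o e u = a e) := by
  obtain ⟨j, rfl⟩ := Nat.exists_eq_add_of_le' hk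
  have hfin : finrank ℝ ((huMaZhang o (j + 4)).S0.AF f) = (j + 4 + 1) * (j + 4 + 2) :=
    finrank_vecPolyLE _
  have h6 : finrank ℝ Jet1 = 6 := by
    rw [finrank_prod, finrank_pi, finrank_matrix]; simp
  -- With `k = j + 4` the count is `(j + 2) j + 3 (3 j + 4) + 3 · 6 = (j + 5)(j + 6)`.
  obtain ⟨hF, hE, hV, hA, hiV, hiE⟩ := trace_squeeze (S := (huMaZhang o (j + 4)).S0) (f := f)
    (nF := (j + 2) * j) (nE := 3 * (j + 4) - 8) (nV := 6)
    (fun e hE x hx u _ h => trEV0_trFE0 (he e hE) hx h) hf.2 (finrank_bubbleF0_le hf he j)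
    (fun e hE => (Submodule.finrank_mono bubbleE0_le).trans (finrank_edgeBubble0_le (he e hE) hk))
    (fun x _ => (Submodule.finrank_le _).trans h6.le)
    (by
      rw [hfin]
      have : 3 * (j + 4) - 8 = 3 * j + 4 := by omega
      rw [this]
      apply le_of_eq
      ring)
  have hbE : ∀ e ∈ f.powersetCard 2, bubbleE (huMaZhang o (j + 4)).S0 f e =
      edgeBubble0 o (j + 4) e := fun e h => by
    apply Submodule.eq_of_le_of_finrank_le bubbleE0_le
    rw [hE e h]
    exact finrank_edgeBubble0_le (he e h) hk
  have hbV : ∀ x ∈ f, bubbleV (huMaZhang o (j + 4)).S0 f x = ⊤ := fun x hx =>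
    Submodule.eq_top_of_finrank_eq (by rw [hV x hx, h6])
  refine ⟨?_, hbE, hbV, fun jt => ?_, fun a ha => ?_⟩
  · rw [hA]
    exact finrank_sum_eq hf.2 hF hE hV
  · obtain ⟨u, hu, h⟩ := hiV jt fun x hx => by rw [hbV x hx]; trivial
    exact ⟨u, mem_vecPolyLE.1 hu, h⟩
  · obtain ⟨u, hu, h⟩ := hiE a fun e h => by rw [hbE e h]; exact ha e h
    exact ⟨u, mem_vecPolyLE.1 hu, h⟩

/-- The polynomials in `P_m` that are orthogonal to `P₁` on a triangle. -/
def orthP1 (f : Finset Plane) (m : ℕ) : Submodule ℝ Poly := polyLE m ⊓ LinearMap.ker (triPair f)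

instance finiteDimensional_orthP1 (m : ℕ) : FiniteDimensional ℝ (orthP1 f m) := by
  unfold orthP1; infer_instance

lemma finrank_orthP1 (hf : IsTri f) {m : ℕ} (hm : 1 ≤ m) :
    2 * finrank ℝ (orthP1 f m) + 6 = (m + 1) * (m + 2) := by
  have h := LinearMap.finrank_range_add_finrank_ker ((triPair f).domRestrict (polyLE m))
  rw [LinearMap.range_eq_top.2 (triPair_surjective hf hm), finrank_top, Subspace.dual_finrank_eq,
    finrank_polyLE, finrank_polyLE] at h
  have h1 : (LinearMap.ker ((triPair f).domRestrict (polyLE m))).map (polyLE m).subtype =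
      orthP1 f m := by
    rw [LinearMap.ker_domRestrict, Submodule.map_comap_subtype]
    rfl
  have h2 := LinearEquiv.finrank_eq (Submodule.equivMapOfInjective _ (polyLE m).injective_subtype
    (LinearMap.ker ((triPair f).domRestrict (polyLE m))))
  rw [h1] at h2
  have := Nat.div_mul_cancel (Nat.even_mul_succ_self (m + 1)).two_dvd
  rw [show m + 1 + 1 = m + 2 from rfl] at this
  omega

lemma divDiv_matFun (σ : MatPoly) : divDiv pd (matFun σ) = polyFun (divDivP σ) := by
  have hm : ∀ i, divM pd (matFun σ) i = polyFun (divM pdP σ i) := by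
    intro i
    simp only [divM, divV, matFun, Matrix.of_apply, pd_polyFun]
    funext x
    simp [polyFun]
  show divV pd (divM pd (matFun σ)) = _
  rw [divV, hm, hm, pd_polyFun, pd_polyFun]
  funext x
  simp [polyFun, divDivP, divDiv, divV]

lemma symCurl_vecFun (u : VecPoly) : symCurl pd (vecFun u) = matFun (symCurlP u) := by
  obtain ⟨h1, h2, h3, h4⟩ := symCurlP_entries u
  obtain ⟨g1, g2, g3, g4⟩ := symCurl_entries (vecFun u)
  have hv : ∀ i j, pd j (vecFun u i) = polyFun (pdP j (u i)) := fun i j => pd_polyFun _ _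
  simp only [hv] at g1 g2 g3 g4
  ext1 i j
  funext x
  fin_cases i <;> fin_cases j
  · simp [g1, h1, matFun, polyFun]
  · simp [g3, h3, matFun, polyFun]
  · simp [g4, h4, matFun, polyFun]
  · simp [g2, h2, matFun, polyFun]

/-- The Stokes formula on polynomials, freed of the bases by the injectivity of `curEquiv`. It makes
`div div` of a bubble orthogonal to `P₁`. -/
lemma triPair_divDivP (ψ : Module.Basis (Fin 3) ℝ (polyLE 1)) (z : Module.Basis (Fin 3) ℝ RT2)
    (hf : IsTri f) (he : ∀ e ∈ f.powersetCard 2, o.IsEdge e) (σ : MatPoly) :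
    triPair f (divDivP σ) = ∑ e ∈ f.powersetCard 2, o.incF e f • edgePair o e (trFE1 o e σ) := by
  apply (curEquiv ψ z).injective
  have h := stokes_triangle (ψ := ψ) (z := z) (o := o) hf he (σ := matFun σ)
    (fun i j => contDiff_polyFun _)
  rw [divDiv_matFun, current_F_polyFun] at h
  rw [h, map_sum]
  exact Finset.sum_congr rfl fun e hE => by rw [current_E_matFun ψ z (he e hE), map_smul]

lemma divDivP_mem_orthP1 (ψ : Module.Basis (Fin 3) ℝ (polyLE 1))
    (z : Module.Basis (Fin 3) ℝ RT2) (hf : IsTri f) (he : ∀ e ∈ f.powersetCard 2, o.IsEdge e)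
    {k : ℕ} {σ : MatPoly} (hσ : σ ∈ bubbleF (huMaZhang o k).S1 f) :
    divDivP σ ∈ orthP1 f (k - 3) := by
  obtain ⟨⟨h1, h2⟩, h3, h4⟩ := mem_bubbleF1.1 hσ
  have h5 := divDivP_mem h2
  rw [Nat.sub_sub, show 1 + 2 = 3 from rfl] at h5
  refine ⟨h5, ?_⟩
  rw [SetLike.mem_coe, LinearMap.mem_ker, triPair_divDivP ψ z hf he]
  exact Finset.sum_eq_zero fun e hE => by rw [h3 e hE, map_zero, smul_zero]

/-- Symmetric matrices. -/
def symMat : Submodule ℝ Mat2 where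
  carrier := {M | M.IsSymm}
  zero_mem' := Matrix.isSymm_zero
  add_mem' := fun ha hb => Matrix.IsSymm.add ha hb
  smul_mem' := fun c _ ha => Matrix.IsSymm.smul ha c

lemma finrank_symMat_le : finrank ℝ symMat ≤ 3 := by
  let Φ : symMat →ₗ[ℝ] (Fin 3 → ℝ) :=
    { toFun := fun M => ![M.1 0 0, M.1 0 1, M.1 1 1]
      map_add' := fun a b => by ext i; fin_cases i <;> rfl
      map_smul' := fun a b => by ext i; fin_cases i <;> rfl }
  have hi : Function.Injective Φ := by
    intro M N h
    have h0 : M.1 0 0 = N.1 0 0 := congrFun h 0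
    have h1 : M.1 0 1 = N.1 0 1 := congrFun h 1
    have h2 : M.1 1 1 = N.1 1 1 := congrFun h 2
    ext i j
    fin_cases i <;> fin_cases j
    · exact h0
    · exact h1
    · exact (M.2.apply 0 1).trans (h1.trans (N.2.apply 0 1).symm)
    · exact h2
  simpa using LinearMap.finrank_le_finrank_of_injective hi

/-- Traces of symmetric fields are symmetric, although all matrices are admitted at a vertex, and
constant fields realize every symmetric matrix. -/
lemma bubbleV1_eq {k : ℕ} (x : Plane) : bubbleV (huMaZhang o k).S1 f x = symMat := by
  apply le_antisymm
  · rintro _ ⟨σ, hσ, rfl⟩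
    ext i j
    exact congrArg (evalAt x) (hσ.1.apply i j)
  · intro M hM
    refine ⟨M.map C, ⟨?_, fun i j => C_mem_polyLE _ _⟩, ?_⟩
    · ext1 i j
      exact congrArg C (hM.apply i j)
    · ext i j
      exact evalAt_C _ _

/-- Rank-nullity for `div div` on bubbles: the kernel is the image of the bubbles in degree 0. The
rank `r` is kept as a separate number because the count in `unisolvence1` determines it. -/
lemma finrank_bubbleF1_le (ψ : Module.Basis (Fin 3) ℝ (polyLE 1))
    (z : Module.Basis (Fin 3) ℝ RT2) (hf : IsTri f) (he : ∀ e ∈ f.powersetCard 2, o.IsEdge e)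
    (j : ℕ) : ∃ r ≤ finrank ℝ (orthP1 f (j + 1)),
    finrank ℝ ((bubbleF (huMaZhang o (j + 4)).S1 f).map divDivP) = r ∧
    finrank ℝ (bubbleF (huMaZhang o (j + 4)).S1 f) ≤ (j + 2) * j + r := by
  set B := bubbleF (huMaZhang o (j + 4)).S1 f
  have fB : FiniteDimensional ℝ B := by unfold B bubbleF; infer_instance
  have fB0 : FiniteDimensional ℝ (bubbleF (huMaZhang o (j + 4)).S0 f) := by
    unfold bubbleF; infer_instance
  refine ⟨_, Submodule.finrank_mono ?_, rfl, ?_⟩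
  · rintro _ ⟨σ, hσ, rfl⟩
    have h := divDivP_mem_orthP1 ψ z hf he hσ
    rwa [show j + 4 - 3 = j + 1 by omega] at h
  have h := LinearMap.finrank_range_add_finrank_ker (divDivP.domRestrict B)
  rw [LinearMap.range_domRestrict] at h
  have hk : finrank ℝ (LinearMap.ker (divDivP.domRestrict B)) ≤ (j + 2) * j := by
    have h2 := LinearEquiv.finrank_eq (Submodule.equivMapOfInjective _ B.injective_subtype
      (LinearMap.ker (divDivP.domRestrict B)))
    rw [h2]
    refine le_trans (le_trans (Submodule.finrank_mono ?_) (Submodule.finrank_map_le symCurlP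
      (bubbleF (huMaZhang o (j + 4)).S0 f))) (finrank_bubbleF0_le hf he j)
    rintro _ ⟨⟨σ, hσ⟩, h, rfl⟩
    obtain ⟨u, hu, hus⟩ := exists_bubble_of_divDiv_eq_zero hf he (by omega) hσ h
    exact ⟨u, hu, hus⟩
  omega

/-- Unisolvence in degree `1`, and the range of `div div` on bubble functions. -/
theorem unisolvence1 (ψ : Module.Basis (Fin 3) ℝ (polyLE 1)) (z : Module.Basis (Fin 3) ℝ RT2)
    (hf : IsTri f) (he : ∀ e ∈ f.powersetCard 2, o.IsEdge e) {k : ℕ} (hk : 4 ≤ k) :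
    (finrank ℝ (bubbleF (huMaZhang o k).S1 f) +
      ∑ e ∈ f.powersetCard 2, finrank ℝ (bubbleE (huMaZhang o k).S1 f e) +
      ∑ x ∈ f, finrank ℝ (bubbleV (huMaZhang o k).S1 f x) =
        finrank ℝ ((huMaZhang o k).S1.AF f)) ∧
    (∀ e ∈ f.powersetCard 2, bubbleE (huMaZhang o k).S1 f e = edgeBubble1 o k e) ∧
    (∀ a : Finset Plane → Edge3, (∀ e ∈ f.powersetCard 2, a e ∈ edgeBubble1 o k e) →
      ∃ σ ∈ symPolyLE (k - 1), (∀ x ∈ f, trFV1 x σ = 0) ∧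
        ∀ e ∈ f.powersetCard 2, trFE1 o e σ = a e) ∧
    (bubbleF (huMaZhang o k).S1 f).map divDivP = orthP1 f (k - 3) := by
  obtain ⟨j, rfl⟩ := Nat.exists_eq_add_of_le' hk
  have hfin : 2 * finrank ℝ ((huMaZhang o (j + 4)).S1.AF f) = 3 * ((j + 3 + 1) * (j + 3 + 2)) :=
    finrank_symPolyLE _
  obtain ⟨r, hr, hrr, hB⟩ := finrank_bubbleF1_le ψ z hf he j
  have ho := finrank_orthP1 hf (m := j + 1) (by omega)
  have hj : 3 * (j + 4) - 5 = 3 * j + 7 := by omega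
  -- With `r` at its bound `(j² + 5 j) / 2`, the count `(j + 2) j + r + 3 (3 j + 7) + 9` equals `3
  -- (j + 4)(j + 5) / 2`, the dimension of the shape functions.
  obtain ⟨hF, hE, hV, hA, hiV, hiE⟩ := trace_squeeze (S := (huMaZhang o (j + 4)).S1) (f := f)
    (nF := (j + 2) * j + r) (nE := 3 * (j + 4) - 5) (nV := 3)
    (fun e hE x hx u _ h => trEV1_trFE1 (he e hE) hx h) hf.2 hB
    (fun e hE => (Submodule.finrank_mono bubbleE1_le).trans (finrank_edgeBubble1_le (he e hE) hk))
    (fun x _ => by rw [bubbleV1_eq]; exact finrank_symMat_le)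
    (by rw [hj]; nlinarith)
  have hbE : ∀ e ∈ f.powersetCard 2, bubbleE (huMaZhang o (j + 4)).S1 f e =
      edgeBubble1 o (j + 4) e := fun e h => by
    apply Submodule.eq_of_le_of_finrank_le bubbleE1_le
    rw [hE e h]
    exact finrank_edgeBubble1_le (he e h) hk
  refine ⟨?_, hbE, fun a ha => ?_, ?_⟩
  · rw [hA]
    exact finrank_sum_eq hf.2 hF hE hV
  · obtain ⟨u, hu, h⟩ := hiE a fun e h => by rw [hbE e h]; exact ha e h
    exact ⟨u, hu, h⟩
  · apply Submodule.eq_of_le_of_finrank_le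
    · rintro _ ⟨σ, hσ, rfl⟩
      exact divDivP_mem_orthP1 ψ z hf he hσ
    -- The equality of dimensions leaves no slack for `r`: it must be the full dimension of the
    -- polynomials orthogonal to `P₁`.
    · rw [hrr, show j + 4 - 3 = j + 1 by omega]
      rw [hj] at hA
      nlinarith

/-- Exactness of the bubble complex of a triangle. -/
theorem exact_bubbleF (ψ : Module.Basis (Fin 3) ℝ (polyLE 1)) (z : Module.Basis (Fin 3) ℝ RT2)
    (hf : IsTri f) (he : ∀ e ∈ f.powersetCard 2, o.IsEdge e) {k : ℕ} (hk : 4 ≤ k) :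
    IsExactSeq (bubbleF (huMaZhang o k).S0 f) (bubbleF (huMaZhang o k).S1 f) (orthP1 f (k - 3))
      symCurlP divDivP := by
  obtain ⟨a, ha⟩ : f.Nonempty := Finset.card_pos.1 (by rw [hf.2]; norm_num)
  refine ⟨?_, ?_, (unisolvence1 ψ z hf he hk).2.2.2⟩
  · rw [eq_bot_iff]
    rintro u ⟨hu, h⟩
    exact RT2_eq_zero_of_jet (symCurlP_eq_zero_iff.1 h) ((mem_bubbleF0.1 hu).2.2 a ha)
  · apply le_antisymm
    · rintro σ ⟨hσ, h⟩
      obtain ⟨u, hu, hus⟩ := exists_bubble_of_divDiv_eq_zero hf he (by omega) hσ h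
      exact ⟨u, hu, hus⟩
    · rintro _ ⟨u, hu, rfl⟩
      exact ⟨symCurlP_mem_bubbleF1 he hu, divDivP_symCurlP u⟩

end LocalDimensions

/-! ## Exactness on edges and at vertices -/

section EdgeExactness

open Module Polynomial

variable {K : Geometry.SimplicialComplex ℝ Plane} {o : EdgeOrientation K} {e f : Finset Plane}

lemma mem_degreeLE_iff {m : ℕ} {p : ℝ[X]} : p ∈ degreeLE ℝ (m : ℕ) ↔ p.natDegree ≤ m := by
  rw [mem_degreeLE, natDegree_le_iff_degree_le]

lemma derivative_mem_degreeLE {m : ℕ} {p : ℝ[X]} (hp : p ∈ degreeLE ℝ (m : ℕ)) :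
    p.derivative ∈ degreeLE ℝ ((m - 1 : ℕ) : ℕ) := by
  rw [mem_degreeLE_iff] at hp ⊢
  have := natDegree_derivative_le p
  omega

lemma exists_antiderivative {m : ℕ} {p : ℝ[X]} (hp : p ∈ degreeLE ℝ (m : ℕ)) :
    ∃ q ∈ degreeLE ℝ ((m + 1 : ℕ) : ℕ), q.derivative = p ∧ q.eval 0 = 0 := by
  refine ⟨∑ i ∈ Finset.range (m + 1), monomial (i + 1) (p.coeff i / (i + 1)), ?_, ?_, ?_⟩
  · refine Submodule.sum_mem _ fun i hi => ?_
    rw [mem_degreeLE_iff]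
    have := Finset.mem_range.1 hi
    exact (natDegree_monomial_le _).trans (by omega)
  · rw [mem_degreeLE_iff] at hp
    conv_rhs => rw [p.as_sum_range' (m + 1) (by omega)]
    rw [derivative_sum]
    refine Finset.sum_congr rfl fun i _ => ?_
    rw [derivative_monomial]
    have : (i : ℝ) + 1 ≠ 0 := by positivity
    congr 1
    push_cast
    field_simp
  · rw [eval_finsetSum]
    exact Finset.sum_eq_zero fun i _ => by simp [eval_monomial]

lemma polyInt_derivative (l : ℝ) (p : ℝ[X]) : polyInt l p.derivative = p.eval l - p.eval 0 := by
  rw [polyInt_apply]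
  exact intervalIntegral.integral_eq_sub_of_hasDerivAt (fun x _ => p.hasDerivAt x)
    (p.derivative.continuous.intervalIntegrable _ _)

lemma eq_zero_of_derivative_eq_zero {p : ℝ[X]} (h : p.derivative = 0) {a : ℝ} (h0 : p.eval a = 0) :
    p = 0 := by
  rw [eq_C_of_derivative_eq_zero h] at h0 ⊢
  rw [eval_C] at h0
  rw [h0, map_zero]

lemma restr_directional (p : polyLE 1) :
    ∃ c d : ℝ, o.restr e (o.nrm e 0 • pdP 0 p.1 + o.nrm e 1 • pdP 1 p.1) = C c ∧
      o.restr e (o.tang e 0 • pdP 0 p.1 + o.tang e 1 • pdP 1 p.1) = C d ∧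
      (o.restr e p.1).derivative = C d := by
  obtain ⟨a, ha⟩ := pdP_of_mem_polyLE_one p.2 0
  obtain ⟨b, hb⟩ := pdP_of_mem_polyLE_one p.2 1
  refine ⟨o.nrm e 0 * a + o.nrm e 1 * b, o.tang e 0 * a + o.tang e 1 * b, ?_, ?_, ?_⟩ <;>
  simp [derivative_restr, ha, hb, restr_C, smul_eq_C_mul]

/-- The integrand is the derivative of `½ a₂ φ - a₀ ∂ₙφ - a₁ ∂ₜφ`, which vanishes at both end
points. -/
lemma edgePair_edgeOp (a : Edge3) (h0 : a.1.eval 0 = 0 ∧ a.2.1.eval 0 = 0 ∧ a.2.2.eval 0 = 0)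
    (h1 : a.1.eval (o.len e) = 0 ∧ a.2.1.eval (o.len e) = 0 ∧ a.2.2.eval (o.len e) = 0) :
    edgePair o e (edgeOp a) = 0 := by
  ext p
  obtain ⟨c, d, hc, hd, hd'⟩ := restr_directional (o := o) (e := e) p
  rw [edgePair_apply, hc, hd]
  have : (edgeOp a).2.2 * o.restr e p.1 - ((edgeOp a).1 * C c + (edgeOp a).2.1 * C d) =
      (C (1 / 2) * a.2.2 * o.restr e p.1 - C c * a.1 - C d * a.2.1).derivative := by
    simp only [edgeOp, LinearMap.coe_mk, AddHom.coe_mk, derivative_sub, derivative_mul,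
      derivative_C, hd', smul_eq_C_mul]
    ring
  rw [this, polyInt_derivative]
  simp [h0, h1]

/-- The arclength coordinate of an edge, as a polynomial on the plane. -/
def coordP (o : EdgeOrientation K) (e : Finset Plane) : polyLE 1 :=
  ⟨MvPolynomial.C (-(o.start e 0 * o.tang e 0 + o.start e 1 * o.tang e 1)) +
    MvPolynomial.C (o.tang e 0) * MvPolynomial.X 0 + MvPolynomial.C (o.tang e 1) * MvPolynomial.X 1,
    Submodule.add_mem _ (Submodule.add_mem _ (C_mem_polyLE _ _)
      (mul_mem_polyLE (C_mem_polyLE _ 0) (X_mem_polyLE 0 le_rfl) le_rfl))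
      (mul_mem_polyLE (C_mem_polyLE _ 0) (X_mem_polyLE 1 le_rfl) le_rfl)⟩

/-- The signed distance from an edge, as a polynomial on the plane. -/
def distP (o : EdgeOrientation K) (e : Finset Plane) : polyLE 1 :=
  ⟨MvPolynomial.C (-(o.start e 0 * o.nrm e 0 + o.start e 1 * o.nrm e 1)) +
    MvPolynomial.C (o.nrm e 0) * MvPolynomial.X 0 + MvPolynomial.C (o.nrm e 1) * MvPolynomial.X 1,
    Submodule.add_mem _ (Submodule.add_mem _ (C_mem_polyLE _ _)
      (mul_mem_polyLE (C_mem_polyLE _ 0) (X_mem_polyLE 0 le_rfl) le_rfl))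
      (mul_mem_polyLE (C_mem_polyLE _ 0) (X_mem_polyLE 1 le_rfl) le_rfl)⟩

/-- The conditions on a triple to be in the kernel of the current. -/
lemma moments_of_edgePair_eq_zero (he : o.IsEdge e) {a : Edge3} (h : edgePair o e a = 0) :
    polyInt (o.len e) a.2.2 = 0 ∧ polyInt (o.len e) a.1 = 0 ∧
      polyInt (o.len e) (a.2.2 * X - a.2.1) = 0 := by
  have ht : C (o.tang e 0) ^ 2 + C (o.tang e 1) ^ 2 = (1 : ℝ[X]) := by
    rw [← map_pow, ← map_pow, ← map_add, he.tang_sq, map_one]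
  have hp := fun p => LinearMap.congr_fun h p
  simp only [edgePair_apply, LinearMap.zero_apply] at hp
  refine ⟨?_, ?_, ?_⟩
  -- The three moments arise from the test functions `1`, the signed distance and the arclength
  -- coordinate.
  · have := hp ⟨1, by simpa using C_mem_polyLE 1 1⟩
    have h1 : ∀ i, pdP i (1 : Poly) = 0 := fun i => by
      rw [← map_one MvPolynomial.C, pdP_C]
    simpa [h1, restr_one] using this
  · have := hp (distP o e)
    have h0 : pdP 0 (distP o e).1 = MvPolynomial.C (o.nrm e 0) := by
      simp only [distP, pdP_add, pdP_mul, pdP_C, pdP_X]; simp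
    have h1 : pdP 1 (distP o e).1 = MvPolynomial.C (o.nrm e 1) := by
      simp only [distP, pdP_add, pdP_mul, pdP_C, pdP_X]; simp
    have h2 : o.restr e (distP o e).1 = 0 := by
      simp only [distP, map_add, restr_mul, restr_C, restr_X, nrm_zero, nrm_one, map_neg, map_mul]
      ring
    rw [h0, h1, h2] at this
    simp only [map_add, map_smul, restr_C, smul_eq_C_mul, nrm_zero, nrm_one, map_neg] at this
    rw [← neg_eq_zero, ← map_neg, ← this]
    congr 1
    linear_combination a.1 * ht
  · have := hp (coordP o e)
    have h0 : pdP 0 (coordP o e).1 = MvPolynomial.C (o.tang e 0) := by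
      simp only [coordP, pdP_add, pdP_mul, pdP_C, pdP_X]; simp
    have h1 : pdP 1 (coordP o e).1 = MvPolynomial.C (o.tang e 1) := by
      simp only [coordP, pdP_add, pdP_mul, pdP_C, pdP_X]; simp
    have h2 : o.restr e (coordP o e).1 = X := by
      simp only [coordP, map_add, restr_mul, restr_C, restr_X, map_neg, map_mul]
      linear_combination X * ht
    rw [h0, h1, h2] at this
    simp only [map_add, map_smul, restr_C, smul_eq_C_mul, nrm_zero, nrm_one, map_neg] at this
    rw [← this]
    congr 1
    linear_combination a.2.1 * ht

/-- Exactness of the bubble complex of an edge. -/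
theorem exact_edge (he : o.IsEdge e) {k : ℕ} (hk : 4 ≤ k) (B : Submodule ℝ PUnit) :
    IsExactSeq (edgeBubble0 o k e) (edgeBubble1 o k e ⊓ LinearMap.ker (edgePair o e)) B
      edgeOp 0 := by
  refine ⟨?_, ?_, Subsingleton.elim _ _⟩
  · rw [eq_bot_iff]
    rintro a ⟨ha, h⟩
    obtain ⟨-, ⟨a1, a2, a3, a4, a5⟩, -⟩ := (mem_edgeBubble0 he).1 ha
    have h1 : a.1.derivative = 0 := congrArg Prod.fst h
    have h2 : a.2.1.derivative - (1 / 2 : ℝ) • a.2.2 = 0 := congrArg (fun b => b.2.1) h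
    have h3 : (1 / 2 : ℝ) • a.2.2.derivative = 0 := congrArg (fun b => b.2.2) h
    have h22 : a.2.2 = 0 := eq_zero_of_derivative_eq_zero
      ((smul_eq_zero.1 h3).resolve_left (by norm_num)) a5
    rw [h22, smul_zero, sub_zero] at h2
    exact Prod.ext (eq_zero_of_derivative_eq_zero h1 a1)
      (Prod.ext (eq_zero_of_derivative_eq_zero h2 a2) h22)
  · apply le_antisymm
    · rintro b ⟨⟨hb, hL⟩, -⟩
      obtain ⟨⟨d0, d1, d2⟩, ⟨b1, b2⟩, ⟨b3, b4⟩⟩ := (mem_edgeBubble1 he).1 hb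
      obtain ⟨m2, m0, m1⟩ := moments_of_edgePair_eq_zero he hL
      -- The preimage is `(p, q, 2 r)`: `p` and `r` integrate the first and third components, and
      -- then `q` integrates the second one plus `r`, since the operator subtracts half of the third
      -- component.
      obtain ⟨p, hp, hp', hp0⟩ := exists_antiderivative d0
      obtain ⟨r, hr, hr', hr0⟩ := exists_antiderivative d2
      have hk1 : k - 1 + 1 = k := by omega
      have hk2 : k - 2 + 1 = k - 1 := by omega
      rw [hk1] at hp
      rw [hk2] at hr
      obtain ⟨q, hq, hq', hq0⟩ := exists_antiderivative (Submodule.add_mem _ d1 hr)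
      rw [hk1] at hq
      have hpl : p.eval (o.len e) = 0 := by
        have := polyInt_derivative (o.len e) p
        rw [hp', m0, hp0] at this
        linarith
      have hrl : r.eval (o.len e) = 0 := by
        have := polyInt_derivative (o.len e) r
        rw [hr', m2, hr0] at this
        linarith
      -- Since `r` vanishes at the far end, `q` there equals `q - s r`, and the derivative of this
      -- difference is minus the integrand of the last moment.
      have hql : q.eval (o.len e) = 0 := by
        have := polyInt_derivative (o.len e) (q - X * r)
        have e1 : (q - X * r).derivative = -(b.2.2 * X - b.2.1) := by
          rw [derivative_sub, derivative_mul, hq', hr', derivative_X]; ring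
        rw [e1, map_neg, m1] at this
        simp [hq0, hrl] at this
        linarith
      refine ⟨(p, q, (2 : ℝ) • r), (mem_edgeBubble0 he).2 ⟨⟨hp, hq, Submodule.smul_mem _ _ hr⟩,
        ⟨hp0, hq0, ?_, ?_, ?_⟩, ⟨hpl, hql, ?_, ?_, ?_⟩⟩, ?_⟩
      · simp only [hp', b1]
      · simp only [hq', eval_add, b2, hr0, add_zero]
      · simp [hr0]
      · simp only [hp', b3]
      · simp only [hq', eval_add, b4, hrl, add_zero]
      · simp [hrl]
      · refine Prod.ext hp' (Prod.ext ?_ ?_)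
        · show q.derivative - (1 / 2 : ℝ) • (2 : ℝ) • r = _
          rw [hq', smul_smul]; norm_num
        · show (1 / 2 : ℝ) • ((2 : ℝ) • r).derivative = _
          rw [derivative_smul, hr', smul_smul]; norm_num
    · rintro _ ⟨a, ha, rfl⟩
      obtain ⟨⟨d0, d1, d2⟩, ⟨a1, a2, a3, a4, a5⟩, ⟨b1, b2, b3, b4, b5⟩⟩ := (mem_edgeBubble0 he).1 ha
      refine ⟨⟨(mem_edgeBubble1 he).2 ⟨⟨derivative_mem_degreeLE d0, ?_, ?_⟩, ⟨a3, ?_⟩, ⟨b3, ?_⟩⟩,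
        edgePair_edgeOp a ⟨a1, a2, a5⟩ ⟨b1, b2, b5⟩⟩, rfl⟩
      · exact Submodule.sub_mem _ (derivative_mem_degreeLE d1) (Submodule.smul_mem _ _ d2)
      · exact Submodule.smul_mem _ _ (derivative_mem_degreeLE d2)
      · simp [edgeOp, a4, a5]
      · simp [edgeOp, b4, b5]

/-- Exactness of the bubble complex of a vertex. -/
theorem exact_vertex (x : Plane) (B : Submodule ℝ PUnit) :
    IsExactSeq (⊤ ⊓ LinearMap.ker (jetPair x)) symMat B jetOp 0 := by
  refine ⟨?_, ?_, Subsingleton.elim _ _⟩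
  · rw [eq_bot_iff]
    rintro j ⟨⟨-, hL⟩, h⟩
    have h00 := congrFun (congrFun h 0) 0
    have h01 := congrFun (congrFun h 0) 1
    have h11 := congrFun (congrFun h 1) 1
    simp [jetOp] at h00 h01 h11
    have hp := fun p => LinearMap.congr_fun hL p
    simp only [jetPair_apply, LinearMap.zero_apply] at hp
    -- Pairing with `1` makes the gradient trace free, and then the coordinate functions give the
    -- value zero. The kernel of `jetOp` consists of multiples of the identity, so nothing is left.
    have p1 := hp ⟨1, by simpa using C_mem_polyLE 1 1⟩
    have p2 := hp ⟨MvPolynomial.X 0, X_mem_polyLE 0 le_rfl⟩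
    have p3 := hp ⟨MvPolynomial.X 1, X_mem_polyLE 1 le_rfl⟩
    have h1 : ∀ i, pdP i (1 : Poly) = 0 := fun i => by
      rw [← map_one MvPolynomial.C, pdP_C]
    simp [h1, evalAt_one] at p1
    simp [pdP_X, evalAt_one, evalAt_X, p1] at p2 p3
    ext i l
    · fin_cases i
      · exact p2
      · exact p3
    · fin_cases i <;> fin_cases l <;> simp <;> linarith
  · apply le_antisymm
    · rintro M ⟨hM, -⟩
      have hs : M 1 0 = M 0 1 := hM.apply 0 1
      -- The preimage has value zero and a trace free gradient, so it lies in the kernel of the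
      -- current.
      refine ⟨(0, !![M 0 1, -M 0 0; M 1 1, -M 0 1]), ⟨trivial, ?_⟩, ?_⟩
      · rw [SetLike.mem_coe, LinearMap.mem_ker]
        ext p
        simp [jetPair_apply]
      · ext i l
        fin_cases i <;> fin_cases l <;> simp [jetOp, hs] <;> ring
    · rintro _ ⟨j, -, rfl⟩
      refine ⟨?_, rfl⟩
      ext i l
      fin_cases i <;> fin_cases l <;> simp [jetOp] <;> ring

end EdgeExactness

/-! ## Generalized currents and compatibility -/

section Currents

open Module MvPolynomial

variable {K : Geometry.SimplicialComplex ℝ Plane} {o : EdgeOrientation K} {e f : Finset Plane}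

lemma isTri_of_mem (hf : f ∈ triangles K) : IsTri f := ⟨K.indep hf.1, hf.2⟩

lemma mem_faces_of_mem_powersetCard (hf : f ∈ triangles K) (he : e ∈ f.powersetCard 2) :
    e ∈ K.faces := by
  obtain ⟨h1, h2⟩ := Finset.mem_powersetCard.1 he
  exact K.down_closed hf.1 h1 (Finset.card_pos.1 (by omega))

lemma isEdge_of_mem_powersetCard (hf : f ∈ triangles K) (e : Finset Plane)
    (he : e ∈ f.powersetCard 2) : o.IsEdge e :=
  isEdge_of_mem_faces (mem_faces_of_mem_powersetCard hf he) (Finset.mem_powersetCard.1 he).2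

lemma exists_triangle_of_edge (hp : ∀ s ∈ K.faces, ∃ f ∈ triangles K, s ⊆ f) (he : e ∈ K.faces)
    (hc : e.card = 2) : ∃ f ∈ triangles K, e ∈ f.powersetCard 2 := by
  obtain ⟨f, hf, h⟩ := hp e he
  exact ⟨f, hf, Finset.mem_powersetCard.2 ⟨h, hc⟩⟩

variable (o e) in
/-- The density of the current on an edge, against an affine function. -/
def edgeDensity (p : Poly) (σ : Matrix (Fin 2) (Fin 2) (Plane → ℝ)) (s : ℝ) : ℝ :=
  (∑ j, divM pd σ j (o.param e s) * o.nrm e j) * polyFun p (o.param e s) -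
      ∑ j, (∑ l, σ j l (o.param e s) * o.nrm e l) * polyFun (pdP j p) (o.param e s)

lemma continuous_edgeDensity (p : Poly) {σ : Matrix (Fin 2) (Fin 2) (Plane → ℝ)}
    (hσ : ∀ i j, ContDiff ℝ ∞ (σ i j)) : Continuous (edgeDensity o e p σ) := by
  have hc := continuous_param (o := o) (e := e)
  have h1 := fun j => (contDiff_divM hσ j).continuous.comp hc
  have h2 := fun j l => (hσ j l).continuous.comp hc
  have h3 := fun q : Poly => (contDiff_polyFun q).continuous.comp hc
  unfold edgeDensity
  refine Continuous.sub (Continuous.mul ?_ (h3 p)) ?_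
  · exact continuous_finsetSum _ fun j _ => (h1 j).mul continuous_const
  · exact continuous_finsetSum _ fun j _ => (continuous_finsetSum _ fun l _ =>
      (h2 j l).mul continuous_const).mul (h3 _)

lemma edgeDensity_add (p : Poly) {σ τ : Matrix (Fin 2) (Fin 2) (Plane → ℝ)}
    (hσ : ∀ i j, ContDiff ℝ ∞ (σ i j)) (hτ : ∀ i j, ContDiff ℝ ∞ (τ i j)) (s : ℝ) :
    edgeDensity o e p (σ + τ) s = edgeDensity o e p σ s + edgeDensity o e p τ s := by
  have h : ∀ j, divM pd (σ + τ) j = divM pd σ j + divM pd τ j := by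
    intro j
    simp only [divM, divV, Matrix.add_apply]
    rw [pd_add (hσ j 0) (hτ j 0), pd_add (hσ j 1) (hτ j 1)]
    abel
  simp only [edgeDensity, h, Matrix.add_apply, Pi.add_apply, Fin.sum_univ_two]
  ring

lemma edgeDensity_smul (p : Poly) (c : ℝ) {σ : Matrix (Fin 2) (Fin 2) (Plane → ℝ)}
    (hσ : ∀ i j, ContDiff ℝ ∞ (σ i j)) (s : ℝ) :
    edgeDensity o e p (c • σ) s = c * edgeDensity o e p σ s := by
  have h : ∀ j, divM pd (c • σ) j = c • divM pd σ j := by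
    intro j
    simp only [divM, divV, Matrix.smul_apply]
    rw [pd_smul (hσ j 0), pd_smul (hσ j 1), smul_add]
  simp only [edgeDensity, h, Matrix.smul_apply, Pi.smul_apply, Fin.sum_univ_two, smul_eq_mul]
  ring

variable (ψ : Module.Basis (Fin 3) ℝ (polyLE 1)) (z : Module.Basis (Fin 3) ℝ RT2)

/-- The current of a vertex as a linear map. -/
def currentV (x : Plane) : SmoothVec →ₗ[ℝ] RT2 :=
  (curEquiv ψ z).toLinearMap ∘ₗ jetPair x ∘ₗ
    { toFun := fun u => (fun i => u.1 i x, Matrix.of fun i j => pd j (u.1 i) x)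
      map_add' := fun u v => by
        ext i j
        · rfl
        · exact congrFun (pd_add (u.2 i) (v.2 i) j) x
      map_smul' := fun c u => by
        ext i j
        · rfl
        · exact congrFun (pd_smul (u.2 i) c j) x }

/-- The current of an edge as a linear map. -/
def currentE (o : EdgeOrientation K) (e : Finset Plane) : SmoothSym →ₗ[ℝ] RT2 where
  toFun σ := (divdivCurrents o ψ z).E e σ
  map_add' σ τ := by
    show ∑ i, (∫ s in (0 : ℝ)..(o.len e), edgeDensity o e (ψ i) (σ.1 + τ.1) s) • z i =
      ∑ i, (∫ s in (0 : ℝ)..(o.len e), edgeDensity o e (ψ i) σ.1 s) • z i +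
      ∑ i, (∫ s in (0 : ℝ)..(o.len e), edgeDensity o e (ψ i) τ.1 s) • z i
    rw [← Finset.sum_add_distrib]
    refine Finset.sum_congr rfl fun i _ => ?_
    rw [← add_smul, ← intervalIntegral.integral_add
      ((continuous_edgeDensity _ σ.2.2).intervalIntegrable _ _)
      ((continuous_edgeDensity _ τ.2.2).intervalIntegrable _ _)]
    simp only [edgeDensity_add _ σ.2.2 τ.2.2]
  map_smul' c σ := by
    show ∑ i, (∫ s in (0 : ℝ)..(o.len e), edgeDensity o e (ψ i) (c • σ.1) s) • z i =
      c • ∑ i, (∫ s in (0 : ℝ)..(o.len e), edgeDensity o e (ψ i) σ.1 s) • z i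
    rw [Finset.smul_sum]
    refine Finset.sum_congr rfl fun i _ => ?_
    rw [smul_smul, ← intervalIntegral.integral_const_mul]
    simp only [edgeDensity_smul _ c σ.2.2]

/-- The current of a triangle as a linear map. -/
def currentF (o : EdgeOrientation K) (f : Finset Plane) : SmoothScalar →ₗ[ℝ] RT2 where
  toFun q := (divdivCurrents o ψ z).F f q
  map_add' q r := by
    show ∑ i, (∫ x in convexHull ℝ (f : Set Plane), (q.1 x + r.1 x) * polyFun (ψ i) x) • z i =
      ∑ i, (∫ x in convexHull ℝ (f : Set Plane), q.1 x * polyFun (ψ i) x) • z i +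
      ∑ i, (∫ x in convexHull ℝ (f : Set Plane), r.1 x * polyFun (ψ i) x) • z i
    have hi : ∀ (g : SmoothScalar) i, MeasureTheory.IntegrableOn
        (fun x => g.1 x * polyFun (ψ i) x) (convexHull ℝ (f : Set Plane)) := fun g i =>
      integrableOn_hull ((show ContDiff ℝ ∞ g.1 from g.2).continuous.mul
        (contDiff_polyFun _).continuous) f
    rw [← Finset.sum_add_distrib]
    refine Finset.sum_congr rfl fun i _ => ?_
    rw [← add_smul, ← MeasureTheory.integral_add (hi q i) (hi r i)]
    simp only [add_mul]
  map_smul' c q := by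
    show ∑ i, (∫ x in convexHull ℝ (f : Set Plane), (c * q.1 x) * polyFun (ψ i) x) • z i =
      c • ∑ i, (∫ x in convexHull ℝ (f : Set Plane), q.1 x * polyFun (ψ i) x) • z i
    rw [Finset.smul_sum]
    refine Finset.sum_congr rfl fun i _ => ?_
    rw [smul_smul, ← MeasureTheory.integral_const_mul]
    simp only [mul_assoc]

/-- The quadratic bubble and an affine third component of `edgePair_bubble_surjective` fit into the
degrees `k - 1` and `k - 2`. -/
lemma exists_edge_moment (ψ : Module.Basis (Fin 3) ℝ (polyLE 1)) (z : Module.Basis (Fin 3) ℝ RT2)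
    (he : o.IsEdge e) {k : ℕ} (hk : 4 ≤ k) (w : RT2) :
    ∃ a ∈ edgeBubble1 o k e, curEquiv ψ z (edgePair o e a) = w := by
  obtain ⟨c, q, hq, h⟩ := edgePair_bubble_surjective he ((curEquiv ψ z).symm w)
  refine ⟨_, (mem_edgeBubble1 he).2 ⟨⟨?_, Submodule.zero_mem _, ?_⟩, ?_, ?_⟩, by
    rw [h, LinearEquiv.apply_symm_apply]⟩
  · rw [mem_degreeLE_iff]
    refine (Polynomial.natDegree_smul_le _ _).trans ?_
    have : (Polynomial.X * (Polynomial.C (o.len e) - Polynomial.X)).natDegree ≤ 1 + 1 :=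
      Polynomial.natDegree_mul_le_of_le Polynomial.natDegree_X_le
        ((Polynomial.natDegree_sub_le _ _).trans (by simp))
    omega
  · rw [mem_degreeLE_iff] at hq ⊢
    exact hq.trans (by omega)
  · simp
  · simp

/-- Polynomial fields suffice for surjectivity. For an edge, a field of the sequence with `k = 4` on
an adjacent triangle is used, whose trace on this edge is a bubble with the given current. -/
theorem isGeneralizedCurrents (hp : ∀ s ∈ K.faces, ∃ f ∈ triangles K, s ⊆ f) :
    IsGeneralizedCurrents K o (divdivCurrents o ψ z) where
  linV x _ := by
    refine ⟨currentV ψ z x, fun u => (current_V ψ z x u.1).symm, fun w => ?_⟩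
    obtain ⟨j, hj⟩ := jetPair_surjective x ((curEquiv ψ z).symm w)
    obtain ⟨u, -, hu⟩ := trFV0_surjective x j
    refine ⟨⟨vecFun u, fun i => contDiff_polyFun _⟩, ?_⟩
    have := current_V_vecFun (o := o) ψ z x u
    rw [current_V, hu, hj, LinearEquiv.apply_symm_apply] at this
    exact this
  linE e he hc := by
    classical
    refine ⟨currentE ψ z o e, fun _ => rfl, fun w => ?_⟩
    obtain ⟨f, hf, hef⟩ := exists_triangle_of_edge hp he hc
    have hE := isEdge_of_mem_powersetCard (o := o) hf
    obtain ⟨a, ha, haw⟩ := exists_edge_moment ψ z (hE e hef) le_rfl w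
    obtain ⟨σ, hσ, -, h⟩ := (unisolvence1 (k := 4) ψ z (isTri_of_mem hf) hE le_rfl).2.2.1
      (fun e' => if e' = e then a else 0) (fun e' _ => by
        split_ifs with h
        · rwa [h]
        · exact Submodule.zero_mem _)
    have hsm : matFun σ ∈ SmoothSym := by
      refine ⟨?_, fun i j => contDiff_polyFun _⟩
      ext1 i j
      exact congrArg polyFun (hσ.1.apply i j)
    refine ⟨⟨matFun σ, hsm⟩, ?_⟩
    show (divdivCurrents o ψ z).E e (matFun σ) = w
    rw [current_E_matFun ψ z (hE e hef), h e hef, if_pos rfl, haw]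
  linF f hf := by
    refine ⟨currentF ψ z o f, fun _ => rfl, fun w => ?_⟩
    obtain ⟨q, hq⟩ := triPair_surjective (isTri_of_mem hf) le_rfl ((curEquiv ψ z).symm w)
    refine ⟨⟨polyFun q.1, contDiff_polyFun _⟩, ?_⟩
    show (divdivCurrents o ψ z).F f (polyFun q.1) = w
    rw [current_F_polyFun]
    have hq' : triPair f q.1 = (curEquiv ψ z).symm w := hq
    rw [hq', LinearEquiv.apply_symm_apply]
  stokesE e he hc u hu := stokes_edge ψ z (isEdge_of_mem_faces he hc) hu
  stokesF f hf σ hσ := stokes_triangle ψ z (isTri_of_mem hf) (isEdge_of_mem_powersetCard hf) hσ.2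

lemma bubbleF2_eq {k : ℕ} : bubbleF (huMaZhang o k).S2 f = polyLE (k - 3) := by
  unfold bubbleF
  have h1 : (⨅ e ∈ f.powersetCard 2, LinearMap.ker ((huMaZhang o k).S2.trFE f e)) = ⊤ := by
    simp [huMaZhang]
  have h2 : (⨅ x ∈ f, LinearMap.ker ((huMaZhang o k).S2.trFV f x)) = ⊤ := by
    simp [huMaZhang]
  rw [h1, h2, inf_top_eq, inf_top_eq]
  rfl

lemma RT2_mem_polyLE {w : VecPoly} (hw : w ∈ RT2) {k : ℕ} (hk : 1 ≤ k) (i : Fin 2) :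
    w i ∈ polyLE k := by
  obtain ⟨a, b, rfl⟩ := hw
  exact Submodule.add_mem _ (C_mem_polyLE _ _)
    (mul_mem_polyLE (C_mem_polyLE _ 0) (X_mem_polyLE i le_rfl) (by omega))

/-- The localized currents are the pairings of traces with `P₁`, followed by the isomorphism
`curEquiv`, so their kernels are those of the pairings. -/
theorem isCompatible {k : ℕ} (hk : 4 ≤ k) :
    IsCompatible K (huMaZhang o k) (divdivCurrents o ψ z) := by
  refine ⟨fun w hw => ⟨fun f => mem_vecPolyLE.2 (RT2_mem_polyLE hw (by omega)),
    fun f g e _ _ => rfl, fun f g x _ _ => rfl⟩,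
    fun x => (curEquiv ψ z).toLinearMap ∘ₗ jetPair x,
    fun e => (curEquiv ψ z).toLinearMap ∘ₗ edgePair o e,
    fun f => (curEquiv ψ z).toLinearMap ∘ₗ triPair f,
    fun f _ x _ u _ => (current_V_vecFun ψ z x u).symm,
    fun f hf e he σ _ => (current_E_matFun ψ z (isEdge_of_mem_powersetCard hf e he) σ).symm,
    fun f _ q _ => (current_F_polyFun ψ z f q).symm, fun f hf => ?_, fun f hf e he => ?_,
    fun f hf x hx => ?_⟩
  · rw [bubbleF2_eq, LinearEquiv.ker_comp]
    exact exact_bubbleF ψ z (isTri_of_mem hf) (isEdge_of_mem_powersetCard hf) hk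
  · rw [(unisolvence0 (isTri_of_mem hf) (isEdge_of_mem_powersetCard hf) hk).2.1 e he,
      (unisolvence1 ψ z (isTri_of_mem hf) (isEdge_of_mem_powersetCard hf) hk).2.1 e he,
      LinearEquiv.ker_comp]
    exact exact_edge (isEdge_of_mem_powersetCard hf e he) hk _
  · rw [(unisolvence0 (o := o) (isTri_of_mem hf) (isEdge_of_mem_powersetCard hf) hk).2.2.1 x hx,
      bubbleV1_eq, LinearEquiv.ker_comp]
    exact exact_vertex x _

lemma hasGeometricDecomposition2 (k : ℕ) : HasGeometricDecomposition K (huMaZhang o k).S2 := by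
  intro f _
  rw [bubbleF2_eq]
  have h1 : ∀ B : Submodule ℝ PUnit, finrank ℝ B = 0 := fun B => finrank_zero_of_subsingleton
  simp only [h1, Finset.sum_const_zero, add_zero]
  rfl

end Currents

/-! ## Geometry of triangulations -/

section Geometry

open Filter Topology

variable {K : Geometry.SimplicialComplex ℝ Plane} {Ω : TopologicalSpace.Opens Plane}
  {o : EdgeOrientation K} {e f g : Finset Plane}

lemma exists_pos_of_eventually {p : Plane} {P : Plane → Prop} (h : ∀ᶠ q in 𝓝 p, P q) (v : Plane) :
    ∃ ε : ℝ, 0 < ε ∧ P (p + ε • v) := by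
  have ht : Tendsto (fun ε : ℝ => p + ε • v) (𝓝[>] 0) (𝓝 p) := by
    have : Tendsto (fun ε : ℝ => p + ε • v) (𝓝 0) (𝓝 (p + (0 : ℝ) • v)) :=
      (continuous_const.add (continuous_id.smul continuous_const)).tendsto 0
    rw [zero_smul, add_zero] at this
    exact this.mono_left nhdsWithin_le_nhds
  obtain ⟨ε, h1, h2⟩ := ((ht.eventually h).and self_mem_nhdsWithin).exists
  exact ⟨ε, h2, h1⟩

/-- A point with one nonzero barycentric coordinate is a vertex. -/
lemma eq_of_bary_eq_zero (hf : IsTri f) {p x : Plane} (hx : x ∈ f)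
    (h : ∀ y ∈ f, y ≠ x → bary f y p = 0) : p = x := by
  have h1 := sum_bary hf p
  have h2 := sum_bary_smul hf p
  rw [Finset.sum_eq_single_of_mem x hx h] at h1
  rw [Finset.sum_eq_single_of_mem x hx fun y hy hyx => by rw [h y hy hyx, zero_smul], h1,
    one_smul] at h2
  exact h2.symm

/-- If a second coordinate vanished, only one would be left and `p` would be a vertex. -/
lemma bary_pos_of_mem_edge [DecidableEq Plane] (hf : IsTri f) {y : Plane} (hy : y ∈ f) {p : Plane}
    (hp : p ∈ convexHull ℝ ((f.erase y : Finset Plane) : Set Plane)) (hpe : p ∉ f.erase y)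
    {x : Plane} (hx : x ∈ f.erase y) : 0 < bary f x p := by
  obtain ⟨h1, h2⟩ := (mem_face_hull_iff hf (Finset.erase_subset y f)).1 hp
  have hx' := Finset.mem_erase.1 hx
  refine lt_of_le_of_ne ((mem_hull_iff hf).1 h1 x hx'.2) fun h0 => hpe ?_
  have hc : ((f.erase y).erase x).card = 1 := by
    rw [Finset.card_erase_of_mem hx, Finset.card_erase_of_mem hy, hf.2]
  obtain ⟨w, hw⟩ := Finset.card_eq_one.1 hc
  have hw' : w ∈ (f.erase y).erase x := by rw [hw]; simp
  have hwe := Finset.mem_of_mem_erase hw'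
  have : p = w := by
    refine eq_of_bary_eq_zero hf (Finset.mem_of_mem_erase hwe) fun v hv hvw => ?_
    by_cases hvx : v = x
    · rw [hvx, ← h0]
    · apply h2 v hv
      intro hve
      have : v ∈ (f.erase y).erase x := Finset.mem_erase.2 ⟨hvx, hve⟩
      rw [hw, Finset.mem_singleton] at this
      exact hvw this
  rwa [this]

/-- Otherwise the height would vanish identically, but it is `1` at `start + n`. -/
lemma hgt_opposite_ne_zero [DecidableEq Plane] (hf : IsTri f) {y : Plane} (hy : y ∈ f)
    (he : o.IsEdge (f.erase y)) : o.hgt (f.erase y) y ≠ 0 := by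
  intro h
  have h1 := hgt_eq_bary hf hy he (o.start (f.erase y) + o.nrm (f.erase y))
  have ht := he.tang_sq
  rw [h, zero_mul, hgt_apply] at h1
  simp only [PiLp.add_apply, nrm_zero, nrm_one] at h1
  nlinarith

lemma bary_eq_hgt_div [DecidableEq Plane] (hf : IsTri f) {y : Plane} (hy : y ∈ f)
    (he : o.IsEdge (f.erase y)) (p : Plane) :
    bary f y p = o.hgt (f.erase y) p / o.hgt (f.erase y) y := by
  rw [hgt_eq_bary hf hy he p, mul_div_cancel_left₀ _ (hgt_opposite_ne_zero hf hy he)]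

lemma incF_eq [DecidableEq Plane] {y : Plane} (hy : y ∈ f)
    (he : o.IsEdge (f.erase y)) :
    o.incF (f.erase y) f = if 0 < o.hgt (f.erase y) y then -1 else 1 := by
  unfold EdgeOrientation.incF
  congr 1
  rw [eq_iff_iff]
  constructor
  · rintro ⟨c, hc, h⟩
    by_cases hcy : c = y
    · rw [hcy] at h; exact h
    · exact absurd (he.hgt_eq_zero (Finset.mem_erase.2 ⟨hcy, hc⟩)) h.ne'
  · exact fun h => ⟨y, hy, h⟩

/-- A point of two triangles is supported on common vertices. -/
lemma mem_of_bary_ne_zero (hf : f ∈ triangles K) (hg : g ∈ K.faces) {p x : Plane}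
    (hpf : p ∈ convexHull ℝ (f : Set Plane)) (hpg : p ∈ convexHull ℝ (g : Set Plane)) (hx : x ∈ f)
    (h : bary f x p ≠ 0) : x ∈ g := by
  classical
  have h1 := K.inter_subset_convexHull hf.1 hg ⟨hpf, hpg⟩
  rw [← Finset.coe_inter, mem_face_hull_iff (isTri_of_mem hf) Finset.inter_subset_left] at h1
  by_contra hxg
  exact h (h1.2 x hx fun h' => hxg (Finset.mem_inter.1 h').2)

lemma eq_of_interior_inter (hf : f ∈ triangles K) (hg : g ∈ triangles K) {p : Plane}
    (hpf : p ∈ interior (convexHull ℝ (f : Set Plane))) (hpg : p ∈ convexHull ℝ (g : Set Plane)) :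
    f = g := by
  refine Finset.eq_of_subset_of_card_le (fun x hx => ?_) (by rw [hf.2, hg.2])
  exact mem_of_bary_ne_zero hf hg.1 (interior_subset hpf) hpg hx
    ((mem_interior_hull_iff (isTri_of_mem hf)).1 hpf x hx).ne'

/-- An edge that contains no third vertex has points that are not vertices. -/
lemma exists_mem_hull_notMem (he : o.IsEdge e) : ∃ p ∈ convexHull ℝ (e : Set Plane), p ∉ e := by
  refine ⟨midpoint ℝ (o.start e) (o.finish e), ?_, ?_⟩
  · exact (convex_convexHull ℝ _).midpoint_mem (subset_convexHull ℝ _ he.start_mem)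
      (subset_convexHull ℝ _ he.finish_mem)
  · rw [he.mem_iff, midpoint_eq_left_iff, midpoint_eq_right_iff]
    simpa using he.2

/-- Near an inner point of an edge, a triangle is a half plane. -/
lemma eventually_mem_hull_edge [DecidableEq Plane] (hf : IsTri f) {y : Plane} (hy : y ∈ f)
    (he : o.IsEdge (f.erase y)) {p : Plane}
    (hp : p ∈ convexHull ℝ ((f.erase y : Finset Plane) : Set Plane)) (hpe : p ∉ f.erase y) :
    ∀ᶠ q in 𝓝 p, (q ∈ convexHull ℝ (f : Set Plane) ↔
      0 ≤ o.hgt (f.erase y) q / o.hgt (f.erase y) y) := by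
  have hp' := (mem_face_hull_iff hf (Finset.erase_subset y f)).1 hp
  filter_upwards [eventually_mem_hull_iff hf hp'.1] with q hq
  rw [hq, ← bary_eq_hgt_div hf hy he]
  constructor
  · exact fun h => h y hy (hp'.2 y hy (Finset.notMem_erase y f))
  · intro h x hx hx0
    by_cases hxy : x = y
    · rwa [hxy]
    · exact absurd hx0 (bary_pos_of_mem_edge hf hy hp hpe (Finset.mem_erase.2 ⟨hxy, hx⟩)).ne'

/-- Two triangles lie on opposite sides of a common edge. -/
lemma opposite_sides [DecidableEq Plane] (hf : f ∈ triangles K) (hg : g ∈ triangles K)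
    (hfg : f ≠ g) {y y' : Plane} (hy : y ∈ f) (hy' : y' ∈ g) (hyy : f.erase y = g.erase y')
    (he : o.IsEdge (f.erase y)) : o.hgt (f.erase y) y * o.hgt (f.erase y) y' < 0 := by
  have tf := isTri_of_mem hf
  have tg := isTri_of_mem hg
  have h1 := hgt_opposite_ne_zero tf hy he
  have h2 : o.hgt (f.erase y) y' ≠ 0 := by
    have := hgt_opposite_ne_zero (o := o) tg hy' (hyy ▸ he)
    rwa [← hyy] at this
  by_contra hcon
  have hpos : 0 < o.hgt (f.erase y) y * o.hgt (f.erase y) y' :=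
    lt_of_le_of_ne (not_lt.1 hcon) (mul_ne_zero h1 h2).symm
  obtain ⟨p, hp, hpe⟩ := exists_mem_hull_notMem he
  have ev1 := eventually_mem_hull_edge tg hy' (hyy ▸ he) (hyy ▸ hp) (hyy ▸ hpe)
  rw [← hyy] at ev1
  have ev2 : ∀ᶠ q in 𝓝 p, ∀ x ∈ f.erase y, 0 < bary f x q := by
    rw [Filter.eventually_all_finset]
    intro x hx
    exact (continuous_bary x).continuousAt.eventually_const_lt (bary_pos_of_mem_edge tf hy hp hpe hx)
  -- An inner point of the edge is pushed slightly towards `y`. It enters the interior of `f`, and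
  -- if `y'` were on the same side it would also lie in `g`.
  obtain ⟨ε, hε, hq1, hq2⟩ := exists_pos_of_eventually (ev1.and ev2)
    (o.hgt (f.erase y) y • o.nrm (f.erase y))
  set q := p + ε • o.hgt (f.erase y) y • o.nrm (f.erase y) with hq
  have hp0 : o.hgt (f.erase y) p = 0 := by
    rw [hgt_eq_bary tf hy he, ((mem_face_hull_iff tf (Finset.erase_subset y f)).1 hp).2 y hy
      (Finset.notMem_erase y f), mul_zero]
  have hhq : o.hgt (f.erase y) q = ε * o.hgt (f.erase y) y := by
    have ht := he.tang_sq
    rw [hgt_apply] at hp0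
    rw [hgt_apply q]
    simp only [hq, PiLp.add_apply, PiLp.smul_apply, smul_eq_mul]
    rw [nrm_zero, nrm_one] at hp0 ⊢
    linear_combination hp0 + ε * o.hgt (f.erase y) y * ht
  have hqf : q ∈ interior (convexHull ℝ (f : Set Plane)) := by
    rw [mem_interior_hull_iff tf]
    intro x hx
    by_cases hxy : x = y
    · rw [hxy, bary_eq_hgt_div tf hy he, hhq, mul_div_cancel_right₀ _ h1]
      exact hε
    · exact hq2 x (Finset.mem_erase.2 ⟨hxy, hx⟩)
  refine hfg (eq_of_interior_inter hf hg hqf (hq1.2 ?_))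
  rw [hhq, mul_div_assoc]
  refine mul_nonneg hε.le ?_
  rw [← mul_div_mul_right _ _ h2]
  exact div_nonneg hpos.le (mul_self_nonneg _)

lemma incF_add_incF (hf : f ∈ triangles K) (hg : g ∈ triangles K) (hfg : f ≠ g)
    (hef : e ∈ f.powersetCard 2) (heg : e ∈ g.powersetCard 2) : o.incF e f + o.incF e g = 0 := by
  classical
  obtain ⟨y, hy, rfl⟩ := exists_eq_erase (isTri_of_mem hf) hef
  obtain ⟨y', hy', hyy⟩ := exists_eq_erase (isTri_of_mem hg) heg
  have he := isEdge_of_mem_powersetCard (o := o) hf _ hef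
  have h := opposite_sides hf hg hfg hy hy' hyy he
  have e1 := incF_eq hy he
  have e2 := incF_eq (o := o) hy' (hyy ▸ he)
  rw [← hyy] at e2
  rw [e1, e2]
  by_cases h1 : 0 < o.hgt (f.erase y) y
  · rw [if_pos h1, if_neg (by nlinarith)]; norm_num
  · rw [if_neg h1, if_pos (by nlinarith)]; norm_num

/-- An edge is contained in at most two triangles. -/
lemma eq_of_three_triangles {h : Finset Plane} (hf : f ∈ triangles K) (hg : g ∈ triangles K)
    (hh : h ∈ triangles K) (hef : e ∈ f.powersetCard 2) (heg : e ∈ g.powersetCard 2)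
    (heh : e ∈ h.powersetCard 2) (hfg : f ≠ g) (hfh : f ≠ h) (o : EdgeOrientation K) : g = h := by
  by_contra hgh
  have h1 := incF_add_incF (o := o) hf hg hfg hef heg
  have h2 := incF_add_incF (o := o) hf hh hfh hef heh
  have h3 := incF_add_incF (o := o) hg hh hgh heg heh
  -- Three numbers with pairwise sums zero vanish, but incidence numbers are `±1`.
  have h4 : o.incF e f = 0 := by linarith
  unfold EdgeOrientation.incF at h4
  split_ifs at h4 <;> norm_num at h4

lemma incF_ne_zero : o.incF e f ≠ 0 := by
  unfold EdgeOrientation.incF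
  split_ifs <;> norm_num

variable (hK : IsTriangulation K Ω)
include hK

lemma finite_triangles : (triangles K).Finite := hK.finite.subset fun _ h => h.1

lemma mem_space_iff_triangle {p : Plane} :
    p ∈ K.space ↔ ∃ f ∈ triangles K, p ∈ convexHull ℝ (f : Set Plane) := by
  rw [Geometry.SimplicialComplex.mem_space_iff]
  constructor
  · rintro ⟨s, hs, hp⟩
    obtain ⟨f, hf, hsf⟩ := hK.pure s hs
    exact ⟨f, hf, convexHull_mono (by exact_mod_cast hsf) hp⟩
  · rintro ⟨f, hf, hp⟩
    exact ⟨f, hf.1, hp⟩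

lemma mem_Ω_iff {p : Plane} : p ∈ Ω ↔ ∀ᶠ q in 𝓝 p, q ∈ K.space := by
  rw [← SetLike.mem_coe, hK.eq_interior, mem_interior_iff_mem_nhds]
  rfl

/-- Near a point, only the triangles that contain it are relevant. -/
lemma eventually_triangles (p : Plane) : ∀ᶠ q in 𝓝 p, ∀ f ∈ triangles K,
    q ∈ convexHull ℝ (f : Set Plane) → p ∈ convexHull ℝ (f : Set Plane) := by
  rw [(finite_triangles hK).eventually_all]
  intro f _
  by_cases h : p ∈ convexHull ℝ (f : Set Plane)
  · exact Eventually.of_forall fun q _ => h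
  · filter_upwards [(isCompact_hull f).isClosed.isOpen_compl.mem_nhds h] with q hq hq'
    exact absurd hq' hq

/-- Near an inner point of the common edge the two triangles are opposite half planes and cover a
neighbourhood. -/
lemma mem_Ω_of_two_triangles (hf : f ∈ triangles K) (hg : g ∈ triangles K) (hfg : f ≠ g)
    (hef : e ∈ f.powersetCard 2) (heg : e ∈ g.powersetCard 2) {p : Plane}
    (hp : p ∈ convexHull ℝ (e : Set Plane)) (hpe : p ∉ e) (o : EdgeOrientation K) : p ∈ Ω := by
  classical
  obtain ⟨y, hy, rfl⟩ := exists_eq_erase (isTri_of_mem hf) hef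
  obtain ⟨y', hy', hyy⟩ := exists_eq_erase (isTri_of_mem hg) heg
  have he := isEdge_of_mem_powersetCard (o := o) hf _ hef
  have h := opposite_sides hf hg hfg hy hy' hyy he
  have ev1 := eventually_mem_hull_edge (isTri_of_mem hf) hy he hp hpe
  have ev2 := eventually_mem_hull_edge (isTri_of_mem hg) hy' (hyy ▸ he) (hyy ▸ hp) (hyy ▸ hpe)
  rw [← hyy] at ev2
  rw [mem_Ω_iff hK]
  filter_upwards [ev1, ev2] with q h1 h2
  rw [mem_space_iff_triangle hK]
  by_cases hc : 0 ≤ o.hgt (f.erase y) q / o.hgt (f.erase y) y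
  · exact ⟨f, hf, h1.2 hc⟩
  · refine ⟨g, hg, h2.2 ?_⟩
    rw [div_nonneg_iff] at hc ⊢
    push Not at hc
    by_cases hq : 0 ≤ o.hgt (f.erase y) q
    · left
      have := hc.1 hq
      exact ⟨hq, by nlinarith⟩
    · right
      have := hc.2 (not_le.1 hq).le
      exact ⟨(not_le.1 hq).le, by nlinarith⟩

/-- An inner point of the edge is pushed away from `y`. A triangle containing the new point would
also contain the old one, hence both end points of the edge, and so be `f`; but the new point lies
outside `f`. -/
lemma notMem_Ω_of_one_triangle (hf : f ∈ triangles K) (hef : e ∈ f.powersetCard 2)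
    (huniq : ∀ g ∈ triangles K, e ⊆ g → g = f) {p : Plane}
    (hp : p ∈ convexHull ℝ (e : Set Plane)) (o : EdgeOrientation K) : p ∉ Ω := by
  classical
  obtain ⟨y, hy, rfl⟩ := exists_eq_erase (isTri_of_mem hf) hef
  have he := isEdge_of_mem_powersetCard (o := o) hf _ hef
  have tf := isTri_of_mem hf
  have key : ∀ p ∈ convexHull ℝ ((f.erase y : Finset Plane) : Set Plane), p ∉ f.erase y → p ∉ Ω := by
    intro p hp hpe hpΩ
    rw [mem_Ω_iff hK] at hpΩ
    have ev1 := eventually_mem_hull_edge tf hy he hp hpe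
    have h1 := hgt_opposite_ne_zero tf hy he
    obtain ⟨ε, hε, ⟨h2, h3⟩, h4⟩ := exists_pos_of_eventually
      ((ev1.and hpΩ).and (eventually_triangles hK p)) (-o.hgt (f.erase y) y • o.nrm (f.erase y))
    obtain ⟨g, hg, hgq⟩ := (mem_space_iff_triangle hK).1 h3
    have hpf := ((mem_face_hull_iff tf (Finset.erase_subset y f)).1 hp)
    have hgf : g = f := huniq g hg fun x hx =>
      mem_of_bary_ne_zero hf hg.1 hpf.1 (h4 g hg hgq) (Finset.mem_of_mem_erase hx)
        (bary_pos_of_mem_edge tf hy hp hpe hx).ne'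
    rw [hgf] at hgq
    have hge := h2.1 hgq
    have hp0 : o.hgt (f.erase y) p = 0 := by
      rw [hgt_eq_bary tf hy he, hpf.2 y hy (Finset.notMem_erase y f), mul_zero]
    have hhq : o.hgt (f.erase y) (p + ε • -o.hgt (f.erase y) y • o.nrm (f.erase y)) =
        -ε * o.hgt (f.erase y) y := by
      have ht := he.tang_sq
      rw [hgt_apply] at hp0
      rw [hgt_apply (p + _)]
      simp only [PiLp.add_apply, PiLp.smul_apply, smul_eq_mul]
      rw [nrm_zero, nrm_one] at hp0 ⊢
      linear_combination hp0 - ε * o.hgt (f.erase y) y * ht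
    rw [hhq, mul_div_cancel_right₀ _ h1] at hge
    linarith
  -- If an end point were in the open set `Ω`, so would be nearby points on the way to the midpoint,
  -- which are inner points of the edge.
  by_cases hpe : p ∈ f.erase y
  · intro hpΩ
    obtain ⟨m, hm, hme⟩ := exists_mem_hull_notMem he
    have hopen : ∀ᶠ q in 𝓝 p, q ∈ Ω := Ω.isOpen.mem_nhds hpΩ
    have hpm : p ≠ m := fun h => hme (h ▸ hpe)
    have hfin : ∀ᶠ q in 𝓝 p, q ≠ p → q ∉ f.erase y := by
      have hc : IsClosed (((f.erase y).erase p : Finset Plane) : Set Plane) :=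
        (Finset.finite_toSet _).isClosed
      filter_upwards [hc.isOpen_compl.mem_nhds (by simp)] with q hq hqp hqe
      exact hq (Finset.mem_coe.2 (Finset.mem_erase.2 ⟨hqp, hqe⟩))
    have hlt : ∀ᶠ q in 𝓝 p, dist q p < dist m p :=
      Metric.ball_mem_nhds p (dist_pos.2 hpm.symm)
    obtain ⟨ε, hε, ⟨h1, h2⟩, h3⟩ := exists_pos_of_eventually ((hopen.and hfin).and hlt) (m - p)
    have hε1 : ε < 1 := by
      rw [dist_eq_norm, add_sub_cancel_left, norm_smul, Real.norm_of_nonneg hε.le, dist_eq_norm]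
        at h3
      have := norm_pos_iff.2 (sub_ne_zero.2 hpm.symm)
      nlinarith
    refine key (p + ε • (m - p)) ?_ (h2 ?_) h1
    · exact (convex_convexHull ℝ _).add_smul_sub_mem hp hm ⟨hε.le, hε1.le⟩
    · intro h
      rw [add_eq_left, smul_eq_zero] at h
      rcases h with h | h
      · exact hε.ne' h
      · exact hpm (sub_eq_zero.1 h).symm
  · exact key p hp hpe

end Geometry

/-! ## Conformity -/

section Conformity

open MeasureTheory

variable {K : Geometry.SimplicialComplex ℝ Plane} {Ω : TopologicalSpace.Opens Plane}
  {o : EdgeOrientation K} {e f : Finset Plane}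

lemma param_mem_hull (he : o.IsEdge e) {s : ℝ} (hs : s ∈ Set.uIcc 0 (o.len e)) :
    o.param e s ∈ convexHull ℝ (e : Set Plane) := by
  have hl := he.len_pos
  rw [Set.uIcc_of_le hl.le] at hs
  have h := (convex_convexHull ℝ (e : Set Plane)).add_smul_sub_mem
    (subset_convexHull ℝ _ he.start_mem) (subset_convexHull ℝ _ he.finish_mem)
    (t := s / o.len e) ⟨div_nonneg hs.1 hl.le, (div_le_one hl).2 hs.2⟩
  rw [← he.len_smul_tang, smul_smul, div_mul_cancel₀ _ hl.ne'] at h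
  exact h

/-- Contributions of inner edges cancel. -/
lemma sum_incF_mul_eq_zero (hK : IsTriangulation K Ω) [Fintype (triangles K)]
    {I : Finset Plane → triangles K → ℝ}
    (h1 : ∀ f g : triangles K, ∀ e ∈ f.1.powersetCard 2, e ⊆ g.1 → I e f = I e g)
    (h2 : ∀ f : triangles K, ∀ e ∈ f.1.powersetCard 2,
      (∀ p ∈ convexHull ℝ (e : Set Plane), p ∉ Ω) → I e f = 0) :
    ∑ f : triangles K, ∑ e ∈ f.1.powersetCard 2, o.incF e f.1 * I e f = 0 := by
  classical
  rw [Finset.sum_comm' (t' := Finset.univ.biUnion fun f : triangles K => f.1.powersetCard 2)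
    (s' := fun e => Finset.univ.filter fun f : triangles K => e ∈ f.1.powersetCard 2)
    (by
      intro f e
      simp only [Finset.mem_univ, true_and, Finset.mem_filter, Finset.mem_biUnion]
      exact ⟨fun h => ⟨h, ⟨f, h⟩⟩, fun h => h.1⟩)]
  refine Finset.sum_eq_zero fun e he => ?_
  obtain ⟨f, -, hef⟩ := Finset.mem_biUnion.1 he
  -- An inner edge has two triangles with equal integrals and opposite incidence numbers. An edge
  -- with one triangle lies outside `Ω`, where the integral vanishes by assumption.
  by_cases hg : ∃ g : triangles K, g ≠ f ∧ e ∈ g.1.powersetCard 2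
  · obtain ⟨g, hgf, heg⟩ := hg
    have hfg : f.1 ≠ g.1 := fun h => hgf (Subtype.ext h.symm)
    have hset : (Finset.univ.filter fun f : triangles K => e ∈ f.1.powersetCard 2) = {f, g} := by
      ext h
      simp only [Finset.mem_filter, Finset.mem_univ, true_and, Finset.mem_insert,
        Finset.mem_singleton]
      constructor
      · intro heh
        by_cases hhf : h = f
        · exact Or.inl hhf
        · right
          exact Subtype.ext (eq_of_three_triangles f.2 g.2 h.2 hef heg heh hfg
            (fun h' => hhf (Subtype.ext h'.symm)) o).symm
      · rintro (rfl | rfl)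
        exacts [hef, heg]
    rw [hset, Finset.sum_pair (Ne.symm hgf), ← h1 f g e hef (Finset.mem_powersetCard.1 heg).1,
      ← add_mul, incF_add_incF f.2 g.2 hfg hef heg, zero_mul]
  · push Not at hg
    refine Finset.sum_eq_zero fun g hgm => ?_
    have heg := (Finset.mem_filter.1 hgm).2
    have hgf : g = f := by
      by_contra h
      exact hg g h heg
    rw [hgf, h2 f e hef fun p hp => ?_, mul_zero]
    refine notMem_Ω_of_one_triangle hK f.2 hef (fun h hh heh => ?_) hp o
    by_contra hne
    exact hg ⟨h, hh⟩ (fun h' => hne (congrArg Subtype.val h'))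
      (Finset.mem_powersetCard.2 ⟨heh, (Finset.mem_powersetCard.1 hef).2⟩)

lemma IsTest.eq_zero {φ : Plane → ℝ} (hφ : IsTest Ω φ) {x : Plane} (hx : x ∉ Ω) : φ x = 0 :=
  image_eq_zero_of_notMem_tsupport fun h => hx (hφ.2.2 h)

lemma IsTest.pd_eq_zero {φ : Plane → ℝ} (hφ : IsTest Ω φ) {x : Plane} (hx : x ∉ Ω) (i : Fin 2) :
    pd i φ x = 0 := by
  have : fderiv ℝ φ x = 0 :=
    image_eq_zero_of_notMem_tsupport fun h => hx (hφ.2.2 (tsupport_fderiv_subset ℝ h))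
  rw [pd, this, zero_apply]

/-- A vector field on an edge in terms of its trace. -/
lemma eval_trFE0 (he : o.IsEdge e) (u : VecPoly) (s : ℝ) (i : Fin 2) :
    vecFun u i (o.param e s) = (trFE0 o e u).1.eval s * o.nrm e i +
      (trFE0 o e u).2.1.eval s * o.tang e i := by
  have ht := he.tang_sq
  simp only [trFE0, LinearMap.coe_mk, AddHom.coe_mk, Fin.sum_univ_two, Polynomial.eval_add,
    Polynomial.eval_smul, eval_restr, smul_eq_mul, vecFun, polyFun]
  fin_cases i
  · simp only [Fin.zero_eta, nrm_zero, nrm_one]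
    linear_combination -(evalAt (o.param e s) (u 0)) * ht
  · simp only [Fin.mk_one, nrm_zero, nrm_one]
    linear_combination -(evalAt (o.param e s) (u 1)) * ht

/-- The normal components of a matrix field on an edge in terms of its trace. -/
lemma eval_trFE1 (he : o.IsEdge e) (σ : MatPoly) (s : ℝ) (j : Fin 2) :
    ∑ l, matFun σ j l (o.param e s) * o.nrm e l = (trFE1 o e σ).1.eval s * o.nrm e j +
      (trFE1 o e σ).2.1.eval s * o.tang e j := by
  have ht := he.tang_sq
  simp only [trFE1, LinearMap.coe_mk, AddHom.coe_mk, Fin.sum_univ_two, Polynomial.eval_add,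
    Polynomial.eval_smul, eval_restr, smul_eq_mul, matFun, polyFun, Matrix.of_apply]
  fin_cases j
  · simp only [Fin.zero_eta, nrm_zero, nrm_one]
    linear_combination -(-evalAt (o.param e s) (σ 0 0) * o.tang e 1 +
      evalAt (o.param e s) (σ 0 1) * o.tang e 0) * ht
  · simp only [Fin.mk_one, nrm_zero, nrm_one]
    linear_combination -(-evalAt (o.param e s) (σ 1 0) * o.tang e 1 +
      evalAt (o.param e s) (σ 1 1) * o.tang e 0) * ht

lemma eval_trFE1_div (σ : MatPoly) (s : ℝ) :
    ∑ j, divM pd (matFun σ) j (o.param e s) * o.nrm e j = (trFE1 o e σ).2.2.eval s := by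
  have hm : ∀ i, divM pd (matFun σ) i = polyFun (divM pdP σ i) := by
    intro i
    simp only [divM, divV, matFun, Matrix.of_apply, pd_polyFun]
    funext x
    simp [polyFun]
  simp only [hm, trFE1, LinearMap.coe_mk, AddHom.coe_mk, Fin.sum_univ_two, Polynomial.eval_add,
    Polynomial.eval_smul, eval_restr, smul_eq_mul, polyFun]
  ring

/-- A symmetric test field does not see the skew part. -/
lemma curlV_inner (u : Fin 2 → Plane → ℝ) {φ : Matrix (Fin 2) (Fin 2) (Plane → ℝ)}
    (hφ : φ.IsSymm) (x : Plane) :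
    ∑ i, ∑ j, curlV pd u i j x * φ i j x = ∑ i, ∑ j, symCurl pd u i j x * φ i j x := by
  obtain ⟨h1, h2, h3, h4⟩ := symCurl_entries u
  have hs : φ 1 0 = φ 0 1 := hφ.apply 0 1
  simp only [Fin.sum_univ_two, h1, h2, h3, h4, hs, curlV]
  simp
  ring

/-- By Green's formula on each triangle only edge integrals remain. The boundary integrand depends
on `u` alone, whose two components on the edge are recovered from the trace. -/
theorem isWeakSymCurl (hK : IsTriangulation K Ω) {k : ℕ} {u : triangles K → VecPoly}
    (hu : u ∈ globalSpace K (huMaZhang o k).S0) :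
    IsWeakSymCurl K Ω u (globalD0 K (huMaZhang o k) u) := by
  intro φ hφ ht
  have : Fintype (triangles K) := (finite_triangles hK).fintype
  rw [finsum_eq_sum_of_fintype, finsum_eq_sum_of_fintype, ← sub_eq_zero, ← neg_eq_zero, neg_sub,
    ← Finset.sum_sub_distrib]
  have hstep : ∀ f : triangles K,
      (∫ x in convexHull ℝ (f.1 : Set Plane), ∑ i, ∑ j,
        polyFun (globalD0 K (huMaZhang o k) u f i j) x * φ i j x) -
      (∫ x in convexHull ℝ (f.1 : Set Plane), ∑ i, polyFun (u f i) x * (- rotV pd (φ i) x)) =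
      ∑ e ∈ f.1.powersetCard 2, o.incF e f.1 * ∫ s in (0 : ℝ)..(o.len e),
        (∑ i, vecFun (u f) i (o.param e s) *
          (o.nrm e 0 * φ i 1 (o.param e s) - o.nrm e 1 * φ i 0 (o.param e s))) := by
    intro f
    rw [← integral_curl_mul (isTri_of_mem f.2) (isEdge_of_mem_powersetCard f.2)
      (u := vecFun (u f)) (fun i => contDiff_polyFun _) (fun i j => (ht i j).1)]
    have hτ : ∀ i j x, polyFun (globalD0 K (huMaZhang o k) u f i j) x =
        symCurl pd (vecFun (u f)) i j x := by
      intro i j x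
      rw [symCurl_vecFun]
      rfl
    simp only [curlV_inner _ hφ, ← hτ]
    rw [integral_sub]
    · rfl
    · refine integrableOn_hull ?_ f.1
      exact continuous_finsetSum _ fun i _ => continuous_finsetSum _ fun j _ =>
        (contDiff_polyFun _).continuous.mul (ht i j).1.continuous
    · refine integrableOn_hull ?_ f.1
      exact continuous_finsetSum _ fun i _ => (contDiff_polyFun _).continuous.mul
        ((continuous_pd (ht i 1).1 0).sub (continuous_pd (ht i 0).1 1)).neg
  rw [Finset.sum_congr rfl fun f _ => hstep f]
  refine sum_incF_mul_eq_zero hK (I := fun e f => ∫ s in (0 : ℝ)..(o.len e),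
        (∑ i, vecFun (u f) i (o.param e s) *
          (o.nrm e 0 * φ i 1 (o.param e s) - o.nrm e 1 * φ i 0 (o.param e s)))) ?_ ?_
  · intro f g e hef heg
    have he := isEdge_of_mem_powersetCard (o := o) f.2 e hef
    have htr : trFE0 o e (u f) = trFE0 o e (u g) := hu.2.1 f g e hef heg
    simp only [eval_trFE0 he, htr]
  · intro f e hef hΩ
    have he := isEdge_of_mem_powersetCard (o := o) f.2 e hef
    rw [intervalIntegral.integral_congr (g := fun _ => 0)]
    · simp
    · intro s hs
      have := hΩ _ (param_mem_hull he hs)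
      simp [(ht _ _).eq_zero this]

/-- The boundary integrand involves `σ n` and `div σ · n`, exactly the edge trace. Since the full
gradient of the test function is kept, no terms at the vertices arise. -/
theorem isWeakDivDiv (hK : IsTriangulation K Ω) {k : ℕ} {σ : triangles K → MatPoly}
    (hσ : σ ∈ globalSpace K (huMaZhang o k).S1) :
    IsWeakDivDiv K Ω σ (globalD1 K (huMaZhang o k) σ) := by
  intro φ ht
  have : Fintype (triangles K) := (finite_triangles hK).fintype
  rw [finsum_eq_sum_of_fintype, finsum_eq_sum_of_fintype, ← sub_eq_zero, ← neg_eq_zero, neg_sub,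
    ← Finset.sum_sub_distrib]
  have hstep : ∀ f : triangles K,
      (∫ x in convexHull ℝ (f.1 : Set Plane),
        polyFun (globalD1 K (huMaZhang o k) σ f) x * φ x) -
      (∫ x in convexHull ℝ (f.1 : Set Plane),
        ∑ i, ∑ j, polyFun (σ f i j) x * pd i (pd j φ) x) =
      ∑ e ∈ f.1.powersetCard 2, o.incF e f.1 * ∫ s in (0 : ℝ)..(o.len e),
        ((∑ j, divM pd (matFun (σ f)) j (o.param e s) * o.nrm e j) * φ (o.param e s) -
          ∑ j, (∑ l, matFun (σ f) j l (o.param e s) * o.nrm e l) * pd j φ (o.param e s)) := by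
    intro f
    rw [← integral_divDiv_mul (isTri_of_mem f.2) (isEdge_of_mem_powersetCard f.2)
      (σ := matFun (σ f)) (fun i j => contDiff_polyFun _) ht.1, divDiv_matFun, integral_sub]
    · rfl
    · exact integrableOn_hull ((contDiff_polyFun _).continuous.mul ht.1.continuous) f.1
    · refine integrableOn_hull ?_ f.1
      exact continuous_finsetSum _ fun i _ => continuous_finsetSum _ fun j _ =>
        (contDiff_polyFun _).continuous.mul (continuous_pd (contDiff_pd ht.1 j) i)
  rw [Finset.sum_congr rfl fun f _ => hstep f]
  refine sum_incF_mul_eq_zero hK (I := fun e f => ∫ s in (0 : ℝ)..(o.len e),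
        ((∑ j, divM pd (matFun (σ f)) j (o.param e s) * o.nrm e j) * φ (o.param e s) -
          ∑ j, (∑ l, matFun (σ f) j l (o.param e s) * o.nrm e l) * pd j φ (o.param e s))) ?_ ?_
  · intro f g e hef heg
    have he := isEdge_of_mem_powersetCard (o := o) f.2 e hef
    have htr : trFE1 o e (σ f) = trFE1 o e (σ g) := hσ.2.1 f g e hef heg
    simp only [eval_trFE1 he, eval_trFE1_div, htr]
  · intro f e hef hΩ
    have he := isEdge_of_mem_powersetCard (o := o) f.2 e hef
    rw [intervalIntegral.integral_congr (g := fun _ => 0)]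
    · simp
    · intro s hs
      have := hΩ _ (param_mem_hull he hs)
      simp [ht.eq_zero this, ht.pd_eq_zero this]

lemma globalD0_mem {k : ℕ} {u : triangles K → VecPoly}
    (hu : u ∈ globalSpace K (huMaZhang o k).S0) :
    globalD0 K (huMaZhang o k) u ∈ globalSpace K (huMaZhang o k).S1 := by
  refine ⟨fun f => ⟨isSymm_symCurlP _, symCurlP_mem (mem_vecPolyLE.1 (hu.1 f))⟩,
    fun f g e hef heg => ?_, fun f g x hf hg => ?_⟩
  · have he := isEdge_of_mem_powersetCard (o := o) f.2 e hef
    exact (trFE1_symCurlP he _).trans ((congrArg edgeOp (hu.2.1 f g e hef heg)).trans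
      (trFE1_symCurlP he _).symm)
  · exact (trFV1_symCurlP x _).trans ((congrArg jetOp (hu.2.2 f g x hf hg)).trans
      (trFV1_symCurlP x _).symm)

lemma globalD1_mem {k : ℕ} {σ : triangles K → MatPoly}
    (hσ : σ ∈ globalSpace K (huMaZhang o k).S1) :
    globalD1 K (huMaZhang o k) σ ∈ globalSpace K (huMaZhang o k).S2 := by
  refine ⟨fun f => ?_, fun f g e hef heg => rfl, fun f g x hf hg => rfl⟩
  have := divDivP_mem (hσ.1 f).2
  rwa [Nat.sub_sub] at this

theorem isFECTS (hK : IsTriangulation K Ω) (k : ℕ) : IsFECTS K Ω (huMaZhang o k) where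
  trace0 := ⟨fun _ _ _ _ _ hu => trFE0_mem (mem_vecPolyLE.1 hu), fun _ _ _ _ _ _ => trivial,
    fun _ _ _ _ _ _ _ _ => trivial, fun _ hf e he _ hx _ _ h =>
      trEV0_trFE0 (isEdge_of_mem_powersetCard hf e he) hx h⟩
  trace1 := ⟨fun _ _ _ _ _ hu => trFE1_mem hu.2, fun _ _ _ _ _ _ => trivial,
    fun _ _ _ _ _ _ _ _ => trivial, fun _ hf e he _ hx _ _ h =>
      trEV1_trFE1 (isEdge_of_mem_powersetCard hf e he) hx h⟩
  trace2 := ⟨fun _ _ _ _ _ _ => trivial, fun _ _ _ _ _ _ => trivial,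
    fun _ _ _ _ _ _ _ _ => trivial, fun _ _ _ _ _ _ _ _ _ => rfl⟩
  conf0 _ hu := ⟨globalD0_mem hu, isWeakSymCurl hK hu⟩
  conf1 _ hσ := ⟨globalD1_mem hσ, isWeakDivDiv hK hσ⟩
  dF0_eq _ _ u _ := (symCurl_vecFun u).symm
  dF1_eq _ _ σ _ := (divDiv_matFun σ).symm
  mapsF _ _ := ⟨fun u hu => ⟨⟨isSymm_symCurlP _, symCurlP_mem (mem_vecPolyLE.1 hu)⟩,
    divDivP_symCurlP u⟩, fun σ hσ => by
      have := divDivP_mem hσ.2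
      rwa [Nat.sub_sub] at this⟩
  mapsE _ _ _ := ⟨fun a ha => ⟨⟨derivative_mem_degreeLE ha.1,
      Submodule.sub_mem _ (derivative_mem_degreeLE ha.2.1) (Submodule.smul_mem _ _ ha.2.2),
      Submodule.smul_mem _ _ (derivative_mem_degreeLE ha.2.2)⟩, rfl⟩, fun _ _ => trivial⟩
  mapsV _ _ := ⟨fun _ _ => ⟨trivial, rfl⟩, fun _ _ => trivial⟩
  commE0 _ hf e he u _ := (trFE1_symCurlP (isEdge_of_mem_powersetCard hf e he) u).symm
  commE1 _ _ _ _ _ _ := rfl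
  commV0 _ _ x _ u _ := (trFV1_symCurlP x u).symm
  commV1 _ _ _ _ _ _ := rfl

end Conformity

/-! ## Connectivity -/

section Connectivity

open Filter Topology

/-- Polar coordinates present the punctured ball as the image of the unit circle times an interval.
-/
lemma isPreconnected_ball_diff_center (x : Plane) (r : ℝ) :
    IsPreconnected (Metric.ball x r \ {x}) := by
  have hrank : 1 < Module.rank ℝ Plane := by
    rw [← Module.finrank_eq_rank]; simp
  have h1 : IsPreconnected (Metric.sphere (0 : Plane) 1 ×ˢ Set.Ioo (0 : ℝ) r) :=
    (isPreconnected_sphere hrank 0 1).prod isPreconnected_Ioo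
  have h2 := h1.image (fun q : Plane × ℝ => x + q.2 • q.1) (by fun_prop)
  convert! h2 using 1
  ext y
  simp only [Set.mem_sdiff, Metric.mem_ball, Set.mem_singleton_iff, Set.mem_image, Set.mem_prod,
    mem_sphere_iff_norm, sub_zero, Set.mem_Ioo, Prod.exists]
  constructor
  · rintro ⟨hy, hne⟩
    have hn : 0 < ‖y - x‖ := norm_pos_iff.2 (sub_ne_zero.2 hne)
    refine ⟨‖y - x‖⁻¹ • (y - x), ‖y - x‖, ⟨?_, hn, by rwa [← dist_eq_norm]⟩, ?_⟩
    · rw [norm_smul, norm_inv, norm_norm, inv_mul_cancel₀ hn.ne']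
    · rw [smul_smul, mul_inv_cancel₀ hn.ne', one_smul, add_sub_cancel]
  · rintro ⟨v, t, ⟨hv, ht, htr⟩, rfl⟩
    constructor
    · rw [dist_eq_norm, add_sub_cancel_left, norm_smul, hv, mul_one, Real.norm_of_nonneg ht.le]
      exact htr
    · intro h
      rw [add_eq_left, smul_eq_zero] at h
      rcases h with h | h
      · exact ht.ne' h
      · rw [h, norm_zero] at hv
        exact zero_ne_one hv

lemma IsPreconnected.diff_singleton_plane {U : Set Plane} (hU : IsPreconnected U) (ho : IsOpen U)
    (x : Plane) : IsPreconnected (U \ {x}) := by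
  by_cases hx : x ∈ U
  swap
  · rwa [Set.sdiff_singleton_eq_self hx]
  obtain ⟨r, hr, hb⟩ := Metric.isOpen_iff.1 ho x hx
  have hball := isPreconnected_ball_diff_center x r
  rw [isPreconnected_iff_subset_of_disjoint] at hU hball ⊢
  -- In a separation of `U \ {x}` the connected punctured ball lies on one side. Adding the full
  -- ball to that side gives a separation of `U`.
  have key : ∀ u v : Set Plane, IsOpen u → IsOpen v → U \ {x} ⊆ u ∪ v →
      U \ {x} ∩ (u ∩ v) = ∅ → Metric.ball x r \ {x} ⊆ u → U \ {x} ⊆ u ∨ U \ {x} ⊆ v := by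
    intro u v hu hv huv hd hbu
    have hcov : U ⊆ u ∪ Metric.ball x r ∪ v \ {x} := by
      intro y hy
      by_cases hyx : y = x
      · left; right; rw [hyx]; exact Metric.mem_ball_self hr
      · rcases huv ⟨hy, hyx⟩ with h | h
        · exact Or.inl (Or.inl h)
        · exact Or.inr ⟨h, hyx⟩
    have hdis : U ∩ ((u ∪ Metric.ball x r) ∩ (v \ {x})) = ∅ := by
      rw [Set.eq_empty_iff_forall_notMem]
      rintro y ⟨hy, h1, h2, h3⟩
      have : y ∈ U \ {x} ∩ (u ∩ v) := by
        refine ⟨⟨hy, h3⟩, ?_, h2⟩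
        rcases h1 with h1 | h1
        · exact h1
        · exact hbu ⟨h1, h3⟩
      rwa [hd] at this
    rcases hU _ _ (hu.union Metric.isOpen_ball) (hv.sdiff isClosed_singleton) hcov hdis with h | h
    · left
      rintro y ⟨hy, hyx⟩
      rcases h hy with h | h
      · exact h
      · exact hbu ⟨h, hyx⟩
    · right
      exact fun y hy => (h hy.1).1
  intro u v hu hv huv hd
  have hsub : Metric.ball x r \ {x} ⊆ U \ {x} := Set.sdiff_subset_sdiff_left hb
  rcases hball u v hu hv (hsub.trans huv)
    (Set.subset_empty_iff.1 (hd ▸ Set.inter_subset_inter_left _ hsub)) with h | h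
  · exact key u v hu hv huv hd h
  · exact (key v u hv hu (by rwa [Set.union_comm]) (by rwa [Set.inter_comm v u]) h).symm

lemma IsPreconnected.diff_finset_plane {U : Set Plane} (hU : IsPreconnected U) (ho : IsOpen U)
    (s : Finset Plane) : IsPreconnected (U \ (s : Set Plane)) := by
  classical
  induction s using Finset.induction_on with
  | empty => simpa using hU
  | insert x s _ ih =>
    have : U \ ((insert x s : Finset Plane) : Set Plane) = (U \ (s : Set Plane)) \ {x} := by
      ext y; simp; tauto
    rw [this]
    exact IsPreconnected.diff_singleton_plane ih (ho.sdiff s.finite_toSet.isClosed) x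

variable {K : Geometry.SimplicialComplex ℝ Plane} {Ω : TopologicalSpace.Opens Plane}
  {o : EdgeOrientation K} {e f g : Finset Plane}

/-- A set of triangles whose union has connected interior is connected through edges. -/
theorem edge_connected {S A : Set (Finset Plane)} (hS : S ⊆ triangles K) (hfin : S.Finite)
    (hconn : IsPreconnected (interior (⋃ f ∈ S, convexHull ℝ (f : Set Plane))))
    (hA : A ⊆ S) (hne : A.Nonempty)
    (hcl : ∀ f ∈ A, ∀ g ∈ S, ∀ e : Finset Plane, e ∈ f.powersetCard 2 → e ∈ g.powersetCard 2 →
      g ∈ A) : A = S := by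
  classical
  by_contra hAS
  obtain ⟨g₀, hg₀, hg₀A⟩ : ∃ g ∈ S, g ∉ A := by
    by_contra h
    push Not at h
    exact hAS (hA.antisymm h)
  obtain ⟨f₀, hf₀⟩ := hne
  -- Removing the finitely many vertices keeps the interior connected; afterwards triangles can only
  -- touch along edges.
  let V : Finset Plane := hfin.toFinset.biUnion id
  have hV := IsPreconnected.diff_finset_plane hconn isOpen_interior V
  have hclosed : ∀ B : Set (Finset Plane), B ⊆ S →
      IsClosed (⋃ f ∈ B, convexHull ℝ (f : Set Plane)) := fun B hB =>
    (hfin.subset hB).isClosed_biUnion fun f _ => (isCompact_hull f).isClosed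
  have hmeet : ∀ B : Set (Finset Plane), ∀ f ∈ B, f ∈ S →
      ((interior (⋃ f ∈ S, convexHull ℝ (f : Set Plane)) \ (V : Set Plane)) ∩
        ⋃ f ∈ B, convexHull ℝ (f : Set Plane)).Nonempty := by
    intro B f hfB hfS
    have hsub : convexHull ℝ (f : Set Plane) ⊆ ⋃ f ∈ S, convexHull ℝ (f : Set Plane) :=
      Set.subset_biUnion_of_mem (u := fun f : Finset Plane => convexHull ℝ (f : Set Plane)) hfS
    have hinf : (interior (convexHull ℝ (f : Set Plane)) \ (V : Set Plane)).Nonempty := by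
      have ho : IsOpen (interior (convexHull ℝ (f : Set Plane))) := isOpen_interior
      obtain ⟨p, hp⟩ := interior_hull_nonempty (isTri_of_mem (hS hfS))
      have hd : Dense ((V : Set Plane)ᶜ) := V.finite_toSet.countable.dense_compl ℝ
      obtain ⟨q, hq, hqV⟩ := hd.inter_open_nonempty _ ho ⟨p, hp⟩
      exact ⟨q, hq, hqV⟩
    obtain ⟨q, hq, hqV⟩ := hinf
    refine ⟨q, ⟨interior_mono hsub hq, hqV⟩, ?_⟩
    exact Set.mem_biUnion hfB (interior_subset hq)
  -- The triangles in `A` and those outside form two closed sets that cover a connected set, so they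
  -- meet at a point that is not a vertex. The common face there must be an edge.
  rw [isPreconnected_closed_iff] at hV
  obtain ⟨p, ⟨hp, hpV⟩, hpA, hpB⟩ := hV _ _ (hclosed A hA) (hclosed (S \ A) Set.sdiff_subset) (by
    rintro p ⟨hp, -⟩
    obtain ⟨f, hf, hpf⟩ := Set.mem_iUnion₂.1 (interior_subset hp)
    by_cases hfA : f ∈ A
    · exact Or.inl (Set.mem_biUnion hfA hpf)
    · exact Or.inr (Set.mem_biUnion (show f ∈ S \ A from ⟨hf, hfA⟩) hpf))
    (hmeet A f₀ hf₀ (hA hf₀)) (hmeet (S \ A) g₀ ⟨hg₀, hg₀A⟩ hg₀)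
  obtain ⟨f, hf, hpf⟩ := Set.mem_iUnion₂.1 hpA
  obtain ⟨g, hg, hpg⟩ := Set.mem_iUnion₂.1 hpB
  have hfS := hA hf
  have h1 := K.inter_subset_convexHull (hS hfS).1 (hS hg.1).1 ⟨hpf, hpg⟩
  rw [← Finset.coe_inter] at h1
  have hfg : f ≠ g := fun h => hg.2 (h ▸ hf)
  have hcard : (f ∩ g).card = 2 := by
    have hlt : (f ∩ g).card < 3 := by
      by_contra h
      have hcf : (f ∩ g).card = 3 := le_antisymm
        ((Finset.card_le_card Finset.inter_subset_left).trans (hS hfS).2.le) (not_lt.1 h)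
      have e1 := Finset.eq_of_subset_of_card_le (Finset.inter_subset_left (s₁ := f) (s₂ := g))
        (by rw [hcf, (hS hfS).2])
      have e2 := Finset.eq_of_subset_of_card_le (Finset.inter_subset_right (s₁ := f) (s₂ := g))
        (by rw [hcf, (hS hg.1).2])
      exact hfg (e1.symm.trans e2)
    have hgt : 1 < (f ∩ g).card := by
      by_contra h
      have hsub : ((f ∩ g : Finset Plane) : Set Plane).Subsingleton := by
        intro a ha b hb
        exact Finset.card_le_one.1 (not_lt.1 h) a ha b hb
      have hconv : Convex ℝ ((f ∩ g : Finset Plane) : Set Plane) := Set.Subsingleton.convex hsub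
      rw [hconv.convexHull_eq] at h1
      refine hpV ?_
      have hpf' : p ∈ f := (Finset.mem_inter.1 h1).1
      exact Finset.mem_coe.2 (Finset.mem_biUnion.2 ⟨f, hfin.mem_toFinset.2 hfS, hpf'⟩)
    omega
  exact hg.2 (hcl f hf g hg.1 (f ∩ g)
    (Finset.mem_powersetCard.2 ⟨Finset.inter_subset_left, hcard⟩)
    (Finset.mem_powersetCard.2 ⟨Finset.inter_subset_right, hcard⟩))

variable (hK : IsTriangulation K Ω)
include hK

/-- A function on the triangles that takes the same value on neighbours is constant. -/
lemma eq_of_neighbours (hΩ : IsPreconnected (Ω : Set Plane)) {α : Type*} {c : triangles K → α}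
    (h : ∀ f g : triangles K, ∀ e : Finset Plane, e ∈ f.1.powersetCard 2 → e ∈ g.1.powersetCard 2 →
      c f = c g) (f g : triangles K) : c f = c g := by
  have hsp : ⋃ f ∈ triangles K, convexHull ℝ (f : Set Plane) = K.space := by
    ext p
    rw [mem_space_iff_triangle hK]
    simp
  have := edge_connected (K := K) (S := triangles K) (A := {g | ∃ hg : g ∈ triangles K, c ⟨g, hg⟩ = c f})
    subset_rfl (finite_triangles hK) (by rw [hsp, ← hK.eq_interior]; exact hΩ) (fun g hg => hg.1)
    ⟨f.1, f.2, rfl⟩ (by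
      rintro g ⟨hg, hgf⟩ g' hg' e he he'
      exact ⟨hg', (h ⟨g', hg'⟩ ⟨g, hg⟩ e he' he).trans hgf⟩)
  obtain ⟨_, h'⟩ : g.1 ∈ {g | ∃ hg : g ∈ triangles K, c ⟨g, hg⟩ = c f} := by rw [this]; exact g.2
  exact h'.symm

/-- A vertex all of whose edges are inner edges is an inner point. -/
lemma vertex_mem_Ω {x : Plane} (hf : f ∈ triangles K) (hx : x ∈ f) (o : EdgeOrientation K)
    (h : ∀ f ∈ triangles K, ∀ e ∈ f.powersetCard 2, x ∈ e → ∃ g ∈ triangles K, g ≠ f ∧ e ⊆ g) :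
    x ∈ Ω := by
  classical
  have hpos : ∀ᶠ q in 𝓝 x, ∀ g ∈ triangles K, x ∈ g → 0 < bary g x q := by
    rw [(finite_triangles hK).eventually_all]
    intro g hg
    by_cases hxg : x ∈ g
    · filter_upwards [(continuous_bary x).continuousAt.eventually_const_lt
        (show 0 < bary g x x by rw [bary_self (isTri_of_mem hg) hxg]; norm_num)] with q hq _
      exact hq
    · exact Eventually.of_forall fun q h' => absurd h' hxg
  -- In this ball only triangles at `x` are met, and their coordinate at `x` stays positive, so
  -- points of the complex other than `x` are inner points of triangles or of edges at `x`.
  obtain ⟨r, hr, hb⟩ := Metric.eventually_nhds_iff_ball.1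
    (hpos.and (eventually_triangles hK x))
  have hxmem : ∀ g ∈ triangles K, x ∈ convexHull ℝ (g : Set Plane) → x ∈ g := by
    intro g hg hxg
    exact mem_of_bary_ne_zero hf hg.1 (subset_convexHull ℝ _ hx) hxg hx
      (by rw [bary_self (isTri_of_mem hf) hx]; norm_num)
  have hopen : ∀ p ∈ Metric.ball x r \ {x}, p ∈ K.space → p ∈ Ω := by
    rintro p ⟨hpb, hpx⟩ hp
    obtain ⟨g, hg, hpg⟩ := (mem_space_iff_triangle hK).1 hp
    have hxg := hxmem g hg ((hb p hpb).2 g hg hpg)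
    have tg := isTri_of_mem hg
    have hxp := (hb p hpb).1 g hg hxg
    by_cases hint : ∀ y ∈ g, bary g y p ≠ 0
    · rw [mem_Ω_iff hK]
      have : p ∈ interior (convexHull ℝ (g : Set Plane)) := by
        rw [mem_interior_hull_iff tg]
        exact fun y hy => lt_of_le_of_ne ((mem_hull_iff tg).1 hpg y hy) (hint y hy).symm
      filter_upwards [mem_interior_iff_mem_nhds.1 this] with q hq
      exact (mem_space_iff_triangle hK).2 ⟨g, hg, hq⟩
    · push Not at hint
      obtain ⟨y, hy, hy0⟩ := hint
      have hxy : x ≠ y := fun h' => by rw [← h'] at hy0; exact hxp.ne' hy0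
      have heg := erase_mem_powersetCard tg hy
      obtain ⟨g', hg', hne, heg'⟩ := h g hg _ heg (Finset.mem_erase.2 ⟨hxy, hxg⟩)
      refine mem_Ω_of_two_triangles hK hg hg' hne.symm heg
        (Finset.mem_powersetCard.2 ⟨heg', (Finset.mem_powersetCard.1 heg).2⟩) ?_ ?_ o
      · rw [mem_face_hull_iff tg (Finset.erase_subset y g)]
        refine ⟨hpg, fun w hw hwe => ?_⟩
        by_cases hwy : w = y
        · rwa [hwy]
        · exact absurd (Finset.mem_erase.2 ⟨hwy, hw⟩) hwe
      · intro hpe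
        have := bary_of_ne tg hxg (Finset.mem_of_mem_erase hpe) (Ne.symm hpx)
        exact hxp.ne' this
  have hcl : IsClosed K.space := by
    have : K.space = ⋃ f ∈ triangles K, convexHull ℝ (f : Set Plane) := by
      ext p
      rw [mem_space_iff_triangle hK]
      simp
    rw [this]
    exact (finite_triangles hK).isClosed_biUnion fun f _ => (isCompact_hull f).isClosed
  have hsub : Metric.ball x r \ {x} ⊆ K.space := by
    -- In the punctured ball the complex is closed, and open because its points lie in `Ω`. Being
    -- nonempty there, it fills the punctured ball.
    have hpre := isPreconnected_ball_diff_center x r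
    rw [isPreconnected_iff_subset_of_disjoint] at hpre
    rcases hpre Ω K.spaceᶜ Ω.isOpen hcl.isOpen_compl (fun p hp => by
        by_cases h' : p ∈ K.space
        · exact Or.inl (hopen p hp h')
        · exact Or.inr h') (by
        rw [Set.eq_empty_iff_forall_notMem]
        rintro p ⟨-, h1, h2⟩
        rw [SetLike.mem_coe, mem_Ω_iff hK] at h1
        exact h2 h1.self_of_nhds) with h' | h'
    · intro p hp
      have := h' hp
      rw [SetLike.mem_coe, mem_Ω_iff hK] at this
      exact this.self_of_nhds
    · exfalso
      obtain ⟨p, hp⟩ := interior_hull_nonempty (isTri_of_mem hf)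
      obtain ⟨y, hy, hyx⟩ := exists_mem_erase_ne (isTri_of_mem hf) x
      -- A point near `x` on the segment to another vertex of `f` shows that the complex meets the
      -- punctured ball.
      obtain ⟨ε, hε, hq1, hq2⟩ := exists_pos_of_eventually
        ((show ∀ᶠ q in 𝓝 x, q ∈ Metric.ball x r from Metric.ball_mem_nhds x hr).and
          (show ∀ᶠ q in 𝓝 x, q ∈ Metric.ball x (dist y x) from
            Metric.ball_mem_nhds x (dist_pos.2 hyx))) (y - x)
      have hε1 : ε < 1 := by
        rw [Metric.mem_ball, dist_eq_norm, add_sub_cancel_left, norm_smul,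
          Real.norm_of_nonneg hε.le, dist_eq_norm] at hq2
        have := norm_pos_iff.2 (sub_ne_zero.2 hyx)
        nlinarith
      refine h' (a := x + ε • (y - x)) ⟨hq1, ?_⟩ ?_
      · intro h''
        rw [Set.mem_singleton_iff, add_eq_left, smul_eq_zero] at h''
        rcases h'' with h'' | h''
        · exact hε.ne' h''
        · exact hyx (sub_eq_zero.1 h'')
      · rw [mem_space_iff_triangle hK]
        exact ⟨f, hf, (convex_convexHull ℝ _).add_smul_sub_mem (subset_convexHull ℝ _ hx)
          (subset_convexHull ℝ _ hy) ⟨hε.le, hε1.le⟩⟩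
  rw [mem_Ω_iff hK]
  filter_upwards [Metric.ball_mem_nhds x hr] with q hq
  by_cases hqx : q = x
  · rw [hqx, mem_space_iff_triangle hK]
    exact ⟨f, hf, subset_convexHull ℝ _ hx⟩
  · exact hsub ⟨hq, hqx⟩

end Connectivity

/-! ### Boundary edges, surjectivity of the boundary map, and edges around a boundary vertex -/

section BoundaryEdges

open Module

variable {K : Geometry.SimplicialComplex ℝ Plane} {Ω : TopologicalSpace.Opens Plane}
  {e f g : Finset Plane}

/-- The adjoint of the boundary map at an inner edge: the sum has two terms with opposite signs. -/
lemma incF_sum_pair (o : EdgeOrientation K) [Fintype (triangles K)] [DecidableEq Plane]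
    {f g : triangles K} (hfg : f ≠ g)
    (hef : e ∈ f.1.powersetCard 2) (heg : e ∈ g.1.powersetCard 2) (m : triangles K → ℝ) :
    ∑ h : triangles K, (if e ∈ h.1.powersetCard 2 then o.incF e h.1 * m h else 0) =
      o.incF e f.1 * (m f - m g) := by
  have hne : f.1 ≠ g.1 := fun h => hfg (Subtype.ext h)
  rw [Finset.sum_eq_add f g hfg]
  · rw [if_pos hef, if_pos heg]
    linear_combination m g * incF_add_incF (o := o) f.2 g.2 hne hef heg
  · rintro h - ⟨hhf, hhg⟩
    rw [if_neg]
    intro heh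
    exact hhg (Subtype.ext (eq_of_three_triangles f.2 g.2 h.2 hef heg heh hne
      (fun h' => hhf (Subtype.ext h'.symm)) o).symm)
  · exact fun h => absurd (Finset.mem_univ _) h
  · exact fun h => absurd (Finset.mem_univ _) h

variable (hK : IsTriangulation K Ω)
include hK

lemma isCompact_space : IsCompact K.space := by
  have : K.space = ⋃ f ∈ triangles K, convexHull ℝ (f : Set Plane) := by
    ext p
    rw [mem_space_iff_triangle hK]
    simp
  rw [this]
  exact (finite_triangles hK).isCompact_biUnion fun f _ => isCompact_hull f

/-- If every edge had a second triangle, every point of the complex, including the vertices by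
`vertex_mem_Ω`, would be in `Ω`. The complex would then be open, compact and nonempty, hence the
whole plane. -/
lemma exists_boundary_edge (hf : f ∈ triangles K) (o : EdgeOrientation K) : ∃ f ∈ triangles K,
    ∃ e ∈ f.powersetCard 2, ∀ g ∈ triangles K, e ⊆ g → g = f := by
  classical
  by_contra hcon
  push Not at hcon
  have h : ∀ f ∈ triangles K, ∀ e ∈ f.powersetCard 2, ∃ g ∈ triangles K, g ≠ f ∧ e ⊆ g := by
    intro f hf e he
    obtain ⟨g, hg, h1, h2⟩ := hcon f hf e he
    exact ⟨g, hg, h2, h1⟩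
  have hsub : K.space ⊆ Ω := by
    intro p hp
    obtain ⟨g, hg, hpg⟩ := (mem_space_iff_triangle hK).1 hp
    have tg := isTri_of_mem hg
    by_cases hv : p ∈ g
    · exact vertex_mem_Ω hK hg hv o fun f hf e he _ => h f hf e he
    by_cases hint : ∀ y ∈ g, bary g y p ≠ 0
    · rw [SetLike.mem_coe, mem_Ω_iff hK]
      have : p ∈ interior (convexHull ℝ (g : Set Plane)) := by
        rw [mem_interior_hull_iff tg]
        exact fun y hy => lt_of_le_of_ne ((mem_hull_iff tg).1 hpg y hy) (hint y hy).symm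
      filter_upwards [mem_interior_iff_mem_nhds.1 this] with q hq
      exact (mem_space_iff_triangle hK).2 ⟨g, hg, hq⟩
    · push Not at hint
      obtain ⟨y, hy, hy0⟩ := hint
      have heg := erase_mem_powersetCard tg hy
      obtain ⟨g', hg', hne, heg'⟩ := h g hg _ heg
      refine mem_Ω_of_two_triangles hK hg hg' hne.symm heg
        (Finset.mem_powersetCard.2 ⟨heg', (Finset.mem_powersetCard.1 heg).2⟩) ?_
        (fun hpe => hv (Finset.mem_of_mem_erase hpe)) o
      rw [mem_face_hull_iff tg (Finset.erase_subset y g)]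
      refine ⟨hpg, fun w hw hwe => ?_⟩
      by_cases hwy : w = y
      · rwa [hwy]
      · exact absurd (Finset.mem_erase.2 ⟨hwy, hw⟩) hwe
  have hcomp := isCompact_space hK
  have hopen : IsOpen K.space := by
    have : K.space = Ω := hsub.antisymm (by rw [hK.eq_interior]; exact interior_subset)
    rw [this]
    exact Ω.isOpen
  have huniv : K.space = Set.univ := IsClopen.eq_univ ⟨hcomp.isClosed, hopen⟩ (by
    obtain ⟨p, hp⟩ := interior_hull_nonempty (isTri_of_mem hf)
    exact ⟨p, (mem_space_iff_triangle hK).2 ⟨f, hf, interior_subset hp⟩⟩)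
  exact noncompact_univ Plane (huniv ▸ hcomp)

/-- The boundary map from edges to triangles is onto. -/
lemma exists_edge_weights (hΩ : IsPreconnected (Ω : Set Plane)) (o : EdgeOrientation K)
    (t : triangles K → ℝ) : ∃ a : Finset Plane → ℝ, ∀ f : triangles K,
      ∑ e ∈ f.1.powersetCard 2, o.incF e f.1 * a e = t f := by
  classical
  have : Fintype (triangles K) := (finite_triangles hK).fintype
  let δ : (Finset Plane → ℝ) →ₗ[ℝ] (triangles K → ℝ) := LinearMap.pi fun f =>
    ∑ e ∈ f.1.powersetCard 2, o.incF e f.1 • LinearMap.proj e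
  have hδ : ∀ a f, δ a f = ∑ e ∈ f.1.powersetCard 2, o.incF e f.1 * a e := fun a f => by
    simp [δ]
  suffices h : LinearMap.range δ = ⊤ by
    obtain ⟨a, ha⟩ := LinearMap.range_eq_top.1 h t
    exact ⟨a, fun f => by rw [← hδ, ha]⟩
  -- A functional `m` that annihilates the range takes equal values on neighbours, so it is
  -- constant; a boundary edge, which has a single triangle, forces the constant to be zero.
  by_contra hne
  obtain ⟨φ, hφ, hle⟩ := Submodule.exists_le_ker_of_lt_top _ (lt_top_iff_ne_top.2 hne)
  let m : triangles K → ℝ := fun f => φ (Pi.single f 1)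
  have hφm : ∀ s, φ s = ∑ f, s f * m f := fun s => by
    rw [LinearMap.pi_apply_eq_sum_univ φ s]
    refine Finset.sum_congr rfl fun f _ => ?_
    rw [smul_eq_mul]
    congr 2
    funext g
    simp [Pi.single_apply, eq_comm]
  have hm : ∀ e, ∑ f : triangles K, (if e ∈ f.1.powersetCard 2 then o.incF e f.1 * m f else 0) = 0 := by
    intro e
    have h1 : φ (δ (Pi.single e 1)) = 0 := hle ⟨_, rfl⟩
    rw [hφm] at h1
    refine Eq.trans (Finset.sum_congr rfl fun f _ => ?_) h1
    rw [hδ]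
    by_cases he : e ∈ f.1.powersetCard 2
    · rw [if_pos he, Finset.sum_eq_single_of_mem e he]
      · simp
      · intro e' _ hne
        simp [hne]
    · have h2 : ∑ e' ∈ f.1.powersetCard 2, o.incF e' f.1 * (Pi.single e 1 : Finset Plane → ℝ) e' = 0 := by
        refine Finset.sum_eq_zero fun e' he' => ?_
        have : e' ≠ e := fun h => he (h ▸ he')
        simp [this]
      rw [if_neg he, h2, zero_mul]
  have hconst := eq_of_neighbours hK hΩ (c := m) (by
    intro f g e hef heg
    by_cases hfg : f = g
    · rw [hfg]
    have h1 := hm e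
    rw [incF_sum_pair o hfg hef heg] at h1
    exact sub_eq_zero.1 ((mul_eq_zero.1 h1).resolve_left incF_ne_zero))
  apply hφ
  refine LinearMap.ext fun s => ?_
  rw [hφm, LinearMap.zero_apply]
  refine Finset.sum_eq_zero fun f _ => ?_
  obtain ⟨g, hg, e, heg, huniq⟩ := exists_boundary_edge hK f.2 o
  have h1 := hm e
  rw [Finset.sum_eq_single_of_mem ⟨g, hg⟩ (Finset.mem_univ _), if_pos heg] at h1
  · have h2 := (mul_eq_zero.1 h1).resolve_left incF_ne_zero
    rw [hconst f ⟨g, hg⟩, h2, mul_zero]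
  · intro h _ hne
    rw [if_neg]
    intro heh
    exact hne (Subtype.ext (huniq h.1 h.2 (Finset.mem_powersetCard.1 heh).1))

/-- At a boundary vertex, functions on the inner edges are differences of functions on the
triangles. -/
lemma exists_potential_at_boundary_vertex {x : Plane} (hx : x ∈ K.vertices) (hxΩ : x ∉ Ω)
    (o : EdgeOrientation K) (c : triangles K → triangles K → ℝ) (hc : ∀ f g, c f g = -c g f) :
    ∃ κ : triangles K → ℝ, ∀ f g : triangles K, x ∈ f.1 → x ∈ g.1 →
      ∀ e ∈ f.1.powersetCard 2, e ∈ g.1.powersetCard 2 → c f g = κ f - κ g := by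
  classical
  have : Fintype (triangles K) := (finite_triangles hK).fintype
  obtain ⟨f₀, hf₀, hxf₀⟩ : ∃ f ∈ triangles K, x ∈ f := by
    obtain ⟨f, hf, h⟩ := hK.pure _ hx
    exact ⟨f, hf, h (by simp)⟩
  let T := {f : triangles K // x ∈ f.1}
  let P : Finset Plane → T → Prop := fun e f => e ∈ f.1.1.powersetCard 2
  let Ex : Finset (Finset Plane) :=
    (Finset.univ.biUnion fun f : T => f.1.1.powersetCard 2).filter fun e => x ∈ e
  let Ei : Finset (Finset Plane) := Ex.filter fun e => ∃ f g : T, f ≠ g ∧ P e f ∧ P e g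
  have hmemEx : ∀ e, e ∈ Ex ↔ (∃ f, P e f) ∧ x ∈ e := fun e => by simp [Ex, P]
  -- counting of incidences
  have hcount : 2 * Ei.card + 1 ≤ 2 * Fintype.card T := by
    -- Each triangle at `x` has two edges at `x`. An inner edge is counted at least twice, and since
    -- `x` is not in `Ω` some edge at `x` is a boundary edge, which accounts for the extra `1`.
    have hdouble := Finset.sum_card_bipartiteAbove_eq_sum_card_bipartiteBelow
      (s := (Finset.univ : Finset T)) (t := Ex) (fun f e => P e f)
    have hl : ∀ f ∈ (Finset.univ : Finset T),
        (Finset.bipartiteAbove (fun f e => P e f) Ex f).card = 2 := by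
      intro f _
      have h1 : Finset.bipartiteAbove (fun f e => P e f) Ex f =
          (f.1.1.powersetCard 2).filter fun e => x ∈ e := by
        ext e
        simp only [Finset.bipartiteAbove, Finset.mem_filter, hmemEx]
        exact ⟨fun h => ⟨h.2, h.1.2⟩, fun h => ⟨⟨⟨f, h.1⟩, h.2⟩, h.1⟩⟩
      have h2 : (f.1.1.powersetCard 2).filter (fun e => ¬ x ∈ e) = {f.1.1.erase x} := by
        ext e
        simp only [Finset.mem_filter, Finset.mem_singleton]
        constructor
        · rintro ⟨h, hxe⟩
          obtain ⟨y, hy, rfl⟩ := exists_eq_erase (isTri_of_mem f.1.2) h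
          have : x = y := by
            by_contra hxy
            exact hxe (Finset.mem_erase.2 ⟨hxy, f.2⟩)
          exact congrArg _ this.symm
        · rintro rfl
          exact ⟨erase_mem_powersetCard (isTri_of_mem f.1.2) f.2, Finset.notMem_erase _ _⟩
      have h3 := Finset.card_filter_add_card_filter_not (s := f.1.1.powersetCard 2) fun e => x ∈ e
      rw [h2, Finset.card_singleton, Finset.card_powersetCard, f.1.2.2,
        show Nat.choose 3 2 = 3 from rfl] at h3
      rw [h1]
      omega
    rw [Finset.sum_congr rfl hl, Finset.sum_const, Finset.card_univ, smul_eq_mul] at hdouble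
    obtain ⟨f, hf, e, hef, hxe, huniq⟩ : ∃ f ∈ triangles K, ∃ e ∈ f.powersetCard 2, x ∈ e ∧
        ∀ g ∈ triangles K, e ⊆ g → g = f := by
      by_contra hcon
      push Not at hcon
      refine hxΩ (vertex_mem_Ω hK hf₀ hxf₀ o fun f hf e he hxe => ?_)
      obtain ⟨g, hg, h1, h2⟩ := hcon f hf e he hxe
      exact ⟨g, hg, h2, h1⟩
    have hxf : x ∈ f := (Finset.mem_powersetCard.1 hef).1 hxe
    have heEx : e ∈ Ex := (hmemEx e).2 ⟨⟨⟨⟨f, hf⟩, hxf⟩, hef⟩, hxe⟩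
    have heEi : e ∉ Ei := by
      intro h
      obtain ⟨-, f1, g1, hne, h1, h2⟩ := Finset.mem_filter.1 h
      apply hne
      apply Subtype.ext
      apply Subtype.ext
      rw [huniq f1.1.1 f1.1.2 (Finset.mem_powersetCard.1 h1).1,
        huniq g1.1.1 g1.1.2 (Finset.mem_powersetCard.1 h2).1]
    have hle : ∑ e ∈ Ei, 2 + 1 ≤ ∑ e ∈ Ex, (Finset.bipartiteBelow (fun f e => P e f)
        (Finset.univ : Finset T) e).card := by
      have h1 : insert e Ei ⊆ Ex := Finset.insert_subset heEx (Finset.filter_subset _ _)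
      refine le_trans ?_ (Finset.sum_le_sum_of_subset h1)
      rw [Finset.sum_insert heEi, add_comm]
      refine add_le_add ?_ (Finset.sum_le_sum fun e' he' => ?_)
      · rw [Nat.succ_le_iff, Finset.card_pos]
        exact ⟨⟨⟨f, hf⟩, hxf⟩, by simpa [Finset.bipartiteBelow, P] using hef⟩
      · obtain ⟨-, f1, g1, hne, h1, h2⟩ := Finset.mem_filter.1 he'
        rw [Nat.succ_le_iff, Finset.one_lt_card]
        exact ⟨f1, by simpa [Finset.bipartiteBelow] using h1, g1,
          by simpa [Finset.bipartiteBelow] using h2, hne⟩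
    rw [Finset.sum_const, smul_eq_mul] at hle
    omega
  -- the difference map
  let δ : (T → ℝ) →ₗ[ℝ] (Ei → ℝ) := LinearMap.pi fun e =>
    ∑ f : T, (if P e.1 f then o.incF e.1 f.1.1 else 0) • LinearMap.proj f
  have hpair : ∀ (e : Ei) (f g : T), f ≠ g → P e.1 f → P e.1 g → ∀ κ : T → ℝ,
      δ κ e = o.incF e.1 f.1.1 * (κ f - κ g) := by
    intro e f g hfg hf hg κ
    have hne : f.1.1 ≠ g.1.1 := fun h => hfg (Subtype.ext (Subtype.ext h))
    have h1 : δ κ e = ∑ h : T, (if P e.1 h then o.incF e.1 h.1.1 else 0) * κ h := by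
      simp only [δ, LinearMap.pi_apply, LinearMap.sum_apply, LinearMap.smul_apply,
        LinearMap.proj_apply, smul_eq_mul]
    rw [h1, Finset.sum_eq_add f g hfg]
    · rw [if_pos hf, if_pos hg]
      linear_combination κ g * incF_add_incF (o := o) f.1.2 g.1.2 hne hf hg
    · rintro h - ⟨hhf, hhg⟩
      rw [if_neg, zero_mul]
      intro heh
      exact hhg (Subtype.ext (Subtype.ext (eq_of_three_triangles f.1.2 g.1.2 h.1.2 hf hg heh hne
        (fun h' => hhf (Subtype.ext (Subtype.ext h'.symm))) o).symm))
    · exact fun h => absurd (Finset.mem_univ _) h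
    · exact fun h => absurd (Finset.mem_univ _) h
  -- If the common edge did not contain `x`, both triangles would be spanned by `x` and this edge.
  have hshare : ∀ f g : T, f ≠ g → ∀ e, P e f → P e g → e ∈ Ei := by
    intro f g hfg e hf hg
    refine Finset.mem_filter.2 ⟨(hmemEx e).2 ⟨⟨f, hf⟩, ?_⟩, f, g, hfg, hf, hg⟩
    by_contra hxe
    have h1 : ∀ h : T, P e h → h.1.1 = insert x e := by
      intro h he
      obtain ⟨h1, h2⟩ := Finset.mem_powersetCard.1 he
      refine (Finset.eq_of_subset_of_card_le (Finset.insert_subset h.2 h1) ?_).symm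
      rw [Finset.card_insert_of_notMem hxe, h2, h.1.2.2]
    exact hfg (Subtype.ext (Subtype.ext ((h1 f hf).trans (h1 g hg).symm)))
  -- A function in the kernel takes equal values on neighbours in the star of `x`. The star is
  -- connected through edges, so one value determines the function.
  have hker : finrank ℝ (LinearMap.ker δ) ≤ 1 := by
    let ev : LinearMap.ker δ →ₗ[ℝ] ℝ :=
      (LinearMap.proj (⟨⟨f₀, hf₀⟩, hxf₀⟩ : T)) ∘ₗ (LinearMap.ker δ).subtype
    have hinj : Function.Injective ev := by
      rw [injective_iff_map_eq_zero]
      rintro ⟨κ, hκ⟩ h0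
      have h0' : κ ⟨⟨f₀, hf₀⟩, hxf₀⟩ = 0 := h0
      have hS := edge_connected (K := K) (S := {f | f ∈ triangles K ∧ x ∈ f})
        (A := {f | ∃ (hf : f ∈ triangles K) (hxf : x ∈ f), κ ⟨⟨f, hf⟩, hxf⟩ = 0})
        (fun f hf => hf.1) ((finite_triangles hK).subset fun f hf => hf.1)
        (hK.star_connected x hx).isPreconnected (fun f hf => ⟨hf.1, hf.2.1⟩)
        ⟨f₀, hf₀, hxf₀, h0'⟩ (by
          rintro f ⟨hf, hxf, hκf⟩ g ⟨hg, hxg⟩ e hef heg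
          refine ⟨hg, hxg, ?_⟩
          let f' : T := ⟨⟨f, hf⟩, hxf⟩
          let g' : T := ⟨⟨g, hg⟩, hxg⟩
          by_cases hfg : f' = g'
          · show κ g' = 0
            rw [← hfg]
            exact hκf
          · have h1 := hpair ⟨e, hshare f' g' hfg e hef heg⟩ f' g' hfg hef heg κ
            rw [LinearMap.mem_ker.1 hκ] at h1
            have h2 := (mul_eq_zero.1 h1.symm).resolve_left incF_ne_zero
            have h3 : κ f' = 0 := hκf
            show κ g' = 0
            linarith)
      apply Subtype.ext
      funext f
      have : f.1.1 ∈ {f | ∃ (hf : f ∈ triangles K) (hxf : x ∈ f), κ ⟨⟨f, hf⟩, hxf⟩ = 0} := by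
        rw [hS]
        exact ⟨f.1.2, f.2⟩
      obtain ⟨_, _, h⟩ := this
      exact h
    simpa using LinearMap.finrank_le_finrank_of_injective hinj
  -- The rank is at least the number of triangles minus one, and by the count there are at most that
  -- many inner edges.
  have hsurj : LinearMap.range δ = ⊤ := by
    apply Submodule.eq_top_of_finrank_eq
    have h1 := LinearMap.finrank_range_add_finrank_ker δ
    have h2 := Submodule.finrank_le (LinearMap.range δ)
    simp only [Module.finrank_fintype_fun_eq_card, Fintype.card_coe] at h1 h2 ⊢
    omega
  -- the values on the inner edges
  have hval : ∀ e : Ei, ∃ r : ℝ, ∀ f g : T, f ≠ g → P e.1 f → P e.1 g →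
      r = o.incF e.1 f.1.1 * c f.1 g.1 := by
    intro e
    obtain ⟨-, f, g, hfg, hf, hg⟩ := Finset.mem_filter.1 e.2
    have hne : f.1.1 ≠ g.1.1 := fun h => hfg (Subtype.ext (Subtype.ext h))
    refine ⟨o.incF e.1 f.1.1 * c f.1 g.1, fun f' g' hfg' hf' hg' => ?_⟩
    have hmem : ∀ h : T, P e.1 h → h = f ∨ h = g := by
      intro h heh
      by_cases hhf : h = f
      · exact Or.inl hhf
      · exact Or.inr (Subtype.ext (Subtype.ext (eq_of_three_triangles f.1.2 g.1.2 h.1.2 hf hg heh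
          hne (fun h' => hhf (Subtype.ext (Subtype.ext h'.symm))) o).symm))
    -- Exchanging the two triangles changes the sign of the incidence number and of `c`, so the
    -- prescribed value depends on the edge only.
    have hinc := incF_add_incF (o := o) f.1.2 g.1.2 hne hf hg
    rcases hmem f' hf' with rfl | rfl <;> rcases hmem g' hg' with rfl | rfl
    · exact absurd rfl hfg'
    · rfl
    · rw [hc f'.1 g'.1]
      linear_combination c g'.1 f'.1 * hinc
    · exact absurd rfl hfg'
  choose r hr using hval
  obtain ⟨κ, hκ⟩ := LinearMap.range_eq_top.1 hsurj r
  refine ⟨fun f => if h : x ∈ f.1 then κ ⟨f, h⟩ else 0, fun f g hf hg e hef heg => ?_⟩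
  show c f g = (if h : x ∈ f.1 then κ ⟨f, h⟩ else 0) - (if h : x ∈ g.1 then κ ⟨g, h⟩ else 0)
  rw [dif_pos hf, dif_pos hg]
  by_cases hfg : f = g
  · subst hfg
    have := hc f f
    rw [sub_self]
    linarith
  let f' : T := ⟨f, hf⟩
  let g' : T := ⟨g, hg⟩
  have hfg' : f' ≠ g' := fun h => hfg (congrArg Subtype.val h)
  have hE := hshare f' g' hfg' e hef heg
  have h1 := hpair ⟨e, hE⟩ f' g' hfg' hef heg κ
  rw [hκ, hr ⟨e, hE⟩ f' g' hfg' hef heg] at h1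
  exact mul_left_cancel₀ incF_ne_zero h1

end BoundaryEdges

/-! ## Cohomology of the global complex in the degrees zero and two -/

section GlobalCohomology

open Module

variable {K : Geometry.SimplicialComplex ℝ Plane} {Ω : TopologicalSpace.Opens Plane}
  {o : EdgeOrientation K} {e f g : Finset Plane}

lemma exists_edge_weights_of_basis (hK : IsTriangulation K Ω) (hΩ : IsPreconnected (Ω : Set Plane))
    (o : EdgeOrientation K) {W : Type} [AddCommGroup W] [Module ℝ W] {n : ℕ} (z : Basis (Fin n) ℝ W)
    (t : triangles K → W) : ∃ a : Finset Plane → W, ∀ f : triangles K,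
      ∑ e ∈ f.1.powersetCard 2, o.incF e f.1 • a e = t f := by
  choose a ha using fun i => exists_edge_weights hK hΩ o fun f => z.repr (t f) i
  refine ⟨fun e => ∑ i, a i e • z i, fun f => ?_⟩
  simp_rw [Finset.smul_sum, smul_smul]
  rw [Finset.sum_comm]
  simp_rw [← Finset.sum_smul, ha]
  exact z.sum_repr (t f)

/-- The global `div div` is onto. -/
theorem exists_globalD1_eq (hK : IsTriangulation K Ω) (hΩ : IsPreconnected (Ω : Set Plane))
    (ψ : Basis (Fin 3) ℝ (polyLE 1)) (z : Basis (Fin 3) ℝ RT2) {k : ℕ} (hk : 4 ≤ k)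
    {q : triangles K → Poly} (hq : q ∈ globalSpace K (huMaZhang o k).S2) :
    ∃ σ ∈ globalSpace K (huMaZhang o k).S1, globalD1 K (huMaZhang o k) σ = q := by
  classical
  -- Edge values whose signed sums are the currents of `q` exist because the boundary map is onto.
  -- They are realized by edge bubbles `b`, chosen once for each edge and so shared by its
  -- triangles.
  obtain ⟨a, ha⟩ := exists_edge_weights_of_basis hK hΩ o z
    fun f => curEquiv ψ z (triPair f.1 (q f))
  have hb : ∀ e, ∃ b : Edge3, o.IsEdge e →
      b ∈ edgeBubble1 o k e ∧ curEquiv ψ z (edgePair o e b) = a e := by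
    intro e
    by_cases he : o.IsEdge e
    · obtain ⟨b, h1, h2⟩ := exists_edge_moment ψ z he hk (a e)
      exact ⟨b, fun _ => ⟨h1, h2⟩⟩
    · exact ⟨0, fun h => absurd h he⟩
  choose b hb using hb
  have hσ : ∀ f : triangles K, ∃ σ ∈ symPolyLE (k - 1), (∀ x ∈ f.1, trFV1 x σ = 0) ∧
      (∀ e ∈ f.1.powersetCard 2, trFE1 o e σ = b e) ∧ divDivP σ = q f := by
    intro f
    have hf := isTri_of_mem f.2
    have he := isEdge_of_mem_powersetCard (o := o) f.2
    obtain ⟨-, -, hint, hrange⟩ := unisolvence1 ψ z hf he hk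
    obtain ⟨σ, h1, h2, h3⟩ := hint b fun e h => (hb e (he e h)).1
    -- By the Stokes formula the defect has the current zero. It is therefore `div div` of a bubble,
    -- whose subtraction changes no trace.
    have h4 : divDivP σ - q f ∈ orthP1 f.1 (k - 3) := by
      refine ⟨Submodule.sub_mem _ ?_ (hq.1 f), ?_⟩
      · have := divDivP_mem h1.2
        rwa [Nat.sub_sub] at this
      · rw [SetLike.mem_coe, LinearMap.mem_ker, map_sub, sub_eq_zero]
        apply (curEquiv ψ z).injective
        rw [triPair_divDivP ψ z hf he, map_sum, ← ha f]
        refine Finset.sum_congr rfl fun e h => ?_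
        rw [map_smul, h3 e h, (hb e (he e h)).2]
    rw [← hrange] at h4
    obtain ⟨β, hβ, hβq⟩ := h4
    obtain ⟨h5, h6, h7⟩ := mem_bubbleF1.1 hβ
    refine ⟨σ - β, Submodule.sub_mem _ h1 h5, fun x hx => ?_, fun e h => ?_, ?_⟩
    · rw [map_sub, h2 x hx, h7 x hx, sub_zero]
    · rw [map_sub, h3 e h, h6 e h, sub_zero]
    · rw [map_sub, hβq]
      abel
  choose σ h1 h2 h3 h4 using hσ
  refine ⟨σ, ⟨h1, fun f g e hef heg => ?_, fun f g x hf hg => ?_⟩, funext h4⟩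
  · exact (h3 f e hef).trans (h3 g e (Finset.mem_powersetCard.2
      ⟨heg, (Finset.mem_powersetCard.1 hef).2⟩)).symm
  · exact (h2 f x hf).trans (h2 g x hg).symm

/-- The kernel of the global `sym curl`. -/
theorem coh0_equiv (hK : IsTriangulation K Ω) (hΩ : IsConnected (Ω : Set Plane)) {k : ℕ}
    (hk : 4 ≤ k) :
    Nonempty (RT2 ≃ₗ[ℝ] Coh0 (globalSpace K (huMaZhang o k).S0) (globalD0 K (huMaZhang o k))) := by
  have hne : Nonempty (triangles K) := by
    obtain ⟨p, hp⟩ := hΩ.nonempty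
    rw [hK.eq_interior] at hp
    obtain ⟨f, hf, -⟩ := (mem_space_iff_triangle hK).1 (interior_subset hp)
    exact ⟨⟨f, hf⟩⟩
  let L : RT2 →ₗ[ℝ] (triangles K → VecPoly) := LinearMap.pi fun _ => RT2.subtype
  have hL : ∀ w, L w ∈ globalSpace K (huMaZhang o k).S0 ⊓ LinearMap.ker (globalD0 K (huMaZhang o k)) :=
    fun w => ⟨⟨fun f => mem_vecPolyLE.2 (RT2_mem_polyLE w.2 (by omega)),
      fun f g e _ _ => rfl, fun f g x _ _ => rfl⟩, funext fun f => symCurlP_eq_zero_iff.2 w.2⟩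
  refine ⟨LinearEquiv.ofBijective (L.codRestrict _ hL) ⟨?_, ?_⟩⟩
  · intro w w' h
    exact Subtype.ext (congrFun (congrArg Subtype.val h) hne.some)
  · rintro ⟨u, hu, h0⟩
    have hRT : ∀ f, u f ∈ RT2 := fun f => symCurlP_eq_zero_iff.1 (congrFun h0 f)
    -- Neighbours share a jet at a vertex of the common edge, and a jet determines the element of
    -- `RT2`.
    have hconst := eq_of_neighbours hK hΩ.isPreconnected (c := u) (by
      intro f g e hef heg
      obtain ⟨x, hx⟩ : e.Nonempty := Finset.card_pos.1 (by
        rw [(Finset.mem_powersetCard.1 hef).2]; norm_num)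
      have h1 : trFV0 x (u f) = trFV0 x (u g) := hu.2.2 f g x
        ((Finset.mem_powersetCard.1 hef).1 hx) ((Finset.mem_powersetCard.1 heg).1 hx)
      exact sub_eq_zero.1 (RT2_eq_zero_of_jet (x := x) (Submodule.sub_mem _ (hRT f) (hRT g))
        (by rw [map_sub, h1, sub_self])))
    exact ⟨⟨u hne.some, hRT _⟩, Subtype.ext (funext fun f => hconst _ _)⟩

/-! ## Local differences -/

variable (K) in
/-- Functions of two triangles that are differences at each vertex. -/
def locDiff (W : Type) [AddCommGroup W] [Module ℝ W] : Submodule ℝ (triangles K → triangles K → W) where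
  carrier := {c | ∀ x : Plane, ∃ κ : triangles K → W, ∀ f g : triangles K, x ∈ f.1 → x ∈ g.1 →
    c f g = κ f - κ g}
  zero_mem' x := ⟨0, fun f g _ _ => by simp⟩
  add_mem' := by
    intro a b ha hb x
    obtain ⟨κ, hκ⟩ := ha x
    obtain ⟨l, hl⟩ := hb x
    refine ⟨κ + l, fun f g hf hg => ?_⟩
    simp only [Pi.add_apply, hκ f g hf hg, hl f g hf hg]
    abel
  smul_mem' := by
    intro r a ha x
    obtain ⟨κ, hκ⟩ := ha x
    refine ⟨r • κ, fun f g hf hg => ?_⟩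
    simp only [Pi.smul_apply, hκ f g hf hg, smul_sub]

variable (K) in
/-- Functions of two triangles that are differences of a single function, for triangles that meet. -/
def globDiff (W : Type) [AddCommGroup W] [Module ℝ W] : Submodule ℝ (triangles K → triangles K → W) where
  carrier := {c | ∃ κ : triangles K → W, ∀ x : Plane, ∀ f g : triangles K, x ∈ f.1 → x ∈ g.1 →
    c f g = κ f - κ g}
  zero_mem' := ⟨0, fun x f g _ _ => by simp⟩
  add_mem' := by
    rintro a b ⟨κ, hκ⟩ ⟨l, hl⟩
    refine ⟨κ + l, fun x f g hf hg => ?_⟩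
    simp only [Pi.add_apply, hκ x f g hf hg, hl x f g hf hg]
    abel
  smul_mem' := by
    rintro r a ⟨κ, hκ⟩
    refine ⟨r • κ, fun x f g hf hg => ?_⟩
    simp only [Pi.smul_apply, hκ x f g hf hg, smul_sub]

variable (K) in
/-- Local modulo global differences. -/
abbrev DiffCoh (W : Type) [AddCommGroup W] [Module ℝ W] : Type :=
  locDiff K W ⧸ (globDiff K W).submoduleOf (locDiff K W)

/-- Two quotients are isomorphic if they are linked by a linear relation. -/
lemma quotient_equiv_of_relation {V W : Type} [AddCommGroup V] [Module ℝ V] [AddCommGroup W]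
    [Module ℝ W] (R : Submodule ℝ (V × W)) (L G : Submodule ℝ V) (C E : Submodule ℝ W)
    (h1 : ∀ v ∈ L, ∃ w ∈ C, (v, w) ∈ R) (h2 : ∀ w ∈ C, ∃ v ∈ L, (v, w) ∈ R)
    (h3 : ∀ v ∈ L, ∀ w ∈ C, (v, w) ∈ R → (v ∈ G ↔ w ∈ E)) :
    Nonempty ((L ⧸ G.submoduleOf L) ≃ₗ[ℝ] (C ⧸ E.submoduleOf C)) := by
  -- Both quotients are images of the space of related pairs. By `h3` the two surjections have the
  -- same kernel.
  let S : Submodule ℝ (V × W) := R ⊓ L.prod C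
  let p : S →ₗ[ℝ] (L ⧸ G.submoduleOf L) := (G.submoduleOf L).mkQ ∘ₗ
    (LinearMap.codRestrict L (LinearMap.fst ℝ V W ∘ₗ S.subtype) fun s => s.2.2.1)
  let q : S →ₗ[ℝ] (C ⧸ E.submoduleOf C) := (E.submoduleOf C).mkQ ∘ₗ
    (LinearMap.codRestrict C (LinearMap.snd ℝ V W ∘ₗ S.subtype) fun s => s.2.2.2)
  have hp : Function.Surjective p := by
    intro y
    obtain ⟨⟨v, hv⟩, rfl⟩ := Submodule.mkQ_surjective _ y
    obtain ⟨w, hw, hR⟩ := h1 v hv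
    exact ⟨⟨(v, w), hR, hv, hw⟩, rfl⟩
  have hq : Function.Surjective q := by
    intro y
    obtain ⟨⟨w, hw⟩, rfl⟩ := Submodule.mkQ_surjective _ y
    obtain ⟨v, hv, hR⟩ := h2 w hw
    exact ⟨⟨(v, w), hR, hv, hw⟩, rfl⟩
  have hker : LinearMap.ker p = LinearMap.ker q := by
    ext ⟨⟨v, w⟩, hR, hv, hw⟩
    simp only [p, q, LinearMap.mem_ker, LinearMap.comp_apply, Submodule.mkQ_apply,
      Submodule.Quotient.mk_eq_zero]
    exact h3 v hv w hw hR
  exact ⟨(p.quotKerEquivOfSurjective hp).symm ≪≫ₗ Submodule.quotEquivOfEq _ _ hker ≪≫ₗ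
    q.quotKerEquivOfSurjective hq⟩

/-- The condition of being a difference, local or global, can be tested on the coordinates in the
basis `z`, so `DiffCoh K W` is a product of `n` copies of `DiffCoh K ℝ`. -/
lemma diffCoh_tensor {W : Type} [AddCommGroup W] [Module ℝ W] {n : ℕ} (z : Basis (Fin n) ℝ W) :
    Nonempty (DiffCoh K W ≃ₗ[ℝ] W ⊗[ℝ] DiffCoh K ℝ) := by
  have hcoord : ∀ (i : Fin n) (c : locDiff K W), (fun f g => z.coord i (c.1 f g)) ∈ locDiff K ℝ := by
    intro i c x
    obtain ⟨κ, hκ⟩ := c.2 x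
    exact ⟨fun f => z.coord i (κ f), fun f g hf hg =>
      (congrArg (z.coord i) (hκ f g hf hg)).trans (map_sub _ _ _)⟩
  let m : Fin n → locDiff K W →ₗ[ℝ] locDiff K ℝ := fun i =>
    { toFun := fun c => ⟨fun f g => z.coord i (c.1 f g), hcoord i c⟩
      map_add' := fun a b => by ext; simp
      map_smul' := fun r a => by ext; simp }
  let p : locDiff K W →ₗ[ℝ] (Fin n → DiffCoh K ℝ) := LinearMap.pi fun i =>
    ((globDiff K ℝ).submoduleOf (locDiff K ℝ)).mkQ ∘ₗ m i
  have hker : LinearMap.ker p = (globDiff K W).submoduleOf (locDiff K W) := by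
    ext c
    have h1 : c ∈ LinearMap.ker p ↔ ∀ i, (fun f g => z.coord i (c.1 f g)) ∈ globDiff K ℝ := by
      rw [LinearMap.mem_ker, funext_iff]
      refine forall_congr' fun i => ?_
      simp only [p, LinearMap.pi_apply, LinearMap.comp_apply, Submodule.mkQ_apply, Pi.zero_apply,
        Submodule.Quotient.mk_eq_zero]
      rfl
    rw [h1]
    constructor
    · intro h
      choose κ hκ using h
      refine ⟨fun f => ∑ i, κ i f • z i, fun x f g hf hg => ?_⟩
      rw [← Finset.sum_sub_distrib]
      refine (z.sum_repr (c.1 f g)).symm.trans ?_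
      refine Finset.sum_congr rfl fun i _ => ?_
      rw [← sub_smul, ← hκ i x f g hf hg]
      rfl
    · rintro ⟨κ, hκ⟩ i
      exact ⟨fun f => z.coord i (κ f), fun x f g hf hg =>
        (congrArg (z.coord i) (hκ x f g hf hg)).trans (map_sub _ _ _)⟩
  have hsurj : Function.Surjective p := by
    intro y
    choose c hc using fun i => Submodule.mkQ_surjective _ (y i)
    refine ⟨⟨fun f g => ∑ i, (c i).1 f g • z i, fun x => ?_⟩, ?_⟩
    · choose κ hκ using fun i => (c i).2 x
      refine ⟨fun f => ∑ i, κ i f • z i, fun f g hf hg => ?_⟩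
      rw [← Finset.sum_sub_distrib]
      exact Finset.sum_congr rfl fun i _ => by rw [hκ i f g hf hg, sub_smul]
    · funext i
      rw [← hc i]
      refine congrArg (Submodule.mkQ _) (Subtype.ext ?_)
      funext f g
      simp [m, Finsupp.single_apply]
  exact ⟨Submodule.quotEquivOfEq _ _ hker.symm ≪≫ₗ p.quotKerEquivOfSurjective hsurj ≪≫ₗ
    (Finsupp.linearEquivFunOnFinite ℝ _ _).symm ≪≫ₗ
    (TensorProduct.equivFinsuppOfBasisLeft z).symm⟩

end GlobalCohomology

/-! ## Cohomology of the global complex in degree one -/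

section GlobalCohomologyOne

open Module MvPolynomial

variable {K : Geometry.SimplicialComplex ℝ Plane} {Ω : TopologicalSpace.Opens Plane}
  {o : EdgeOrientation K} {e : Finset Plane}

/-- In the kernel of `jetOp` the gradient is a multiple of the identity, which is what a jet of `a +
b x` looks like. -/
lemma exists_RT2_jet (x : Plane) {j : Jet1} (h : jetOp j = 0) : ∃ r ∈ RT2, trFV0 x r = j := by
  have h0 := congrFun (congrFun h 0) 0
  have h1 := congrFun (congrFun h 0) 1
  have h2 := congrFun (congrFun h 1) 1
  simp [jetOp] at h0 h1 h2
  refine ⟨_, ⟨fun i => j.1 i - j.2 0 0 * x i, j.2 0 0, rfl⟩, ?_⟩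
  ext i k
  · simp [trFV0, evalAt]
  · fin_cases i <;> fin_cases k <;> simp [trFV0, evalAt, pdP] <;> linarith

lemma RT2_eq_zero_of_trFE0 (he : o.IsEdge e) {r : VecPoly} (hr : r ∈ RT2) (h : trFE0 o e r = 0) :
    r = 0 := by
  obtain ⟨a, b, rfl⟩ := hr
  obtain ⟨h1, h2⟩ := (trFE0_eq_zero_iff he).1 h
  have hb : b = 0 := by
    have h3 : divV pdP (fun i : Fin 2 => (C (a i) + C b * X i : Poly)) = C (2 * b) := by
      simp only [divV, pdP_add, pdP_C, pdP_mul, pdP_X, if_true, map_mul]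
      rw [show (C 2 : Poly) = 2 from rfl]
      ring
    rw [h3] at h2
    simpa [EdgeOrientation.restr] using h2
  subst hb
  funext i
  have := h1 i
  simpa [EdgeOrientation.restr] using this

/-- Uniqueness for an initial value problem along the edge: the third component is constant and
vanishes at `x`, and then so do the other two. -/
lemma trFE0_eq_zero_of_edgeOp (he : o.IsEdge e) {x : Plane} (hx : x ∈ e) {v : VecPoly}
    (hv : trFV0 x v = 0) (h : edgeOp (trFE0 o e v) = 0) : trFE0 o e v = 0 := by
  have hev := (trEV0_eq_zero_iff he).1 (trEV0_trFE0 he hx hv)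
  revert h hev
  generalize trFE0 o e v = a
  obtain ⟨a0, a1, a2⟩ := a
  intro h hev
  have h0 : Polynomial.derivative a0 = 0 := congrArg Prod.fst h
  have h1 : Polynomial.derivative a1 - (1 / 2 : ℝ) • a2 = 0 := congrArg (fun a => a.2.1) h
  have h2 : (1 / 2 : ℝ) • Polynomial.derivative a2 = 0 := congrArg (fun a => a.2.2) h
  have hc : ∀ p : Polynomial ℝ, Polynomial.derivative p = 0 → p.eval (o.coord e x) = 0 → p = 0 := by
    intro p hp h0
    rw [Polynomial.eq_C_of_derivative_eq_zero hp, Polynomial.eval_C] at h0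
    rw [Polynomial.eq_C_of_derivative_eq_zero hp, h0, map_zero]
  have ha2 := hc a2 ((smul_eq_zero.1 h2).resolve_left (by norm_num)) hev.2.2.2.2
  rw [ha2, smul_zero, sub_zero] at h1
  rw [hc a0 h0 hev.1, hc a1 h1 hev.2.1, ha2]
  rfl

/-- A field with single-valued `sym curl` on an edge has, at both end points, the jet of the same
element of `RT2`, which also gives its trace on the edge. -/
lemma exists_RT2_of_trace_eq_zero (he : o.IsEdge e) {v : VecPoly}
    (hE : trFE1 o e (symCurlP v) = 0) (hV : ∀ x ∈ e, trFV1 x (symCurlP v) = 0) :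
    ∃ r ∈ RT2, trFE0 o e v = trFE0 o e r ∧ ∀ x ∈ e, trFV0 x v = trFV0 x r := by
  -- At each end point the jet is that of an element of `RT2`, which determines the trace along the
  -- edge by uniqueness. The two elements have the same trace, hence coincide.
  have key : ∀ x ∈ e, ∃ r ∈ RT2, trFE0 o e v = trFE0 o e r ∧ trFV0 x v = trFV0 x r := by
    intro x hx
    have h := hV x hx
    rw [trFV1_symCurlP] at h
    obtain ⟨r, hr, hrv⟩ := exists_RT2_jet x h
    refine ⟨r, hr, ?_, hrv.symm⟩
    rw [← sub_eq_zero, ← map_sub]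
    refine trFE0_eq_zero_of_edgeOp he hx (by rw [map_sub, hrv, sub_self]) ?_
    rw [← trFE1_symCurlP he, map_sub, symCurlP_eq_zero_iff.2 hr, sub_zero, hE]
  obtain ⟨r, hr, hrE, -⟩ := key _ he.start_mem
  refine ⟨r, hr, hrE, fun x hx => ?_⟩
  obtain ⟨r', hr', hrE', hrx⟩ := key x hx
  have : r' - r = 0 := RT2_eq_zero_of_trFE0 he (Submodule.sub_mem _ hr' hr)
    (by rw [map_sub, ← hrE, ← hrE', sub_self])
  rw [hrx, sub_eq_zero.1 this]

lemma RT2_eq_of_jet {r r' : VecPoly} (hr : r ∈ RT2) (hr' : r' ∈ RT2) {x : Plane}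
    (h : trFV0 x r = trFV0 x r') : r = r' :=
  sub_eq_zero.1 (RT2_eq_zero_of_jet (Submodule.sub_mem _ hr hr') (x := x)
    (by rw [map_sub, h, sub_self]))

lemma mem_powersetCard_two {f g : Finset Plane} (hef : e ∈ f.powersetCard 2) (heg : e ⊆ g) :
    e ∈ g.powersetCard 2 :=
  Finset.mem_powersetCard.2 ⟨heg, (Finset.mem_powersetCard.1 hef).2⟩

lemma exists_mem_of_mem_powersetCard {f : Finset Plane} (hef : e ∈ f.powersetCard 2) :
    ∃ x ∈ e, x ∈ f := by
  obtain ⟨x, hx⟩ : e.Nonempty := Finset.card_pos.1 (by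
    rw [(Finset.mem_powersetCard.1 hef).2]; norm_num)
  exact ⟨x, hx, (Finset.mem_powersetCard.1 hef).1 hx⟩

variable (o) in
/-- The piecewise potentials `u` of `σ` have the jumps `c`. -/
def IsJump (k : ℕ) (c : triangles K → triangles K → RT2) (u : triangles K → VecPoly) : Prop :=
  (∀ f i, u f i ∈ polyLE k) ∧
  (∀ f g : triangles K, ∀ e ∈ f.1.powersetCard 2, e ⊆ g.1 →
    trFE0 o e (u f - u g) = trFE0 o e (c f g).1) ∧
  ∀ f g : triangles K, ∀ x ∈ f.1, x ∈ g.1 → trFV0 x (u f - u g) = trFV0 x (c f g).1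

variable (o) in
/-- The relation between local differences with values in `RT2` and the closed piecewise fields
whose potentials have these differences as jumps. -/
def jumpRel (k : ℕ) : Submodule ℝ ((triangles K → triangles K → RT2) × (triangles K → MatPoly)) where
  carrier := {p | ∃ u, IsJump o k p.1 u ∧ ∀ f, symCurlP (u f) = p.2 f}
  zero_mem' := ⟨0, ⟨fun f i => Submodule.zero_mem _, fun f g e _ _ => by simp,
    fun f g x _ _ => by simp⟩, fun f => by simp⟩
  add_mem' := by
    rintro p q ⟨u, ⟨h1, h2, h3⟩, h4⟩ ⟨v, ⟨g1, g2, g3⟩, g4⟩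
    refine ⟨u + v, ⟨fun f i => Submodule.add_mem _ (h1 f i) (g1 f i), fun f g e hef heg => ?_,
      fun f g x hf hg => ?_⟩, fun f => ?_⟩
    · rw [Pi.add_apply, Pi.add_apply, add_sub_add_comm, map_add, h2 f g e hef heg, g2 f g e hef heg]
      exact (map_add _ _ _).symm
    · rw [Pi.add_apply, Pi.add_apply, add_sub_add_comm, map_add, h3 f g x hf hg, g3 f g x hf hg]
      exact (map_add _ _ _).symm
    · rw [Pi.add_apply, map_add, h4, g4]
      rfl
  smul_mem' := by
    rintro r p ⟨u, ⟨h1, h2, h3⟩, h4⟩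
    refine ⟨r • u, ⟨fun f i => Submodule.smul_mem _ r (h1 f i), fun f g e hef heg => ?_,
      fun f g x hf hg => ?_⟩, fun f => ?_⟩
    · rw [Pi.smul_apply, Pi.smul_apply, ← smul_sub, map_smul, h2 f g e hef heg]
      exact (map_smul _ _ _).symm
    · rw [Pi.smul_apply, Pi.smul_apply, ← smul_sub, map_smul, h3 f g x hf hg]
      exact (map_smul _ _ _).symm
    · rw [Pi.smul_apply, map_smul, h4]
      rfl

lemma IsJump.globalSpace_mem {k : ℕ} {c : triangles K → triangles K → RT2}
    {u : triangles K → VecPoly} (h : IsJump o k c u) :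
    globalD0 K (huMaZhang o k) u ∈ globalSpace K (huMaZhang o k).S1 := by
  obtain ⟨h1, h2, h3⟩ := h
  have hc : ∀ f g, symCurlP (c f g).1 = 0 := fun f g => symCurlP_eq_zero_iff.2 (c f g).2
  refine ⟨fun f => ⟨isSymm_symCurlP _, symCurlP_mem (h1 f)⟩, fun f g e hef heg => ?_,
    fun f g x hf hg => ?_⟩
  · have he := isEdge_of_mem_powersetCard (o := o) f.2 e hef
    show trFE1 o e (symCurlP (u f)) = trFE1 o e (symCurlP (u g))
    rw [← sub_eq_zero, ← map_sub, ← map_sub, trFE1_symCurlP he, h2 f g e hef heg,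
      ← trFE1_symCurlP he, hc, map_zero]
  · show trFV1 x (symCurlP (u f)) = trFV1 x (symCurlP (u g))
    rw [← sub_eq_zero, ← map_sub, ← map_sub, trFV1_symCurlP, h3 f g x hf hg,
      ← trFV1_symCurlP, hc, map_zero]

/-- Local differences are the jumps of piecewise polynomials. -/
lemma exists_isJump {k : ℕ} (hk : 4 ≤ k) {c : triangles K → triangles K → RT2}
    (hc : c ∈ locDiff K RT2) : ∃ u, IsJump o k c u := by
  classical
  choose κ hκ using hc
  have huni := fun f : triangles K => unisolvence0 (isTri_of_mem f.2)
    (isEdge_of_mem_powersetCard (o := o) f.2) hk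
  -- The jets of `κ x` are interpolated at each vertex `x`, so that the vertex traces already have
  -- the jumps `c`. The jumps along edges are then off by edge bubbles only.
  choose v hvk hv using fun f : triangles K => (huni f).2.2.2.1 fun x => trFV0 x (κ x f).1
  have hadd : ∀ f g h : triangles K, ∀ x, x ∈ f.1 → x ∈ g.1 → x ∈ h.1 →
      (c f g).1 + (c g h).1 = (c f h).1 := by
    intro f g h x hf hg hh
    rw [hκ x f g hf hg, hκ x g h hg hh, hκ x f h hf hh]
    simp
  have hjet : ∀ f g : triangles K, ∀ x, x ∈ f.1 → x ∈ g.1 → trFV0 x (v f - v g - (c f g).1) = 0 := by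
    intro f g x hf hg
    rw [map_sub, map_sub, hv f x hf, hv g x hg, hκ x f g hf hg]
    simp
  -- For each edge one triangle `g` is fixed as a reference. The corrections on the other triangles
  -- are taken relative to it, which makes them consistent.
  have href : ∀ e : Finset Plane, ∃ h : triangles K → Edge3, ∀ f : triangles K,
      e ∈ f.1.powersetCard 2 → ∃ g : triangles K, e ⊆ g.1 ∧
        (∀ f' : triangles K, e ∈ f'.1.powersetCard 2 →
          h f' = -trFE0 o e (v f' - v g - (c f' g).1)) := by
    intro e
    by_cases h : ∃ g : triangles K, e ∈ g.1.powersetCard 2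
    · obtain ⟨g, hg⟩ := h
      exact ⟨fun f => -trFE0 o e (v f - v g - (c f g).1), fun f hf =>
        ⟨g, (Finset.mem_powersetCard.1 hg).1, fun f' _ => rfl⟩⟩
    · exact ⟨0, fun f hf => absurd ⟨f, hf⟩ h⟩
  choose a ha using href
  have hmem : ∀ f : triangles K, ∀ e ∈ f.1.powersetCard 2, a e f ∈ edgeBubble0 o k e := by
    intro f e hef
    obtain ⟨g, hg, hag⟩ := ha e f hef
    rw [hag f hef]
    refine Submodule.neg_mem _ ⟨trFE0_mem fun i => ?_, ?_⟩
    · exact Submodule.sub_mem _ (Submodule.sub_mem _ (hvk f i) (hvk g i))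
        (RT2_mem_polyLE (c f g).2 (by omega) i)
    · simp only [SetLike.mem_coe, Submodule.mem_iInf, LinearMap.mem_ker]
      intro x hx
      exact trEV0_trFE0 (isEdge_of_mem_powersetCard f.2 e hef) hx
        (hjet f g x ((Finset.mem_powersetCard.1 hef).1 hx) (hg hx))
  choose w hwk hw0 hwE using fun f : triangles K => (huni f).2.2.2.2 (fun e => a e f) (hmem f)
  refine ⟨fun f => v f + w f, fun f i => Submodule.add_mem _ (hvk f i) (hwk f i),
    fun f g e hef heg => ?_, fun f g x hf hg => ?_⟩
  · have heg' := mem_powersetCard_two hef heg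
    obtain ⟨h, hh, hah⟩ := ha e f hef
    obtain ⟨x, hx, hxf⟩ := exists_mem_of_mem_powersetCard hef
    have h1 := hwE f e hef
    have h2 := hwE g e heg'
    rw [hah f hef] at h1
    rw [hah g heg'] at h2
    rw [← hadd f h g x hxf (hh hx) (heg hx)]
    have h3 := hadd g h g x (heg hx) (hh hx) (heg hx)
    have h4 : (c g g).1 = 0 := by
      rw [hκ x g g (heg hx) (heg hx), sub_self]
      rfl
    rw [h4] at h3
    -- Local differences are additive and antisymmetric at a common vertex, so the two jumps
    -- relative to the reference triangle combine to the jump between `f` and `g`.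
    have h5 : (c h g).1 = -(c g h).1 := by
      rw [eq_neg_iff_add_eq_zero, add_comm, h3]
    rw [h5, add_sub_add_comm, map_add, map_sub (trFE0 o e) (w f), h1, h2]
    simp only [map_sub, map_add, map_neg]
    abel
  · have := hjet f g x hf hg
    rw [map_sub, sub_eq_zero] at this
    rw [add_sub_add_comm, map_add, this, map_sub, hw0 f x hf, hw0 g x hg, sub_zero, add_zero]

/-- Closed piecewise fields have piecewise potentials with jumps in `RT2`. -/
lemma exists_jump_of_closed {k : ℕ} (hk : 4 ≤ k) {σ : triangles K → MatPoly}
    (hσ : σ ∈ globalSpace K (huMaZhang o k).S1) (h0 : ∀ f, divDivP (σ f) = 0) :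
    ∃ c ∈ locDiff K RT2, (c, σ) ∈ jumpRel o k := by
  classical
  have hu : ∀ f, ∃ u : VecPoly, (∀ i, u i ∈ polyLE k) ∧ symCurlP u = σ f := by
    intro f
    obtain ⟨u, _, h1, h2, -⟩ := exists_symCurl_of_divDiv_eq_zero (hσ.1 f).2 (hσ.1 f).1 (h0 f)
    rw [show k - 1 + 1 = k by omega] at h1
    exact ⟨u, h1, h2⟩
  choose u huk hus using hu
  have hV : ∀ f g : triangles K, ∀ x ∈ f.1, x ∈ g.1 → trFV1 x (symCurlP (u f - u g)) = 0 := by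
    intro f g x hf hg
    rw [map_sub, map_sub, hus, hus, sub_eq_zero]
    exact hσ.2.2 f g x hf hg
  have hE : ∀ f g : triangles K, ∀ e ∈ f.1.powersetCard 2, e ⊆ g.1 →
      trFE1 o e (symCurlP (u f - u g)) = 0 := by
    intro f g e hf hg
    rw [map_sub, map_sub, hus, hus, sub_eq_zero]
    exact hσ.2.1 f g e hf hg
  -- The jump is read off from the jet at one common vertex. Distinct triangles share at most one
  -- edge, along which the element of `RT2` stays the same.
  have hc : ∀ f g : triangles K, ∃ r : RT2,
      (∀ e ∈ f.1.powersetCard 2, e ⊆ g.1 → trFE0 o e (u f - u g) = trFE0 o e r.1) ∧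
      ∀ x ∈ f.1, x ∈ g.1 → trFV0 x (u f - u g) = trFV0 x r.1 := by
    intro f g
    by_cases hfg : f = g
    · subst hfg
      exact ⟨0, by simp, by simp⟩
    by_cases hx : ∃ x ∈ f.1, x ∈ g.1
    swap
    · refine ⟨0, fun e hef heg => ?_, fun x hf hg => absurd ⟨x, hf, hg⟩ hx⟩
      obtain ⟨x, hx', hxf⟩ := exists_mem_of_mem_powersetCard hef
      exact absurd ⟨x, hxf, heg hx'⟩ hx
    obtain ⟨x, hxf, hxg⟩ := hx
    have h1 := hV f g x hxf hxg
    rw [trFV1_symCurlP] at h1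
    obtain ⟨r, hr, hrx⟩ := exists_RT2_jet x h1
    have hne : f.1 ≠ g.1 := fun h => hfg (Subtype.ext h)
    have hcard : (f.1 ∩ g.1).card ≤ 2 := by
      by_contra hlt
      push Not at hlt
      have h3 : f.1 ∩ g.1 = f.1 := Finset.eq_of_subset_of_card_le Finset.inter_subset_left
        (by rw [f.2.2]; omega)
      have h4 : f.1 ∩ g.1 = g.1 := Finset.eq_of_subset_of_card_le Finset.inter_subset_right
        (by rw [g.2.2]; omega)
      exact hne (h3.symm.trans h4)
    have hedge : ∀ e ∈ f.1.powersetCard 2, e ⊆ g.1 → e = f.1 ∩ g.1 := by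
      intro e hef heg
      refine Finset.eq_of_subset_of_card_le
        (Finset.subset_inter (Finset.mem_powersetCard.1 hef).1 heg) ?_
      rw [(Finset.mem_powersetCard.1 hef).2]
      exact hcard
    have hmain : ∀ e ∈ f.1.powersetCard 2, e ⊆ g.1 → trFE0 o e (u f - u g) = trFE0 o e r ∧
        ∀ y ∈ e, trFV0 y (u f - u g) = trFV0 y r := by
      intro e hef heg
      obtain ⟨r', hr', h3, h4⟩ := exists_RT2_of_trace_eq_zero
        (isEdge_of_mem_powersetCard (o := o) f.2 e hef) (hE f g e hef heg)
        (fun y hy => hV f g y ((Finset.mem_powersetCard.1 hef).1 hy) (heg hy))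
      have hxe : x ∈ e := by
        rw [hedge e hef heg]
        exact Finset.mem_inter.2 ⟨hxf, hxg⟩
      have : r' = r := RT2_eq_of_jet hr' hr (x := x) (by rw [← h4 x hxe, hrx])
      subst this
      exact ⟨h3, h4⟩
    refine ⟨⟨r, hr⟩, fun e hef heg => (hmain e hef heg).1, fun y hyf hyg => ?_⟩
    by_cases hyx : y = x
    · subst hyx
      exact hrx.symm
    · have hsub : ({x, y} : Finset Plane) ⊆ g.1 := by
        simp [Finset.insert_subset_iff, hxg, hyg]
      refine (hmain {x, y} (Finset.mem_powersetCard.2 ⟨?_, Finset.card_pair (Ne.symm hyx)⟩)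
        hsub).2 y (by simp)
      simp [Finset.insert_subset_iff, hxf, hyf]
  choose c hcE hcV using hc
  refine ⟨c, fun x => ?_, u, ⟨huk, hcE, hcV⟩, hus⟩
  by_cases hx : ∃ h : triangles K, x ∈ h.1
  · obtain ⟨h, hh⟩ := hx
    -- Differences at `x` are taken against one fixed triangle `h`; jets at `x` are additive and
    -- determine the elements of `RT2`.
    refine ⟨fun f => c f h, fun f g hf hg => Subtype.ext ?_⟩
    refine RT2_eq_of_jet (c f g).2 (c f h - c g h).2 (x := x) ?_
    rw [← hcV f g x hf hg, Submodule.coe_sub, map_sub (trFV0 x) (c f h).1, ← hcV f h x hf hh,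
      ← hcV g h x hg hh]
    simp only [map_sub]
    abel
  · exact ⟨0, fun f g hf _ => absurd ⟨f, hf⟩ hx⟩

/-- Related pairs consist of a field with piecewise potentials and their jumps. The jumps are global
differences precisely when the potentials can be changed by elements of `RT2` on each triangle into
a conforming one. -/
theorem coh1_equiv {k : ℕ} (hk : 4 ≤ k) :
    Nonempty (DiffCoh K RT2 ≃ₗ[ℝ] Coh1 (globalSpace K (huMaZhang o k).S0)
      (globalSpace K (huMaZhang o k).S1) (globalD0 K (huMaZhang o k))
      (globalD1 K (huMaZhang o k))) := by
  refine quotient_equiv_of_relation (jumpRel o k) _ _ _ _ ?_ ?_ ?_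
  · intro c hc
    obtain ⟨u, hu⟩ := exists_isJump (o := o) hk hc
    exact ⟨globalD0 K (huMaZhang o k) u, ⟨hu.globalSpace_mem,
      funext fun f => divDivP_symCurlP _⟩, u, hu, fun f => rfl⟩
  · rintro σ ⟨hσ, h0⟩
    exact exists_jump_of_closed hk hσ fun f => congrFun h0 f
  · rintro c - σ - ⟨u, ⟨h1, h2, h3⟩, h4⟩
    constructor
    · rintro ⟨b, hb⟩
      have hbE : ∀ f g : triangles K, ∀ x ∈ f.1, x ∈ g.1 → (c f g).1 = (b f).1 - (b g).1 :=
        fun f g x hf hg => congrArg Subtype.val (hb x f g hf hg)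
      refine ⟨fun f => u f - (b f).1, ⟨fun f => mem_vecPolyLE.2 fun i =>
        Submodule.sub_mem _ (h1 f i) (RT2_mem_polyLE (b f).2 (by omega) i),
        fun f g e hef heg => ?_, fun f g x hf hg => ?_⟩, funext fun f => ?_⟩
      · show trFE0 o e (u f - (b f).1) = trFE0 o e (u g - (b g).1)
        obtain ⟨x, hx, hxf⟩ := exists_mem_of_mem_powersetCard hef
        rw [← sub_eq_zero, ← map_sub, sub_sub_sub_comm, map_sub, h2 f g e hef heg,
          hbE f g x hxf (heg hx), sub_self]
      · show trFV0 x (u f - (b f).1) = trFV0 x (u g - (b g).1)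
        rw [← sub_eq_zero, ← map_sub, sub_sub_sub_comm, map_sub, h3 f g x hf hg,
          hbE f g x hf hg, sub_self]
      · show symCurlP (u f - (b f).1) = σ f
        rw [map_sub, h4, symCurlP_eq_zero_iff.2 (b f).2, sub_zero]
    · rintro ⟨v, hv, rfl⟩
      have hb : ∀ f, u f - v f ∈ RT2 := fun f => by
        rw [← symCurlP_eq_zero_iff, map_sub, sub_eq_zero]
        exact h4 f
      refine ⟨fun f => ⟨u f - v f, hb f⟩, fun x f g hf hg => Subtype.ext ?_⟩
      refine RT2_eq_of_jet (c f g).2 (Submodule.sub_mem _ (hb f) (hb g)) (x := x) ?_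
      have h5 : trFV0 x (v f) = trFV0 x (v g) := hv.2.2 f g x hf hg
      refine (h3 f g x hf hg).symm.trans ?_
      show trFV0 x (u f - u g) = trFV0 x ((u f - v f) - (u g - v g))
      rw [sub_sub_sub_comm, map_sub _ (u f - u g), map_sub _ (v f), h5, sub_self, sub_zero]

end GlobalCohomologyOne

/-! ## De Rham cohomology in the degrees zero and two -/

section DeRhamBasics

open Set Filter Topology MeasureTheory

variable {Ω : TopologicalSpace.Opens Plane}

/-- The element of `C^∞(Ω)` given by a function on the plane. -/
def toCinf (F : Plane → ℝ) (hF : ContDiffOn ℝ ∞ F Ω) : Cinf Ω :=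
  ⟨fun x => F x, hF.congr fun x hx => extZero_apply Ω _ ⟨x, hx⟩⟩

lemma extZero_eventuallyEq {g : Ω → ℝ} {F : Plane → ℝ} {x : Plane} (hx : x ∈ Ω)
    (h : ∀ᶠ y in 𝓝 x, ∀ hy : y ∈ Ω, g ⟨y, hy⟩ = F y) : extZero Ω g =ᶠ[𝓝 x] F := by
  filter_upwards [h, Ω.isOpen.mem_nhds hx] with y hy hyΩ
  exact (extZero_apply Ω g ⟨y, hyΩ⟩).trans (hy hyΩ)

lemma pdΩ_apply {g : Cinf Ω} {F : Plane → ℝ} {x : Plane} (hx : x ∈ Ω)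
    (h : ∀ᶠ y in 𝓝 x, ∀ hy : y ∈ Ω, g.1 ⟨y, hy⟩ = F y) (i : Fin 2) :
    (pdΩ Ω i g).1 ⟨x, hx⟩ = pd i F x := by
  show fderiv ℝ (extZero Ω g.1) x _ = fderiv ℝ F x _
  rw [(extZero_eventuallyEq hx h).fderiv_eq]

lemma clm_plane_ext {E : Type*} [NormedAddCommGroup E] [NormedSpace ℝ E] {L M : Plane →L[ℝ] E}
    (h : ∀ i, L (EuclideanSpace.single i 1) = M (EuclideanSpace.single i 1)) : L = M := by
  have : (L : Plane →ₗ[ℝ] E) = M :=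
    (EuclideanSpace.basisFun (Fin 2) ℝ).toBasis.ext fun i => by simpa using h i
  exact ContinuousLinearMap.coe_injective this

lemma clm_plane_apply {E : Type*} [NormedAddCommGroup E] [NormedSpace ℝ E] (L : Plane →L[ℝ] E)
    (v : Plane) : L v = v 0 • L (EuclideanSpace.single 0 1) + v 1 • L (EuclideanSpace.single 1 1) := by
  have : v = v 0 • EuclideanSpace.single 0 1 + v 1 • EuclideanSpace.single 1 1 := by
    ext i
    fin_cases i <;> simp
  conv_lhs => rw [this]
  rw [map_add, map_smul, map_smul]

theorem hdR0_equiv (hΩ : IsConnected (Ω : Set Plane)) : Nonempty (HdR0 Ω ≃ₗ[ℝ] ℝ) := by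
  obtain ⟨p, hp⟩ := hΩ.nonempty
  let ev : HdR0 Ω →ₗ[ℝ] ℝ :=
    { toFun := fun g => g.1.1 ⟨p, hp⟩
      map_add' := fun _ _ => rfl
      map_smul' := fun _ _ => rfl }
  refine ⟨LinearEquiv.ofBijective ev ⟨?_, fun c => ?_⟩⟩
  · rw [injective_iff_map_eq_zero]
    rintro ⟨g, hg'⟩ h0
    have h0' : g.1 ⟨p, hp⟩ = 0 := h0
    have hg := hg'.2
    apply Subtype.ext
    apply Subtype.ext
    funext ⟨y, hy⟩
    have h1 : ∀ x ∈ (Ω : Set Plane), fderiv ℝ (extZero Ω g.1) x = 0 := by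
      intro x hx
      apply clm_plane_ext
      intro i
      have := congrFun (congrArg Subtype.val (congrFun (LinearMap.mem_ker.1 hg) i)) ⟨x, hx⟩
      exact this
    have h2 := Ω.isOpen.is_const_of_fderiv_eq_zero hΩ.isPreconnected
      (g.2.differentiableOn (by simp)) h1 hy hp
    rw [extZero_apply Ω g.1 ⟨y, hy⟩, extZero_apply Ω g.1 ⟨p, hp⟩] at h2
    exact h2.trans h0'
  · refine ⟨⟨toCinf (fun _ => c) contDiffOn_const, trivial, ?_⟩, rfl⟩
    rw [SetLike.mem_coe, LinearMap.mem_ker]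
    funext i
    apply Subtype.ext
    funext ⟨x, hx⟩
    refine (pdΩ_apply hx (F := fun _ => c) (Eventually.of_forall fun y hy => rfl) i).trans ?_
    simp [pd]

/-- A function that vanishes far away from `p` is `v · ∇a + 2 a`, where `v` is the radial vector
field at `p`, on any open set all of whose outward rays stay in the domain of smoothness. -/
lemma exists_radial_primitive {U V : Set Plane} (hU : IsOpen U) (hV : IsOpen V) {p : Plane}
    (hp : p ∉ U) {h : Plane → ℝ} (hh : ContDiffOn ℝ ∞ h V)
    (hray : ∀ y ∈ U, ∀ s : ℝ, 1 ≤ s → p + s • (y - p) ∈ V) {R : ℝ}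
    (hR : ∀ y, R ≤ ‖y - p‖ → h y = 0) :
    ∃ a : Plane → ℝ, ContDiffOn ℝ ∞ a U ∧ ∀ y ∈ U, fderiv ℝ a y (y - p) + 2 * a y = h y := by
  let ray : Plane → ℝ → Plane := fun y τ => p + Real.exp τ • (y - p)
  have hrayc : ContDiff ℝ ∞ (fun z : Plane × ℝ => ray z.1 z.2) :=
    contDiff_const.add ((Real.contDiff_exp.comp contDiff_snd).smul (contDiff_fst.sub contDiff_const))
  -- Along the ray the function `exp(2τ) a` should have the derivative `exp(2τ) h`. It is integrated
  -- inwards from infinity, where `h` vanishes.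
  let a : Plane → ℝ := fun y => -∫ τ in Ioi 0, Real.exp τ ^ 2 * h (ray y τ)
  -- Locally uniform in `y`, the rays start slightly before `y` inside the domain of smoothness and
  -- leave the support of `h` after the parameter `T`.
  have hloc : ∀ y₀ ∈ U, ∃ ε > 0, ∃ T > 0, ∃ B : Set Plane, IsOpen B ∧ y₀ ∈ B ∧
      (∀ y ∈ B, ∀ τ, -ε < τ → ray y τ ∈ V) ∧ ∀ y ∈ B, ∀ τ, T ≤ τ → h (ray y τ) = 0 := by
    intro y₀ hy₀
    have h1 : ∀ᶠ z : Plane × ℝ in 𝓝 (y₀, 0), ray z.1 z.2 ∈ V := by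
      apply hrayc.continuous.continuousAt.eventually_mem
      apply hV.mem_nhds
      simpa [ray] using hray y₀ hy₀ 1 le_rfl
    rw [nhds_prod_eq] at h1
    obtain ⟨P, hP, Q, hQ, hPQ⟩ := eventually_prod_iff.1 h1
    obtain ⟨ε, hε, hQε⟩ := Metric.eventually_nhds_iff.1 hQ
    have hne : 0 < ‖y₀ - p‖ := norm_pos_iff.2 (sub_ne_zero.2 fun h => hp (h ▸ hy₀))
    have h2 : ∀ᶠ y in 𝓝 y₀, ‖y₀ - p‖ / 2 < ‖y - p‖ :=
      (show Continuous fun y : Plane => ‖y - p‖ by fun_prop).continuousAt.eventually_const_lt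
        (by linarith)
    obtain ⟨B, hB, hBo, hyB⟩ := eventually_nhds_iff.1 ((hP.and h2).and (hU.mem_nhds hy₀))
    obtain ⟨T, hT⟩ : ∃ T : ℝ, R ≤ Real.exp T * (‖y₀ - p‖ / 2) := by
      obtain ⟨T, hT⟩ := (Real.tendsto_exp_atTop.eventually_ge_atTop (R / (‖y₀ - p‖ / 2))).exists
      exact ⟨T, (div_le_iff₀ (by positivity)).1 hT⟩
    refine ⟨ε, hε, max T 1, by positivity, B, hBo, hyB, fun y hy τ hτ => ?_, fun y hy τ hτ => ?_⟩
    · by_cases h0 : 0 ≤ τ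
      · exact hray y (hB y hy).2 _ (Real.one_le_exp h0)
      · push Not at h0
        refine hPQ (hB y hy).1.1 (hQε ?_)
        rw [Real.dist_eq, sub_zero, abs_of_neg h0]
        linarith
    · apply hR
      have h3 : ray y τ - p = Real.exp τ • (y - p) := by simp [ray]
      rw [h3, norm_smul, Real.norm_eq_abs, Real.abs_exp]
      refine hT.trans (mul_le_mul (Real.exp_le_exp.2 ((le_max_left _ _).trans hτ)) (hB y hy).1.2.le
        (by positivity) (Real.exp_pos _).le)
  have hsmooth : ContDiffOn ℝ ∞ a U := by
    intro y₀ hy₀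
    obtain ⟨ε, hε, T, hT, B, hBo, hyB, hBV, hB0⟩ := hloc y₀ hy₀
    -- The cut-off is `1` for positive parameters and `0` before `-ε / 2`. It makes the integrand
    -- smooth for all parameters without changing the integral over the positive ones.
    let χ : ℝ → ℝ := fun τ => Real.smoothTransition (1 + 2 * τ / ε)
    have hχ : ContDiff ℝ ∞ χ := Real.smoothTransition.contDiff.comp
      (contDiff_const.add ((contDiff_const.mul contDiff_id).div_const ε))
    have hχ1 : ∀ τ, 0 < τ → χ τ = 1 := fun τ h0 =>
      Real.smoothTransition.one_of_one_le (by linarith [show 0 < 2 * τ / ε by positivity])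
    have hχ0 : ∀ τ, τ ≤ -(ε / 2) → χ τ = 0 := fun τ h0 => by
      apply Real.smoothTransition.zero_of_nonpos
      have : 2 * τ / ε ≤ -1 := by
        rw [div_le_iff₀ hε]
        linarith
      linarith
    let g : Plane → ℝ → ℝ := fun y τ => χ τ * (Real.exp τ ^ 2 * h (ray y τ))
    have hg : ContDiffOn ℝ ∞ ↿g (B ×ˢ univ) := by
      rintro ⟨y, τ⟩ ⟨hy, -⟩
      apply ContDiffAt.contDiffWithinAt
      by_cases hτ : -ε < τ
      · have h1 : ContDiffAt ℝ ∞ (fun z : Plane × ℝ => h (ray z.1 z.2)) (y, τ) :=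
          ContDiffAt.comp (g := h) (y, τ) (hh.contDiffAt (hV.mem_nhds (hBV y hy τ hτ)))
            hrayc.contDiffAt
        exact (hχ.comp contDiff_snd).contDiffAt.mul
          (((Real.contDiff_exp.comp contDiff_snd).pow 2).contDiffAt.mul h1)
      · have : ↿g =ᶠ[𝓝 (y, τ)] fun _ => 0 := by
          filter_upwards [(continuous_snd.continuousAt (x := (y, τ))).eventually_lt_const
            (show τ < -(ε / 2) by linarith)] with z hz
          show χ z.2 * _ = 0
          rw [hχ0 _ hz.le, zero_mul]
        exact contDiffAt_const.congr_of_eventuallyEq this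
    -- The integral over positive parameters is the value at `0` of a convolution with the indicator
    -- of the negative half line, so smooth dependence on `y` is that of convolutions with
    -- parameters.
    have hconv := contDiffOn_convolution_right_with_param_comp (μ := volume) (n := ⊤)
      (ContinuousLinearMap.lsmul ℝ ℝ) (v := fun _ : Plane => (0 : ℝ)) contDiffOn_const
      (f := (Iic (0 : ℝ)).indicator fun _ => (1 : ℝ)) (g := g) hBo
      (isCompact_Icc (a := -ε) (b := T)) (fun y τ hy hτ => by
        rw [mem_Icc, not_and_or, not_le, not_le] at hτ
        rcases hτ with hτ | hτ
        · show χ τ * _ = 0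
          rw [hχ0 τ (by linarith), zero_mul]
        · show _ * (_ * h _) = 0
          rw [hB0 y hy τ hτ.le, mul_zero, mul_zero])
      ((locallyIntegrable_const (1 : ℝ)).indicator measurableSet_Iic) hg
    have heq : ∀ y, a y = -(MeasureTheory.convolution ((Iic (0 : ℝ)).indicator fun _ => (1 : ℝ)) (g y)
        (ContinuousLinearMap.lsmul ℝ ℝ) volume) 0 := by
      intro y
      rw [convolution_def]
      have h1 : ∀ t : ℝ, (ContinuousLinearMap.lsmul ℝ ℝ) ((Iic (0 : ℝ)).indicator (fun _ => (1 : ℝ)) t)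
          (g y (0 - t)) = (Iic (0 : ℝ)).indicator (fun t => g y (-t)) t := by
        intro t
        by_cases ht : t ∈ Iic (0 : ℝ) <;> simp [ht]
      simp_rw [h1]
      rw [integral_indicator measurableSet_Iic, integral_comp_neg_Iic, neg_zero]
      refine congrArg Neg.neg (setIntegral_congr_fun measurableSet_Ioi fun τ hτ => ?_)
      show _ = χ τ * _
      rw [hχ1 τ hτ, one_mul]
    have : ContDiffAt ℝ ∞ a y₀ := by
      rw [show a = fun y => _ from funext heq]
      exact (hconv.contDiffAt (hBo.mem_nhds hyB)).neg
    exact this.contDiffWithinAt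
  refine ⟨a, hsmooth, fun y hy => ?_⟩
  obtain ⟨ε, hε, T, hT, B, hBo, hyB, hBV, hB0⟩ := hloc y hy
  let G : ℝ → ℝ := fun τ => Real.exp τ ^ 2 * h (ray y τ)
  have hGc : ContinuousOn G (Ioi (-ε)) := by
    refine (Real.continuous_exp.pow 2).continuousOn.mul (hh.continuousOn.comp ?_ ?_)
    · exact (hrayc.continuous.comp (Continuous.prodMk_right y)).continuousOn
    · exact fun τ hτ => hBV y hyB τ hτ
  have hderiv : HasDerivAt (fun θ => -∫ τ in θ..T, G τ) (G 0) 0 := by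
    have h1 := intervalIntegral.integral_hasDerivAt_left (f := G) (a := 0) (b := T)
      ((hGc.mono fun τ hτ => by
        rw [uIcc_of_le hT.le] at hτ
        exact lt_of_lt_of_le (by linarith) hτ.1).intervalIntegrable)
      (hGc.stronglyMeasurableAtFilter isOpen_Ioi 0 (by simpa using hε))
      (hGc.continuousAt (Ioi_mem_nhds (by simpa using hε)))
    rw [← neg_neg (G 0)]
    exact h1.neg
  -- Moving `y` along its ray shifts the parameter, so only the lower limit of the integral changes;
  -- its derivative is the differential equation.
  have hval : ∀ᶠ θ in 𝓝 (0 : ℝ), Real.exp θ ^ 2 * a (ray y θ) = -∫ τ in θ..T, G τ := by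
    filter_upwards [Iio_mem_nhds hT] with θ hθ
    have h1 : ∀ τ, Real.exp θ ^ 2 * (Real.exp τ ^ 2 * h (ray (ray y θ) τ)) = G (τ + θ) := by
      intro τ
      have h2 : ray (ray y θ) τ = ray y (τ + θ) := by
        simp only [ray, add_sub_cancel_left, smul_smul, Real.exp_add]
      simp only [G, h2, Real.exp_add]
      ring
    show Real.exp θ ^ 2 * (-∫ τ in Ioi 0, Real.exp τ ^ 2 * h (ray (ray y θ) τ)) = _
    rw [mul_neg, ← integral_const_mul]
    simp_rw [h1]
    have h4 := (measurePreserving_add_right volume θ).setIntegral_preimage_emb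
      (measurableEmbedding_addRight θ) G (Ioi θ)
    rw [show (fun x => x + θ) ⁻¹' Ioi θ = Ioi 0 by ext; simp] at h4
    rw [h4, intervalIntegral.integral_of_le (le_of_lt hθ)]
    congr 1
    refine setIntegral_eq_of_subset_of_forall_sdiff_eq_zero measurableSet_Ioi
      (fun τ hτ => hτ.1) fun τ hτ => ?_
    have h3 : T < τ := by
      by_contra hle
      exact hτ.2 ⟨hτ.1, not_lt.1 hle⟩
    show _ * h _ = 0
    rw [hB0 y hyB τ h3.le, mul_zero]
  have hda : HasFDerivAt a (fderiv ℝ a y) y :=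
    ((hsmooth.contDiffAt (hU.mem_nhds hy)).differentiableAt (by simp)).hasFDerivAt
  have hchain : HasDerivAt (fun θ => Real.exp θ ^ 2 * a (ray y θ))
      (2 * a y + fderiv ℝ a y (y - p)) 0 := by
    have hr : HasDerivAt (ray y) (y - p) 0 := by
      have := ((Real.hasDerivAt_exp 0).smul_const (y - p)).const_add p
      rwa [Real.exp_zero, one_smul] at this
    have h0 : ray y 0 = y := by simp [ray]
    have h1 : HasDerivAt (fun θ => a (ray y θ)) (fderiv ℝ a y (y - p)) 0 :=
      HasFDerivAt.comp_hasDerivAt (l := a) (0 : ℝ) (by rw [h0]; exact hda) hr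
    have h2 := ((Real.hasDerivAt_exp 0).pow 2).mul h1
    have h3 : 2 * a y + fderiv ℝ a y (y - p) = (2 : ℕ) * Real.exp 0 ^ (2 - 1) * Real.exp 0 *
        a (ray y 0) + Real.exp 0 ^ 2 * fderiv ℝ a y (y - p) := by
      rw [h0, Real.exp_zero]
      norm_num
    rw [h3]
    exact h2
  have := hchain.unique (hderiv.congr_of_eventuallyEq hval)
  have hG0 : G 0 = h y := by simp [G, ray]
  rw [hG0] at this
  linarith

end DeRhamBasics

/-! ### Vanishing of de Rham cohomology in degree two -/

section DeRhamTwo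

open Set Filter Topology

variable {K : Geometry.SimplicialComplex ℝ Plane} {Ω : TopologicalSpace.Opens Plane}

lemma extZero_of_notMem (g : Ω → ℝ) {x : Plane} (hx : x ∉ Ω) : extZero Ω g x = 0 :=
  Function.extend_apply' (f := ((↑) : Ω → Plane)) g (0 : Plane → ℝ) x
    (by rintro ⟨y, rfl⟩; exact hx y.2)

lemma exists_smooth_partition {ι : Type} [Fintype ι] {s : Set Plane} (hs : IsClosed s)
    (U : ι → Set Plane) (ho : ∀ i, IsOpen (U i)) (hU : s ⊆ ⋃ i, U i) :
    ∃ ρ : ι → Plane → ℝ, (∀ i, ContDiff ℝ ∞ (ρ i)) ∧ (∀ i, tsupport (ρ i) ⊆ U i) ∧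
      ∀ x ∈ s, ∑ i, ρ i x = 1 := by
  obtain ⟨f, hf⟩ := SmoothPartitionOfUnity.exists_isSubordinate (modelWithCornersSelf ℝ Plane) hs U ho hU
  refine ⟨fun i => f i, fun i => (f i).contMDiff.contDiff, hf, fun x hx => ?_⟩
  rw [← f.sum_eq_one hx, finsum_eq_sum_of_fintype]

/-- The field is `a` times the quarter turn of `y - p`; its `rot` is `2 a + ∇a · (y - p)`. -/
lemma exists_rot_of_radial {V : Set Plane} (hV : IsOpen V) {p : Plane}
    (hp : p ∉ Ω) {h : Plane → ℝ} (hh : ContDiffOn ℝ ∞ h V)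
    (hray : ∀ y ∈ Ω, ∀ s : ℝ, 1 ≤ s → p + s • (y - p) ∈ V) {R : ℝ}
    (hR : ∀ y, R ≤ ‖y - p‖ → h y = 0) :
    ∃ w : Fin 2 → Cinf Ω, ∀ x : Ω, (rotΩ Ω w).1 x = h x := by
  obtain ⟨a, ha, hah⟩ := exists_radial_primitive Ω.isOpen hV hp hh hray hR
  have hl : ∀ i, ContDiff ℝ ∞ fun y : Plane => y i - p i := fun i =>
    (EuclideanSpace.proj i : Plane →L[ℝ] ℝ).contDiff.sub contDiff_const
  have hl' : ContDiff ℝ ∞ fun y : Plane => p 1 - y 1 :=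
    contDiff_const.sub (EuclideanSpace.proj 1 : Plane →L[ℝ] ℝ).contDiff
  refine ⟨![toCinf (fun y => a y * (p 1 - y 1)) (ha.mul hl'.contDiffOn),
    toCinf (fun y => a y * (y 0 - p 0)) (ha.mul (hl 0).contDiffOn)], ?_⟩
  rintro ⟨x, hx⟩
  have hax : HasFDerivAt a (fderiv ℝ a x) x :=
    ((ha.contDiffAt (Ω.isOpen.mem_nhds hx)).differentiableAt (by simp)).hasFDerivAt
  have hd : ∀ i, HasFDerivAt (fun y : Plane => y i - p i) (EuclideanSpace.proj i : Plane →L[ℝ] ℝ) x :=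
    fun i => (EuclideanSpace.proj i : Plane →L[ℝ] ℝ).hasFDerivAt.sub_const _
  have hd1 : HasFDerivAt (fun y : Plane => p 1 - y 1) (-(EuclideanSpace.proj 1 : Plane →L[ℝ] ℝ)) x :=
    (EuclideanSpace.proj 1 : Plane →L[ℝ] ℝ).hasFDerivAt.const_sub _
  have e0 : fderiv ℝ (fun y => a y * (y 0 - p 0)) x = _ := (hax.mul (hd 0)).fderiv
  have e1 : fderiv ℝ (fun y => a y * (p 1 - y 1)) x = _ := (hax.mul hd1).fderiv
  show (pdΩ Ω 0 _).1 ⟨x, hx⟩ - (pdΩ Ω 1 _).1 ⟨x, hx⟩ = h x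
  rw [pdΩ_apply hx (F := fun y => a y * (y 0 - p 0)) (Eventually.of_forall fun y hy => rfl),
    pdΩ_apply hx (F := fun y => a y * (p 1 - y 1)) (Eventually.of_forall fun y hy => rfl), pd, pd,
    e0, e1, ← hah x hx, clm_plane_apply _ (x - p)]
  simp
  ring

variable (hK : IsTriangulation K Ω)
include hK

lemma subset_space : (Ω : Set Plane) ⊆ K.space := by
  rw [hK.eq_interior]
  exact interior_subset

/-- A triangulated domain is conical near each point. -/
lemma exists_conical_ball (p : Plane) : ∃ r > 0, ∀ y ∈ Ω, ∀ s : ℝ, 1 ≤ s →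
    p + s • (y - p) ∈ Metric.ball p r → p + s • (y - p) ∈ Ω := by
  have h1 : ∀ᶠ q in 𝓝 p, ∀ f ∈ triangles K, p ∈ convexHull ℝ (f : Set Plane) →
      (q ∈ convexHull ℝ (f : Set Plane) ↔ ∀ x ∈ f, bary f x p = 0 → 0 ≤ bary f x q) := by
    rw [(finite_triangles hK).eventually_all]
    intro f hf
    by_cases h : p ∈ convexHull ℝ (f : Set Plane)
    · filter_upwards [eventually_mem_hull_iff (isTri_of_mem hf) h] with q hq _ using hq
    · exact Eventually.of_forall fun q hq => absurd hq h
  obtain ⟨r, hr, hball⟩ := Metric.eventually_nhds_iff.1 (h1.and (eventually_triangles hK p))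
  have hin : ∀ y : Plane, ∀ s : ℝ, 1 ≤ s → p + s • (y - p) ∈ Metric.ball p r → dist y p < r := by
    intro y s hs h
    rw [Metric.mem_ball, dist_eq_norm, add_sub_cancel_left, norm_smul, Real.norm_eq_abs,
      abs_of_nonneg (by linarith)] at h
    rw [dist_eq_norm]
    nlinarith [norm_nonneg (y - p)]
  -- Near `p` a triangle at `p` is described by the coordinates that vanish at `p`, and these are
  -- multiplied by `s` along the ray.
  have hspace : ∀ y ∈ K.space, ∀ s : ℝ, 1 ≤ s → p + s • (y - p) ∈ Metric.ball p r →
      p + s • (y - p) ∈ K.space := by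
    intro y hy s hs hb
    obtain ⟨f, hf, hyf⟩ := (mem_space_iff_triangle hK).1 hy
    have hy' := hball (hin y s hs hb)
    have hpf := hy'.2 f hf hyf
    refine (mem_space_iff_triangle hK).2 ⟨f, hf, ((hball hb).1 f hf hpf).2 fun x hx h0 => ?_⟩
    have h2 := ((hy'.1 f hf hpf).1 hyf) x hx h0
    have h3 : p + s • (y - p) = AffineMap.lineMap p y s := by
      rw [AffineMap.lineMap_apply, vsub_eq_sub, vadd_eq_add, add_comm]
    rw [h3, AffineMap.apply_lineMap, h0, AffineMap.lineMap_apply, vsub_eq_sub, vadd_eq_add,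
      sub_zero, add_zero, smul_eq_mul]
    positivity
  refine ⟨r, hr, fun y hy s hs hb => ?_⟩
  rw [mem_Ω_iff hK] at hy ⊢
  have hs0 : s ≠ 0 := by linarith
  -- A neighbourhood of the new point is pulled back by the inverse homothety into a neighbourhood
  -- of `y`.
  have ht : Tendsto (fun q => p + s⁻¹ • (q - p)) (𝓝 (p + s • (y - p))) (𝓝 y) := by
    have : Continuous fun q : Plane => p + s⁻¹ • (q - p) := by fun_prop
    have h4 := this.tendsto (p + s • (y - p))
    rwa [add_sub_cancel_left, smul_smul, inv_mul_cancel₀ hs0, one_smul, add_sub_cancel] at h4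
  filter_upwards [ht.eventually hy, Metric.isOpen_ball.mem_nhds hb] with q hq hqb
  have h5 : p + s • (p + s⁻¹ • (q - p) - p) = q := by
    rw [add_sub_cancel_left, smul_smul, mul_inv_cancel₀ hs0, one_smul, add_sub_cancel]
  have := hspace _ hq s hs (by rw [h5]; exact hqb)
  rwa [h5] at this

/-- Every smooth function is a `rot`. -/
theorem exists_rotΩ_eq (q : Cinf Ω) : ∃ w, rotΩ Ω w = q := by
  classical
  have hc := isCompact_space hK
  obtain ⟨p₀, hp₀⟩ : ∃ p, p ∉ K.space := by
    by_contra hcon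
    push Not at hcon
    exact noncompact_univ Plane (eq_univ_of_forall hcon ▸ hc)
  choose r hr hcon using exists_conical_ball hK
  -- The boundary is covered by finitely many conical balls, each with its center as the origin of
  -- rays. The remaining piece is supported in `Ω` and can use any center outside.
  obtain ⟨t, ht, hcov⟩ := (hc.diff Ω.isOpen).elim_nhds_subcover (fun p => Metric.ball p (r p))
    fun p _ => Metric.ball_mem_nhds p (hr p)
  let ctr : Option t → Plane := fun i => i.elim p₀ fun x => x.1
  let U : Option t → Set Plane := fun i => i.elim Ω fun x => Metric.ball x.1 (r x.1)
  obtain ⟨ρ, hρ, hρU, hρ1⟩ := exists_smooth_partition hc.isClosed U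
    (by
      rintro (_ | x)
      · exact Ω.isOpen
      · exact Metric.isOpen_ball)
    (by
      intro p hp
      by_cases hpΩ : p ∈ Ω
      · exact mem_iUnion.2 ⟨none, hpΩ⟩
      · obtain ⟨x, hx, hpx⟩ := mem_iUnion₂.1 (hcov ⟨hp, hpΩ⟩)
        exact mem_iUnion.2 ⟨some ⟨x, hx⟩, hpx⟩)
  have hctr : ∀ i, ctr i ∉ Ω := by
    rintro (_ | x)
    · exact fun h => hp₀ (subset_space hK h)
    · exact (ht x.1 x.2).2
  have hray : ∀ i, ∀ y ∈ Ω, ∀ s : ℝ, 1 ≤ s → ctr i + s • (y - ctr i) ∈ tsupport (ρ i) →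
      ctr i + s • (y - ctr i) ∈ Ω := by
    rintro (_ | x) y hy s hs h
    · exact hρU none h
    · exact hcon x.1 y hy s hs (hρU (some x) h)
  have hw : ∀ i, ∃ w : Fin 2 → Cinf Ω, ∀ x : Ω, (rotΩ Ω w).1 x = ρ i x * extZero Ω q.1 x := by
    intro i
    obtain ⟨R, hR⟩ := hc.isBounded.exists_norm_le
    -- Off the support of `ρ i` the extended function is zero, so it is smooth also on rays that
    -- leave `Ω` there.
    refine exists_rot_of_radial (V := Ω ∪ (tsupport (ρ i))ᶜ) (p := ctr i) (R := R + ‖ctr i‖ + 1)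
      (Ω.isOpen.union (isClosed_tsupport _).isOpen_compl) (hctr i)
      (h := fun x => ρ i x * extZero Ω q.1 x) ?_ (fun y hy s hs => ?_) fun y hy => ?_
    · rintro x (hx | hx)
      · exact ((hρ i).contDiffAt.mul (q.2.contDiffAt (Ω.isOpen.mem_nhds hx))).contDiffWithinAt
      · refine (contDiffAt_const (c := (0 : ℝ)).congr_of_eventuallyEq ?_).contDiffWithinAt
        filter_upwards [(isClosed_tsupport _).isOpen_compl.mem_nhds hx] with y hy
        rw [image_eq_zero_of_notMem_tsupport hy, zero_mul]
    · by_cases h : ctr i + s • (y - ctr i) ∈ tsupport (ρ i)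
      · exact Or.inl (hray i y hy s hs h)
      · exact Or.inr h
    · rw [extZero_of_notMem, mul_zero]
      intro hyΩ
      have h1 := hR y (subset_space hK hyΩ)
      have h2 := norm_sub_le y (ctr i)
      linarith
  choose w hw using hw
  refine ⟨∑ i, w i, ?_⟩
  rw [map_sum]
  apply Subtype.ext
  funext x
  have h1 : (∑ i, rotΩ Ω (w i)).1 x = ∑ i, (rotΩ Ω (w i)).1 x := by
    rw [AddSubmonoidClass.coe_finsetSum, Finset.sum_apply]
  rw [h1]
  simp_rw [hw]
  rw [← Finset.sum_mul, hρ1 x (subset_space hK x.2), one_mul, extZero_apply]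

end DeRhamTwo

/-! ## De Rham cohomology in degree one -/

section DeRhamOne

open Set Filter Topology

variable {K : Geometry.SimplicialComplex ℝ Plane} {Ω : TopologicalSpace.Opens Plane}

/-- The one-form with the components `w`. -/
def form (w : Fin 2 → Cinf Ω) (y : Plane) : Plane →L[ℝ] ℝ :=
  ∑ i, extZero Ω (w i).1 y • (EuclideanSpace.proj i : Plane →L[ℝ] ℝ)

lemma form_single (w : Fin 2 → Cinf Ω) (y : Plane) (i : Fin 2) :
    form w y (EuclideanSpace.single i 1) = extZero Ω (w i).1 y := by
  fin_cases i <;> simp [form]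

lemma form_add (w w' : Fin 2 → Cinf Ω) (y : Plane) : form (w + w') y = form w y + form w' y := by
  apply clm_plane_ext
  intro i
  simp only [form_single, add_apply]
  show extZero Ω ((w i).1 + (w' i).1) y = _
  rw [map_add]
  rfl

lemma form_smul (c : ℝ) (w : Fin 2 → Cinf Ω) (y : Plane) : form (c • w) y = c • form w y := by
  apply clm_plane_ext
  intro i
  rw [smul_apply, form_single, form_single]
  show extZero Ω (c • (w i).1) y = _
  rw [map_smul]
  rfl

lemma contDiffOn_form (w : Fin 2 → Cinf Ω) : ContDiffOn ℝ ∞ (form w) Ω :=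
  ContDiffOn.sum fun i _ => (w i).2.smul contDiffOn_const

lemma hasFDerivAt_extZero {g : Cinf Ω} {w : Fin 2 → Cinf Ω} (h : gradΩ Ω g = w) {y : Plane}
    (hy : y ∈ Ω) : HasFDerivAt (extZero Ω g.1) (form w y) y := by
  have h1 := (Cinf_differentiableAt g ⟨y, hy⟩).hasFDerivAt
  have h2 : fderiv ℝ (extZero Ω g.1) y = form w y := by
    apply clm_plane_ext
    intro i
    rw [form_single, extZero_apply Ω _ ⟨y, hy⟩, ← h]
    rfl
  rwa [← h2]

lemma exists_gradΩ_eq {w : Fin 2 → Cinf Ω} {H : Plane → ℝ}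
    (hH : ∀ y ∈ Ω, HasFDerivAt H (form w y) y) : ∃ g, gradΩ Ω g = w := by
  have hs : ContDiffOn ℝ ∞ H Ω := by
    rw [contDiffOn_infty_iff_fderiv_of_isOpen Ω.isOpen]
    exact ⟨fun y hy => (hH y hy).differentiableAt.differentiableWithinAt,
      (contDiffOn_form w).congr fun y hy => (hH y hy).fderiv⟩
  refine ⟨toCinf H hs, ?_⟩
  funext i
  apply Subtype.ext
  funext ⟨x, hx⟩
  refine (pdΩ_apply hx (F := H) (Eventually.of_forall fun y hy => rfl) i).trans ?_
  rw [pd, (hH x hx).fderiv, form_single, extZero_apply Ω _ ⟨x, hx⟩]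

/-- The Poincaré lemma on convex sets. -/
lemma exists_primitive {w : Fin 2 → Cinf Ω} (hw : rotΩ Ω w = 0) {U : Set Plane} (hU : IsOpen U)
    (hc : Convex ℝ U) (hUΩ : U ⊆ Ω) : ∃ F : Plane → ℝ, ∀ y ∈ U, HasFDerivAt F (form w y) y := by
  refine hc.exists_forall_hasFDerivAt_of_fderiv_symmetric hU
    (((contDiffOn_form w).differentiableOn (by simp)).mono hUΩ) fun a ha x y => ?_
  have h1 : HasFDerivAt (form w) (∑ i, (fderiv ℝ (extZero Ω (w i).1) a).smulRight
      (EuclideanSpace.proj i : Plane →L[ℝ] ℝ)) a :=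
    HasFDerivAt.fun_sum fun i _ => HasFDerivAt.smul_const
      (show HasFDerivAt (extZero Ω (w i).1) (fderiv ℝ (extZero Ω (w i).1) a) a from
        (Cinf_differentiableAt (w i) ⟨a, hUΩ ha⟩).hasFDerivAt)
      (EuclideanSpace.proj i : Plane →L[ℝ] ℝ)
  have h2 : fderiv ℝ (extZero Ω (w 1).1) a (EuclideanSpace.single 0 1) -
      fderiv ℝ (extZero Ω (w 0).1) a (EuclideanSpace.single 1 1) = 0 :=
    congrFun (congrArg Subtype.val hw) ⟨a, hUΩ ha⟩
  rw [h1.fderiv]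
  rw [Fin.sum_univ_two]
  show fderiv ℝ (extZero Ω (w 0).1) a x * y 0 + fderiv ℝ (extZero Ω (w 1).1) a x * y 1 =
    fderiv ℝ (extZero Ω (w 0).1) a y * x 0 + fderiv ℝ (extZero Ω (w 1).1) a y * x 1
  have h3 := fun i => clm_plane_apply (fderiv ℝ (extZero Ω (w i).1) a)
  rw [h3 0 x, h3 1 x, h3 0 y, h3 1 y]
  simp only [smul_eq_mul]
  linear_combination (x 0 * y 1 - x 1 * y 0) * h2

lemma exists_const_of_hasFDerivAt {U : Set Plane} (hU : IsOpen U) (hc : IsPreconnected U)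
    {F G : Plane → ℝ} {φ : Plane → Plane →L[ℝ] ℝ} (hF : ∀ y ∈ U, HasFDerivAt F (φ y) y)
    (hG : ∀ y ∈ U, HasFDerivAt G (φ y) y) : ∃ c, ∀ y ∈ U, F y = G y + c := by
  obtain ⟨c, hc⟩ := hU.exists_is_const_of_fderiv_eq_zero hc (f := fun y => F y - G y)
    (fun y hy => ((hF y hy).sub (hG y hy)).differentiableAt.differentiableWithinAt)
    (fun y hy => by
      have := ((hF y hy).sub (hG y hy)).fderiv
      rw [sub_self] at this
      exact this)
  exact ⟨c, fun y hy => by linarith [hc y hy]⟩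

lemma frequently_mem_interior {f : Finset Plane} (hf : f ∈ triangles K) {y : Plane}
    (hy : y ∈ convexHull ℝ (f : Set Plane)) :
    ∃ᶠ z in 𝓝 y, z ∈ interior (convexHull ℝ (f : Set Plane)) := by
  rw [← mem_closure_iff_frequently, (convex_convexHull ℝ _).closure_interior_eq_closure_of_nonempty_interior
    (interior_hull_nonempty (isTri_of_mem hf))]
  exact subset_closure hy

lemma exists_common_vertex {f g : Finset Plane} (hf : f ∈ triangles K) (hg : g ∈ triangles K)
    {p : Plane} (hpf : p ∈ convexHull ℝ (f : Set Plane)) (hpg : p ∈ convexHull ℝ (g : Set Plane)) :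
    ∃ x ∈ f, x ∈ g := by
  obtain ⟨x, hx⟩ := convexHull_nonempty_iff.1 ⟨p, K.inter_subset_convexHull hf.1 hg.1 ⟨hpf, hpg⟩⟩
  exact ⟨x, hx.1, hx.2⟩

lemma exists_inner_point {f g e : Finset Plane} (hK : IsTriangulation K Ω) (o : EdgeOrientation K)
    (hf : f ∈ triangles K) (hg : g ∈ triangles K) (hfg : f ≠ g) (hef : e ∈ f.powersetCard 2)
    (heg : e ∈ g.powersetCard 2) :
    ∃ p ∈ Ω, p ∈ convexHull ℝ (f : Set Plane) ∧ p ∈ convexHull ℝ (g : Set Plane) := by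
  classical
  obtain ⟨hef', hc⟩ := Finset.mem_powersetCard.1 hef
  have heg' := (Finset.mem_powersetCard.1 heg).1
  obtain ⟨u, v, huv, rfl⟩ := Finset.card_eq_two.1 hc
  have hp : midpoint ℝ u v ∈ convexHull ℝ ((({u, v} : Finset Plane)) : Set Plane) := by
    rw [Finset.coe_pair, convexHull_pair]
    exact midpoint_mem_segment u v
  refine ⟨midpoint ℝ u v, mem_Ω_of_two_triangles hK hf hg hfg hef heg hp ?_ o,
    convexHull_mono (by exact_mod_cast hef') hp, convexHull_mono (by exact_mod_cast heg') hp⟩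
  rw [Finset.mem_insert, Finset.mem_singleton, midpoint_eq_left_iff, midpoint_eq_right_iff]
  tauto

/-- Two distinct common points make the common face an edge, and a point strictly between them is an
inner point of this edge, which lies in `Ω`. -/
lemma convex_inter_hull {f g : Finset Plane} (hK : IsTriangulation K Ω) (o : EdgeOrientation K)
    (hf : f ∈ triangles K) (hg : g ∈ triangles K) (hfg : f ≠ g) :
    Convex ℝ {p | p ∈ Ω ∧ p ∈ convexHull ℝ (f : Set Plane) ∧ p ∈ convexHull ℝ (g : Set Plane)} := by
  classical
  rw [convex_iff_pairwise_pos]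
  rintro p ⟨-, hpf, hpg⟩ q ⟨-, hqf, hqg⟩ hpq a b ha hb hab
  refine ⟨?_, convex_convexHull ℝ _ hpf hqf ha.le hb.le hab,
    convex_convexHull ℝ _ hpg hqg ha.le hb.le hab⟩
  have tf := isTri_of_mem hf
  have hp := K.inter_subset_convexHull hf.1 hg.1 ⟨hpf, hpg⟩
  have hq := K.inter_subset_convexHull hf.1 hg.1 ⟨hqf, hqg⟩
  rw [← Finset.coe_inter] at hp hq
  have hcard : (f ∩ g).card = 2 := by
    apply le_antisymm
    · by_contra hlt
      push Not at hlt
      have h3 : f ∩ g = f := Finset.eq_of_subset_of_card_le Finset.inter_subset_left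
        (by rw [hf.2]; omega)
      have h4 : f ∩ g = g := Finset.eq_of_subset_of_card_le Finset.inter_subset_right
        (by rw [hg.2]; omega)
      exact hfg (h3.symm.trans h4)
    · by_contra hlt
      push Not at hlt
      obtain ⟨x, hx⟩ := Finset.card_le_one_iff_subset_singleton.1 (Nat.lt_succ_iff.1 hlt)
      have h1 : convexHull ℝ ((f ∩ g : Finset Plane) : Set Plane) ⊆ {x} := by
        rw [← convexHull_singleton (𝕜 := ℝ) x]
        exact convexHull_mono (by exact_mod_cast hx)
      exact hpq ((h1 hp).trans (h1 hq).symm)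
  refine mem_Ω_of_two_triangles hK hf hg hfg
    (Finset.mem_powersetCard.2 ⟨Finset.inter_subset_left, hcard⟩)
    (Finset.mem_powersetCard.2 ⟨Finset.inter_subset_right, hcard⟩)
    (convex_convexHull ℝ _ hp hq ha.le hb.le hab) (fun hmem => ?_) o
  have hx := (Finset.mem_inter.1 hmem).1
  have h0 : ∀ y ∈ f, y ≠ a • p + b • q → bary f y p = 0 ∧ bary f y q = 0 := by
    intro y hy hne
    have h1 := bary_of_ne tf hy hx hne
    rw [Convex.combo_affine_apply hab, smul_eq_mul, smul_eq_mul] at h1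
    have h2 := (mem_hull_iff tf).1 hpf y hy
    have h3 := (mem_hull_iff tf).1 hqf y hy
    have h4 : a * bary f y p = 0 := by nlinarith [mul_nonneg ha.le h2, mul_nonneg hb.le h3]
    have h5 : b * bary f y q = 0 := by linarith
    exact ⟨(mul_eq_zero.1 h4).resolve_left ha.ne', (mul_eq_zero.1 h5).resolve_left hb.ne'⟩
  exact hpq ((eq_of_bary_eq_zero tf hx fun y hy h => (h0 y hy h).1).trans
    (eq_of_bary_eq_zero tf hx fun y hy h => (h0 y hy h).2).symm)

variable (K) in
/-- Near the point `x`, the functions `F` on the triangles are, up to constants with the differences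
`c`, the restrictions of a primitive of `w`. -/
def IsLocalPotential (c : triangles K → triangles K → ℝ) (w : Fin 2 → Cinf Ω)
    (F : triangles K → Plane → ℝ) (x : Plane) (G : Plane → ℝ) (κ : triangles K → ℝ) : Prop :=
  (∀ᶠ y in 𝓝 x, HasFDerivAt G (form w y) y) ∧
  (∀ f : triangles K, x ∈ convexHull ℝ (f.1 : Set Plane) →
    ∀ᶠ y in 𝓝 x, y ∈ interior (convexHull ℝ (f.1 : Set Plane)) → F f y = G y + κ f) ∧
  ∀ f g : triangles K, x ∈ convexHull ℝ (f.1 : Set Plane) → x ∈ convexHull ℝ (g.1 : Set Plane) →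
    c f g = κ f - κ g

variable (K Ω) in
/-- The relation between local differences and the closed one-forms whose primitives on the
triangles have these differences. -/
def potentialRel : Submodule ℝ ((triangles K → triangles K → ℝ) × (Fin 2 → Cinf Ω)) where
  carrier := {p | ∃ F, ∀ x ∈ Ω, ∃ G κ, IsLocalPotential K p.1 p.2 F x G κ}
  zero_mem' := ⟨0, fun x _ => ⟨0, 0, Eventually.of_forall fun y => by
    have : form (0 : Fin 2 → Cinf Ω) y = 0 := by simpa using form_smul 0 (0 : Fin 2 → Cinf Ω) y
    rw [Prod.snd_zero, this]
    exact hasFDerivAt_const 0 y, fun f _ => Eventually.of_forall fun y _ => by simp,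
    fun f g _ _ => by simp⟩⟩
  add_mem' := by
    rintro p q ⟨F, hF⟩ ⟨F', hF'⟩
    refine ⟨F + F', fun x hx => ?_⟩
    obtain ⟨G, κ, h1, h2, h3⟩ := hF x hx
    obtain ⟨G', κ', h1', h2', h3'⟩ := hF' x hx
    refine ⟨G + G', κ + κ', ?_, fun f hf => ?_, fun f g hf hg => ?_⟩
    · filter_upwards [h1, h1'] with y hy hy'
      rw [Prod.snd_add, form_add]
      exact hy.add hy'
    · filter_upwards [h2 f hf, h2' f hf] with y hy hy' hyf
      simp only [Pi.add_apply, hy hyf, hy' hyf]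
      ring
    · simp only [Prod.fst_add, Pi.add_apply, h3 f g hf hg, h3' f g hf hg]
      ring
  smul_mem' := by
    rintro r p ⟨F, hF⟩
    refine ⟨r • F, fun x hx => ?_⟩
    obtain ⟨G, κ, h1, h2, h3⟩ := hF x hx
    refine ⟨r • G, r • κ, ?_, fun f hf => ?_, fun f g hf hg => ?_⟩
    · filter_upwards [h1] with y hy
      rw [Prod.smul_snd, form_smul]
      exact hy.const_smul r
    · filter_upwards [h2 f hf] with y hy hyf
      simp only [Pi.smul_apply, hy hyf, smul_eq_mul]
      ring
    · simp only [Prod.smul_fst, Pi.smul_apply, h3 f g hf hg, smul_eq_mul]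
      ring

variable (hK : IsTriangulation K Ω)
include hK

lemma exists_triangle_of_mem_Ω {x : Plane} (hx : x ∈ Ω) :
    ∃ f : triangles K, x ∈ convexHull ℝ (f.1 : Set Plane) := by
  obtain ⟨f, hf, h⟩ := (mem_space_iff_triangle hK).1 (subset_space hK hx)
  exact ⟨⟨f, hf⟩, h⟩

lemma interior_hull_subset_Ω (f : triangles K) :
    interior (convexHull ℝ (f.1 : Set Plane)) ⊆ Ω := by
  rw [hK.eq_interior]
  exact interior_mono fun p hp => (mem_space_iff_triangle hK).2 ⟨f.1, f.2, hp⟩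

/-- The functions `F f - b f` fit together: near `x` all of them equal `G x` plus the constant `t
x`. -/
lemma exact_of_globDiff {c : triangles K → triangles K → ℝ} {w : Fin 2 → Cinf Ω}
    (hR : (c, w) ∈ potentialRel K Ω) (hc : c ∈ globDiff K ℝ) : ∃ g, gradΩ Ω g = w := by
  classical
  obtain ⟨F, hF⟩ := hR
  obtain ⟨b, hb⟩ := hc
  have hF' : ∀ x, ∃ G κ, x ∈ Ω → IsLocalPotential K c w F x G κ := by
    intro x
    by_cases hx : x ∈ Ω
    · obtain ⟨G, κ, h⟩ := hF x hx
      exact ⟨G, κ, fun _ => h⟩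
    · exact ⟨0, 0, fun h => absurd h hx⟩
  choose G κ hG using hF'
  have hb' : ∀ x f g, x ∈ convexHull ℝ (f.1 : Set Plane) → x ∈ convexHull ℝ (g.1 : Set Plane) →
      c f g = b f - b g := by
    intro x f g hf hg
    obtain ⟨v, hvf, hvg⟩ := exists_common_vertex f.2 g.2 hf hg
    exact hb v f g hvf hvg
  let t : Plane → ℝ := fun x => if h : x ∈ Ω then
    κ x (exists_triangle_of_mem_Ω hK h).choose - b (exists_triangle_of_mem_Ω hK h).choose else 0
  have ht : ∀ x ∈ Ω, ∀ f : triangles K, x ∈ convexHull ℝ (f.1 : Set Plane) → t x = κ x f - b f := by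
    intro x hx f hf
    have h1 := (exists_triangle_of_mem_Ω hK hx).choose_spec
    simp only [t, dif_pos hx]
    linarith [hb' x f _ hf h1, (hG x hx).2.2 f _ hf h1]
  refine exists_gradΩ_eq (H := fun x => G x x + t x) fun x hx => ?_
  have hev : ∀ᶠ y in 𝓝 x, G y y + t y = G x y + t x := by
    have h1 : ∀ᶠ y in 𝓝 x, ∀ᶠ z in 𝓝 y, ∀ f : triangles K, x ∈ convexHull ℝ (f.1 : Set Plane) →
        z ∈ interior (convexHull ℝ (f.1 : Set Plane)) → F f z = G x z + κ x f := by
      have : Finite (triangles K) := finite_triangles hK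
      refine (eventually_all.2 fun f => ?_).eventually_nhds
      by_cases hf : x ∈ convexHull ℝ (f.1 : Set Plane)
      · filter_upwards [(hG x hx).2.1 f hf] with z hz _ using hz
      · exact Eventually.of_forall fun z h => absurd h hf
    filter_upwards [h1, (hG x hx).1, eventually_triangles hK x, Ω.isOpen.mem_nhds hx] with
      y hy hyd hyt hyΩ
    obtain ⟨f, hf⟩ := exists_triangle_of_mem_Ω hK hyΩ
    have hxf := hyt f.1 f.2 hf
    -- The primitives at `x` and at `y` are compared at interior points of a triangle that
    -- accumulate at `y`, since `y` may lie on its boundary; continuity carries the equality over.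
    have h2 : ∃ᶠ z in 𝓝 y, G y z + κ y f = G x z + κ x f := by
      refine ((frequently_mem_interior f.2 hf).and_eventually (hy.and ((hG y hyΩ).2.1 f hf))).mono ?_
      rintro z ⟨hzf, hz1, hz2⟩
      rw [← hz1 f hxf hzf, hz2 hzf]
    have h3 := tendsto_nhds_unique_of_frequently_eq
      (((hG y hyΩ).1.self_of_nhds.continuousAt.add_const (κ y f)).tendsto)
      ((hyd.continuousAt.add_const (κ x f)).tendsto) h2
    rw [ht y hyΩ f hf, ht x hx f hxf]
    linarith
  exact ((hG x hx).1.self_of_nhds.add_const (t x)).congr_of_eventuallyEq hev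

/-- On each triangle `F f` differs from the given primitive by a constant `b f`, and at points of
`Ω` these constants have the differences `c`. At a vertex on the boundary, the local function `κ`
and `b` have equal differences across common edges, and the star is connected through edges. -/
lemma globDiff_of_exact (o : EdgeOrientation K) {c : triangles K → triangles K → ℝ}
    {w : Fin 2 → Cinf Ω} (hR : (c, w) ∈ potentialRel K Ω) (hc : c ∈ locDiff K ℝ) {u : Cinf Ω}
    (hu : gradΩ Ω u = w) : c ∈ globDiff K ℝ := by
  classical
  obtain ⟨F, hF⟩ := hR
  have hH : ∀ y ∈ Ω, HasFDerivAt (extZero Ω u.1) (form w y) y := fun y hy =>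
    hasFDerivAt_extZero hu hy
  have hb : ∀ f : triangles K, ∃ b : ℝ, ∀ y ∈ interior (convexHull ℝ (f.1 : Set Plane)),
      F f y = extZero Ω u.1 y + b := by
    intro f
    refine exists_const_of_hasFDerivAt isOpen_interior (convex_convexHull ℝ _).interior.isPreconnected
      (φ := form w) (fun y hy => ?_) fun y hy => hH y (interior_hull_subset_Ω hK f hy)
    obtain ⟨G, κ, h1, h2, -⟩ := hF y (interior_hull_subset_Ω hK f hy)
    refine (h1.self_of_nhds.add_const (κ f)).congr_of_eventuallyEq ?_
    filter_upwards [h2 f (interior_subset hy), isOpen_interior.mem_nhds hy] with z hz hzf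
    exact hz hzf
  choose b hb using hb
  have hbΩ : ∀ x ∈ Ω, ∀ f g : triangles K, x ∈ convexHull ℝ (f.1 : Set Plane) →
      x ∈ convexHull ℝ (g.1 : Set Plane) → c f g = b f - b g := by
    intro x hx f g hf hg
    obtain ⟨G, κ, h1, h2, h3⟩ := hF x hx
    obtain ⟨r, hr, hball⟩ := Metric.eventually_nhds_iff_ball.1 (h1.and (Ω.isOpen.mem_nhds hx))
    obtain ⟨m, hm⟩ := exists_const_of_hasFDerivAt Metric.isOpen_ball
      (convex_ball x r).isPreconnected (φ := form w) (fun y hy => (hball y hy).1)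
      (fun y hy => hH y (hball y hy).2)
    have h4 : ∀ f : triangles K, x ∈ convexHull ℝ (f.1 : Set Plane) → b f = m + κ f := by
      intro f hf
      obtain ⟨z, hzf, hz, hzr⟩ := ((frequently_mem_interior f.2 hf).and_eventually
        ((h2 f hf).and (Metric.ball_mem_nhds x hr))).exists
      linarith [hb f z hzf, hz hzf, hm z hzr]
    refine (h3 f g hf hg).trans ?_
    rw [h4 f hf, h4 g hg]
    ring
  refine ⟨b, fun x f g hf hg => ?_⟩
  obtain ⟨κ, hκ⟩ := hc x
  have hxv : x ∈ K.vertices :=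
    K.down_closed f.2.1 (Finset.singleton_subset_iff.2 hf) (Finset.singleton_nonempty x)
  have hS := edge_connected (K := K) (S := {f | f ∈ triangles K ∧ x ∈ f})
    (A := {g | ∃ (hg : g ∈ triangles K) (_ : x ∈ g), κ ⟨g, hg⟩ - b ⟨g, hg⟩ = κ f - b f})
    (fun f hf => hf.1) ((finite_triangles hK).subset fun f hf => hf.1)
    (hK.star_connected x hxv).isPreconnected (fun f hf => ⟨hf.1, hf.2.1⟩) ⟨f.1, f.2, hf, rfl⟩ (by
      rintro h ⟨hh, hxh, hκh⟩ h' ⟨hh', hxh'⟩ e heh heh'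
      refine ⟨hh', hxh', ?_⟩
      by_cases hne : h = h'
      · subst hne
        exact hκh
      · obtain ⟨p, hpΩ, hph, hph'⟩ := exists_inner_point hK o hh hh' hne heh heh'
        have h1 := hbΩ p hpΩ ⟨h, hh⟩ ⟨h', hh'⟩ hph hph'
        have h2 := hκ ⟨h, hh⟩ ⟨h', hh'⟩ hxh hxh'
        linarith)
  obtain ⟨_, _, h⟩ : g.1 ∈ {g | ∃ (hg : g ∈ triangles K) (_ : x ∈ g),
      κ ⟨g, hg⟩ - b ⟨g, hg⟩ = κ f - b f} := by
    rw [hS]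
    exact ⟨g.2, hg⟩
  rw [hκ f g hf hg]
  have h' : κ g - b g = κ f - b f := h
  linarith

end DeRhamOne

/-! ### The correspondence between local differences and closed one-forms -/

section DeRhamOne

open Set Filter Topology

variable {K : Geometry.SimplicialComplex ℝ Plane} {Ω : TopologicalSpace.Opens Plane}
  (hK : IsTriangulation K Ω)
include hK

/-- Local differences are the differences of smooth functions. -/
lemma exists_smooth_of_locDiff {c : triangles K → triangles K → ℝ} (hc : c ∈ locDiff K ℝ) :
    ∃ F : triangles K → Plane → ℝ, (∀ f, ContDiff ℝ ∞ (F f)) ∧ ∀ p ∈ Ω, ∀ᶠ y in 𝓝 p,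
      ∀ f g : triangles K, p ∈ convexHull ℝ (f.1 : Set Plane) → p ∈ convexHull ℝ (g.1 : Set Plane) →
        F f y = F g y + c f g := by
  classical
  choose κ hκ using hc
  let V : Finset Plane := (finite_triangles hK).toFinset.biUnion id
  -- The open star of the vertex: every triangle that meets it contains `v`, so `κ v` has the
  -- differences `c` there. Averaging the `κ v` with a partition of unity preserves the differences.
  let U : V → Set Plane := fun v =>
    (⋃ f ∈ {f | f ∈ triangles K ∧ v.1 ∉ f}, convexHull ℝ (f : Set Plane))ᶜ
  have hU : ∀ v p, p ∈ U v → ∀ f ∈ triangles K, p ∈ convexHull ℝ (f : Set Plane) → v.1 ∈ f := by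
    intro v p hp f hf hpf
    by_contra hv
    exact hp (mem_iUnion₂.2 ⟨f, ⟨hf, hv⟩, hpf⟩)
  obtain ⟨ρ, hρ, hρU, hρ1⟩ := exists_smooth_partition (isCompact_space hK).isClosed U
    (fun v => (((finite_triangles hK).subset fun f hf => hf.1).isClosed_biUnion
      fun f _ => (isCompact_hull f).isClosed).isOpen_compl)
    (by
      intro p hp
      obtain ⟨f, hf, hpf⟩ := (mem_space_iff_triangle hK).1 hp
      obtain ⟨x, hx, hx0⟩ : ∃ x ∈ f, bary f x p ≠ 0 := by
        by_contra hcon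
        push Not at hcon
        have := sum_bary (isTri_of_mem hf) p
        rw [Finset.sum_eq_zero hcon] at this
        exact zero_ne_one this
      refine mem_iUnion.2 ⟨⟨x, Finset.mem_biUnion.2 ⟨f, (finite_triangles hK).mem_toFinset.2 hf, hx⟩⟩,
        fun hmem => ?_⟩
      obtain ⟨g, ⟨hg, hxg⟩, hpg⟩ := mem_iUnion₂.1 hmem
      exact hxg (mem_of_bary_ne_zero hf hg.1 hpf hpg hx hx0))
  refine ⟨fun f y => ∑ v, ρ v y * κ v.1 f, fun f => ContDiff.sum fun v _ =>
    (hρ v).mul contDiff_const, fun p hp => ?_⟩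
  have h1 : ∀ᶠ y in 𝓝 p, ∀ v, ρ v y = 0 ∨
      ∀ f ∈ triangles K, p ∈ convexHull ℝ (f : Set Plane) → v.1 ∈ f := by
    rw [eventually_all]
    intro v
    by_cases hv : p ∈ tsupport (ρ v)
    · exact Eventually.of_forall fun y => Or.inr (hU v p (hρU v hv))
    · filter_upwards [(isClosed_tsupport _).isOpen_compl.mem_nhds hv] with y hy
      exact Or.inl (image_eq_zero_of_notMem_tsupport hy)
  filter_upwards [h1, Ω.isOpen.mem_nhds hp] with y hy hyΩ f g hf hg
  have h2 : ∑ v, ρ v y * κ v.1 f - ∑ v, ρ v y * κ v.1 g = ∑ v, ρ v y * c f g := by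
    rw [← Finset.sum_sub_distrib]
    refine Finset.sum_congr rfl fun v _ => ?_
    rcases hy v with h0 | hv
    · rw [h0]
      ring
    · rw [hκ v.1 f g (hv f.1 f.2 hf) (hv g.1 g.2 hg)]
      ring
  rw [← Finset.sum_mul, hρ1 y (subset_space hK hyΩ), one_mul] at h2
  show ∑ v, ρ v y * κ v.1 f = ∑ v, ρ v y * κ v.1 g + c f g
  linarith

/-- The smooth functions differ by constants near every point of `Ω`, so their gradients agree there
and define a closed form. -/
lemma exists_closed_of_locDiff {c : triangles K → triangles K → ℝ} (hc : c ∈ locDiff K ℝ) :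
    ∃ w : Fin 2 → Cinf Ω, rotΩ Ω w = 0 ∧ (c, w) ∈ potentialRel K Ω := by
  obtain ⟨F, hF, hd⟩ := exists_smooth_of_locDiff hK hc
  choose t ht using fun y : Ω => exists_triangle_of_mem_Ω hK y.2
  have hpd : ∀ p : Ω, ∀ᶠ y in 𝓝 p.1, ∀ (hy : y ∈ Ω) (i : Fin 2),
      pd i (F (t ⟨y, hy⟩)) y = pd i (F (t p)) y := by
    intro p
    filter_upwards [(hd p p.2).eventually_nhds, eventually_triangles hK p.1] with y hy hyt hyΩ i
    have h1 : F (t ⟨y, hyΩ⟩) =ᶠ[𝓝 y] fun z => F (t p) z + c (t ⟨y, hyΩ⟩) (t p) := by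
      filter_upwards [hy] with z hz
      exact hz _ _ (hyt _ (t ⟨y, hyΩ⟩).2 (ht ⟨y, hyΩ⟩)) (ht p)
    rw [pd, pd, h1.fderiv_eq, fderiv_add_const]
  have hsm : ∀ i f, ContDiff ℝ ∞ (pd i (F f)) := fun i f => contDiff_pd (hF f) i
  let w : Fin 2 → Cinf Ω := fun i => ⟨fun y => pd i (F (t y)) y, fun x hx =>
    (((hsm i (t ⟨x, hx⟩)).contDiffAt).congr_of_eventuallyEq (extZero_eventuallyEq hx (by
      filter_upwards [hpd ⟨x, hx⟩] with y hy hyΩ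
      exact hy hyΩ i))).contDiffWithinAt⟩
  refine ⟨w, ?_, F, fun p hp => ⟨F (t ⟨p, hp⟩), fun f => c f (t ⟨p, hp⟩), ?_, fun f hf => ?_,
    fun f g hf hg => ?_⟩⟩
  · apply Subtype.ext
    funext ⟨x, hx⟩
    show (pdΩ Ω 0 (w 1)).1 ⟨x, hx⟩ - (pdΩ Ω 1 (w 0)).1 ⟨x, hx⟩ = 0
    have h1 : ∀ i, ∀ᶠ y in 𝓝 x, ∀ hy : y ∈ Ω, (w i).1 ⟨y, hy⟩ = pd i (F (t ⟨x, hx⟩)) y := by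
      intro i
      filter_upwards [hpd ⟨x, hx⟩] with y hy hyΩ
      exact hy hyΩ i
    rw [pdΩ_apply hx (h1 1), pdΩ_apply hx (h1 0), pd_comm (hF _) 0 1, sub_self]
  · filter_upwards [hpd ⟨p, hp⟩, Ω.isOpen.mem_nhds hp] with y hy hyΩ
    have h1 : form w y = fderiv ℝ (F (t ⟨p, hp⟩)) y := by
      apply clm_plane_ext
      intro i
      rw [form_single, extZero_apply Ω _ ⟨y, hyΩ⟩]
      exact hy hyΩ i
    rw [h1]
    exact ((hF _).differentiable (by simp)).differentiableAt.hasFDerivAt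
  · filter_upwards [hd p hp] with y hy _
    exact hy f _ hf (ht ⟨p, hp⟩)
  · have h1 := (hd p hp).self_of_nhds
    have h2 := h1 f _ hf (ht ⟨p, hp⟩)
    have h3 := h1 g _ hg (ht ⟨p, hp⟩)
    have h4 := h1 f g hf hg
    show c f g = c f _ - c g _
    linarith

/-- Each triangle has a primitive by convexity. The difference of two of them is locally constant on
the part of the common face inside `Ω`, which is convex. At vertices in `Ω` a primitive on a ball
gives the local differences; at the others the values across inner edges are differences by
`exists_potential_at_boundary_vertex`. -/
lemma exists_locDiff_of_closed (o : EdgeOrientation K) {w : Fin 2 → Cinf Ω} (hw : rotΩ Ω w = 0) :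
    ∃ c ∈ locDiff K ℝ, (c, w) ∈ potentialRel K Ω := by
  classical
  have hF : ∀ f : triangles K, ∃ F : Plane → ℝ,
      ∀ y ∈ interior (convexHull ℝ (f.1 : Set Plane)), HasFDerivAt F (form w y) y := fun f =>
    exists_primitive hw isOpen_interior (convex_convexHull ℝ _).interior (interior_hull_subset_Ω hK f)
  choose F hF using hF
  have hloc : ∀ p : Ω, ∃ (r : ℝ) (G : Plane → ℝ) (κ : triangles K → ℝ), 0 < r ∧
      (∀ y ∈ Metric.ball p.1 r, HasFDerivAt G (form w y) y) ∧
      ∀ f, ∀ y ∈ Metric.ball p.1 r ∩ interior (convexHull ℝ (f.1 : Set Plane)), F f y = G y + κ f := by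
    intro p
    obtain ⟨r, hr, hb⟩ := Metric.isOpen_iff.1 Ω.isOpen p.1 p.2
    obtain ⟨G, hG⟩ := exists_primitive hw Metric.isOpen_ball (convex_ball p.1 r) hb
    choose κ hκ using fun f : triangles K => exists_const_of_hasFDerivAt
      (Metric.isOpen_ball.inter isOpen_interior)
      ((convex_ball p.1 r).inter (convex_convexHull ℝ (f.1 : Set Plane)).interior).isPreconnected
      (fun y hy => hF f y hy.2) (fun y hy => hG y hy.1)
    exact ⟨r, G, κ, hr, hG, hκ⟩
  choose r G κ hr hG hκ using hloc
  -- the differences are locally constant on common edges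
  have hnear : ∀ p q : Ω, q.1 ∈ Metric.ball p.1 (r p) → ∃ m : ℝ, ∀ f : triangles K,
      q.1 ∈ convexHull ℝ (f.1 : Set Plane) → κ q f = κ p f + m := by
    intro p q hq
    obtain ⟨m, hm⟩ := exists_const_of_hasFDerivAt (Metric.isOpen_ball.inter Metric.isOpen_ball)
      ((convex_ball p.1 (r p)).inter (convex_ball q.1 (r q))).isPreconnected
      (fun y hy => hG p y hy.1) (fun y hy => hG q y hy.2)
    refine ⟨m, fun f hf => ?_⟩
    obtain ⟨z, hzf, hz⟩ := ((frequently_mem_interior f.2 hf).and_eventually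
      ((Metric.isOpen_ball.inter Metric.isOpen_ball).mem_nhds
        ⟨hq, Metric.mem_ball_self (hr q)⟩)).exists
    linarith [hm z hz, hκ p f z ⟨hz.1, hzf⟩, hκ q f z ⟨hz.2, hzf⟩]
  have hconst : ∀ f g : triangles K, ∃ d : ℝ, ∀ p : Ω, p.1 ∈ convexHull ℝ (f.1 : Set Plane) →
      p.1 ∈ convexHull ℝ (g.1 : Set Plane) → d = κ p f - κ p g := by
    intro f g
    by_cases hfg : f = g
    · subst hfg
      exact ⟨0, fun p _ _ => (sub_self _).symm⟩
    let S : Set Plane := {p | p ∈ Ω ∧ p ∈ convexHull ℝ (f.1 : Set Plane) ∧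
      p ∈ convexHull ℝ (g.1 : Set Plane)}
    have hS : IsPreconnected S :=
      (convex_inter_hull hK o f.2 g.2 fun h => hfg (Subtype.ext h)).isPreconnected
    let D : Plane → ℝ := fun p => if h : p ∈ Ω then κ ⟨p, h⟩ f - κ ⟨p, h⟩ g else 0
    have hD : ∀ p : Ω, D p.1 = κ p f - κ p g := fun p => dif_pos p.2
    have hDc : ∀ x ∈ S, ∀ y ∈ S, D x = D y := by
      intro x hx y hy
      refine hS.induction₂ (fun a b => D a = D b) (fun a ha => ?_) (fun a b c _ _ _ h1 h2 => h1.trans h2)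
        (fun a b _ _ h => h.symm) hx hy
      filter_upwards [nhdsWithin_le_nhds (Metric.ball_mem_nhds a (hr ⟨a, ha.1⟩)),
        self_mem_nhdsWithin] with b hb hbS
      obtain ⟨m, hm⟩ := hnear ⟨a, ha.1⟩ ⟨b, hbS.1⟩ hb
      rw [hD ⟨a, ha.1⟩, hD ⟨b, hbS.1⟩, hm f hbS.2.1, hm g hbS.2.2]
      ring
    by_cases hne : S.Nonempty
    · obtain ⟨x, hx⟩ := hne
      exact ⟨D x, fun p hf hg => by rw [← hD p, hDc x hx p ⟨p.2, hf, hg⟩]⟩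
    · exact ⟨0, fun p hf hg => absurd ⟨p.1, p.2, hf, hg⟩ hne⟩
  choose d hd using hconst
  -- The chosen constants are arbitrary for triangles that do not meet in `Ω`; antisymmetrizing
  -- makes `c₀` admissible for the lemma on boundary vertices.
  let c₀ : triangles K → triangles K → ℝ := fun f g => (d f g - d g f) / 2
  have hc₀ : ∀ f g, ∀ p : Ω, p.1 ∈ convexHull ℝ (f.1 : Set Plane) →
      p.1 ∈ convexHull ℝ (g.1 : Set Plane) → c₀ f g = κ p f - κ p g := by
    intro f g p hf hg
    simp only [c₀, hd f g p hf hg, hd g f p hg hf]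
    ring
  have hbd : ∀ x : Plane, ∃ l : triangles K → ℝ, x ∉ Ω → ∀ f g : triangles K, x ∈ f.1 → x ∈ g.1 →
      ∀ e ∈ f.1.powersetCard 2, e ∈ g.1.powersetCard 2 → c₀ f g = l f - l g := by
    intro x
    by_cases hx : x ∈ K.vertices ∧ x ∉ Ω
    · obtain ⟨l, hl⟩ := exists_potential_at_boundary_vertex hK hx.1 hx.2 o c₀
        fun f g => by simp only [c₀]; ring
      exact ⟨l, fun _ => hl⟩
    · refine ⟨0, fun hxΩ f g hf _ => absurd ⟨?_, hxΩ⟩ hx⟩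
      exact K.down_closed f.2.1 (Finset.singleton_subset_iff.2 hf) (Finset.singleton_nonempty x)
  choose l hl using hbd
  have hc : ∀ f g : triangles K, ∃ s : ℝ,
      (∀ p : Ω, p.1 ∈ convexHull ℝ (f.1 : Set Plane) → p.1 ∈ convexHull ℝ (g.1 : Set Plane) →
        s = κ p f - κ p g) ∧
      ∀ x, x ∉ Ω → x ∈ f.1 → x ∈ g.1 → s = l x f - l x g := by
    intro f g
    by_cases hfg : f = g
    · subst hfg
      exact ⟨0, fun p _ _ => (sub_self _).symm, fun x _ _ _ => (sub_self _).symm⟩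
    by_cases he : ∃ e, e ∈ f.1.powersetCard 2 ∧ e ∈ g.1.powersetCard 2
    · obtain ⟨e, hef, heg⟩ := he
      exact ⟨c₀ f g, hc₀ f g, fun x hx hf hg => hl x hx f g hf hg e hef heg⟩
    -- Without a common edge the triangles share at most one vertex. If it is outside `Ω`, no
    -- condition from `Ω` interferes and the potential `l` at this vertex defines the value.
    have huniq : ∀ x ∈ f.1, x ∈ g.1 → ∀ y ∈ f.1, y ∈ g.1 → x = y := by
      intro x hxf hxg y hyf hyg
      by_contra hxy
      refine he ⟨{x, y}, Finset.mem_powersetCard.2 ⟨?_, Finset.card_pair hxy⟩,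
        Finset.mem_powersetCard.2 ⟨?_, Finset.card_pair hxy⟩⟩
      · simp [Finset.insert_subset_iff, hxf, hyf]
      · simp [Finset.insert_subset_iff, hxg, hyg]
    by_cases hx : ∃ x, x ∉ Ω ∧ x ∈ f.1 ∧ x ∈ g.1
    · obtain ⟨x, hxΩ, hxf, hxg⟩ := hx
      refine ⟨l x f - l x g, fun p hpf hpg => absurd p.2 ?_, fun y _ hyf hyg => ?_⟩
      · have h1 := K.inter_subset_convexHull f.2.1 g.2.1 ⟨hpf, hpg⟩
        have h2 : ((f.1 : Set Plane) ∩ g.1) ⊆ {x} := fun y hy =>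
          huniq y hy.1 hy.2 x hxf hxg
        have h3 := convexHull_mono (𝕜 := ℝ) h2 h1
        rw [convexHull_singleton, mem_singleton_iff] at h3
        rwa [h3]
      · rw [huniq y hyf hyg x hxf hxg]
    · exact ⟨c₀ f g, hc₀ f g, fun x hxΩ hf hg => absurd ⟨x, hxΩ, hf, hg⟩ hx⟩
  choose c hcΩ hcb using hc
  refine ⟨c, fun x => ?_, F, fun p hp => ⟨G ⟨p, hp⟩, κ ⟨p, hp⟩, ?_, fun f _ => ?_,
    fun f g => hcΩ f g ⟨p, hp⟩⟩⟩
  · by_cases hx : x ∈ Ω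
    · exact ⟨κ ⟨x, hx⟩, fun f g hf hg => hcΩ f g ⟨x, hx⟩ (subset_convexHull ℝ _ hf)
        (subset_convexHull ℝ _ hg)⟩
    · exact ⟨l x, fun f g hf hg => hcb f g x hx hf hg⟩
  · filter_upwards [Metric.ball_mem_nhds p (hr ⟨p, hp⟩)] with y hy
    exact hG ⟨p, hp⟩ y hy
  · filter_upwards [Metric.ball_mem_nhds p (hr ⟨p, hp⟩)] with y hy hyf
    exact hκ ⟨p, hp⟩ f y ⟨hy, hyf⟩

theorem hdR1_equiv (o : EdgeOrientation K) : Nonempty (DiffCoh K ℝ ≃ₗ[ℝ] HdR1 Ω) := by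
  refine quotient_equiv_of_relation (potentialRel K Ω) _ _ _ _ (fun c hc => ?_) ?_ ?_
  · obtain ⟨w, hw, hR⟩ := exists_closed_of_locDiff hK hc
    exact ⟨w, ⟨trivial, hw⟩, hR⟩
  · rintro w ⟨-, hw⟩
    exact exists_locDiff_of_closed hK o hw
  · rintro c hc w - hR
    constructor
    · intro h
      obtain ⟨g, hg⟩ := exact_of_globDiff hK hR h
      exact ⟨g, trivial, hg⟩
    · rintro ⟨g, -, hg⟩
      exact globDiff_of_exact hK o hR hc hg

end DeRhamOne

end DivDiv

end

/-! ### Assembly of the theorem -/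

open DivDiv in
theorem mainTheorem8 (K : Geometry.SimplicialComplex ℝ Plane) (Ω : TopologicalSpace.Opens Plane)
    (hΩ : IsConnected (Ω : Set Plane)) (hK : IsTriangulation K Ω) (o : EdgeOrientation K)
    (k : ℕ) (hk : 4 ≤ k)
    (ψ : Module.Basis (Fin 3) ℝ (polyLE 1)) (z : Module.Basis (Fin 3) ℝ RT2) :
    -- the currents are generalized currents, and the sequence is a conforming finite element
    -- complex with trace structure and geometric decomposition
    IsGeneralizedCurrents K o (divdivCurrents o ψ z) ∧
    IsFECTS K Ω (huMaZhang o k) ∧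
    HasGeometricDecomposition K (huMaZhang o k).S0 ∧
    HasGeometricDecomposition K (huMaZhang o k).S1 ∧
    HasGeometricDecomposition K (huMaZhang o k).S2 ∧
    -- compatibility
    IsCompatible K (huMaZhang o k) (divdivCurrents o ψ z) ∧
    -- cohomology of the global complex
    Nonempty (Coh0 (globalSpace K (huMaZhang o k).S0) (globalD0 K (huMaZhang o k)) ≃ₗ[ℝ]
      RT2 ⊗[ℝ] HdR0 Ω) ∧
    Nonempty (Coh1 (globalSpace K (huMaZhang o k).S0) (globalSpace K (huMaZhang o k).S1)
      (globalD0 K (huMaZhang o k)) (globalD1 K (huMaZhang o k)) ≃ₗ[ℝ] RT2 ⊗[ℝ] HdR1 Ω) ∧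
    Nonempty (Coh2 (globalSpace K (huMaZhang o k).S1) (globalSpace K (huMaZhang o k).S2)
      (globalD1 K (huMaZhang o k)) ≃ₗ[ℝ] RT2 ⊗[ℝ] HdR2 Ω) := by
  have hp := hΩ.isPreconnected
  refine ⟨isGeneralizedCurrents ψ z hK.pure, isFECTS hK k,
    fun f hf => (unisolvence0 (isTri_of_mem hf) (isEdge_of_mem_powersetCard hf) hk).1,
    fun f hf => (unisolvence1 ψ z (isTri_of_mem hf) (isEdge_of_mem_powersetCard hf) hk).1,
    hasGeometricDecomposition2 k, isCompatible ψ z hk, ?_, ?_, ?_⟩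
  · obtain ⟨a⟩ := coh0_equiv (o := o) hK hΩ hk
    obtain ⟨b⟩ := hdR0_equiv hΩ
    exact ⟨a.symm ≪≫ₗ (TensorProduct.rid ℝ RT2).symm ≪≫ₗ
      TensorProduct.congr (LinearEquiv.refl ℝ RT2) b.symm⟩
  · obtain ⟨a⟩ := coh1_equiv (K := K) (o := o) hk
    obtain ⟨b⟩ := diffCoh_tensor (K := K) z
    obtain ⟨c⟩ := hdR1_equiv hK o
    exact ⟨a.symm ≪≫ₗ b ≪≫ₗ TensorProduct.congr (LinearEquiv.refl ℝ RT2) c⟩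
  -- In degree 2 both cohomology spaces vanish.
  · have h1 : Subsingleton (Coh2 (globalSpace K (huMaZhang o k).S1)
        (globalSpace K (huMaZhang o k).S2) (globalD1 K (huMaZhang o k))) := by
      refine Submodule.Quotient.subsingleton_iff.2 (eq_top_iff.2 ?_)
      rintro ⟨q, hq⟩ -
      obtain ⟨σ, hσ, h⟩ := exists_globalD1_eq hK hp ψ z hk hq
      exact ⟨σ, hσ, h⟩
    have h2 : Subsingleton (HdR2 Ω) := by
      refine Submodule.Quotient.subsingleton_iff.2 (eq_top_iff.2 ?_)
      rintro ⟨q, hq⟩ -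
      obtain ⟨w, hw⟩ := exists_rotΩ_eq hK q
      exact ⟨w, trivial, hw⟩
    have h3 : Subsingleton (RT2 ⊗[ℝ] HdR2 Ω) := inferInstance
    exact ⟨⟨0, 0, fun _ => Subsingleton.elim _ _, fun _ => Subsingleton.elim _ _⟩⟩
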